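/- Let $s\ge 0$. For $\tau>0$, $\sigma\in\mathbb R$ write $\|f\|_{H^\sigma_\tau}^2=\int_{\mathbb R}(\tau^2+\xi^2)^{\sigma}|\hat f(\xi)|^2\,d\xi$ (unitary Fourier transform) and $H^\sigma=H^\sigma_1$, with inner product $\langle f,g\rangle_{H^\sigma}$ linear in $f$. For $q\in H^s_{\rm loc}(\mathbb R;\mathbb C)$ let $$E^s(q)=\bigl(\||q|^2-1\|_{H^{s-1}_2}^2+\|q'\|_{H^{s-1}_2}^2\bigr)^{1/2},$$ let $X^s$ be the set of $q\in H^s_{\rm loc}$ with $E^s(q)<\infty$, where functions that differ by a constant factor of modulus $1$ are identified, and put $$d^s(p,q)=\Bigl(\int_{\mathbb R}\inf_{|\lambda|=1}\bigl\|\operatorname{sech}(\cdot-y)(\lambda p-q)\bigr\|_{H^s}^2\,dy\Bigr)^{1/2},\qquad B^s_r(q)=\{p\in X^s: d^s(p,q)<r\}.$$ Let $l^2_d$ be the space of real sequences $(a_n)_{n\in\mathbb Z}$ with $\|(a_n)\|_{l^2_d}=(\sum_n|a_n-a_{n-1}|^2)^{1/2}<\infty$, modulo constant sequences. Fix real-valued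 functions $\eta,\rho\in C_c^\infty(\mathbb R)$ such that $\operatorname{supp}\eta\subset[-1,1]$, $\eta=1$ on $[-\frac12,\frac12]$, $\rho\ge 0$, $\rho=1$ on $[-1,1]$ and $\sum_{n\in\mathbb Z}\rho(x-4n)=1$ for all $x$. For $L>0$ and $q$ with $E^s(q)<\infty$ write $\eta_n(x)=\eta((x-4Ln)/L)$, and let $\tilde H^s=\tilde H^s_{q,L}$ be the real subspace of all $b\in H^s$ with $\langle\eta_n b,\eta_n q\rangle_{H^s}\in\mathbb R$ for all $n\in\mathbb Z$, with the norm of $H^s$. **Theorem.** There are functions $r,L:[0,\infty)\to(0,\infty)$ and $K,C_k:[0,\infty)\to[0,\infty)$ $(k\ge1)$, depending only on $s,\eta,\rho$, such that the following holds for every $q$ with $E=E^s(q)<\infty$; put $r=r(E)$, $L=L(E)$. 1. (Chart.) For every $p\in B^s_r(q)$ there is exactly one $\Phi_q(p)=((a_n)_n,b)\in l^2_d\times\tilde H^s_{q,L}$ such that, for a representative of $p$ and of the sequence class $(a_n)_n$: for all $n$, $\mu_n=\langle\eta_n p,\eta_n q\rangle_{H^s}\neq 0$ and $e^{ia_n}=\mu_n/|\mu_n|$;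 moreover $\sum_n|a_n-a_{n-1}|^2<\frac12$; and $b=e^{-i\theta}p-q$ with $\theta(x)=\sum_n a_n\,\rho((x-4Ln)/L)$. 2. The map $\Phi_q:B^s_r(q)\to l^2_d\times\tilde H^s_{q,L}$ is bi-Lipschitz (with constant $K(E)$) onto its image, and the image is open in $l^2_d\times\tilde H^s_{q,L}$. 3. (Coordinate changes.) Let $E^s(q_1)<\infty$, $E_1=E^s(q_1)$, and suppose that $U=B^s_{r(E)}(q)\cap B^s_{r(E_1)}(q_1)\ne\emptyset$ (for example, $d^s(q,q_1)<r(E)$). Then $\Phi_q(U)$ and $\Phi_{q_1}(U)$ are open and $\Phi_{q_1}\circ\Phi_q^{-1}:\Phi_q(U)\to\Phi_{q_1}(U)$ is a real-analytic diffeomorphism (it and its inverse are real analytic); for every $k\ge1$ the $k$-th derivatives of this map and of its inverse are bounded in norm by $C_k(E)$ on $\Phi_q(U)$ and $\Phi_{q_1}(U)$ respectively. -/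

import Mathlib

open MeasureTheory TemperedDistribution
open scoped ENNReal NNReal ContDiff SchwartzMap

namespace GrossPitaevskii

noncomputable section

/-! ### Sobolev spaces on the line -/

/-- The symbol `(τ² + ξ²)^(σ/2)`. Mathlib's Fourier transform uses the frequency variable `x` with
`ξ = 2πx`; with this substitution all Sobolev norms below are the ones of the unitary Fourier
transform, e.g. `H⁰ = L²` isometrically. -/
def symbol (τ σ : ℝ) (x : ℝ) : ℝ := (τ ^ 2 + (2 * Real.pi * x) ^ 2) ^ (σ / 2)

theorem symbol_hasTemperateGrowth {τ : ℝ} (hτ : 0 < τ) (σ : ℝ) :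
    (symbol τ σ).HasTemperateGrowth := by
  have h1 := Function.hasTemperateGrowth_one_add_norm_sq_rpow ℝ (σ / 2)
  have h2 : (fun x : ℝ ↦ (2 * Real.pi / τ) * x).HasTemperateGrowth := by fun_prop
  have h3 := h1.comp h2
  have h4 : symbol τ σ = fun x ↦ (τ ^ 2) ^ (σ / 2) *
      ((fun x : ℝ ↦ (1 + ‖x‖ ^ 2) ^ (σ / 2)) ∘ (fun x : ℝ ↦ (2 * Real.pi / τ) * x)) x := by
    funext x
    simp only [symbol, Function.comp_apply]
    rw [← Real.mul_rpow (by positivity) (by positivity)]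
    congr 1
    rw [Real.norm_eq_abs, sq_abs]
    field_simp
  rw [h4]
  fun_prop

theorem symbol_ofReal_hasTemperateGrowth {τ : ℝ} (hτ : 0 < τ) (σ : ℝ) :
    (fun x ↦ (symbol τ σ x : ℂ)).HasTemperateGrowth := by
  have := symbol_hasTemperateGrowth hτ σ
  fun_prop

/-- The operator `(τ² + D²)^(σ/2)` on tempered distributions. -/
def bessel (τ σ : ℝ) : 𝓢'(ℝ, ℂ) →L[ℂ] 𝓢'(ℝ, ℂ) :=
  fourierMultiplierCLM ℂ (fun x ↦ (symbol τ σ x : ℂ))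

theorem bessel_injective {τ : ℝ} (hτ : 0 < τ) (σ : ℝ) {u : 𝓢'(ℝ, ℂ)}
    (h : bessel τ σ u = 0) : u = 0 := by
  have h1 : bessel τ (-σ) (bessel τ σ u) = u := by
    simp only [bessel]
    rw [fourierMultiplierCLM_fourierMultiplierCLM_apply (symbol_ofReal_hasTemperateGrowth hτ σ)
      (symbol_ofReal_hasTemperateGrowth hτ (-σ))]
    have : (fun x ↦ (symbol τ σ x : ℂ)) * (fun x ↦ (symbol τ (-σ) x : ℂ)) = fun _ ↦ 1 := by
      funext x
      simp only [Pi.mul_apply, symbol]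
      rw [← Complex.ofReal_mul, ← Real.rpow_add (by positivity)]
      simp [neg_div]
    rw [this]
    simp
  rw [← h1, h, map_zero]

/-- The norm of `u` in `H^σ_τ`, i.e. `(∫ (τ² + ξ²)^σ |û(ξ)|² dξ)^(1/2)`; it is `∞` if `u` does not
belong to `H^σ`. -/
def sobolevNorm (τ σ : ℝ) (u : 𝓢'(ℝ, ℂ)) : ℝ≥0∞ :=
  ⨅ (g : Lp ℂ 2 (volume : Measure ℝ)) (_ : bessel τ σ u = (g : 𝓢'(ℝ, ℂ))), ‖g‖ₑ

/-- The norm in `H^σ_τ` of the distribution on `ℝ` given by the functional `T` on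
`C_c^∞(ℝ, ℂ)`. -/
def distributionNorm (τ σ : ℝ) (T : 𝓢(ℝ, ℂ) → ℂ) : ℝ≥0∞ :=
  ⨅ (u : 𝓢'(ℝ, ℂ)) (_ : ∀ φ : 𝓢(ℝ, ℂ), HasCompactSupport φ → u φ = T φ), sobolevNorm τ σ u

/-- The norm in `H^σ_τ` of a locally integrable function. -/
def functionNorm (τ σ : ℝ) (f : ℝ → ℂ) : ℝ≥0∞ :=
  distributionNorm τ σ (fun φ ↦ ∫ x, φ x * f x)

/-- The norm in `H^σ_τ` of the distributional derivative of a locally integrable function. -/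
def derivNorm (τ σ : ℝ) (f : ℝ → ℂ) : ℝ≥0∞ :=
  distributionNorm τ σ (fun φ ↦ -∫ x, deriv φ x * f x)

/-- The tempered distributions in `H^s`. -/
def sobolevSubmodule (s : ℝ) : Submodule ℂ 𝓢'(ℝ, ℂ) where
  carrier := {u | ∃ g : Lp ℂ 2 (volume : Measure ℝ), bessel 1 s u = (g : 𝓢'(ℝ, ℂ))}
  add_mem' := by
    rintro u v ⟨g, hg⟩ ⟨h, hh⟩
    refine ⟨g + h, ?_⟩
    rw [← Lp.toTemperedDistributionCLM_apply] at *
    simp [map_add, hg, hh]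
  zero_mem' := ⟨0, by rw [← Lp.toTemperedDistributionCLM_apply, map_zero, map_zero]⟩
  smul_mem' := by
    rintro c u ⟨g, hg⟩
    refine ⟨c • g, ?_⟩
    rw [← Lp.toTemperedDistributionCLM_apply] at *
    simp [hg]

/-- The Sobolev space `H^s(ℝ, ℂ)`. -/
def Hs (s : ℝ) : Type := sobolevSubmodule s

instance (s : ℝ) : AddCommGroup (Hs s) := inferInstanceAs (AddCommGroup (sobolevSubmodule s))

instance (s : ℝ) : Module ℂ (Hs s) := inferInstanceAs (Module ℂ (sobolevSubmodule s))

/-- The inclusion of `H^s` into the tempered distributions. -/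
def Hs.toDistribution (s : ℝ) : Hs s →ₗ[ℂ] 𝓢'(ℝ, ℂ) := (sobolevSubmodule s).subtype

/-- The map `u ↦ (1 + D²)^(s/2) u` from `H^s` to `L²`. -/
def Hs.toL2 (s : ℝ) : Hs s →ₗ[ℂ] Lp ℂ 2 (volume : Measure ℝ) where
  toFun u := u.2.choose
  map_add' u v := by
    have hk := Lp.ker_toTemperedDistributionCLM_eq_bot (F := ℂ) (μ := (volume : Measure ℝ)) (p := 2)
    apply LinearMap.ker_eq_bot.1 hk
    simp only [ContinuousLinearMap.coe_coe, map_add, Lp.toTemperedDistributionCLM_apply]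
    rw [← u.2.choose_spec, ← v.2.choose_spec, ← (u + v).2.choose_spec, ← map_add]
    rfl
  map_smul' c u := by
    have hk := Lp.ker_toTemperedDistributionCLM_eq_bot (F := ℂ) (μ := (volume : Measure ℝ)) (p := 2)
    apply LinearMap.ker_eq_bot.1 hk
    simp only [ContinuousLinearMap.coe_coe, map_smul, Lp.toTemperedDistributionCLM_apply,
      RingHom.id_apply]
    rw [← u.2.choose_spec, ← (c • u).2.choose_spec, ← map_smul]
    rfl

theorem Hs.bessel_toDistribution {s : ℝ} (u : Hs s) :
    bessel 1 s (Hs.toDistribution s u) = (Hs.toL2 s u : 𝓢'(ℝ, ℂ)) := u.2.choose_spec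

theorem Hs.toL2_injective (s : ℝ) : Function.Injective (Hs.toL2 s) := by
  rw [← LinearMap.ker_eq_bot, LinearMap.ker_eq_bot']
  intro u hu
  have h := Hs.bessel_toDistribution u
  rw [hu, ← Lp.toTemperedDistributionCLM_apply, map_zero] at h
  exact Subtype.ext (bessel_injective one_pos s h)

instance (s : ℝ) : NormedAddCommGroup (Hs s) :=
  NormedAddCommGroup.induced _ _ (Hs.toL2 s) (Hs.toL2_injective s)

instance (s : ℝ) : NormedSpace ℂ (Hs s) := NormedSpace.induced ℂ _ _ (Hs.toL2 s)

/-- `H^s` with the inner product `∫ (1 + ξ²)^s conj(û(ξ)) v̂(ξ) dξ`. -/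
instance (s : ℝ) : InnerProductSpace ℂ (Hs s) where
  inner u v := inner ℂ (Hs.toL2 s u) (Hs.toL2 s v)
  norm_sq_eq_re_inner u := norm_sq_eq_re_inner (𝕜 := ℂ) (Hs.toL2 s u)
  conj_inner_symm u v := inner_conj_symm _ _
  add_left u v w := by simp only [map_add, inner_add_left]
  smul_left u v c := by simp only [map_smul, inner_smul_left]

theorem Hs.enorm_eq_sobolevNorm {s : ℝ} (u : Hs s) :
    ‖u‖ₑ = sobolevNorm 1 s (Hs.toDistribution s u) := by
  have h0 : ‖u‖ₑ = ‖Hs.toL2 s u‖ₑ := rfl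
  rw [h0, sobolevNorm]
  refine le_antisymm (le_iInf₂ fun g hg ↦ ?_) (iInf₂_le (Hs.toL2 s u) (Hs.bessel_toDistribution u))
  rw [Hs.bessel_toDistribution u] at hg
  have hk := Lp.ker_toTemperedDistributionCLM_eq_bot (F := ℂ) (μ := (volume : Measure ℝ)) (p := 2)
  rw [LinearMap.ker_eq_bot.1 hk hg]

/-- The element `u` of `H^s` is the function `f`, as distributions on `ℝ`. -/
def Hs.Represents {s : ℝ} (u : Hs s) (f : ℝ → ℂ) : Prop :=
  ∀ φ : 𝓢(ℝ, ℂ), HasCompactSupport φ → Hs.toDistribution s u φ = ∫ x, φ x * f x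

open Classical in
/-- A locally integrable function in `H^s`, as an element of `H^s` (and `0` if it is not in
`H^s`). -/
def toHs (s : ℝ) (f : ℝ → ℂ) : Hs s :=
  if h : ∃ u : Hs s, u.Represents f then h.choose else 0

/-- The inner product `⟨f, g⟩_{H^s}` of two functions in `H^s`, linear in `f` and antilinear
in `g`. -/
def hsInner (s : ℝ) (f g : ℝ → ℂ) : ℂ := inner ℂ (toHs s g) (toHs s f)

/-! ### The energy space `X^s` -/

/-- The energy `E^s(q) = (‖|q|² - 1‖² + ‖q'‖²)^(1/2)` with norms in `H^{s-1}_2`. -/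
def energy (s : ℝ) (q : ℝ → ℂ) : ℝ≥0∞ :=
  (functionNorm 2 (s - 1) (fun x ↦ ((‖q x‖ ^ 2 - 1 : ℝ) : ℂ)) ^ 2
    + derivNorm 2 (s - 1) q ^ 2) ^ (1 / 2 : ℝ)

/-- The functions in `H^s_loc` with finite energy `E^s`. -/
structure EnergyFun (s : ℝ) where
  /-- the underlying function -/
  toFun : ℝ → ℂ
  locallyIntegrable : LocallyIntegrable toFun volume
  hs_loc : ∀ χ : ℝ → ℂ, ContDiff ℝ ∞ χ → HasCompactSupport χ →
    ∃ u : Hs s, u.Represents (fun x ↦ χ x * toFun x)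
  energy_lt_top : energy s toFun < ⊤

/-- Two functions are identified if they agree almost everywhere up to a constant factor of
modulus one. -/
instance energySetoid (s : ℝ) : Setoid (EnergyFun s) where
  r p q := ∃ c : ℂ, ‖c‖ = 1 ∧ p.toFun =ᵐ[volume] fun x ↦ c * q.toFun x
  iseqv :=
    { refl := fun p ↦ ⟨1, by simp, by simp⟩
      symm := by
        rintro p q ⟨c, hc, h⟩
        have hc0 : c ≠ 0 := by rintro rfl; simp at hc
        refine ⟨c⁻¹, by simp [hc], ?_⟩
        filter_upwards [h] with x hx
        rw [hx, inv_mul_cancel_left₀ hc0]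
      trans := by
        rintro p q w ⟨c, hc, h⟩ ⟨d, hd, h'⟩
        refine ⟨c * d, by simp [hc, hd], ?_⟩
        filter_upwards [h, h'] with x hx hx'
        rw [hx, hx', mul_assoc] }

/-- The energy space `X^s`. -/
def EnergySpace (s : ℝ) : Type := Quotient (energySetoid s)

/-- The distance
`d^s(p, q) = (∫ inf_{|c|=1} ‖sech(· - y)(c p - q)‖²_{H^s} dy)^(1/2)` of two functions. -/
def funDist (s : ℝ) (p q : ℝ → ℂ) : ℝ≥0∞ :=
  (∫⁻ y : ℝ, ⨅ c : Metric.sphere (0 : ℂ) 1,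
    functionNorm 1 s (fun x ↦ ((1 / Real.cosh (x - y) : ℝ) : ℂ) * (c * p x - q x)) ^ 2)
      ^ (1 / 2 : ℝ)

theorem sobolevNorm_smul_le (τ σ : ℝ) (c : ℂ) (hc : ‖c‖ = 1) (u : 𝓢'(ℝ, ℂ)) :
    sobolevNorm τ σ (c • u) ≤ sobolevNorm τ σ u := by
  refine le_iInf₂ fun g hg ↦ (iInf₂_le (c • g) ?_).trans ?_
  · rw [← Lp.toTemperedDistributionCLM_apply] at *
    simp [hg]
  · rw [enorm_smul]
    simp [← ofReal_norm, hc]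

theorem functionNorm_le_of_ae_eq (τ σ : ℝ) (c : ℂ) (hc : ‖c‖ = 1) {f g : ℝ → ℂ}
    (h : f =ᵐ[volume] fun x ↦ c * g x) : functionNorm τ σ f ≤ functionNorm τ σ g := by
  refine le_iInf₂ fun u hu ↦ (iInf₂_le (c • u) ?_).trans (sobolevNorm_smul_le τ σ c hc u)
  intro φ hφ
  have h1 : (c • u) φ = c * u φ := rfl
  rw [h1, hu φ hφ, ← integral_const_mul]
  refine integral_congr_ae ?_
  filter_upwards [h] with x hx
  rw [hx]
  ring

theorem funDist_le_of_equiv (s : ℝ) {p p' q q' : ℝ → ℂ} {c d : ℂ} (hc : ‖c‖ = 1) (hd : ‖d‖ = 1)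
    (hp : p =ᵐ[volume] fun x ↦ c * p' x) (hq : q =ᵐ[volume] fun x ↦ d * q' x) :
    funDist s p q ≤ funDist s p' q' := by
  have hc0 : c ≠ 0 := by rintro rfl; simp at hc
  refine ENNReal.rpow_le_rpow (lintegral_mono fun y ↦ le_iInf fun e ↦ ?_) (by norm_num)
  have he : ‖(e : ℂ)‖ = 1 := by simp
  refine (iInf_le _ (⟨d * e * c⁻¹, by simp [hc, hd, he]⟩ : Metric.sphere (0 : ℂ) 1)).trans ?_
  refine pow_le_pow_left₀ (zero_le) (functionNorm_le_of_ae_eq 1 s d hd ?_) 2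
  filter_upwards [hp, hq] with x hx hx'
  simp only [hx, hx']
  field_simp

/-- The distance `d^s` on `X^s`. -/
def energyDist (s : ℝ) : EnergySpace s → EnergySpace s → ℝ≥0∞ :=
  Quotient.lift₂ (fun p q : EnergyFun s ↦ funDist s p.toFun q.toFun) (by
    rintro p q p' q' ⟨c, hc, h⟩ ⟨d, hd, h'⟩
    have hc0 : c ≠ 0 := by rintro rfl; simp at hc
    have hd0 : d ≠ 0 := by rintro rfl; simp at hd
    refine le_antisymm (funDist_le_of_equiv s hc hd h h')
      (funDist_le_of_equiv s (c := c⁻¹) (d := d⁻¹) (by simp [hc]) (by simp [hd]) ?_ ?_)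
    · filter_upwards [h] with x hx
      rw [hx, inv_mul_cancel_left₀ hc0]
    · filter_upwards [h'] with x hx
      rw [hx, inv_mul_cancel_left₀ hd0])

/-- The class in `X^s` of a function of finite energy. -/
def EnergyFun.toClass {s : ℝ} (q : EnergyFun s) : EnergySpace s := Quotient.mk _ q

/-- The ball `B_r^s(q) = {p ∈ X^s | d^s(p, q) < r}`. -/
def energyBall (s : ℝ) (q : EnergyFun s) (r : ℝ) : Set (EnergySpace s) :=
  {P | energyDist s P q.toClass < ENNReal.ofReal r}

/-! ### The model spaces `l²_d` and `H̃^s` -/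

/-- The real sequences `(a_n)_{n ∈ ℤ}` with `∑ |a_n - a_{n-1}|² < ∞`. -/
def l2dSubmodule : Submodule ℝ (ℤ → ℝ) where
  carrier := {a | Memℓp (fun n ↦ a n - a (n - 1)) 2}
  add_mem' := by
    intro a b ha hb
    have h := Memℓp.add ha hb
    have e : (fun n ↦ (a + b) n - (a + b) (n - 1))
        = (fun n ↦ a n - a (n - 1)) + fun n ↦ b n - b (n - 1) := by
      funext n
      simp only [Pi.add_apply]
      ring
    rw [Set.mem_ofPred_eq, e]
    exact h
  zero_mem' := by
    have h := zero_memℓp (E := fun _ : ℤ ↦ ℝ) (p := 2)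
    have e : (fun n ↦ (0 : ℤ → ℝ) n - (0 : ℤ → ℝ) (n - 1)) = 0 := by
      funext n
      simp
    change Memℓp (fun n ↦ (0 : ℤ → ℝ) n - (0 : ℤ → ℝ) (n - 1)) 2
    rw [e]
    exact h
  smul_mem' := by
    intro c a ha
    have h := Memℓp.const_smul ha c
    have e : (fun n ↦ (c • a) n - (c • a) (n - 1)) = c • fun n ↦ a n - a (n - 1) := by
      funext n
      simp only [Pi.smul_apply, smul_eq_mul]
      ring
    rw [Set.mem_ofPred_eq, e]
    exact h

/-- The space of sequences with `∑ |a_n - a_{n-1}|² < ∞`, with the seminorm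
`(∑ |a_n - a_{n-1}|²)^(1/2)`. -/
def L2dSeq : Type := l2dSubmodule

instance : AddCommGroup L2dSeq := inferInstanceAs (AddCommGroup l2dSubmodule)

instance : Module ℝ L2dSeq := inferInstanceAs (Module ℝ l2dSubmodule)

/-- The sequence underlying an element of `L2dSeq`. -/
def L2dSeq.seq : L2dSeq →ₗ[ℝ] (ℤ → ℝ) := l2dSubmodule.subtype

/-- The difference map `(a_n) ↦ (a_n - a_{n-1})` into `ℓ²(ℤ)`. -/
def L2dSeq.diff : L2dSeq →ₗ[ℝ] lp (fun _ : ℤ ↦ ℝ) 2 where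
  toFun a := ⟨fun n ↦ a.seq n - a.seq (n - 1), a.2⟩
  map_add' a b := by
    ext n
    simp only [map_add, Pi.add_apply, lp.coeFn_add]
    ring
  map_smul' c a := by
    ext n
    simp only [map_smul, Pi.smul_apply, smul_eq_mul, lp.coeFn_smul, RingHom.id_apply]
    ring

instance : SeminormedAddCommGroup L2dSeq := SeminormedAddCommGroup.induced _ _ L2dSeq.diff

instance : NormedSpace ℝ L2dSeq := NormedSpace.induced ℝ _ _ L2dSeq.diff

theorem L2dSeq.hasSum_norm_sq (a : L2dSeq) :
    HasSum (fun n : ℤ ↦ |a.seq n - a.seq (n - 1)| ^ 2) (‖a‖ ^ 2) := by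
  have h := lp.hasSum_norm (p := 2) (by norm_num) (L2dSeq.diff a)
  have e : ‖a‖ = ‖L2dSeq.diff a‖ := rfl
  rw [e]
  have h2 : (2 : ℝ≥0∞).toReal = ((2 : ℕ) : ℝ) := by norm_num
  simp only [h2, Real.rpow_natCast] at h
  exact h

/-- The normed space `l²_d`. The seminorm of `L2dSeq` vanishes exactly on the constant sequences;
they are divided out. -/
abbrev L2d : Type := SeparationQuotient L2dSeq

/-- The window `η((x - 4Ln)/L)`. -/
def window (η : ℝ → ℝ) (L : ℝ) (n : ℤ) (x : ℝ) : ℝ := η ((x - 4 * L * n) / L)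

/-- The function `η((x - 4Ln)/L) f(x)`. -/
def windowed (η : ℝ → ℝ) (L : ℝ) (n : ℤ) (f : ℝ → ℂ) (x : ℝ) : ℂ := (window η L n x : ℂ) * f x

/-- The real subspace `H̃^s` of all `b ∈ H^s` such that
`⟨η((x - 4Ln)/L) b, η((x - 4Ln)/L) q⟩_{H^s}` is real for all `n ∈ ℤ`. The element `w` below is the
product `η((x - 4Ln)/L) b`. -/
def Htilde (s : ℝ) (η : ℝ → ℝ) (L : ℝ) (q : EnergyFun s) : Submodule ℝ (Hs s) where
  carrier := {b | ∀ n : ℤ, ∃ w : Hs s,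
    Hs.toDistribution s w
      = smulLeftCLM ℂ (fun x ↦ (window η L n x : ℂ)) (Hs.toDistribution s b) ∧
    (inner ℂ (toHs s (windowed η L n q.toFun)) w : ℂ).im = 0}
  add_mem' := by
    intro b b' hb hb' n
    obtain ⟨w, hw, h⟩ := hb n
    obtain ⟨w', hw', h'⟩ := hb' n
    exact ⟨w + w', by rw [map_add, map_add, map_add, hw, hw'], by
      rw [inner_add_right, Complex.add_im, h, h', add_zero]⟩
  zero_mem' := fun n ↦ ⟨0, by simp, by simp⟩
  smul_mem' := by
    intro c b hb n
    obtain ⟨w, hw, h⟩ := hb n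
    refine ⟨(c : ℂ) • w, ?_, ?_⟩
    · have : (c • b : Hs s) = (c : ℂ) • b := rfl
      rw [this, map_smul, map_smul, map_smul, hw]
    · rw [inner_smul_right, Complex.im_ofReal_mul, h, mul_zero]

/-! ### The charts -/

/-- The phase `θ(x) = ∑ a_n ρ((x - 4Ln)/L)`. -/
def phase (ρ : ℝ → ℝ) (L : ℝ) (a : ℤ → ℝ) (x : ℝ) : ℝ := ∑' n : ℤ, a n * window ρ L n x

/-- `μ_n = ⟨η((x - 4Ln)/L) p, η((x - 4Ln)/L) q⟩_{H^s}`. -/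
def correlation (s : ℝ) (η : ℝ → ℝ) (L : ℝ) (q p : EnergyFun s) (n : ℤ) : ℂ :=
  hsInner s (windowed η L n p.toFun) (windowed η L n q.toFun)

/-- `(α, b)` are the coordinates of `P ∈ X^s` in the chart around `q`: for a function `p` in the
class `P`, `α` is the class of a sequence `(a_n)` with `e^{i a_n} = μ_n / |μ_n|`, where the branch
of the phases is chosen such that `∑ |a_n - a_{n-1}|² < 1/2`, and `b = e^{-iθ} p - q`. -/
def IsCoordinate (s : ℝ) (η ρ : ℝ → ℝ) (L : ℝ) (q : EnergyFun s) (P : EnergySpace s)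
    (z : L2d × Htilde s η L q) : Prop :=
  ∃ (p : EnergyFun s) (a : L2dSeq), p.toClass = P ∧ SeparationQuotient.mk a = z.1 ∧
    (∀ n : ℤ, correlation s η L q p n ≠ 0 ∧
      Complex.exp (Complex.I * (a.seq n : ℂ))
        = correlation s η L q p n / (‖correlation s η L q p n‖ : ℂ)) ∧
    ‖a‖ ^ 2 < 1 / 2 ∧
    (z.2 : Hs s).Represents (fun x ↦
      Complex.exp (-Complex.I * (phase ρ L a.seq x : ℂ)) * p.toFun x - q.toFun x)

open Classical in
/-- The chart `P ↦ ((a_n), b)` around `q`. -/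
def chart (s : ℝ) (η ρ : ℝ → ℝ) (L : ℝ) (q : EnergyFun s) (P : EnergySpace s) :
    L2d × Htilde s η L q :=
  if h : ∃ z, IsCoordinate s η ρ L q P z then h.choose else 0

end

end GrossPitaevskii

open GrossPitaevskii

open FourierTransform

namespace GrossPitaevskii

noncomputable section

/-! ### Weighted `L²` bounds for Schwartz functions -/

theorem symbol_pos {τ : ℝ} (hτ : 0 < τ) (σ x : ℝ) : 0 < symbol τ σ x := by
  unfold symbol; positivity

theorem symbol_add {τ : ℝ} (hτ : 0 < τ) (σ σ' x : ℝ) :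
    symbol τ (σ + σ') x = symbol τ σ x * symbol τ σ' x := by
  unfold symbol
  rw [add_div, Real.rpow_add (by positivity)]

theorem symbol_zero (τ x : ℝ) : symbol τ 0 x = 1 := by simp [symbol]

theorem symbol_neg {τ : ℝ} (hτ : 0 < τ) (σ x : ℝ) :
    symbol τ (-σ) x = (symbol τ σ x)⁻¹ := by
  refine eq_inv_of_mul_eq_one_left ?_
  rw [← symbol_add hτ, neg_add_cancel, symbol_zero]

theorem symbol_mono {τ : ℝ} (hτ : 1 ≤ τ) {σ σ' : ℝ} (h : σ ≤ σ') (x : ℝ) :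
    symbol τ σ x ≤ symbol τ σ' x :=
  Real.rpow_le_rpow_of_exponent_le (by nlinarith [sq_nonneg (2 * Real.pi * x)]) (by linarith)

theorem symbol_neg_arg (τ σ x : ℝ) : symbol τ σ (-x) = symbol τ σ x := by
  simp [symbol]

theorem continuous_symbol {τ : ℝ} (hτ : 0 < τ) (σ : ℝ) : Continuous (symbol τ σ) :=
  (symbol_hasTemperateGrowth hτ σ).1.continuous

theorem symbol_peetre_nonneg {σ : ℝ} (hσ : 0 ≤ σ) (x y : ℝ) :
    symbol 1 σ (x + y) ≤ 2 ^ (σ / 2) * (symbol 1 σ x * symbol 1 σ y) := by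
  unfold symbol
  rw [← Real.mul_rpow (by positivity) (by positivity),
    ← Real.mul_rpow (by positivity) (by positivity)]
  refine Real.rpow_le_rpow (by positivity) ?_ (by positivity)
  nlinarith [sq_nonneg (2 * Real.pi * x - 2 * Real.pi * y),
    mul_nonneg (sq_nonneg (2 * Real.pi * x)) (sq_nonneg (2 * Real.pi * y))]

/-- Peetre's inequality. -/
theorem symbol_peetre (σ x y : ℝ) :
    symbol 1 σ (x + y) ≤ 2 ^ (|σ| / 2) * (symbol 1 |σ| x * symbol 1 σ y) := by
  rcases le_total 0 σ with h | h
  · simpa [abs_of_nonneg h] using symbol_peetre_nonneg h x y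
  · have h1 := symbol_peetre_nonneg (σ := -σ) (by linarith) (-x) (x + y)
    rw [neg_add_cancel_left, symbol_neg_arg, symbol_neg one_pos σ y,
      symbol_neg one_pos σ (x + y)] at h1
    rw [abs_of_nonpos h]
    have p1 := symbol_pos one_pos σ y
    have p2 := symbol_pos one_pos σ (x + y)
    have h2 := mul_le_mul_of_nonneg_right h1 (mul_pos p1 p2).le
    calc symbol 1 σ (x + y) = (symbol 1 σ y)⁻¹ * (symbol 1 σ y * symbol 1 σ (x + y)) := by
          rw [inv_mul_cancel_left₀ p1.ne']
      _ ≤ _ := h2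
      _ = 2 ^ (-σ / 2) * (symbol 1 (-σ) x * symbol 1 σ y)
          * ((symbol 1 σ (x + y))⁻¹ * symbol 1 σ (x + y)) := by ring
      _ = _ := by rw [inv_mul_cancel₀ p2.ne', mul_one]

/-- The symbol `(1 + ξ²)^(σ/2)` as an extended nonnegative number. -/
def esymbol (σ x : ℝ) : ℝ≥0∞ := ENNReal.ofReal (symbol 1 σ x)

theorem measurable_esymbol (σ : ℝ) : Measurable (esymbol σ) :=
  (continuous_symbol one_pos σ).measurable.ennreal_ofReal

theorem esymbol_peetre (σ x y : ℝ) :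
    esymbol σ (x + y) ≤ ENNReal.ofReal (2 ^ (|σ| / 2)) * (esymbol |σ| x * esymbol σ y) := by
  unfold esymbol
  rw [← ENNReal.ofReal_mul (symbol_pos one_pos _ _).le, ← ENNReal.ofReal_mul (by positivity)]
  exact ENNReal.ofReal_le_ofReal (symbol_peetre σ x y)

theorem esymbol_mono {σ σ' : ℝ} (h : σ ≤ σ') (x : ℝ) : esymbol σ x ≤ esymbol σ' x :=
  ENNReal.ofReal_le_ofReal (symbol_mono le_rfl h x)

theorem esymbol_add (σ σ' x : ℝ) : esymbol (σ + σ') x = esymbol σ x * esymbol σ' x := by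
  unfold esymbol
  rw [← ENNReal.ofReal_mul (symbol_pos one_pos _ _).le, symbol_add one_pos]

theorem esymbol_zero (x : ℝ) : esymbol 0 x = 1 := by simp [esymbol, symbol_zero]

/-- The square of the norm of a Schwartz function in `H^σ`. -/
def sobolevSq (σ : ℝ) (φ : 𝓢(ℝ, ℂ)) : ℝ≥0∞ := ∫⁻ x, (esymbol σ x * ‖𝓕 φ x‖ₑ) ^ 2

theorem lintegral_mul_sq_le {α : Type*} [MeasurableSpace α] (μ : Measure α) {f g : α → ℝ≥0∞}
    (hf : AEMeasurable f μ) (hg : AEMeasurable g μ) :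
    (∫⁻ a, f a * g a ∂μ) ^ 2 ≤ (∫⁻ a, f a ^ 2 ∂μ) * ∫⁻ a, g a ^ 2 ∂μ := by
  have h := ENNReal.lintegral_mul_le_Lp_mul_Lq μ Real.HolderConjugate.two_two hf hg
  have e : ∀ x : ℝ≥0∞, (x ^ (1 / (2 : ℝ))) ^ 2 = x := fun x ↦ by
    rw [← ENNReal.rpow_natCast, ← ENNReal.rpow_mul]; norm_num
  simp only [Pi.mul_apply, ENNReal.rpow_two] at h
  calc _ ≤ _ := pow_le_pow_left₀ zero_le h 2
    _ = _ := by rw [mul_pow, e, e]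

theorem lintegral_weight_mul_sq_le {α : Type*} [MeasurableSpace α] (μ : Measure α)
    {k g : α → ℝ≥0∞} (hk : AEMeasurable k μ) (hg : AEMeasurable g μ) :
    (∫⁻ a, k a * g a ∂μ) ^ 2 ≤ (∫⁻ a, k a ∂μ) * ∫⁻ a, k a * g a ^ 2 ∂μ := by
  have e : ∀ x : ℝ≥0∞, (x ^ (1 / (2 : ℝ))) ^ 2 = x := fun x ↦ by
    rw [← ENNReal.rpow_natCast, ← ENNReal.rpow_mul]; norm_num
  have h := lintegral_mul_sq_le μ (f := fun a ↦ k a ^ (1 / (2 : ℝ)))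
    (g := fun a ↦ k a ^ (1 / (2 : ℝ)) * g a) (hk.pow_const _) ((hk.pow_const _).mul hg)
  simp only [mul_pow, e, ← mul_assoc, ← sq] at h
  exact h

theorem measurable_enorm_schwartz (φ : 𝓢(ℝ, ℂ)) : Measurable fun x ↦ ‖φ x‖ₑ :=
  φ.continuous.measurable.enorm

theorem lintegral_enorm_sq_fourier (φ : 𝓢(ℝ, ℂ)) :
    ∫⁻ x, ‖𝓕 φ x‖ₑ ^ 2 = ∫⁻ x, ‖φ x‖ₑ ^ 2 := by
  have key : ∀ ψ : 𝓢(ℝ, ℂ), ∫⁻ x, ‖ψ x‖ₑ ^ 2 = ENNReal.ofReal (∫ x, ‖ψ x‖ ^ 2) := by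
    intro ψ
    have hi : Integrable (fun x ↦ ‖ψ x‖ ^ 2) := (ψ.memLp 2).integrable_norm_pow (by norm_num)
    rw [ofReal_integral_eq_lintegral_ofReal hi (.of_forall fun x ↦ by positivity)]
    refine lintegral_congr fun x ↦ ?_
    rw [ENNReal.ofReal_pow (norm_nonneg _), ofReal_norm]
  rw [key, key, SchwartzMap.integral_norm_sq_fourier]

/-- The product of two Schwartz functions. -/
def smul' (f φ : 𝓢(ℝ, ℂ)) : 𝓢(ℝ, ℂ) := SchwartzMap.smulLeftCLM ℂ f φ

@[simp] theorem smul'_apply (f φ : 𝓢(ℝ, ℂ)) (x : ℝ) : smul' f φ x = f x * φ x :=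
  SchwartzMap.smulLeftCLM_apply_apply f.hasTemperateGrowth φ x

/-- The translate `f(· - a)`. -/
def translate (a : ℝ) (f : 𝓢(ℝ, ℂ)) : 𝓢(ℝ, ℂ) := SchwartzMap.compSubConstCLM ℂ a f

@[simp] theorem translate_apply (a : ℝ) (f : 𝓢(ℝ, ℂ)) (x : ℝ) : translate a f x = f (x - a) :=
  SchwartzMap.compSubConstCLM_apply f a x

theorem fourier_fourier_apply (f : 𝓢(ℝ, ℂ)) (x : ℝ) : 𝓕 (𝓕 f) x = f (-x) := by
  have h := SchwartzMap.fourierInv_apply_eq (𝓕 f)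
  rw [fourierInv_fourier_eq] at h
  conv_rhs => rw [h]
  simp

theorem fourier_smul' (f φ : 𝓢(ℝ, ℂ)) (x : ℝ) :
    𝓕 (smul' f φ) x = ∫ y, 𝓕 f y * 𝓕 φ (x - y) := by
  have h1 : 𝓕 (SchwartzMap.convolution (ContinuousLinearMap.mul ℂ ℂ) (𝓕 f) (𝓕 φ))
      = 𝓕 (𝓕 (smul' f φ)) := by
    rw [SchwartzMap.fourier_convolution]
    ext y
    rw [SchwartzMap.pairing_apply_apply, fourier_fourier_apply, fourier_fourier_apply,
      fourier_fourier_apply]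
    simp
  have h2 : SchwartzMap.convolution (ContinuousLinearMap.mul ℂ ℂ) (𝓕 f) (𝓕 φ)
      = 𝓕 (smul' f φ) := by
    have h3 := congrArg (fun g : 𝓢(ℝ, ℂ) ↦ (𝓕⁻ g : 𝓢(ℝ, ℂ))) h1
    simpa only [fourierInv_fourier_eq] using h3
  rw [← h2, SchwartzMap.convolution_apply]
  rfl

theorem fourier_translate (a : ℝ) (f : 𝓢(ℝ, ℂ)) (x : ℝ) :
    𝓕 (translate a f) x = Complex.exp (↑(-2 * Real.pi * (a * x)) * Complex.I) * 𝓕 f x := by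
  rw [SchwartzMap.fourier_coe, SchwartzMap.fourier_coe, Real.fourier_eq', Real.fourier_eq',
    ← integral_const_mul, ← integral_add_right_eq_self _ a]
  refine integral_congr_ae (.of_forall fun y ↦ ?_)
  simp only [translate_apply, add_sub_cancel_right, smul_eq_mul, ← mul_assoc, ← Complex.exp_add]
  congr 2
  simp only [RCLike.inner_apply, conj_trivial]
  push_cast
  ring

theorem enorm_fourier_translate (a : ℝ) (f : 𝓢(ℝ, ℂ)) (x : ℝ) :
    ‖𝓕 (translate a f) x‖ₑ = ‖𝓕 f x‖ₑ := by
  rw [fourier_translate, enorm_mul, ← ofReal_norm, Complex.norm_exp_ofReal_mul_I]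
  simp

theorem lintegral_sub_left (g : ℝ → ℝ≥0∞) (y : ℝ) : ∫⁻ x, g (x - y) = ∫⁻ x, g x :=
  lintegral_sub_right_eq_self g y

/-- A bound for the norm of the multiplication by `f` in `H^σ`. -/
def multBound (σ : ℝ) (f : 𝓢(ℝ, ℂ)) : ℝ≥0∞ :=
  ENNReal.ofReal (2 ^ (|σ| / 2)) * ∫⁻ x, esymbol |σ| x * ‖𝓕 f x‖ₑ

theorem multBound_translate (σ a : ℝ) (f : 𝓢(ℝ, ℂ)) :
    multBound σ (translate a f) = multBound σ f := by
  simp only [multBound, enorm_fourier_translate]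

theorem esymbol_mul_fourier_le (σ : ℝ) (φ : 𝓢(ℝ, ℂ)) :
    ∃ ψ : 𝓢(ℝ, ℂ), ∀ x, esymbol σ x * ‖𝓕 φ x‖ₑ = ‖ψ x‖ₑ := by
  refine ⟨SchwartzMap.smulLeftCLM ℂ (fun x ↦ (symbol 1 σ x : ℂ)) (𝓕 φ), fun x ↦ ?_⟩
  rw [SchwartzMap.smulLeftCLM_apply_apply (symbol_ofReal_hasTemperateGrowth one_pos σ),
    smul_eq_mul, enorm_mul]
  congr 1
  rw [esymbol, ← ofReal_norm, Complex.norm_real, Real.norm_of_nonneg (symbol_pos one_pos _ _).le]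

theorem lintegral_enorm_schwartz_lt_top (φ : 𝓢(ℝ, ℂ)) : ∫⁻ x, ‖φ x‖ₑ < ⊤ :=
  φ.integrable.2

theorem lintegral_enorm_sq_schwartz_lt_top (φ : 𝓢(ℝ, ℂ)) : ∫⁻ x, ‖φ x‖ₑ ^ 2 < ⊤ := by
  have h := (φ.memLp 2).2
  rw [eLpNorm_lt_top_iff_lintegral_rpow_enorm_lt_top (by norm_num) (by norm_num)] at h
  simpa using h

theorem multBound_lt_top (σ : ℝ) (f : 𝓢(ℝ, ℂ)) : multBound σ f < ⊤ := by
  obtain ⟨ψ, hψ⟩ := esymbol_mul_fourier_le |σ| f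
  refine ENNReal.mul_lt_top ENNReal.ofReal_lt_top ?_
  simp only [hψ]
  exact lintegral_enorm_schwartz_lt_top ψ

theorem sobolevSq_lt_top (σ : ℝ) (f : 𝓢(ℝ, ℂ)) : sobolevSq σ f < ⊤ := by
  obtain ⟨ψ, hψ⟩ := esymbol_mul_fourier_le σ f
  simp only [sobolevSq, hψ]
  exact lintegral_enorm_sq_schwartz_lt_top ψ

theorem sobolevSq_smul'_le (σ : ℝ) (f φ : 𝓢(ℝ, ℂ)) :
    sobolevSq σ (smul' f φ) ≤ multBound σ f ^ 2 * sobolevSq σ φ := by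
  set c := ENNReal.ofReal (2 ^ (|σ| / 2))
  set k : ℝ → ℝ≥0∞ := fun y ↦ esymbol |σ| y * ‖𝓕 f y‖ₑ
  set g : ℝ → ℝ≥0∞ := fun y ↦ esymbol σ y * ‖𝓕 φ y‖ₑ
  have hk : Measurable k := (measurable_esymbol _).mul (measurable_enorm_schwartz _)
  have hg : Measurable g := (measurable_esymbol _).mul (measurable_enorm_schwartz _)
  have h1 : ∀ x, esymbol σ x * ‖𝓕 (smul' f φ) x‖ₑ ≤ c * ∫⁻ y, k y * g (x - y) := by
    intro x
    rw [fourier_smul', ← lintegral_const_mul' _ _ ENNReal.ofReal_ne_top]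
    calc _ ≤ esymbol σ x * ∫⁻ y, ‖𝓕 f y * 𝓕 φ (x - y)‖ₑ := by
          gcongr; exact enorm_integral_le_lintegral_enorm _
      _ = ∫⁻ y, esymbol σ x * ‖𝓕 f y * 𝓕 φ (x - y)‖ₑ := by
          rw [lintegral_const_mul]
          exact ((𝓕 f).continuous.mul
            ((𝓕 φ).continuous.comp (continuous_const.sub continuous_id))).measurable.enorm
      _ ≤ _ := lintegral_mono fun y ↦ by
          rw [enorm_mul]
          have := esymbol_peetre σ y (x - y)
          rw [add_sub_cancel] at this
          calc _ ≤ (c * (esymbol |σ| y * esymbol σ (x - y))) * (‖𝓕 f y‖ₑ * ‖𝓕 φ (x - y)‖ₑ) := by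
                gcongr
            _ = _ := by simp only [k, g]; ring
  calc sobolevSq σ (smul' f φ) ≤ ∫⁻ x, c ^ 2 * ((∫⁻ y, k y) * ∫⁻ y, k y * g (x - y) ^ 2) := by
        refine lintegral_mono fun x ↦ ?_
        calc _ ≤ (c * ∫⁻ y, k y * g (x - y)) ^ 2 := pow_le_pow_left₀ zero_le (h1 x) 2
          _ ≤ _ := by
            rw [mul_pow]
            gcongr
            exact lintegral_weight_mul_sq_le _ hk.aemeasurable
              (hg.comp (measurable_const_sub x)).aemeasurable
    _ = c ^ 2 * ((∫⁻ y, k y) * ∫⁻ x, ∫⁻ y, k y * g (x - y) ^ 2) := by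
        have hm : Measurable fun p : ℝ × ℝ ↦ k p.2 * g (p.1 - p.2) ^ 2 :=
          (hk.comp measurable_snd).mul
            ((hg.comp (measurable_fst.sub measurable_snd)).pow_const 2)
        rw [lintegral_const_mul, lintegral_const_mul]
        · exact hm.lintegral_prod_right'
        · exact (hm.lintegral_prod_right').const_mul _
    _ = c ^ 2 * ((∫⁻ y, k y) * ∫⁻ y, k y * ∫⁻ x, g x ^ 2) := by
        rw [lintegral_lintegral_swap]
        · congr 3
          funext y
          rw [lintegral_const_mul, lintegral_sub_left (fun x ↦ g x ^ 2)]
          exact (hg.comp (measurable_sub_const y)).pow_const 2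
        · exact ((hk.comp measurable_snd).mul
            ((hg.comp (measurable_fst.sub measurable_snd)).pow_const 2)).aemeasurable
    _ = _ := by
        rw [lintegral_mul_const _ hk]
        simp only [multBound, sobolevSq]
        ring

/-- Localization by the translates of a Schwartz function is bounded in `H^σ`. -/
theorem lintegral_sobolevSq_translate_le (σ : ℝ) (f φ : 𝓢(ℝ, ℂ)) :
    ∫⁻ a, sobolevSq σ (smul' (translate a f) φ)
      ≤ ENNReal.ofReal (2 ^ (|σ| / 2)) ^ 2 * sobolevSq |σ| f * sobolevSq σ φ := by
  set c := ENNReal.ofReal (2 ^ (|σ| / 2))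
  have hmeas : Measurable fun p : ℝ × ℝ ↦ ‖𝓕 (smul' (translate p.1 f) φ) p.2‖ₑ := by
    refine StronglyMeasurable.enorm ?_
    have : (fun p : ℝ × ℝ ↦ 𝓕 (smul' (translate p.1 f) φ) p.2) = fun p : ℝ × ℝ ↦
        ∫ y, Complex.exp (↑(-2 * Real.pi * (p.1 * y)) * Complex.I) * 𝓕 f y * 𝓕 φ (p.2 - y) := by
      funext p
      rw [fourier_smul']
      simp only [fourier_translate]
    rw [this]
    refine StronglyMeasurable.integral_prod_right
      (f := fun (p : ℝ × ℝ) (y : ℝ) ↦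
        Complex.exp (↑(-2 * Real.pi * (p.1 * y)) * Complex.I) * 𝓕 f y * 𝓕 φ (p.2 - y)) ?_
    refine Continuous.stronglyMeasurable ?_
    have h1 := (𝓕 f).continuous
    have h2 := (𝓕 φ).continuous
    fun_prop
  have hfix : ∀ x, ∫⁻ a, ‖𝓕 (smul' (translate a f) φ) x‖ₑ ^ 2
      = ∫⁻ y, ‖𝓕 f y‖ₑ ^ 2 * ‖𝓕 φ (x - y)‖ₑ ^ 2 := by
    intro x
    set g : 𝓢(ℝ, ℂ) := smul' (𝓕 f) (translate x (SchwartzMap.compCLMOfContinuousLinearEquiv ℂ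
      (LinearIsometryEquiv.neg ℝ : ℝ ≃ₗᵢ[ℝ] ℝ).toContinuousLinearEquiv (𝓕 φ)))
    have hg : ∀ y, g y = 𝓕 f y * 𝓕 φ (x - y) := fun y ↦ by
      simp [g]
    have e : ∀ a, 𝓕 (smul' (translate a f) φ) x = 𝓕 g a := by
      intro a
      rw [fourier_smul', SchwartzMap.fourier_coe g, Real.fourier_eq']
      refine integral_congr_ae (.of_forall fun y ↦ ?_)
      simp only [fourier_translate, hg, smul_eq_mul, mul_assoc]
      congr 4
    simp only [e, lintegral_enorm_sq_fourier, hg, enorm_mul, mul_pow]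
  calc ∫⁻ a, sobolevSq σ (smul' (translate a f) φ)
      = ∫⁻ x, esymbol σ x ^ 2 * ∫⁻ a, ‖𝓕 (smul' (translate a f) φ) x‖ₑ ^ 2 := by
        simp only [sobolevSq, mul_pow]
        rw [lintegral_lintegral_swap]
        · refine lintegral_congr fun x ↦ ?_
          rw [lintegral_const_mul]
          exact (hmeas.comp (measurable_id.prodMk measurable_const)).pow_const 2
        · exact ((((measurable_esymbol σ).comp measurable_snd).pow_const 2).mul
            (hmeas.pow_const 2)).aemeasurable
    _ ≤ ∫⁻ x, ∫⁻ y, c ^ 2 * ((esymbol |σ| y * ‖𝓕 f y‖ₑ) ^ 2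
          * (esymbol σ (x - y) * ‖𝓕 φ (x - y)‖ₑ) ^ 2) := by
        refine lintegral_mono fun x ↦ ?_
        rw [hfix, ← lintegral_const_mul]
        · refine lintegral_mono fun y ↦ ?_
          have := esymbol_peetre σ y (x - y)
          rw [add_sub_cancel] at this
          calc _ ≤ (c * (esymbol |σ| y * esymbol σ (x - y))) ^ 2
                * (‖𝓕 f y‖ₑ ^ 2 * ‖𝓕 φ (x - y)‖ₑ ^ 2) := by gcongr
            _ = _ := by ring
        · exact ((measurable_enorm_schwartz _).pow_const 2).mul
            (((measurable_enorm_schwartz _).comp (measurable_const_sub x)).pow_const 2)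
    _ = _ := by
        have m1 : Measurable fun y ↦ (esymbol |σ| y * ‖𝓕 f y‖ₑ) ^ 2 :=
          ((measurable_esymbol _).mul (measurable_enorm_schwartz _)).pow_const 2
        have m2 : Measurable fun y ↦ (esymbol σ y * ‖𝓕 φ y‖ₑ) ^ 2 :=
          ((measurable_esymbol _).mul (measurable_enorm_schwartz _)).pow_const 2
        have m3 : Measurable fun p : ℝ × ℝ ↦ (esymbol |σ| p.2 * ‖𝓕 f p.2‖ₑ) ^ 2
          * (esymbol σ (p.1 - p.2) * ‖𝓕 φ (p.1 - p.2)‖ₑ) ^ 2 :=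
          (m1.comp measurable_snd).mul (m2.comp (measurable_fst.sub measurable_snd))
        rw [lintegral_lintegral_swap (m3.const_mul _).aemeasurable]
        have : ∀ y, ∫⁻ x, c ^ 2 * ((esymbol |σ| y * ‖𝓕 f y‖ₑ) ^ 2
            * (esymbol σ (x - y) * ‖𝓕 φ (x - y)‖ₑ) ^ 2)
            = c ^ 2 * ((esymbol |σ| y * ‖𝓕 f y‖ₑ) ^ 2 * sobolevSq σ φ) := by
          intro y
          have m4 : Measurable fun x ↦ (esymbol σ (x - y) * ‖𝓕 φ (x - y)‖ₑ) ^ 2 :=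
            m2.comp (measurable_sub_const y)
          rw [lintegral_const_mul _ (m4.const_mul _), lintegral_const_mul _ m4,
            lintegral_sub_left (fun x ↦ (esymbol σ x * ‖𝓕 φ x‖ₑ) ^ 2)]
          rfl
        simp only [this]
        rw [lintegral_const_mul _ (m1.mul_const _), lintegral_mul_const _ m1, ← mul_assoc]
        rfl

/-- The complex conjugate of a Schwartz function. -/
def conjS (φ : 𝓢(ℝ, ℂ)) : 𝓢(ℝ, ℂ) :=
  SchwartzMap.postcompCLM (𝕜 := ℝ) (Complex.conjCLE : ℂ →L[ℝ] ℂ) φ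

@[simp] theorem conjS_apply (φ : 𝓢(ℝ, ℂ)) (x : ℝ) : conjS φ x = starRingEnd ℂ (φ x) := rfl

theorem fourier_conjS (φ : 𝓢(ℝ, ℂ)) (x : ℝ) : 𝓕 (conjS φ) x = starRingEnd ℂ (𝓕 φ (-x)) := by
  rw [SchwartzMap.fourier_coe, SchwartzMap.fourier_coe, Real.fourier_eq', Real.fourier_eq',
    ← integral_conj]
  refine integral_congr_ae (.of_forall fun y ↦ ?_)
  simp only [conjS_apply, smul_eq_mul, map_mul, ← Complex.exp_conj, Complex.conj_ofReal,
    Complex.conj_I]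
  congr 2
  simp

theorem sobolevSq_conjS (σ : ℝ) (φ : 𝓢(ℝ, ℂ)) : sobolevSq σ (conjS φ) = sobolevSq σ φ := by
  unfold sobolevSq
  rw [← lintegral_neg_eq_self]
  refine lintegral_congr fun x ↦ ?_
  rw [fourier_conjS, neg_neg]
  congr 2
  · simp [esymbol, symbol_neg_arg]
  · rw [← ofReal_norm, ← ofReal_norm, RCLike.norm_conj]

theorem lintegral_esymbol_neg_one_sq_lt_top : ∫⁻ x, esymbol (-1) x ^ 2 < ⊤ := by
  have h1 : Integrable (fun x : ℝ ↦ (1 + (2 * Real.pi * x) ^ 2)⁻¹) := by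
    have := (integrable_inv_one_add_sq).comp_mul_left' (R := 2 * Real.pi) (by positivity)
    exact this
  refine lt_of_le_of_lt (le_of_eq ?_) h1.lintegral_lt_top
  refine lintegral_congr fun x ↦ ?_
  rw [esymbol, ← ENNReal.ofReal_pow (symbol_pos one_pos _ _).le, symbol, ← Real.rpow_natCast,
    ← Real.rpow_mul (by positivity), one_pow]
  norm_num [Real.rpow_neg_one]

/-- The product maps `H^s × H^s` into `H^{s-1}`. -/
theorem sobolevSq_mul_le {s : ℝ} (hs : 0 ≤ s) (φ ψ : 𝓢(ℝ, ℂ)) :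
    sobolevSq (s - 1) (smul' φ ψ) ≤ (∫⁻ x, esymbol (-1) x ^ 2) * ENNReal.ofReal (2 ^ (s / 2)) ^ 2
      * (sobolevSq s φ * sobolevSq s ψ) := by
  set c := ENNReal.ofReal (2 ^ (s / 2))
  have hmf := fun (χ : 𝓢(ℝ, ℂ)) ↦
    ((measurable_esymbol s).mul (measurable_enorm_schwartz (𝓕 χ)))
  have h1 : ∀ x, esymbol s x * ‖𝓕 (smul' φ ψ) x‖ₑ ≤ c * ∫⁻ y, (esymbol s y * ‖𝓕 φ y‖ₑ)
      * (esymbol s (x - y) * ‖𝓕 ψ (x - y)‖ₑ) := by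
    intro x
    rw [fourier_smul', ← lintegral_const_mul' _ _ ENNReal.ofReal_ne_top]
    calc _ ≤ esymbol s x * ∫⁻ y, ‖𝓕 φ y * 𝓕 ψ (x - y)‖ₑ := by
          gcongr; exact enorm_integral_le_lintegral_enorm _
      _ = ∫⁻ y, esymbol s x * ‖𝓕 φ y * 𝓕 ψ (x - y)‖ₑ := by
          rw [lintegral_const_mul]
          exact ((𝓕 φ).continuous.mul
            ((𝓕 ψ).continuous.comp (continuous_const.sub continuous_id))).measurable.enorm
      _ ≤ _ := lintegral_mono fun y ↦ by
          rw [enorm_mul]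
          have := esymbol_peetre s y (x - y)
          rw [add_sub_cancel, abs_of_nonneg hs] at this
          calc _ ≤ (c * (esymbol s y * esymbol s (x - y))) * (‖𝓕 φ y‖ₑ * ‖𝓕 ψ (x - y)‖ₑ) := by
                gcongr
            _ = _ := by ring
  have h2 : ∀ x, (esymbol s x * ‖𝓕 (smul' φ ψ) x‖ₑ) ^ 2
      ≤ c ^ 2 * (sobolevSq s φ * sobolevSq s ψ) := by
    intro x
    calc _ ≤ (c * ∫⁻ y, (esymbol s y * ‖𝓕 φ y‖ₑ)
          * (esymbol s (x - y) * ‖𝓕 ψ (x - y)‖ₑ)) ^ 2 := pow_le_pow_left₀ zero_le (h1 x) 2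
      _ ≤ c ^ 2 * (sobolevSq s φ * ∫⁻ y, (esymbol s (x - y) * ‖𝓕 ψ (x - y)‖ₑ) ^ 2) := by
        rw [mul_pow]
        gcongr
        exact lintegral_mul_sq_le _ (hmf φ).aemeasurable
          ((hmf ψ).comp (measurable_const_sub x)).aemeasurable
      _ = _ := by
        rw [lintegral_sub_left_eq_self (fun y ↦ (esymbol s y * ‖𝓕 ψ y‖ₑ) ^ 2) x]
        rfl
  calc sobolevSq (s - 1) (smul' φ ψ)
      ≤ ∫⁻ x, esymbol (-1) x ^ 2 * (c ^ 2 * (sobolevSq s φ * sobolevSq s ψ)) := by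
        refine lintegral_mono fun x ↦ ?_
        rw [sub_eq_neg_add, esymbol_add, mul_assoc, mul_pow]
        gcongr
        exact h2 x
    _ = _ := by
        rw [lintegral_mul_const _ ((measurable_esymbol _).pow_const 2)]
        ring


/-! ### The spaces `H^σ` -/

theorem Lp.toTemperedDistribution_injective {g h : Lp ℂ 2 (volume : Measure ℝ)}
    (e : (g : 𝓢'(ℝ, ℂ)) = (h : 𝓢'(ℝ, ℂ))) : g = h :=
  LinearMap.ker_eq_bot.1 (Lp.ker_toTemperedDistributionCLM_eq_bot (F := ℂ)
    (μ := (volume : Measure ℝ)) (p := 2)) e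

theorem bessel_bessel (σ σ' : ℝ) (u : 𝓢'(ℝ, ℂ)) :
    bessel 1 σ (bessel 1 σ' u) = bessel 1 (σ + σ') u := by
  simp only [bessel]
  rw [fourierMultiplierCLM_fourierMultiplierCLM_apply
    (symbol_ofReal_hasTemperateGrowth one_pos σ') (symbol_ofReal_hasTemperateGrowth one_pos σ)]
  congr 2
  funext x
  simp only [Pi.mul_apply]
  rw [← Complex.ofReal_mul, ← symbol_add one_pos, add_comm]

theorem bessel_zero (u : 𝓢'(ℝ, ℂ)) : bessel 1 0 u = u := by
  simp [bessel, symbol_zero]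

theorem bessel_neg_bessel (σ : ℝ) (u : 𝓢'(ℝ, ℂ)) : bessel 1 (-σ) (bessel 1 σ u) = u := by
  rw [bessel_bessel, neg_add_cancel, bessel_zero]

theorem bessel_bessel_neg (σ : ℝ) (u : 𝓢'(ℝ, ℂ)) : bessel 1 σ (bessel 1 (-σ) u) = u := by
  rw [bessel_bessel, add_neg_cancel, bessel_zero]

/-- The operator `(1 + D²)^(σ/2)` on Schwartz functions. -/
def besselS (σ : ℝ) : 𝓢(ℝ, ℂ) →L[ℂ] 𝓢(ℝ, ℂ) :=
  SchwartzMap.fourierMultiplierCLM ℂ (fun x ↦ (symbol 1 σ x : ℂ))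

theorem bessel_coe (σ : ℝ) (φ : 𝓢(ℝ, ℂ)) :
    bessel 1 σ (φ : 𝓢'(ℝ, ℂ)) = (besselS σ φ : 𝓢'(ℝ, ℂ)) :=
  fourierMultiplierCLM_toTemperedDistributionCLM_eq (symbol_ofReal_hasTemperateGrowth one_pos σ) φ

theorem fourier_besselS (σ : ℝ) (φ : 𝓢(ℝ, ℂ)) (x : ℝ) :
    𝓕 (besselS σ φ) x = (symbol 1 σ x : ℂ) * 𝓕 φ x := by
  rw [besselS, SchwartzMap.fourierMultiplierCLM_apply, fourier_fourierInv_eq,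
    SchwartzMap.smulLeftCLM_apply_apply (symbol_ofReal_hasTemperateGrowth one_pos σ), smul_eq_mul]

theorem besselS_besselS_neg (σ : ℝ) (φ : 𝓢(ℝ, ℂ)) : besselS σ (besselS (-σ) φ) = φ := by
  have h : 𝓕 (besselS σ (besselS (-σ) φ)) = 𝓕 φ := by
    ext x
    rw [fourier_besselS, fourier_besselS, ← mul_assoc, ← Complex.ofReal_mul,
      ← symbol_add one_pos, add_neg_cancel, symbol_zero]
    simp
  have h3 := congrArg (fun g : 𝓢(ℝ, ℂ) ↦ (𝓕⁻ g : 𝓢(ℝ, ℂ))) h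
  simpa only [fourierInv_fourier_eq] using h3

theorem enorm_symbol (σ x : ℝ) : ‖(symbol 1 σ x : ℂ)‖ₑ = esymbol σ x := by
  rw [esymbol, ← ofReal_norm, Complex.norm_real, Real.norm_of_nonneg (symbol_pos one_pos _ _).le]

theorem enorm_toLp_sq (φ : 𝓢(ℝ, ℂ)) : ‖φ.toLp 2‖ₑ ^ 2 = ∫⁻ x, ‖φ x‖ₑ ^ 2 := by
  rw [Lp.enorm_def, eLpNorm_congr_ae (φ.coeFn_toLp 2 volume),
    eLpNorm_eq_lintegral_rpow_enorm_toReal (by norm_num) (by norm_num), ← ENNReal.rpow_natCast,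
    ← ENNReal.rpow_mul]
  norm_num

theorem lintegral_besselS (σ : ℝ) (φ : 𝓢(ℝ, ℂ)) :
    ∫⁻ x, ‖besselS σ φ x‖ₑ ^ 2 = sobolevSq σ φ := by
  rw [← lintegral_enorm_sq_fourier]
  simp only [fourier_besselS, enorm_mul, enorm_symbol, sobolevSq]

/-- A Schwartz function as an element of `H^σ`. -/
def ofS (σ : ℝ) : 𝓢(ℝ, ℂ) →ₗ[ℂ] Hs σ where
  toFun φ := (⟨φ, (besselS σ φ).toLp 2, by
    rw [Lp.toTemperedDistribution_toLp_eq, bessel_coe]⟩ : sobolevSubmodule σ)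
  map_add' φ ψ := Subtype.ext (by simp; rfl)
  map_smul' c φ := Subtype.ext (by simp; rfl)

@[simp] theorem toDistribution_ofS (σ : ℝ) (φ : 𝓢(ℝ, ℂ)) :
    Hs.toDistribution σ (ofS σ φ) = (φ : 𝓢'(ℝ, ℂ)) := rfl

theorem toL2_ofS (σ : ℝ) (φ : 𝓢(ℝ, ℂ)) : Hs.toL2 σ (ofS σ φ) = (besselS σ φ).toLp 2 := by
  apply Lp.toTemperedDistribution_injective
  rw [← Hs.bessel_toDistribution, toDistribution_ofS, Lp.toTemperedDistribution_toLp_eq, bessel_coe]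

theorem enorm_ofS_sq (σ : ℝ) (φ : 𝓢(ℝ, ℂ)) : ‖ofS σ φ‖ₑ ^ 2 = sobolevSq σ φ := by
  have h : ‖ofS σ φ‖ₑ = ‖Hs.toL2 σ (ofS σ φ)‖ₑ := rfl
  rw [h, toL2_ofS, enorm_toLp_sq, lintegral_besselS]

theorem norm_ofS_le {σ σ' : ℝ} {φ ψ : 𝓢(ℝ, ℂ)} {C : ℝ≥0∞} (hC : C ≠ ⊤)
    (h : sobolevSq σ' ψ ≤ C ^ 2 * sobolevSq σ φ) : ‖ofS σ' ψ‖ ≤ C.toReal * ‖ofS σ φ‖ := by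
  rw [← enorm_ofS_sq, ← enorm_ofS_sq, ← mul_pow] at h
  have h1 : ‖ofS σ' ψ‖ₑ ≤ C * ‖ofS σ φ‖ₑ := (ENNReal.pow_le_pow_left_iff two_ne_zero).1 h
  have h2 := ENNReal.toReal_mono (ENNReal.mul_ne_top hC enorm_ne_top) h1
  simpa [ENNReal.toReal_mul] using h2

theorem Hs.toDistribution_injective (σ : ℝ) : Function.Injective (Hs.toDistribution σ) :=
  Subtype.val_injective

theorem Hs.toL2_surjective (σ : ℝ) : Function.Surjective (Hs.toL2 σ) := by
  intro g
  let u : Hs σ := (⟨bessel 1 (-σ) g, g, bessel_bessel_neg σ _⟩ : sobolevSubmodule σ)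
  refine ⟨u, ?_⟩
  apply Lp.toTemperedDistribution_injective
  rw [← Hs.bessel_toDistribution u]
  exact bessel_bessel_neg σ _

/-- The isometry `(1 + D²)^(σ/2)` from `H^σ` onto `L²`. -/
def Hs.toL2Equiv (σ : ℝ) : Hs σ ≃ₗᵢ[ℂ] Lp ℂ 2 (volume : Measure ℝ) where
  __ := LinearEquiv.ofBijective (Hs.toL2 σ) ⟨Hs.toL2_injective σ, Hs.toL2_surjective σ⟩
  norm_map' _ := rfl

@[simp] theorem Hs.toL2Equiv_apply (σ : ℝ) (u : Hs σ) : Hs.toL2Equiv σ u = Hs.toL2 σ u := rfl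

instance (σ : ℝ) : CompleteSpace (Hs σ) :=
  ((Hs.toL2Equiv σ).isometry.isUniformInducing.completeSpace_congr
    (Hs.toL2Equiv σ).surjective).2 inferInstance

/-- The continuous inclusion of `H^σ` into the tempered distributions. -/
def Hs.toDistributionCLM (σ : ℝ) : Hs σ →L[ℂ] 𝓢'(ℝ, ℂ) :=
  (bessel 1 (-σ)).comp ((Lp.toTemperedDistributionCLM ℂ volume 2).comp
    ((Hs.toL2Equiv σ).toContinuousLinearEquiv : Hs σ →L[ℂ] Lp ℂ 2 (volume : Measure ℝ)))

@[simp] theorem Hs.toDistributionCLM_apply (σ : ℝ) (u : Hs σ) :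
    Hs.toDistributionCLM σ u = Hs.toDistribution σ u := by
  have h : Hs.toDistributionCLM σ u = bessel 1 (-σ) (Hs.toL2 σ u : 𝓢'(ℝ, ℂ)) := rfl
  rw [h, ← Hs.bessel_toDistribution, bessel_neg_bessel]

theorem Hs.continuous_toDistribution (σ : ℝ) : Continuous (Hs.toDistribution σ) := by
  have h : (Hs.toDistributionCLM σ : Hs σ → 𝓢'(ℝ, ℂ)) = Hs.toDistribution σ :=
    funext (Hs.toDistributionCLM_apply σ)
  rw [← h]
  exact (Hs.toDistributionCLM σ).continuous

theorem continuous_eval (φ : 𝓢(ℝ, ℂ)) : Continuous fun u : 𝓢'(ℝ, ℂ) ↦ u φ :=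
  (PointwiseConvergenceCLM.evalCLM (RingHom.id ℂ) ℂ φ : 𝓢'(ℝ, ℂ) →L[ℂ] ℂ).continuous

theorem denseRange_ofS (σ : ℝ) : DenseRange (ofS σ) := by
  have h1 : DenseRange (fun φ : 𝓢(ℝ, ℂ) ↦ (Hs.toL2Equiv σ).symm (φ.toLp 2)) :=
    (Hs.toL2Equiv σ).symm.surjective.denseRange.comp
      (SchwartzMap.denseRange_toLpCLM (E := ℝ) (F := ℂ) (p := 2) (μ := volume)
        ENNReal.ofNat_ne_top) (Hs.toL2Equiv σ).symm.continuous
  refine h1.mono ?_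
  rintro _ ⟨φ, rfl⟩
  refine ⟨besselS (-σ) φ, ?_⟩
  apply (Hs.toL2Equiv σ).injective
  rw [Hs.toL2Equiv_apply, toL2_ofS, besselS_besselS_neg]
  exact ((Hs.toL2Equiv σ).apply_symm_apply _).symm

/-- Extension by density of an operator that is bounded on Schwartz functions. -/
theorem exists_extension {σ σ' : ℝ} (A : 𝓢'(ℝ, ℂ) →L[ℂ] 𝓢'(ℝ, ℂ)) (A₀ : 𝓢(ℝ, ℂ) →ₗ[ℂ] 𝓢(ℝ, ℂ))
    (hA : ∀ φ : 𝓢(ℝ, ℂ), A (φ : 𝓢'(ℝ, ℂ)) = (A₀ φ : 𝓢'(ℝ, ℂ))) {C : ℝ≥0∞} (hC : C ≠ ⊤)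
    (h : ∀ φ, sobolevSq σ' (A₀ φ) ≤ C ^ 2 * sobolevSq σ φ) :
    ∃ T : Hs σ →L[ℂ] Hs σ', (∀ u, Hs.toDistribution σ' (T u) = A (Hs.toDistribution σ u)) ∧
      ‖T‖ ≤ C.toReal ∧ ∀ φ, T (ofS σ φ) = ofS σ' (A₀ φ) := by
  have hb : ∀ φ, ‖((ofS σ').comp A₀) φ‖ ≤ C.toReal * ‖ofS σ φ‖ := fun φ ↦ norm_ofS_le hC (h φ)
  have e := LinearMap.extendOfNorm_eq (f := (ofS σ').comp A₀) (denseRange_ofS σ) ⟨_, hb⟩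
  refine ⟨((ofS σ').comp A₀).extendOfNorm (ofS σ), fun u ↦ ?_,
    LinearMap.opNorm_extendOfNorm_le (denseRange_ofS σ) ENNReal.toReal_nonneg hb, fun φ ↦ e φ⟩
  refine (denseRange_ofS σ).induction_on u ?_ fun φ ↦ ?_
  · exact isClosed_eq ((Hs.continuous_toDistribution σ').comp (ContinuousLinearMap.continuous _))
      (A.continuous.comp (Hs.continuous_toDistribution σ))
  · rw [e, toDistribution_ofS, hA]
    rfl

theorem smulLeftCLM_coe (f φ : 𝓢(ℝ, ℂ)) :
    smulLeftCLM ℂ f (φ : 𝓢'(ℝ, ℂ)) = (smul' f φ : 𝓢'(ℝ, ℂ)) := by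
  ext ψ
  rw [smulLeftCLM_apply_apply, SchwartzMap.coe_apply, SchwartzMap.coe_apply]
  refine integral_congr_ae (.of_forall fun x ↦ ?_)
  simp only [SchwartzMap.smulLeftCLM_apply_apply f.hasTemperateGrowth, smul'_apply, smul_eq_mul]
  ring

theorem exists_mulOp (σ : ℝ) (f : 𝓢(ℝ, ℂ)) : ∃ T : Hs σ →L[ℂ] Hs σ,
    (∀ u, Hs.toDistribution σ (T u) = smulLeftCLM ℂ f (Hs.toDistribution σ u)) ∧
      ‖T‖ ≤ (multBound σ f).toReal ∧ ∀ φ, T (ofS σ φ) = ofS σ (smul' f φ) :=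
  exists_extension (smulLeftCLM ℂ f) (SchwartzMap.smulLeftCLM ℂ f).toLinearMap
    (smulLeftCLM_coe f) (multBound_lt_top σ f).ne (sobolevSq_smul'_le σ f)

/-- The multiplication by a Schwartz function in `H^σ`. -/
def mulOp (σ : ℝ) (f : 𝓢(ℝ, ℂ)) : Hs σ →L[ℂ] Hs σ := (exists_mulOp σ f).choose

theorem toDistribution_mulOp {σ : ℝ} (f : 𝓢(ℝ, ℂ)) (u : Hs σ) :
    Hs.toDistribution σ (mulOp σ f u) = smulLeftCLM ℂ f (Hs.toDistribution σ u) :=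
  (exists_mulOp σ f).choose_spec.1 u

theorem toDistribution_mulOp_apply {σ : ℝ} (f : 𝓢(ℝ, ℂ)) (u : Hs σ) (φ : 𝓢(ℝ, ℂ)) :
    Hs.toDistribution σ (mulOp σ f u) φ = Hs.toDistribution σ u (smul' f φ) := by
  rw [toDistribution_mulOp]; rfl

theorem norm_mulOp_le (σ : ℝ) (f : 𝓢(ℝ, ℂ)) : ‖mulOp σ f‖ ≤ (multBound σ f).toReal :=
  (exists_mulOp σ f).choose_spec.2.1

theorem mulOp_ofS (σ : ℝ) (f φ : 𝓢(ℝ, ℂ)) : mulOp σ f (ofS σ φ) = ofS σ (smul' f φ) :=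
  (exists_mulOp σ f).choose_spec.2.2 φ

theorem Hs.ext_distribution {σ : ℝ} {u v : Hs σ}
    (h : ∀ φ, Hs.toDistribution σ u φ = Hs.toDistribution σ v φ) : u = v :=
  Hs.toDistribution_injective σ (by ext φ; exact h φ)

theorem mulOp_mulOp {σ : ℝ} {f g h : 𝓢(ℝ, ℂ)} (e : ∀ x, f x * g x = h x) (u : Hs σ) :
    mulOp σ f (mulOp σ g u) = mulOp σ h u := by
  apply Hs.ext_distribution
  intro φ
  rw [toDistribution_mulOp_apply, toDistribution_mulOp_apply, toDistribution_mulOp_apply]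
  congr 1
  ext x
  simp only [smul'_apply, ← e]
  ring

theorem mulOp_add (σ : ℝ) (f g : 𝓢(ℝ, ℂ)) : mulOp σ (f + g) = mulOp σ f + mulOp σ g := by
  ext1 u
  apply Hs.ext_distribution
  intro φ
  rw [add_apply, map_add]
  change _ = Hs.toDistribution σ _ φ + Hs.toDistribution σ _ φ
  rw [toDistribution_mulOp_apply, toDistribution_mulOp_apply, toDistribution_mulOp_apply,
    ← map_add]
  congr 1
  ext x
  simp [add_mul]

theorem mulOp_smul (σ : ℝ) (c : ℂ) (f : 𝓢(ℝ, ℂ)) : mulOp σ (c • f) = c • mulOp σ f := by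
  ext1 u
  apply Hs.ext_distribution
  intro φ
  rw [smul_apply, map_smul]
  change _ = c • Hs.toDistribution σ _ φ
  rw [toDistribution_mulOp_apply, toDistribution_mulOp_apply, ← map_smul]
  congr 1
  ext x
  simp [mul_assoc]

/-- `mulOp` as a linear map. -/
def mulOpₗ (σ : ℝ) : 𝓢(ℝ, ℂ) →ₗ[ℂ] (Hs σ →L[ℂ] Hs σ) where
  toFun := mulOp σ
  map_add' := mulOp_add σ
  map_smul' := mulOp_smul σ

theorem exists_incl {σ σ' : ℝ} (h : σ' ≤ σ) : ∃ T : Hs σ →L[ℂ] Hs σ',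
    (∀ u, Hs.toDistribution σ' (T u) = Hs.toDistribution σ u) ∧ ‖T‖ ≤ 1 := by
  obtain ⟨T, h1, h2, -⟩ := exists_extension (σ := σ) (σ' := σ') (.id ℂ _) .id (fun _ ↦ rfl)
    (C := 1) (by simp) (fun φ ↦ by
      rw [one_pow, one_mul]
      exact lintegral_mono fun x ↦ pow_le_pow_left₀ zero_le
        (mul_le_mul_left (esymbol_mono h x) _) 2)
  exact ⟨T, h1, by simpa using h2⟩

/-- The inclusion `H^σ ⊆ H^σ'` for `σ' ≤ σ`. -/
def incl {σ σ' : ℝ} (h : σ' ≤ σ) : Hs σ →L[ℂ] Hs σ' := (exists_incl h).choose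

@[simp] theorem toDistribution_incl {σ σ' : ℝ} (h : σ' ≤ σ) (u : Hs σ) :
    Hs.toDistribution σ' (incl h u) = Hs.toDistribution σ u := (exists_incl h).choose_spec.1 u

theorem norm_incl_le {σ σ' : ℝ} (h : σ' ≤ σ) (u : Hs σ) : ‖incl h u‖ ≤ ‖u‖ := by
  simpa using (incl h).le_of_opNorm_le (exists_incl h).choose_spec.2 u

theorem incl_ofS {σ σ' : ℝ} (h : σ' ≤ σ) (φ : 𝓢(ℝ, ℂ)) : incl h (ofS σ φ) = ofS σ' φ :=
  Hs.toDistribution_injective _ (by simp)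

theorem fourier_derivS (φ : 𝓢(ℝ, ℂ)) (x : ℝ) :
    𝓕 (SchwartzMap.derivCLM ℂ ℂ φ) x = 2 * Real.pi * Complex.I * x * 𝓕 φ x := by
  have h := Real.fourier_deriv (f := φ) φ.integrable φ.differentiable
    (SchwartzMap.derivCLM ℂ ℂ φ).integrable
  have h2 := congrFun h x
  rw [SchwartzMap.fourier_coe, SchwartzMap.fourier_coe]
  exact h2

theorem esymbol_sq_eq (σ x : ℝ) : esymbol σ x ^ 2
    = esymbol (σ - 1) x ^ 2 + esymbol (σ - 1) x ^ 2 * ENNReal.ofReal ((2 * Real.pi * x) ^ 2) := by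
  have h : esymbol 1 x ^ 2 = 1 + ENNReal.ofReal ((2 * Real.pi * x) ^ 2) := by
    rw [esymbol, ← ENNReal.ofReal_pow (symbol_pos one_pos _ _).le, symbol, ← Real.rpow_natCast,
      ← Real.rpow_mul (by positivity)]
    norm_num
    rw [ENNReal.ofReal_add (by norm_num) (by positivity), ENNReal.ofReal_one]
  calc _ = (esymbol (σ - 1) x * esymbol 1 x) ^ 2 := by rw [← esymbol_add, sub_add_cancel]
    _ = _ := by rw [mul_pow, h, mul_add, mul_one]

theorem sobolevSq_eq_add_deriv (σ : ℝ) (φ : 𝓢(ℝ, ℂ)) : sobolevSq σ φ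
    = sobolevSq (σ - 1) φ + sobolevSq (σ - 1) (SchwartzMap.derivCLM ℂ ℂ φ) := by
  unfold sobolevSq
  have hm : Measurable fun x ↦ (esymbol (σ - 1) x * ‖𝓕 φ x‖ₑ) ^ 2 :=
    ((measurable_esymbol _).mul (measurable_enorm_schwartz _)).pow_const 2
  rw [← lintegral_add_left hm]
  refine lintegral_congr fun x ↦ ?_
  have h : ‖𝓕 (SchwartzMap.derivCLM ℂ ℂ φ) x‖ₑ ^ 2
      = ENNReal.ofReal ((2 * Real.pi * x) ^ 2) * ‖𝓕 φ x‖ₑ ^ 2 := by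
    rw [fourier_derivS, enorm_mul, mul_pow]
    congr 1
    rw [← ofReal_norm, ← ENNReal.ofReal_pow (norm_nonneg _)]
    congr 1
    simp only [norm_mul, Complex.norm_I, Complex.norm_real, mul_one, Real.norm_eq_abs,
      Complex.norm_ofNat]
    rw [mul_pow, mul_pow, sq_abs, sq_abs]
    ring
  simp only [mul_pow, h]
  rw [esymbol_sq_eq σ x]
  ring_nf

theorem exists_derivOp (σ : ℝ) : ∃ T : Hs σ →L[ℂ] Hs (σ - 1),
    (∀ u, Hs.toDistribution (σ - 1) (T u) = TemperedDistribution.derivCLM ℂ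
      (Hs.toDistribution σ u)) ∧ ‖T‖ ≤ (1 : ℝ≥0∞).toReal ∧
      ∀ φ, T (ofS σ φ) = ofS (σ - 1) (SchwartzMap.derivCLM ℂ ℂ φ) :=
  exists_extension _ (SchwartzMap.derivCLM ℂ ℂ).toLinearMap
    (fun φ ↦ derivCLM_toTemperedDistributionCLM_eq ℂ φ) (by simp) (fun φ ↦ by
      rw [one_pow, one_mul, sobolevSq_eq_add_deriv σ φ]
      exact le_add_self)

/-- The derivative as an operator from `H^σ` to `H^{σ-1}`. -/
def derivOp (σ : ℝ) : Hs σ →L[ℂ] Hs (σ - 1) := (exists_derivOp σ).choose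

theorem toDistribution_derivOp_apply {σ : ℝ} (u : Hs σ) (φ : 𝓢(ℝ, ℂ)) :
    Hs.toDistribution (σ - 1) (derivOp σ u) φ
      = -Hs.toDistribution σ u (SchwartzMap.derivCLM ℂ ℂ φ) := by
  rw [derivOp, (exists_derivOp σ).choose_spec.1 u, derivCLM_apply_apply]
  simp

theorem norm_derivOp_le {σ : ℝ} (u : Hs σ) : ‖derivOp σ u‖ ≤ ‖u‖ := by
  simpa using (derivOp σ).le_of_opNorm_le (exists_derivOp σ).choose_spec.2.1 u

theorem derivOp_ofS (σ : ℝ) (φ : 𝓢(ℝ, ℂ)) :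
    derivOp σ (ofS σ φ) = ofS (σ - 1) (SchwartzMap.derivCLM ℂ ℂ φ) :=
  (exists_derivOp σ).choose_spec.2.2 φ

theorem norm_sq_eq_add_derivOp {σ : ℝ} (u : Hs σ) :
    ‖u‖ ^ 2 = ‖incl (sub_le_self σ zero_le_one) u‖ ^ 2 + ‖derivOp σ u‖ ^ 2 := by
  refine (denseRange_ofS σ).induction_on u (isClosed_eq (by fun_prop) (by fun_prop)) fun φ ↦ ?_
  rw [incl_ofS, derivOp_ofS]
  have h := sobolevSq_eq_add_deriv σ φ
  rw [← enorm_ofS_sq, ← enorm_ofS_sq, ← enorm_ofS_sq] at h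
  have h2 := congrArg ENNReal.toReal h
  rw [ENNReal.toReal_add (by simp) (by simp)] at h2
  simpa using h2

/-- The duality of `H^σ` and `H^{-σ}`. -/
theorem norm_toDistribution_apply_le {σ : ℝ} (u : Hs σ) (φ : 𝓢(ℝ, ℂ)) :
    ‖Hs.toDistribution σ u φ‖ ≤ ‖u‖ * ‖ofS (-σ) φ‖ := by
  refine (denseRange_ofS σ).induction_on u (isClosed_le ?_ (by fun_prop)) fun ψ ↦ ?_
  · exact ((continuous_eval φ).comp (Hs.continuous_toDistribution σ)).norm
  · rw [toDistribution_ofS, SchwartzMap.coe_apply]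
    have h1 : ∫ x, φ x • ψ x = ∫ x, 𝓕 φ x * 𝓕 ψ (-x) := by
      have h := SchwartzMap.integral_fourier_mul_eq φ (𝓕⁻ ψ)
      rw [fourier_fourierInv_eq] at h
      simp only [smul_eq_mul]
      rw [← h]
      refine integral_congr_ae (.of_forall fun x ↦ ?_)
      simp [SchwartzMap.fourierInv_apply_eq]
    have h2 : ‖∫ x, φ x • ψ x‖ₑ ^ 2 ≤ (‖ofS σ ψ‖ₑ * ‖ofS (-σ) φ‖ₑ) ^ 2 := by
      rw [h1, mul_pow, enorm_ofS_sq, enorm_ofS_sq, mul_comm (sobolevSq σ ψ)]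
      have m1 : Measurable fun x ↦ esymbol (-σ) x * ‖𝓕 φ x‖ₑ :=
        (measurable_esymbol _).mul (measurable_enorm_schwartz _)
      have m2 : Measurable fun x ↦ esymbol σ (-x) * ‖𝓕 ψ (-x)‖ₑ :=
        ((measurable_esymbol σ).mul (measurable_enorm_schwartz (𝓕 ψ))).comp measurable_neg
      calc _ ≤ (∫⁻ x, ‖𝓕 φ x * 𝓕 ψ (-x)‖ₑ) ^ 2 :=
            pow_le_pow_left₀ zero_le (enorm_integral_le_lintegral_enorm _) 2
        _ = (∫⁻ x, esymbol (-σ) x * ‖𝓕 φ x‖ₑ * (esymbol σ (-x) * ‖𝓕 ψ (-x)‖ₑ)) ^ 2 := by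
            congr 1
            refine lintegral_congr fun x ↦ ?_
            have e : esymbol (-σ) x * esymbol σ (-x) = 1 := by
              have e1 : esymbol σ (-x) = esymbol σ x := by simp [esymbol, symbol_neg_arg]
              rw [e1, ← esymbol_add, neg_add_cancel, esymbol_zero]
            rw [enorm_mul, mul_mul_mul_comm, e, one_mul]
        _ ≤ _ := lintegral_mul_sq_le _ m1.aemeasurable m2.aemeasurable
        _ = _ := by
            rw [lintegral_neg_eq_self (fun x ↦ (esymbol σ x * ‖𝓕 ψ x‖ₑ) ^ 2)]
            rfl
    have h3 := (ENNReal.pow_le_pow_left_iff two_ne_zero).1 h2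
    have h4 := ENNReal.toReal_mono (ENNReal.mul_ne_top enorm_ne_top enorm_ne_top) h3
    simpa [ENNReal.toReal_mul] using h4


theorem norm_ofS_sq_eq (σ : ℝ) (w : 𝓢(ℝ, ℂ)) :
    ∃ φ : 𝓢(ℝ, ℂ), ‖ofS (-σ) φ‖ = ‖ofS σ w‖ ∧ (w : 𝓢'(ℝ, ℂ)) φ = ((‖ofS σ w‖ ^ 2 : ℝ) : ℂ) := by
  refine ⟨conjS (besselS (2 * σ) w), ?_, ?_⟩
  · have h : sobolevSq (-σ) (conjS (besselS (2 * σ) w)) = sobolevSq σ w := by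
      rw [sobolevSq_conjS]
      refine lintegral_congr fun x ↦ ?_
      rw [fourier_besselS, enorm_mul, enorm_symbol, ← mul_assoc, ← esymbol_add]
      congr 3
      ring
    rw [← enorm_ofS_sq, ← enorm_ofS_sq] at h
    have h2 := congrArg ENNReal.toReal h
    rw [ENNReal.toReal_pow, ENNReal.toReal_pow, toReal_enorm, toReal_enorm] at h2
    exact (pow_left_inj₀ (norm_nonneg _) (norm_nonneg _) two_ne_zero).1 h2
  · rw [SchwartzMap.coe_apply]
    have h1 : ‖ofS σ w‖ = ‖(besselS σ w).toLp 2‖ := by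
      rw [← toL2_ofS]; rfl
    rw [h1, Complex.ofReal_pow]
    have h2 := inner_self_eq_norm_sq_to_K (𝕜 := ℂ) ((besselS σ w).toLp 2)
    rw [SchwartzMap.inner_toL2_toL2_eq _ _ volume, ← SchwartzMap.integral_inner_fourier_fourier] at h2
    refine Eq.trans ?_ h2
    have h3 := SchwartzMap.integral_inner_fourier_fourier (besselS (2 * σ) w) w
    have e1 : ∀ x, conjS (besselS (2 * σ) w) x • w x = inner ℂ (besselS (2 * σ) w x) (w x) := by
      intro x
      simp [RCLike.inner_apply, mul_comm]
    simp only [e1]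
    rw [← h3]
    refine integral_congr_ae (.of_forall fun x ↦ ?_)
    simp only [fourier_besselS, RCLike.inner_apply, map_mul, Complex.conj_ofReal]
    rw [two_mul, symbol_add one_pos]
    push_cast
    ring

theorem toDistribution_sub_apply {σ : ℝ} (u v : Hs σ) (φ : 𝓢(ℝ, ℂ)) :
    Hs.toDistribution σ (u - v) φ = Hs.toDistribution σ u φ - Hs.toDistribution σ v φ := by
  rw [map_sub]; rfl

theorem toDistribution_add_apply {σ : ℝ} (u v : Hs σ) (φ : 𝓢(ℝ, ℂ)) :
    Hs.toDistribution σ (u + v) φ = Hs.toDistribution σ u φ + Hs.toDistribution σ v φ := by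
  rw [map_add]; rfl

theorem toDistribution_smul_apply {σ : ℝ} (c : ℂ) (u : Hs σ) (φ : 𝓢(ℝ, ℂ)) :
    Hs.toDistribution σ (c • u) φ = c * Hs.toDistribution σ u φ := by
  rw [map_smul]; rfl

/-- Evaluation at a test function as a continuous linear functional on `H^σ`. -/
def evalOp (σ : ℝ) (φ : 𝓢(ℝ, ℂ)) : Hs σ →L[ℂ] ℂ :=
  (PointwiseConvergenceCLM.evalCLM (RingHom.id ℂ) ℂ φ : 𝓢'(ℝ, ℂ) →L[ℂ] ℂ).comp
    (Hs.toDistributionCLM σ)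

@[simp] theorem evalOp_apply {σ : ℝ} (φ : 𝓢(ℝ, ℂ)) (u : Hs σ) :
    evalOp σ φ u = Hs.toDistribution σ u φ := by
  rw [← Hs.toDistributionCLM_apply]; rfl

theorem norm_le_of_forall_apply_le {σ : ℝ} (w : Hs σ) {C : ℝ} (hC : 0 ≤ C)
    (h : ∀ φ : 𝓢(ℝ, ℂ), ‖Hs.toDistribution σ w φ‖ ≤ C * ‖ofS (-σ) φ‖) : ‖w‖ ≤ C := by
  refine le_of_forall_pos_le_add fun ε hε ↦ ?_
  obtain ⟨w₀, hw₀⟩ := (denseRange_ofS σ).exists_dist_lt w (half_pos hε)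
  rw [dist_eq_norm] at hw₀
  have h1 : ‖w‖ ≤ ‖ofS σ w₀‖ + ε / 2 := by
    have := norm_add_le (w - ofS σ w₀) (ofS σ w₀)
    rw [sub_add_cancel] at this
    linarith
  obtain ⟨φ, hφ, hw⟩ := norm_ofS_sq_eq σ w₀
  have h2 := norm_toDistribution_apply_le (w - ofS σ w₀) φ
  rw [toDistribution_sub_apply, toDistribution_ofS, hw, hφ] at h2
  have h3 := h φ
  rw [hφ] at h3
  have h4 : ‖ofS σ w₀‖ ^ 2 ≤ (C + ε / 2) * ‖ofS σ w₀‖ := by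
    have h5 := norm_sub_norm_le (((‖ofS σ w₀‖ ^ 2 : ℝ) : ℂ)) (Hs.toDistribution σ w φ)
    rw [norm_sub_rev, Complex.norm_real, Real.norm_of_nonneg (by positivity)] at h5
    nlinarith [norm_nonneg (ofS σ w₀)]
  rcases (norm_nonneg (ofS σ w₀)).eq_or_lt with h0 | h0
  · linarith
  · have : ‖ofS σ w₀‖ ≤ C + ε / 2 := by nlinarith
    linarith

/-! ### Dilations and cut-off functions -/

/-- The dilate `f(· / L)`. -/
def dilate (L : ℝ) (hL : 0 < L) (f : 𝓢(ℝ, ℂ)) : 𝓢(ℝ, ℂ) :=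
  SchwartzMap.compCLMOfContinuousLinearEquiv ℂ
    (ContinuousLinearEquiv.smulLeft (Units.mk0 L⁻¹ (inv_pos.2 hL).ne')) f

theorem dilate_apply {L : ℝ} (hL : 0 < L) (f : 𝓢(ℝ, ℂ)) (x : ℝ) :
    dilate L hL f x = f (x / L) := by
  simp [dilate, div_eq_inv_mul, Units.smul_def]

theorem fourier_dilate {L : ℝ} (hL : 0 < L) (f : 𝓢(ℝ, ℂ)) (x : ℝ) :
    𝓕 (dilate L hL f) x = L * 𝓕 f (L * x) := by
  rw [SchwartzMap.fourier_coe, SchwartzMap.fourier_coe, Real.fourier_eq', Real.fourier_eq']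
  have h := Measure.integral_comp_div
    (fun y : ℝ ↦ Complex.exp (↑(-2 * Real.pi * inner ℝ y (L * x)) * Complex.I) • f y) L
  rw [abs_of_pos hL, Complex.real_smul] at h
  rw [← h]
  refine integral_congr_ae (.of_forall fun y ↦ ?_)
  simp only [dilate_apply hL, RCLike.inner_apply, conj_trivial]
  congr 4
  field_simp

theorem esymbol_div_le {σ L : ℝ} (hσ : 0 ≤ σ) (hL : 1 ≤ L) (x : ℝ) :
    esymbol σ (x / L) ≤ esymbol σ x := by
  refine ENNReal.ofReal_le_ofReal (Real.rpow_le_rpow (by positivity) ?_ (by positivity))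
  have : (x / L) ^ 2 ≤ x ^ 2 := by
    rw [div_pow]
    exact div_le_self (sq_nonneg _) (one_le_pow₀ hL)
  nlinarith [sq_nonneg Real.pi, mul_le_mul_of_nonneg_left this (sq_nonneg (2 * Real.pi))]

theorem lintegral_scale {L : ℝ} (hL : 0 < L) (g : ℝ → ℝ≥0∞) :
    ENNReal.ofReal L * ∫⁻ x, g (L * x) = ∫⁻ x, g x := by
  conv_rhs => rw [← Real.smul_map_volume_mul_left hL.ne', abs_of_pos hL]
  rw [lintegral_smul_measure, smul_eq_mul]
  exact congrArg _ ((Homeomorph.mulLeft₀ L hL.ne').measurableEmbedding.lintegral_map g).symm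

theorem multBound_dilate_le {σ L : ℝ} (hL : 1 ≤ L) (f : 𝓢(ℝ, ℂ)) :
    multBound σ (dilate L (zero_lt_one.trans_le hL) f) ≤ multBound σ f := by
  have hL0 := zero_lt_one.trans_le hL
  unfold multBound
  refine mul_le_mul_right ?_ _
  rw [← lintegral_scale hL0 (fun x ↦ esymbol |σ| x * ‖𝓕 f x‖ₑ),
    ← lintegral_const_mul' _ _ ENNReal.ofReal_ne_top]
  refine lintegral_mono fun x ↦ ?_
  rw [fourier_dilate, enorm_mul]
  have h1 : ‖(L : ℂ)‖ₑ = ENNReal.ofReal L := by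
    rw [← ofReal_norm, Complex.norm_real, Real.norm_of_nonneg hL0.le]
  have h2 := esymbol_div_le (abs_nonneg σ) hL (L * x)
  rw [mul_div_cancel_left₀ x hL0.ne'] at h2
  rw [h1, mul_left_comm]
  gcongr

theorem sobolevSq_dilate_le {σ L : ℝ} (hσ : 0 ≤ σ) (hL : 1 ≤ L) (f : 𝓢(ℝ, ℂ)) :
    sobolevSq σ (dilate L (zero_lt_one.trans_le hL) f) ≤ ENNReal.ofReal L * sobolevSq σ f := by
  have hL0 := zero_lt_one.trans_le hL
  unfold sobolevSq
  rw [← lintegral_scale hL0 (fun x ↦ (esymbol σ x * ‖𝓕 f x‖ₑ) ^ 2), ← mul_assoc,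
    ← lintegral_const_mul' _ _ (by finiteness)]
  refine lintegral_mono fun x ↦ ?_
  rw [fourier_dilate, enorm_mul]
  have h1 : ‖(L : ℂ)‖ₑ = ENNReal.ofReal L := by
    rw [← ofReal_norm, Complex.norm_real, Real.norm_of_nonneg hL0.le]
  have h2 := esymbol_div_le hσ hL (L * x)
  rw [mul_div_cancel_left₀ x hL0.ne'] at h2
  rw [h1, mul_left_comm, mul_pow, ← sq]
  gcongr

/-- A smooth cut-off function that equals `1` on `[-R, R]` and vanishes outside `[-R-1, R+1]`. -/
theorem exists_cutoff (R : ℝ) : ∃ f : 𝓢(ℝ, ℂ), HasCompactSupport f ∧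
    (∀ x, |x| ≤ R → f x = 1) ∧ ∀ x, ‖f x‖ ≤ 1 := by
  let b : ContDiffBump (0 : ℝ) := ⟨max R 0 + 1, max R 0 + 2, by positivity, by linarith⟩
  have hc : HasCompactSupport (fun x ↦ (b x : ℂ)) :=
    b.hasCompactSupport.comp_left Complex.ofReal_zero
  have hs : ContDiff ℝ ∞ (fun x ↦ (b x : ℂ)) := Complex.ofRealCLM.contDiff.comp b.contDiff
  refine ⟨hc.toSchwartzMap hs, hc, fun x hx ↦ ?_, fun x ↦ ?_⟩
  · have h1 : b x = 1 := b.one_of_mem_closedBall (by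
      rw [Metric.mem_closedBall, dist_zero_right, Real.norm_eq_abs]
      exact hx.trans ((le_max_left R 0).trans (le_add_of_nonneg_right zero_le_one)))
    change (b x : ℂ) = 1
    rw [h1, Complex.ofReal_one]
  · change ‖(b x : ℂ)‖ ≤ 1
    rw [Complex.norm_real, Real.norm_of_nonneg b.nonneg]
    exact b.le_one

theorem exists_bound_of_hasCompactSupport {f : ℝ → ℂ} (hf : HasCompactSupport f) :
    ∃ R, 0 ≤ R ∧ ∀ x, R < |x| → f x = 0 := by
  obtain ⟨R, hR⟩ := hf.isBounded.exists_norm_le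
  refine ⟨max R 0, le_max_right _ _, fun x hx ↦ ?_⟩
  by_contra h
  have := hR x (subset_tsupport f h)
  rw [Real.norm_eq_abs] at this
  exact absurd (lt_of_le_of_lt (le_max_left _ _) hx) (not_lt.2 this)

theorem toReal_multBound_mono {σ : ℝ} {f g : 𝓢(ℝ, ℂ)} (h : multBound σ f ≤ multBound σ g) :
    (multBound σ f).toReal ≤ (multBound σ g).toReal :=
  ENNReal.toReal_mono (multBound_lt_top σ g).ne h

theorem norm_mulOp_translate_le (σ a : ℝ) (f : 𝓢(ℝ, ℂ)) :
    ‖mulOp σ (translate a f)‖ ≤ (multBound σ f).toReal := by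
  rw [← multBound_translate σ a f]
  exact norm_mulOp_le σ _

/-- Elements of `H^σ` are determined by their values on test functions with compact support. -/
theorem Hs.ext_of_hasCompactSupport {σ : ℝ} {u v : Hs σ}
    (h : ∀ φ : 𝓢(ℝ, ℂ), HasCompactSupport φ →
      Hs.toDistribution σ u φ = Hs.toDistribution σ v φ) : u = v := by
  obtain ⟨χ, hχc, hχ1, hχb⟩ := exists_cutoff 1
  let χk : ℕ → 𝓢(ℝ, ℂ) := fun k ↦ dilate (k + 1) (by positivity) χ
  have hc : ∀ k, HasCompactSupport (χk k) := by
    intro k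
    obtain ⟨R, hR0, hR⟩ := exists_bound_of_hasCompactSupport hχc
    refine HasCompactSupport.of_support_subset_isCompact
      (isCompact_Icc (a := -(R * (k + 1))) (b := R * (k + 1))) fun x hx ↦ ?_
    rw [Function.mem_support, dilate_apply] at hx
    have h1 := not_lt.1 (mt (hR _) hx)
    have hk : (0 : ℝ) < k + 1 := by positivity
    rw [abs_div, abs_of_pos hk, div_le_iff₀ hk] at h1
    exact abs_le.1 h1
  set M := (multBound σ χ).toReal
  have hM : ∀ k, ‖mulOp σ (χk k)‖ ≤ M := fun k ↦
    (norm_mulOp_le σ _).trans (toReal_multBound_mono (multBound_dilate_le (by simp) χ))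
  have hM0 : 0 ≤ M := ENNReal.toReal_nonneg
  rw [← sub_eq_zero]
  set w := u - v
  have hw : ∀ k, mulOp σ (χk k) w = 0 := by
    intro k
    apply Hs.ext_distribution
    intro φ
    rw [toDistribution_mulOp_apply, toDistribution_sub_apply, h, sub_self, map_zero]
    · rfl
    · have : (smul' (χk k) φ : ℝ → ℂ) = fun x ↦ χk k x * φ x := funext (smul'_apply _ _)
      rw [this]
      exact (hc k).mul_right
  apply Hs.ext_distribution
  intro φ
  rw [map_zero]
  change _ = (0 : ℂ)
  rw [← norm_le_zero_iff]
  refine le_of_forall_pos_le_add fun ε hε ↦ ?_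
  set N := ‖ofS (-σ) φ‖
  obtain ⟨w₀, hw₀⟩ := (denseRange_ofS σ).exists_dist_lt w
    (show 0 < ε / 2 / ((1 + M) * (N + 1)) by positivity)
  rw [dist_eq_norm, lt_div_iff₀ (by positivity)] at hw₀
  have h0 : Filter.Tendsto (fun k ↦ Hs.toDistribution σ (ofS σ w₀ - mulOp σ (χk k) (ofS σ w₀)) φ)
      Filter.atTop (nhds 0) := by
    have e : ∀ k, Hs.toDistribution σ (ofS σ w₀ - mulOp σ (χk k) (ofS σ w₀)) φ
        = ∫ x, (φ x * w₀ x) * (1 - χk k x) := by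
      intro k
      rw [mulOp_ofS, toDistribution_sub_apply, toDistribution_ofS, toDistribution_ofS,
        SchwartzMap.coe_apply, SchwartzMap.coe_apply, ← integral_sub]
      · refine integral_congr_ae (.of_forall fun x ↦ ?_)
        simp only [smul_eq_mul, smul'_apply]
        ring
      · exact (smul' φ w₀).integrable.congr (.of_forall fun x ↦ by simp)
      · exact (smul' φ (smul' (χk k) w₀)).integrable.congr (.of_forall fun x ↦ by simp)
    simp only [e]
    have := tendsto_integral_of_dominated_convergence (μ := volume)
      (F := fun (k : ℕ) x ↦ (φ x * w₀ x) * (1 - χk k x)) (f := fun _ ↦ 0)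
      (fun x ↦ ‖smul' φ w₀ x‖ * 2) (fun k ↦ by
        have := φ.continuous; have := w₀.continuous; have := (χk k).continuous
        exact Continuous.aestronglyMeasurable (by fun_prop))
      ((smul' φ w₀).integrable.norm.mul_const 2) (fun k ↦ .of_forall fun x ↦ by
        rw [norm_mul, smul'_apply]
        gcongr
        refine (norm_sub_le _ _).trans ?_
        have := hχb (x / (k + 1))
        simp only [χk, dilate_apply, norm_one]
        linarith)
      (.of_forall fun x ↦ by
        refine tendsto_const_nhds.congr' ?_
        filter_upwards [Filter.eventually_ge_atTop ⌈|x|⌉₊] with k hk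
        have h1 : |x| ≤ k := (Nat.le_ceil _).trans (by exact_mod_cast hk)
        have h2 : χk k x = 1 := by
          simp only [χk, dilate_apply]
          apply hχ1
          have hk : (0 : ℝ) < k + 1 := by positivity
          rw [abs_div, abs_of_pos hk, div_le_one hk]
          linarith
        simp [h2])
    simpa using this
  obtain ⟨k, hk⟩ := (h0.norm.eventually_lt_const (show ‖(0 : ℂ)‖ < ε / 2 by
    rw [norm_zero]; exact half_pos hε)).exists
  have h1 : Hs.toDistribution σ w φ
      = Hs.toDistribution σ ((w - ofS σ w₀) - mulOp σ (χk k) (w - ofS σ w₀)) φ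
        + Hs.toDistribution σ (ofS σ w₀ - mulOp σ (χk k) (ofS σ w₀)) φ := by
    rw [← toDistribution_add_apply]
    congr 2
    rw [map_sub, hw]
    abel
  have h2 : ‖(w - ofS σ w₀) - mulOp σ (χk k) (w - ofS σ w₀)‖ ≤ (1 + M) * ‖w - ofS σ w₀‖ := by
    refine (norm_sub_le _ _).trans ?_
    have := (mulOp σ (χk k)).le_of_opNorm_le (hM k) (w - ofS σ w₀)
    linarith
  rw [h1, zero_add]
  refine (norm_add_le _ _).trans ?_
  have h3 := norm_toDistribution_apply_le ((w - ofS σ w₀) - mulOp σ (χk k) (w - ofS σ w₀)) φ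
  have h4 : ‖(w - ofS σ w₀) - mulOp σ (χk k) (w - ofS σ w₀)‖ * N ≤ ε / 2 := by
    have hN : 0 ≤ N := norm_nonneg _
    have p1 := mul_le_mul_of_nonneg_right h2 hN
    have p2 : 0 ≤ (1 + M) * ‖w - ofS σ w₀‖ := by positivity
    nlinarith
  linarith

/-! ### Localization by translates -/

theorem tsum_sobolevSq_translate_le (σ : ℝ) {h : ℝ} (hh : 1 ≤ h) {χ : 𝓢(ℝ, ℂ)}
    (hχ : HasCompactSupport χ) : ∃ C : ℝ≥0∞, C ≠ ⊤ ∧ ∀ φ : 𝓢(ℝ, ℂ),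
      ∑' m : ℤ, sobolevSq σ (smul' (translate (h * m) χ) φ) ≤ C * sobolevSq σ φ := by
  obtain ⟨R, hR0, hR⟩ := exists_bound_of_hasCompactSupport hχ
  obtain ⟨f, -, hf, -⟩ := exists_cutoff (R + 1)
  refine ⟨multBound σ χ ^ 2 * (ENNReal.ofReal (2 ^ (|σ| / 2)) ^ 2 * sobolevSq |σ| f),
    ENNReal.mul_ne_top (ENNReal.pow_ne_top (multBound_lt_top σ χ).ne)
      (ENNReal.mul_ne_top (by finiteness) (sobolevSq_lt_top _ f).ne), fun φ ↦ ?_⟩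
  set I : ℤ → Set ℝ := fun m ↦ Set.Ico (h * m) (h * m + 1)
  have hdisj : Pairwise (Function.onFun Disjoint I) := by
    intro m n hmn
    refine Set.disjoint_left.2 fun x hx hx' ↦ ?_
    rcases lt_or_gt_of_ne hmn with hl | hl
    · have : (m : ℝ) + 1 ≤ n := by exact_mod_cast hl
      nlinarith [hx.2, hx'.1]
    · have : (n : ℝ) + 1 ≤ m := by exact_mod_cast hl
      nlinarith [hx'.2, hx.1]
  have h1 : ∀ m : ℤ, sobolevSq σ (smul' (translate (h * m) χ) φ)
      ≤ ∫⁻ a in I m, multBound σ χ ^ 2 * sobolevSq σ (smul' (translate a f) φ) := by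
    intro m
    have hI : (volume (I m)) = 1 := by simp [I]
    calc sobolevSq σ (smul' (translate (h * m) χ) φ)
        = ∫⁻ a in I m, sobolevSq σ (smul' (translate (h * m) χ) φ) := by
          rw [setLIntegral_const, hI, mul_one]
      _ ≤ _ := by
          refine setLIntegral_mono' measurableSet_Ico fun a ha ↦ ?_
          have e : smul' (translate (h * m) χ) φ
              = smul' (translate (h * m) χ) (smul' (translate a f) φ) := by
            ext x
            simp only [smul'_apply, translate_apply]
            by_cases hx : R < |x - h * m|
            · rw [hR _ hx]; simp
            · rw [hf, one_mul]
              rw [not_lt, abs_le] at hx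
              rw [abs_le]
              constructor <;> linarith [ha.1, ha.2, hx.1, hx.2]
          rw [e]
          refine (sobolevSq_smul'_le σ _ _).trans ?_
          rw [multBound_translate]
  calc _ ≤ ∑' m : ℤ, ∫⁻ a in I m, multBound σ χ ^ 2 * sobolevSq σ (smul' (translate a f) φ) :=
        ENNReal.tsum_le_tsum h1
    _ = ∫⁻ a in ⋃ m, I m, multBound σ χ ^ 2 * sobolevSq σ (smul' (translate a f) φ) :=
        (lintegral_iUnion (fun _ ↦ measurableSet_Ico) hdisj _).symm
    _ ≤ ∫⁻ a, multBound σ χ ^ 2 * sobolevSq σ (smul' (translate a f) φ) :=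
        lintegral_mono' Measure.restrict_le_self le_rfl
    _ = multBound σ χ ^ 2 * ∫⁻ a, sobolevSq σ (smul' (translate a f) φ) :=
        lintegral_const_mul' _ _ (ENNReal.pow_ne_top (multBound_lt_top σ χ).ne)
    _ ≤ _ := by
        rw [mul_assoc]
        gcongr
        exact lintegral_sobolevSq_translate_le σ f φ

theorem exists_sum_norm_mulOp_translate_sq_le (σ : ℝ) {h : ℝ} (hh : 1 ≤ h) {χ : 𝓢(ℝ, ℂ)}
    (hχ : HasCompactSupport χ) : ∃ C : ℝ, 0 ≤ C ∧ ∀ (u : Hs σ) (F : Finset ℤ),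
      ∑ m ∈ F, ‖mulOp σ (translate (h * m) χ) u‖ ^ 2 ≤ C ^ 2 * ‖u‖ ^ 2 := by
  obtain ⟨C, hC, h1⟩ := tsum_sobolevSq_translate_le σ hh hχ
  refine ⟨√C.toReal, Real.sqrt_nonneg _, fun u F ↦ ?_⟩
  rw [Real.sq_sqrt ENNReal.toReal_nonneg]
  refine (denseRange_ofS σ).induction_on u (isClosed_le ?_ ?_) fun φ ↦ ?_
  · fun_prop
  · fun_prop
  · have h2 := (ENNReal.sum_le_tsum F).trans (h1 φ)
    simp only [← enorm_ofS_sq, ← mulOp_ofS] at h2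
    have h3 := ENNReal.toReal_mono (ENNReal.mul_ne_top hC (by simp)) h2
    rw [ENNReal.toReal_sum (by simp)] at h3
    simpa [ENNReal.toReal_mul] using h3

theorem exists_norm_sum_mulOp_translate_le (σ : ℝ) {h : ℝ} (hh : 1 ≤ h) {χ : 𝓢(ℝ, ℂ)}
    (hχ : HasCompactSupport χ) : ∃ C : ℝ, 0 ≤ C ∧ ∀ (y : ℤ → Hs σ) (F : Finset ℤ),
      ‖∑ m ∈ F, mulOp σ (translate (h * m) χ) (y m)‖ ≤ C * √(∑ m ∈ F, ‖y m‖ ^ 2) := by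
  obtain ⟨C, hC, h1⟩ := exists_sum_norm_mulOp_translate_sq_le (-σ) hh hχ
  refine ⟨C, hC, fun y F ↦ norm_le_of_forall_apply_le _ (by positivity) fun φ ↦ ?_⟩
  rw [← evalOp_apply, map_sum]
  simp only [evalOp_apply, toDistribution_mulOp_apply]
  calc _ ≤ ∑ m ∈ F, ‖y m‖ * ‖mulOp (-σ) (translate (h * m) χ) (ofS (-σ) φ)‖ := by
        refine (norm_sum_le _ _).trans (Finset.sum_le_sum fun m _ ↦ ?_)
        rw [mulOp_ofS]
        exact norm_toDistribution_apply_le _ _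
    _ ≤ √(∑ m ∈ F, ‖y m‖ ^ 2)
        * √(∑ m ∈ F, ‖mulOp (-σ) (translate (h * m) χ) (ofS (-σ) φ)‖ ^ 2) :=
        Real.sum_mul_le_sqrt_mul_sqrt _ _ _
    _ ≤ √(∑ m ∈ F, ‖y m‖ ^ 2) * (C * ‖ofS (-σ) φ‖) := by
        gcongr
        refine Real.sqrt_le_iff.2 ⟨by positivity, ?_⟩
        rw [mul_pow]
        exact h1 _ _
    _ = _ := by ring


/-! ### Functions in `H^s` -/

theorem toDistribution_zero_eq (u : Hs 0) :
    Hs.toDistribution 0 u = (Hs.toL2 0 u : 𝓢'(ℝ, ℂ)) := by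
  rw [← Hs.bessel_toDistribution, bessel_zero]

/-- An element of `H^s` as an element of `L²`. -/
def Hs.fn {s : ℝ} (hs : 0 ≤ s) : Hs s →L[ℂ] Lp ℂ 2 (volume : Measure ℝ) :=
  ((Hs.toL2Equiv 0).toContinuousLinearEquiv : Hs 0 →L[ℂ] Lp ℂ 2 (volume : Measure ℝ)).comp (incl hs)

theorem Hs.toDistribution_eq_fn {s : ℝ} (hs : 0 ≤ s) (u : Hs s) :
    Hs.toDistribution s u = (Hs.fn hs u : 𝓢'(ℝ, ℂ)) := by
  rw [← toDistribution_incl hs u]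
  exact toDistribution_zero_eq _

theorem Hs.toDistribution_apply {s : ℝ} (hs : 0 ≤ s) (u : Hs s) (φ : 𝓢(ℝ, ℂ)) :
    Hs.toDistribution s u φ = ∫ x, φ x * Hs.fn hs u x := by
  rw [Hs.toDistribution_eq_fn hs, Lp.toTemperedDistribution_apply]
  rfl

theorem Hs.norm_fn_le {s : ℝ} (hs : 0 ≤ s) (u : Hs s) : ‖Hs.fn hs u‖ ≤ ‖u‖ :=
  ((Hs.toL2Equiv 0).norm_map _).le.trans (norm_incl_le hs u)

theorem locallyIntegrable_Lp (g : Lp ℂ 2 (volume : Measure ℝ)) : LocallyIntegrable g volume :=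
  (Lp.memLp g).locallyIntegrable (by norm_num)

theorem Hs.represents_fn {s : ℝ} (hs : 0 ≤ s) (u : Hs s) : u.Represents (Hs.fn hs u) :=
  fun φ _ ↦ Hs.toDistribution_apply hs u φ

theorem ae_eq_of_forall_integral_eq {f g : ℝ → ℂ} (hf : LocallyIntegrable f volume)
    (hg : LocallyIntegrable g volume)
    (h : ∀ φ : 𝓢(ℝ, ℂ), HasCompactSupport φ → ∫ x, φ x * f x = ∫ x, φ x * g x) :
    f =ᵐ[volume] g := by
  refine ae_eq_of_integral_contDiff_smul_eq hf hg fun ψ hψ hc ↦ ?_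
  have hc' : HasCompactSupport (fun x ↦ (ψ x : ℂ)) := hc.comp_left Complex.ofReal_zero
  have hs' : ContDiff ℝ ∞ (fun x ↦ (ψ x : ℂ)) := Complex.ofRealCLM.contDiff.comp hψ
  exact h (hc'.toSchwartzMap hs') hc'

theorem Hs.Represents.ae_eq_fn {s : ℝ} (hs : 0 ≤ s) {u : Hs s} {f : ℝ → ℂ}
    (hf : LocallyIntegrable f volume) (h : u.Represents f) : Hs.fn hs u =ᵐ[volume] f :=
  ae_eq_of_forall_integral_eq (locallyIntegrable_Lp _) hf fun φ hφ ↦ by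
    rw [← h φ hφ, Hs.toDistribution_apply hs]

theorem hasCompactSupport_smul' (f : 𝓢(ℝ, ℂ)) {φ : 𝓢(ℝ, ℂ)} (hφ : HasCompactSupport φ) :
    HasCompactSupport (smul' f φ) := by
  have : (smul' f φ : ℝ → ℂ) = fun x ↦ f x * φ x := funext (smul'_apply _ _)
  rw [this]
  exact hφ.mul_left

theorem Hs.Represents.mulOp {σ : ℝ} {u : Hs σ} {f : ℝ → ℂ} (h : u.Represents f) (g : 𝓢(ℝ, ℂ)) :
    (mulOp σ g u).Represents (fun x ↦ g x * f x) := by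
  intro φ hφ
  rw [toDistribution_mulOp_apply, h _ (hasCompactSupport_smul' g hφ)]
  refine integral_congr_ae (.of_forall fun x ↦ ?_)
  simp only [smul'_apply]
  ring

theorem integrable_mul_of_hasCompactSupport {f : ℝ → ℂ} (hf : LocallyIntegrable f volume)
    {φ : 𝓢(ℝ, ℂ)} (hφ : HasCompactSupport φ) : Integrable (fun x ↦ φ x * f x) := by
  have := hf.integrable_smul_left_of_hasCompactSupport φ.continuous hφ
  exact this

theorem Hs.Represents.add {σ : ℝ} {u v : Hs σ} {f g : ℝ → ℂ} (hu : u.Represents f)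
    (hv : v.Represents g) (hf : LocallyIntegrable f volume) (hg : LocallyIntegrable g volume) :
    (u + v).Represents (fun x ↦ f x + g x) := by
  intro φ hφ
  rw [toDistribution_add_apply, hu φ hφ, hv φ hφ, ← integral_add
    (integrable_mul_of_hasCompactSupport hf hφ) (integrable_mul_of_hasCompactSupport hg hφ)]
  refine integral_congr_ae (.of_forall fun x ↦ ?_)
  simp only
  ring

theorem Hs.Represents.const_smul {σ : ℝ} {u : Hs σ} {f : ℝ → ℂ} (hu : u.Represents f) (c : ℂ) :
    (c • u).Represents (fun x ↦ c * f x) := by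
  intro φ hφ
  rw [toDistribution_smul_apply, hu φ hφ, ← integral_const_mul]
  refine integral_congr_ae (.of_forall fun x ↦ ?_)
  simp only
  ring

theorem Hs.Represents.sub {σ : ℝ} {u v : Hs σ} {f g : ℝ → ℂ} (hu : u.Represents f)
    (hv : v.Represents g) (hf : LocallyIntegrable f volume) (hg : LocallyIntegrable g volume) :
    (u - v).Represents (fun x ↦ f x - g x) := by
  intro φ hφ
  rw [toDistribution_sub_apply, hu φ hφ, hv φ hφ, ← integral_sub
    (integrable_mul_of_hasCompactSupport hf hφ) (integrable_mul_of_hasCompactSupport hg hφ)]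
  refine integral_congr_ae (.of_forall fun x ↦ ?_)
  simp only
  ring

theorem Hs.Represents.congr {σ : ℝ} {u : Hs σ} {f g : ℝ → ℂ} (hu : u.Represents f)
    (h : f =ᵐ[volume] g) : u.Represents g := by
  intro φ hφ
  rw [hu φ hφ]
  refine integral_congr_ae ?_
  filter_upwards [h] with x hx
  rw [hx]

theorem Hs.Represents.unique {σ : ℝ} {u v : Hs σ} {f : ℝ → ℂ} (hu : u.Represents f)
    (hv : v.Represents f) : u = v :=
  Hs.ext_of_hasCompactSupport fun φ hφ ↦ (hu φ hφ).trans (hv φ hφ).symm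

theorem toHs_eq {σ : ℝ} {u : Hs σ} {f : ℝ → ℂ} (hu : u.Represents f) : toHs σ f = u := by
  have h : ∃ u : Hs σ, u.Represents f := ⟨u, hu⟩
  rw [toHs, dif_pos h]
  exact h.choose_spec.unique hu

theorem functionNorm_le {σ : ℝ} {u : Hs σ} {f : ℝ → ℂ} (hu : u.Represents f) :
    functionNorm 1 σ f ≤ ‖u‖ₑ := by
  rw [Hs.enorm_eq_sobolevNorm]
  exact iInf₂_le (Hs.toDistribution σ u) hu

theorem exists_of_functionNorm_lt {σ : ℝ} {f : ℝ → ℂ} {c : ℝ≥0∞} (h : functionNorm 1 σ f < c) :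
    ∃ u : Hs σ, u.Represents f ∧ ‖u‖ₑ < c := by
  simp only [functionNorm, distributionNorm, iInf_lt_iff] at h
  obtain ⟨v, hv, h⟩ := h
  simp only [sobolevNorm, iInf_lt_iff] at h
  obtain ⟨g, hg, h⟩ := h
  let u : Hs σ := (⟨v, g, hg⟩ : sobolevSubmodule σ)
  refine ⟨u, hv, ?_⟩
  have e : Hs.toL2 σ u = g := by
    apply Lp.toTemperedDistribution_injective
    rw [← Hs.bessel_toDistribution]
    exact hg
  have e2 : ‖u‖ₑ = ‖Hs.toL2 σ u‖ₑ := rfl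
  rw [e2, e]
  exact h

/-! ### Bounded Fourier multipliers and the parameter `τ` -/

theorem exists_bounded_multiplier {g : ℝ → ℂ} (hg : g.HasTemperateGrowth) {C : ℝ} (hC : 0 ≤ C)
    (hb : ∀ x, ‖g x‖ ≤ C) (f : Lp ℂ 2 (volume : Measure ℝ)) :
    ∃ h : Lp ℂ 2 (volume : Measure ℝ), fourierMultiplierCLM ℂ g (f : 𝓢'(ℝ, ℂ)) = (h : 𝓢'(ℝ, ℂ)) ∧
      ‖h‖ ≤ C * ‖f‖ := by
  obtain ⟨T, h1, h2, -⟩ := exists_extension (σ := 0) (σ' := 0) (fourierMultiplierCLM ℂ g)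
    (SchwartzMap.fourierMultiplierCLM ℂ g).toLinearMap
    (fun φ ↦ fourierMultiplierCLM_toTemperedDistributionCLM_eq hg φ) (C := ENNReal.ofReal C)
    ENNReal.ofReal_ne_top (fun φ ↦ by
      unfold sobolevSq
      rw [← lintegral_const_mul' _ _ (by finiteness)]
      refine lintegral_mono fun x ↦ ?_
      rw [← mul_pow]
      refine pow_le_pow_left₀ zero_le ?_ 2
      have e : 𝓕 ((SchwartzMap.fourierMultiplierCLM ℂ g).toLinearMap φ) x = g x * 𝓕 φ x := by
        change 𝓕 (SchwartzMap.fourierMultiplierCLM ℂ g φ) x = _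
        rw [SchwartzMap.fourierMultiplierCLM_apply, fourier_fourierInv_eq,
          SchwartzMap.smulLeftCLM_apply_apply hg, smul_eq_mul]
      rw [e, enorm_mul, mul_left_comm]
      gcongr
      rw [← ofReal_norm]
      exact ENNReal.ofReal_le_ofReal (hb x))
  rw [ENNReal.toReal_ofReal hC] at h2
  refine ⟨Hs.toL2 0 (T ((Hs.toL2Equiv 0).symm f)), ?_, ?_⟩
  · rw [← toDistribution_zero_eq, h1, toDistribution_zero_eq]
    congr 2
    exact ((Hs.toL2Equiv 0).apply_symm_apply f).symm
  · have := T.le_of_opNorm_le h2 ((Hs.toL2Equiv 0).symm f)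
    rwa [LinearIsometryEquiv.norm_map] at this

theorem rpow_le_four_rpow_abs {r : ℝ} (h1 : 1 / 4 ≤ r) (h2 : r ≤ 4) (t : ℝ) : r ^ t ≤ 4 ^ |t| := by
  have hr : 0 < r := by linarith
  rcases le_total 0 t with h | h
  · rw [abs_of_nonneg h]
    exact Real.rpow_le_rpow hr.le h2 h
  · rw [abs_of_nonpos h, ← neg_neg t, Real.rpow_neg hr.le, neg_neg, ← Real.inv_rpow hr.le]
    refine Real.rpow_le_rpow (by positivity) ?_ (by linarith)
    rw [inv_le_comm₀ hr (by norm_num)]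
    linarith

theorem exists_bessel_change {τ τ' : ℝ} (hτ : τ = 1 ∨ τ = 2) (hτ' : τ' = 1 ∨ τ' = 2) (σ : ℝ)
    {u : 𝓢'(ℝ, ℂ)} {g : Lp ℂ 2 (volume : Measure ℝ)} (hg : bessel τ σ u = (g : 𝓢'(ℝ, ℂ))) :
    ∃ h : Lp ℂ 2 (volume : Measure ℝ), bessel τ' σ u = (h : 𝓢'(ℝ, ℂ)) ∧
      ‖h‖ ≤ 4 ^ |σ / 2| * ‖g‖ := by
  have p : 0 < τ := by rcases hτ with rfl | rfl <;> norm_num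
  have p' : 0 < τ' := by rcases hτ' with rfl | rfl <;> norm_num
  have hT : (fun x ↦ ((symbol τ' σ x * symbol τ (-σ) x : ℝ) : ℂ)).HasTemperateGrowth := by
    have h1 := symbol_hasTemperateGrowth p' σ
    have h2 := symbol_hasTemperateGrowth p (-σ)
    fun_prop
  obtain ⟨h, h1, h2⟩ := exists_bounded_multiplier hT (C := 4 ^ |σ / 2|) (by positivity)
    (fun x ↦ by
      rw [Complex.norm_real, Real.norm_of_nonneg (mul_pos (symbol_pos p' _ _)
        (symbol_pos p _ _)).le, symbol_neg p, ← div_eq_mul_inv]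
      unfold symbol
      rw [← Real.div_rpow (by positivity) (by positivity)]
      refine rpow_le_four_rpow_abs ?_ ?_ _
      · rw [le_div_iff₀ (by positivity)]
        rcases hτ with rfl | rfl <;> rcases hτ' with rfl | rfl <;>
          nlinarith [sq_nonneg (2 * Real.pi * x)]
      · rw [div_le_iff₀ (by positivity)]
        rcases hτ with rfl | rfl <;> rcases hτ' with rfl | rfl <;>
          nlinarith [sq_nonneg (2 * Real.pi * x)]) g
  refine ⟨h, ?_, h2⟩
  rw [← h1, ← hg]
  simp only [bessel]
  rw [fourierMultiplierCLM_fourierMultiplierCLM_apply (symbol_ofReal_hasTemperateGrowth p σ) hT]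
  congr 2
  funext x
  simp only [Pi.mul_apply]
  rw [← Complex.ofReal_mul, symbol_neg p]
  congr 1
  have := (symbol_pos p σ x).ne'
  field_simp

theorem exists_of_distributionNorm_two_lt {σ : ℝ} {T : 𝓢(ℝ, ℂ) → ℂ} {c : ℝ} 
    (h : distributionNorm 2 σ T < ENNReal.ofReal c) :
    ∃ u : Hs σ, (∀ φ : 𝓢(ℝ, ℂ), HasCompactSupport φ → Hs.toDistribution σ u φ = T φ) ∧
      ‖u‖ ≤ 4 ^ |σ / 2| * c := by
  simp only [distributionNorm, iInf_lt_iff] at h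
  obtain ⟨v, hv, h⟩ := h
  simp only [sobolevNorm, iInf_lt_iff] at h
  obtain ⟨g, hg, h⟩ := h
  obtain ⟨g', hg', hn⟩ := exists_bessel_change (.inr rfl) (τ' := 1) (.inl rfl) σ hg
  let u : Hs σ := (⟨v, g', hg'⟩ : sobolevSubmodule σ)
  have e : Hs.toL2 σ u = g' := by
    apply Lp.toTemperedDistribution_injective
    rw [← Hs.bessel_toDistribution]
    exact hg'
  have e2 : ‖u‖ = ‖Hs.toL2 σ u‖ := rfl
  refine ⟨u, hv, ?_⟩
  rw [e2, e]
  refine hn.trans ?_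
  gcongr
  rw [← ofReal_norm] at h
  exact ((ENNReal.ofReal_lt_ofReal_iff_of_nonneg (norm_nonneg _)).1 h).le

theorem distributionNorm_two_le {σ : ℝ} {T : 𝓢(ℝ, ℂ) → ℂ} (u : Hs σ)
    (hu : ∀ φ : 𝓢(ℝ, ℂ), HasCompactSupport φ → Hs.toDistribution σ u φ = T φ) :
    distributionNorm 2 σ T ≤ ENNReal.ofReal (4 ^ |σ / 2| * ‖u‖) := by
  obtain ⟨g, hg, hn⟩ := exists_bessel_change (.inl rfl) (τ' := 2) (.inr rfl) σ
    (Hs.bessel_toDistribution u)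
  refine (iInf₂_le (Hs.toDistribution σ u) hu).trans ((iInf₂_le g hg).trans ?_)
  rw [← ofReal_norm]
  exact ENNReal.ofReal_le_ofReal hn

/-! ### Products -/

/-- A bound for the product `H^s × H^s → H^{s-1}`. -/
def prodBound (s : ℝ) : ℝ≥0∞ :=
  ((∫⁻ x, esymbol (-1) x ^ 2) * ENNReal.ofReal (2 ^ (s / 2)) ^ 2) ^ (1 / 2 : ℝ)

theorem prodBound_ne_top (s : ℝ) : prodBound s ≠ ⊤ :=
  ENNReal.rpow_ne_top_of_nonneg (by norm_num)
    (ENNReal.mul_ne_top lintegral_esymbol_neg_one_sq_lt_top.ne (by finiteness))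

theorem prodBound_sq (s : ℝ) : prodBound s ^ 2
    = (∫⁻ x, esymbol (-1) x ^ 2) * ENNReal.ofReal (2 ^ (s / 2)) ^ 2 := by
  rw [prodBound, ← ENNReal.rpow_natCast, ← ENNReal.rpow_mul]
  norm_num

theorem exists_prodOp_schwartz {s : ℝ} (hs : 0 ≤ s) (f : 𝓢(ℝ, ℂ)) : ∃ T : Hs s →L[ℂ] Hs (s - 1),
    (∀ u, Hs.toDistribution (s - 1) (T u) = smulLeftCLM ℂ f (Hs.toDistribution s u)) ∧
      ‖T‖ ≤ (prodBound s).toReal * ‖ofS s f‖ := by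
  obtain ⟨T, h1, h2, -⟩ := exists_extension (σ := s) (σ' := s - 1) (smulLeftCLM ℂ f)
    (SchwartzMap.smulLeftCLM ℂ f).toLinearMap (smulLeftCLM_coe f) (C := prodBound s * ‖ofS s f‖ₑ)
    (ENNReal.mul_ne_top (prodBound_ne_top s) enorm_ne_top) (fun φ ↦ by
      rw [mul_pow, prodBound_sq, enorm_ofS_sq, mul_assoc]
      exact sobolevSq_mul_le hs f φ)
  refine ⟨T, h1, ?_⟩
  rwa [ENNReal.toReal_mul, toReal_enorm] at h2

theorem ofS_conjS_norm (σ : ℝ) (φ : 𝓢(ℝ, ℂ)) : ‖ofS σ (conjS φ)‖ = ‖ofS σ φ‖ := by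
  have h := sobolevSq_conjS σ φ
  rw [← enorm_ofS_sq, ← enorm_ofS_sq] at h
  have h2 := congrArg ENNReal.toReal h
  rw [ENNReal.toReal_pow, ENNReal.toReal_pow, toReal_enorm, toReal_enorm] at h2
  exact (pow_left_inj₀ (norm_nonneg _) (norm_nonneg _) two_ne_zero).1 h2

theorem fn_ofS {s : ℝ} (hs : 0 ≤ s) (φ : 𝓢(ℝ, ℂ)) : Hs.fn hs (ofS s φ) =ᵐ[volume] φ := by
  refine Hs.Represents.ae_eq_fn hs φ.integrable.locallyIntegrable fun ψ _ ↦ ?_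
  rw [toDistribution_ofS, SchwartzMap.coe_apply]
  rfl

theorem fn_mulOp {s : ℝ} (hs : 0 ≤ s) (φ : 𝓢(ℝ, ℂ)) (u : Hs s) :
    Hs.fn hs (mulOp s φ u) =ᵐ[volume] fun x ↦ φ x * Hs.fn hs u x :=
  ((Hs.represents_fn hs u).mulOp φ).ae_eq_fn hs <| by
    have h : MemLp (fun x ↦ φ x * Hs.fn hs u x) 2 volume :=
      (Lp.memLp (Hs.fn hs u)).mul (φ.memLp ⊤)
    exact h.locallyIntegrable (by norm_num)

/-- For `s ≥ 0` the product `u v̄` of functions in `H^s` belongs to `H^{s-1}`. -/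
theorem exists_product {s : ℝ} (hs : 0 ≤ s) (u v : Hs s) : ∃ w : Hs (s - 1),
    ‖w‖ ≤ (prodBound s).toReal * ‖u‖ * ‖v‖ ∧ ∀ φ : 𝓢(ℝ, ℂ), Hs.toDistribution (s - 1) w φ
      = ∫ x, φ x * (Hs.fn hs u x * starRingEnd ℂ (Hs.fn hs v x)) := by
  choose P hP hPn using fun ψ : 𝓢(ℝ, ℂ) ↦ exists_prodOp_schwartz hs (conjS ψ)
  have hPapp : ∀ ψ φ, Hs.toDistribution (s - 1) (P ψ u) φ
      = Hs.toDistribution s u (smul' (conjS ψ) φ) := fun ψ φ ↦ by rw [hP]; rfl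
  let A : 𝓢(ℝ, ℂ) →ₛₗ[starRingEnd ℂ] Hs (s - 1) :=
    { toFun := fun ψ ↦ P ψ u
      map_add' := fun ψ ψ' ↦ by
        apply Hs.ext_distribution
        intro φ
        rw [toDistribution_add_apply, hPapp, hPapp, hPapp, ← map_add]
        congr 1
        ext x
        simp [add_mul]
      map_smul' := fun c ψ ↦ by
        apply Hs.ext_distribution
        intro φ
        rw [toDistribution_smul_apply, hPapp, hPapp, ← smul_eq_mul, ← map_smul]
        congr 1
        ext x
        simp [mul_assoc] }
  have hA : ∀ ψ, ‖A ψ‖ ≤ ((prodBound s).toReal * ‖u‖) * ‖ofS s ψ‖ := fun ψ ↦ by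
    have := (P ψ).le_of_opNorm_le (hPn ψ) u
    rw [ofS_conjS_norm] at this
    calc _ ≤ _ := this
      _ = _ := by ring
  refine ⟨A.extendOfNorm (ofS s) v,
    LinearMap.norm_extendOfNorm_apply_le (denseRange_ofS s) _ hA v, fun φ ↦ ?_⟩
  have e : ∀ v, ∫ x, φ x * (Hs.fn hs u x * starRingEnd ℂ (Hs.fn hs v x))
      = inner ℂ (Hs.fn hs v) (Hs.fn hs (mulOp s φ u)) := by
    intro v
    rw [L2.inner_def]
    refine integral_congr_ae ?_
    filter_upwards [fn_mulOp hs φ u] with x hx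
    rw [hx, RCLike.inner_apply]
    ring
  rw [e]
  refine (denseRange_ofS s).induction_on (p := fun v ↦ Hs.toDistribution (s - 1)
    (A.extendOfNorm (ofS s) v) φ = inner ℂ (Hs.fn hs v) (Hs.fn hs (mulOp s φ u))) v
    (isClosed_eq ?_ ?_) fun ψ ↦ ?_
  · simp only [← evalOp_apply]
    fun_prop
  · fun_prop
  · rw [LinearMap.extendOfNorm_eq (denseRange_ofS s) ⟨_, hA⟩, ← e]
    change Hs.toDistribution (s - 1) (P ψ u) φ = _
    rw [hPapp, Hs.toDistribution_apply hs]
    refine integral_congr_ae ?_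
    filter_upwards [fn_ofS hs ψ] with x hx
    rw [hx, smul'_apply, conjS_apply]
    ring


/-! ### Functions that are locally in `H^s` -/

/-- The locally integrable functions in `H^s_loc`. -/
structure LocHs (s : ℝ) (f : ℝ → ℂ) : Prop where
  locallyIntegrable : LocallyIntegrable f volume
  exists_represents : ∀ χ : ℝ → ℂ, ContDiff ℝ ∞ χ → HasCompactSupport χ →
    ∃ u : Hs s, u.Represents (fun x ↦ χ x * f x)

theorem EnergyFun.locHs {s : ℝ} (q : EnergyFun s) : LocHs s q.toFun :=
  ⟨q.locallyIntegrable, q.hs_loc⟩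

/-- The function `χ f` as an element of `H^s`. -/
def loc (s : ℝ) (χ : 𝓢(ℝ, ℂ)) (f : ℝ → ℂ) : Hs s := toHs s (fun x ↦ χ x * f x)

theorem loc_eq {s : ℝ} {χ : 𝓢(ℝ, ℂ)} {f : ℝ → ℂ} {u : Hs s}
    (h : u.Represents (fun x ↦ χ x * f x)) : loc s χ f = u := toHs_eq h

theorem loc_congr {s : ℝ} {χ : 𝓢(ℝ, ℂ)} {f g : ℝ → ℂ} (h : ∀ x, χ x * f x = χ x * g x) :
    loc s χ f = loc s χ g := by
  simp only [loc, h]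

namespace LocHs

variable {s : ℝ} {f g : ℝ → ℂ} {χ ψ : 𝓢(ℝ, ℂ)}

theorem locallyIntegrable_smul (hf : LocHs s f) (χ : 𝓢(ℝ, ℂ)) :
    LocallyIntegrable (fun x ↦ χ x * f x) volume :=
  hf.locallyIntegrable.continuous_mul χ.continuous

theorem represents (hf : LocHs s f) (hχ : HasCompactSupport χ) :
    (loc s χ f).Represents (fun x ↦ χ x * f x) := by
  obtain ⟨u, hu⟩ := hf.exists_represents χ (χ.smooth _) hχ
  rwa [loc_eq hu]

theorem mulOp_loc (hf : LocHs s f) (hχ : HasCompactSupport χ) {g : 𝓢(ℝ, ℂ)}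
    (e : ∀ x, g x * χ x = ψ x) : mulOp s g (loc s χ f) = loc s ψ f := by
  refine (loc_eq ?_).symm
  have h := (hf.represents hχ).mulOp g
  simp only [← mul_assoc, e] at h
  exact h

theorem sub (hf : LocHs s f) (hg : LocHs s g) : LocHs s (fun x ↦ f x - g x) := by
  refine ⟨hf.locallyIntegrable.sub hg.locallyIntegrable, fun χ h1 h2 ↦ ?_⟩
  obtain ⟨u, hu⟩ := hf.exists_represents χ h1 h2
  obtain ⟨v, hv⟩ := hg.exists_represents χ h1 h2
  refine ⟨u - v, ?_⟩
  simp only [mul_sub]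
  exact hu.sub hv (hf.locallyIntegrable.continuous_mul h1.continuous)
    (hg.locallyIntegrable.continuous_mul h1.continuous)

theorem add (hf : LocHs s f) (hg : LocHs s g) : LocHs s (fun x ↦ f x + g x) := by
  refine ⟨hf.locallyIntegrable.add hg.locallyIntegrable, fun χ h1 h2 ↦ ?_⟩
  obtain ⟨u, hu⟩ := hf.exists_represents χ h1 h2
  obtain ⟨v, hv⟩ := hg.exists_represents χ h1 h2
  refine ⟨u + v, ?_⟩
  simp only [mul_add]
  exact hu.add hv (hf.locallyIntegrable.continuous_mul h1.continuous)
    (hg.locallyIntegrable.continuous_mul h1.continuous)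

theorem smooth_mul (hf : LocHs s f) {g : ℝ → ℂ} (hg : ContDiff ℝ ∞ g) :
    LocHs s (fun x ↦ g x * f x) := by
  refine ⟨hf.locallyIntegrable.continuous_mul hg.continuous, fun χ h1 h2 ↦ ?_⟩
  obtain ⟨u, hu⟩ := hf.exists_represents (fun x ↦ χ x * g x) (h1.mul hg) h2.mul_right
  exact ⟨u, by simpa only [mul_assoc] using hu⟩

theorem const_mul (hf : LocHs s f) (c : ℂ) : LocHs s (fun x ↦ c * f x) :=
  hf.smooth_mul contDiff_const

theorem of_represents {u : Hs s} (hf : LocallyIntegrable f volume)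
    (hu : u.Represents f) : LocHs s f :=
  ⟨hf, fun _ h1 h2 ↦ ⟨_, hu.mulOp (h2.toSchwartzMap h1)⟩⟩

theorem fn (hs : 0 ≤ s) (u : Hs s) : LocHs s (Hs.fn hs u) :=
  of_represents (locallyIntegrable_Lp _) (Hs.represents_fn hs u)

theorem loc_sub (hf : LocHs s f) (hg : LocHs s g) (hχ : HasCompactSupport χ) :
    loc s χ (fun x ↦ f x - g x) = loc s χ f - loc s χ g := by
  apply loc_eq
  simp only [mul_sub]
  exact (hf.represents hχ).sub (hg.represents hχ) (hf.locallyIntegrable_smul χ)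
    (hg.locallyIntegrable_smul χ)

theorem loc_add (hf : LocHs s f) (hg : LocHs s g) (hχ : HasCompactSupport χ) :
    loc s χ (fun x ↦ f x + g x) = loc s χ f + loc s χ g := by
  apply loc_eq
  simp only [mul_add]
  exact (hf.represents hχ).add (hg.represents hχ) (hf.locallyIntegrable_smul χ)
    (hg.locallyIntegrable_smul χ)

theorem loc_const_mul (hf : LocHs s f) (hχ : HasCompactSupport χ) (c : ℂ) :
    loc s χ (fun x ↦ c * f x) = c • loc s χ f := by
  apply loc_eq
  simp only [mul_left_comm]
  exact (hf.represents hχ).const_smul c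

end LocHs

theorem loc_of_represents {s : ℝ} {u : Hs s} {f : ℝ → ℂ} (hu : u.Represents f) (χ : 𝓢(ℝ, ℂ)) :
    loc s χ f = mulOp s χ u :=
  loc_eq (hu.mulOp χ)

/-! ### Exponentials of multiplication operators -/

theorem Hs.Represents.mulOp_pow {σ : ℝ} {u : Hs σ} {f : ℝ → ℂ} (h : u.Represents f) (g : 𝓢(ℝ, ℂ))
    (n : ℕ) : ((GrossPitaevskii.mulOp σ g ^ n) u).Represents (fun x ↦ g x ^ n * f x) := by
  induction n with
  | zero => simpa using h
  | succ n ih =>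
    rw [pow_succ', mul_apply_eq_comp]
    have := ih.mulOp g
    simpa only [pow_succ', mul_assoc] using this

theorem Hs.Represents.exp_mulOp {σ : ℝ} {u : Hs σ} {f : ℝ → ℂ} (h : u.Represents f)
    (hf : LocallyIntegrable f volume) (g : 𝓢(ℝ, ℂ)) :
    ((NormedSpace.exp (GrossPitaevskii.mulOp σ g)) u).Represents
      (fun x ↦ Complex.exp (g x) * f x) := by
  intro φ hφ
  have h1 := NormedSpace.exp_series_hasSum_exp' (𝕂 := ℂ) (GrossPitaevskii.mulOp σ g)
  have h2 := (evalOp σ φ).hasSum ((ContinuousLinearMap.apply ℂ (Hs σ) u).hasSum h1)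
  simp only [ContinuousLinearMap.apply_apply, evalOp_apply, _root_.smul_apply,
    toDistribution_smul_apply] at h2
  obtain ⟨M, hM⟩ : ∃ M, ∀ x, ‖g x‖ ≤ M := by
    obtain ⟨M, hM⟩ := g.toBoundedContinuousFunction.isBounded_range.exists_norm_le
    exact ⟨M, fun x ↦ hM _ ⟨x, rfl⟩⟩
  have hi := integrable_mul_of_hasCompactSupport hf hφ
  have hg : Continuous g := g.continuous
  have hfm : AEStronglyMeasurable f volume := hf.aestronglyMeasurable
  have h3 : HasSum (fun n : ℕ ↦ ∫ x, (n.factorial⁻¹ : ℂ) * (φ x * (g x ^ n * f x)))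
      (∫ x, φ x * (Complex.exp (g x) * f x)) := by
    refine hasSum_integral_of_dominated_convergence
      (fun n x ↦ (M ^ n / n.factorial) * ‖φ x * f x‖) ?_ ?_ ?_ ?_ ?_
    · intro n
      exact ((φ.continuous.aestronglyMeasurable).mul
        ((hg.pow n).aestronglyMeasurable.mul hfm)).const_mul _
    · intro n
      refine .of_forall fun x ↦ ?_
      rw [norm_mul, norm_mul, norm_mul, norm_mul, norm_pow, norm_inv, Complex.norm_natCast]
      have := pow_le_pow_left₀ (norm_nonneg _) (hM x) n
      calc (n.factorial : ℝ)⁻¹ * (‖φ x‖ * (‖g x‖ ^ n * ‖f x‖))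
          = ‖g x‖ ^ n / n.factorial * (‖φ x‖ * ‖f x‖) := by ring
        _ ≤ _ := by gcongr
    · exact .of_forall fun x ↦ (Real.summable_pow_div_factorial M).mul_right _
    · simp only [tsum_mul_right]
      exact hi.norm.const_mul _
    · refine .of_forall fun x ↦ ?_
      have := NormedSpace.exp_series_hasSum_exp' (𝕂 := ℂ) (g x)
      rw [← Complex.exp_eq_exp_ℂ] at this
      have := (this.mul_right (f x)).mul_left (φ x)
      have e : (fun n : ℕ ↦ (n.factorial⁻¹ : ℂ) * (φ x * (g x ^ n * f x)))
          = fun n : ℕ ↦ φ x * ((n.factorial⁻¹ : ℂ) • g x ^ n * f x) := by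
        funext n
        rw [smul_eq_mul]
        ring
      rw [e]
      exact this
  refine h2.unique ?_
  convert h3 using 2 with n
  rw [h.mulOp_pow g n φ hφ, integral_const_mul]

theorem norm_exp_sub_one_le_mul_exp {A : Type*} [NormedRing A] [NormedAlgebra ℂ A]
    [CompleteSpace A] (a : A) :
    ‖NormedSpace.exp a - 1‖ ≤ ‖a‖ * Real.exp ‖a‖ := by
  have h1 := NormedSpace.exp_series_hasSum_exp' (𝕂 := ℂ) a
  have h2 := (hasSum_nat_add_iff' 1).2 h1
  simp only [Finset.range_one, Finset.sum_singleton, Nat.factorial_zero, Nat.cast_one, inv_one,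
    pow_zero, one_smul] at h2
  have h3 : HasSum (fun n : ℕ ↦ ‖a‖ * (‖a‖ ^ n / n.factorial)) (‖a‖ * Real.exp ‖a‖) := by
    have := NormedSpace.expSeries_div_hasSum_exp (‖a‖)
    rw [← Real.exp_eq_exp_ℝ] at this
    exact this.mul_left _
  rw [← h2.tsum_eq, ← h3.tsum_eq]
  refine tsum_of_norm_bounded h3.summable.hasSum fun n ↦ ?_
  rw [norm_smul, norm_inv, Complex.norm_natCast]
  have h4 : ‖a ^ (n + 1)‖ ≤ ‖a‖ * ‖a‖ ^ n := by
    rw [← pow_succ']; exact norm_pow_le' a n.succ_pos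
  have h5 : ((n + 1).factorial : ℝ)⁻¹ ≤ (n.factorial : ℝ)⁻¹ := by
    apply inv_anti₀ (by positivity)
    exact_mod_cast Nat.factorial_le (Nat.le_succ n)
  calc ((n + 1).factorial : ℝ)⁻¹ * ‖a ^ (n + 1)‖
      ≤ (n.factorial : ℝ)⁻¹ * (‖a‖ * ‖a‖ ^ n) := by gcongr
    _ = _ := by ring

/-! ### Synthesis -/

/-- The functions `ρ(x - hn)`, `n ∈ ℤ`, are a partition of unity. -/
def IsPartition (h : ℝ) (ρ : 𝓢(ℝ, ℂ)) : Prop :=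
  HasCompactSupport ρ ∧ ∀ x, ∑' n : ℤ, ρ (x - h * n) = 1

theorem finite_translate {h : ℝ} (hh : 0 < h) {ρ : 𝓢(ℝ, ℂ)} (hρ : HasCompactSupport ρ) (R : ℝ) :
    ∃ F : Finset ℤ, ∀ n ∉ F, ∀ x, |x| ≤ R → ρ (x - h * n) = 0 := by
  obtain ⟨R', hR0, hR'⟩ := exists_bound_of_hasCompactSupport hρ
  refine ⟨Finset.Icc (-⌈(R + R') / h⌉) ⌈(R + R') / h⌉, fun n hn x hx ↦ hR' _ ?_⟩
  rw [Finset.mem_Icc, ← abs_le, not_le] at hn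
  have h1 : (R + R') / h < |(n : ℝ)| := by
    refine (Int.le_ceil _).trans_lt ?_
    exact_mod_cast hn
  rw [div_lt_iff₀ hh] at h1
  have h2 : |h * n| = |(n : ℝ)| * h := by rw [abs_mul, abs_of_pos hh, mul_comm]
  have h3 := abs_sub_abs_le_abs_sub (h * n) x
  rw [abs_sub_comm] at h3
  linarith

theorem IsPartition.exists_sum_eq {h : ℝ} (hh : 0 < h) {ρ : 𝓢(ℝ, ℂ)} (hρ : IsPartition h ρ)
    {φ : 𝓢(ℝ, ℂ)} (hφ : HasCompactSupport φ) : ∃ F : Finset ℤ,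
      (∀ n ∉ F, smul' (translate (h * n) ρ) φ = 0) ∧
      ∑ n ∈ F, smul' (translate (h * n) ρ) φ = φ := by
  obtain ⟨R, hR0, hR⟩ := exists_bound_of_hasCompactSupport hφ
  obtain ⟨F, hF⟩ := finite_translate hh hρ.1 R
  refine ⟨F, fun n hn ↦ ?_, ?_⟩
  · ext x
    rw [smul'_apply, translate_apply]
    by_cases hx : |x| ≤ R
    · rw [hF n hn x hx, zero_mul]; rfl
    · rw [hR x (not_le.1 hx), mul_zero]; rfl
  · ext x
    rw [sum_apply]
    simp only [smul'_apply, translate_apply]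
    rw [← Finset.sum_mul]
    by_cases hx : |x| ≤ R
    · rw [← tsum_eq_sum (L := .unconditional ℤ) (s := F) fun n hn ↦ hF n hn x hx, hρ.2, one_mul]
    · rw [hR x (not_le.1 hx), mul_zero]

theorem exists_synthesis (σ : ℝ) {h : ℝ} (hh : 1 ≤ h) {ρ : 𝓢(ℝ, ℂ)} (hρ : HasCompactSupport ρ) :
    ∃ C : ℝ, 0 ≤ C ∧ ∀ y : ℤ → Hs σ, Summable (fun n ↦ ‖y n‖ ^ 2) →
      Summable (fun n : ℤ ↦ mulOp σ (translate (h * n) ρ) (y n)) ∧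
      ‖∑' n : ℤ, mulOp σ (translate (h * n) ρ) (y n)‖ ≤ C * √(∑' n, ‖y n‖ ^ 2) := by
  obtain ⟨C, hC0, hC⟩ := exists_norm_sum_mulOp_translate_le σ hh hρ
  refine ⟨C, hC0, fun y hy ↦ ?_⟩
  have hs : Summable (fun n : ℤ ↦ mulOp σ (translate (h * n) ρ) (y n)) := by
    rw [summable_iff_vanishing_norm]
    intro ε hε
    rw [summable_iff_vanishing_norm] at hy
    obtain ⟨F, hF⟩ := hy ((ε / (C + 1)) ^ 2) (by positivity)
    refine ⟨F, fun t ht ↦ (hC y t).trans_lt ?_⟩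
    have h1 := hF t ht
    rw [Real.norm_of_nonneg (by positivity)] at h1
    have h2 : √(∑ m ∈ t, ‖y m‖ ^ 2) ≤ ε / (C + 1) := Real.sqrt_le_iff.2 ⟨by positivity, h1.le⟩
    calc C * √(∑ m ∈ t, ‖y m‖ ^ 2) ≤ C * (ε / (C + 1)) := by gcongr
      _ < ε := by
        rw [mul_div_assoc', div_lt_iff₀ (by positivity)]
        nlinarith
  refine ⟨hs, ?_⟩
  refine le_of_tendsto hs.hasSum.norm (.of_forall fun F ↦ (hC y F).trans ?_)
  gcongr
  exact hy.sum_le_tsum F (fun _ _ ↦ by positivity)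

theorem exists_of_cells (σ : ℝ) {h : ℝ} (hh : 1 ≤ h) {ρ : 𝓢(ℝ, ℂ)} (hρ : IsPartition h ρ) :
    ∃ C : ℝ, 0 ≤ C ∧ ∀ (T : 𝓢(ℝ, ℂ) → ℂ) (y : ℤ → Hs σ),
      (∀ φ ψ : 𝓢(ℝ, ℂ), HasCompactSupport φ → HasCompactSupport ψ → T (φ + ψ) = T φ + T ψ) →
      (∀ n (φ : 𝓢(ℝ, ℂ)), HasCompactSupport φ →
        Hs.toDistribution σ (y n) (smul' (translate (h * n) ρ) φ)
          = T (smul' (translate (h * n) ρ) φ)) →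
      Summable (fun n ↦ ‖y n‖ ^ 2) →
      (∀ φ : 𝓢(ℝ, ℂ), HasCompactSupport φ → Hs.toDistribution σ
        (∑' n : ℤ, mulOp σ (translate (h * n) ρ) (y n)) φ = T φ) ∧
      ‖∑' n : ℤ, mulOp σ (translate (h * n) ρ) (y n)‖ ≤ C * √(∑' n, ‖y n‖ ^ 2) := by
  obtain ⟨C, hC0, hC⟩ := exists_synthesis σ hh hρ.1
  refine ⟨C, hC0, fun T y hT hy hs ↦ ⟨fun φ hφ ↦ ?_, (hC y hs).2⟩⟩
  obtain ⟨F, hF0, hF⟩ := hρ.exists_sum_eq (zero_lt_one.trans_le hh) hφ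
  rw [← evalOp_apply, (evalOp σ φ).map_tsum (hC y hs).1]
  simp only [evalOp_apply, toDistribution_mulOp_apply]
  have h0 : HasCompactSupport (0 : 𝓢(ℝ, ℂ)) := HasCompactSupport.zero
  have hT0 : T 0 = 0 := by
    have := hT 0 0 h0 h0
    rw [add_zero] at this
    exact left_eq_add.1 this
  have hTs : ∀ G : Finset ℤ, T (∑ n ∈ G, smul' (translate (h * n) ρ) φ)
      = ∑ n ∈ G, T (smul' (translate (h * n) ρ) φ) ∧
      HasCompactSupport (⇑(∑ n ∈ G, smul' (translate (h * n) ρ) φ : 𝓢(ℝ, ℂ))) := by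
    intro G
    induction G using Finset.induction_on with
    | empty => exact ⟨hT0, h0⟩
    | insert a G ha ih =>
      have h1 := hasCompactSupport_smul' (translate (h * a) ρ) hφ
      have h2 := hT (smul' (translate (h * a) ρ) φ) (∑ n ∈ G, smul' (translate (h * n) ρ) φ) h1 ih.2
      rw [Finset.sum_insert ha, Finset.sum_insert ha, h2, ih.1]
      exact ⟨rfl, HasCompactSupport.add (f := smul' (translate (h * a) ρ) φ)
        (f' := ⇑(∑ n ∈ G, smul' (translate (h * n) ρ) φ)) h1 ih.2⟩
  have hz : ∀ n : ℤ, n ∉ F →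
      Hs.toDistribution σ (y n) (smul' (translate (h * n) ρ) φ) = 0 := fun n hn ↦ by
    rw [hF0 n hn]
    exact map_zero (Hs.toDistribution σ (y n))
  rw [tsum_eq_sum (s := F) hz]
  calc ∑ n ∈ F, Hs.toDistribution σ (y n) (smul' (translate (h * n) ρ) φ)
      = ∑ n ∈ F, T (smul' (translate (h * n) ρ) φ) := Finset.sum_congr rfl fun n _ ↦ hy n φ hφ
    _ = T (∑ n ∈ F, smul' (translate (h * n) ρ) φ) := (hTs F).1.symm
    _ = T φ := by rw [hF]


/-! ### The energy -/

theorem integrable_norm_sq_Lp (g : Lp ℂ 2 (volume : Measure ℝ)) :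
    Integrable (fun x ↦ ‖g x‖ ^ 2) :=
  (memLp_two_iff_integrable_sq_norm (Lp.aestronglyMeasurable g)).1 (Lp.memLp g)

theorem norm_sq_Lp (g : Lp ℂ 2 (volume : Measure ℝ)) : ‖g‖ ^ 2 = ∫ x, ‖g x‖ ^ 2 := by
  have h := inner_self_eq_norm_sq (𝕜 := ℂ) g
  rw [← h, MeasureTheory.L2.inner_def]
  have e : ∀ x, (inner ℂ (g x) (g x) : ℂ) = ((‖g x‖ ^ 2 : ℝ) : ℂ) := fun x ↦ by
    rw [inner_self_eq_norm_sq_to_K]; push_cast; rfl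
  simp only [e]
  rw [integral_complex_ofReal]
  exact Complex.ofReal_re _

theorem LocHs.fn_loc {s : ℝ} (hs : 0 ≤ s) {f : ℝ → ℂ} (hf : LocHs s f) {χ : 𝓢(ℝ, ℂ)}
    (hχ : HasCompactSupport χ) : Hs.fn hs (loc s χ f) =ᵐ[volume] fun x ↦ χ x * f x :=
  (hf.represents hχ).ae_eq_fn hs (hf.locallyIntegrable_smul χ)

theorem LocHs.integrable_norm_sq {s : ℝ} (hs : 0 ≤ s) {f : ℝ → ℂ} (hf : LocHs s f) {χ : 𝓢(ℝ, ℂ)}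
    (hχ : HasCompactSupport χ) : Integrable (fun x ↦ ‖χ x * f x‖ ^ 2) := by
  refine (integrable_norm_sq_Lp (Hs.fn hs (loc s χ f))).congr ?_
  filter_upwards [hf.fn_loc hs hχ] with x hx
  rw [hx]

theorem LocHs.integrable_mul_norm_sq {s : ℝ} (hs : 0 ≤ s) {f : ℝ → ℂ} (hf : LocHs s f)
    {φ : 𝓢(ℝ, ℂ)} (hφ : HasCompactSupport φ) :
    Integrable (fun x ↦ φ x * ((‖f x‖ ^ 2 : ℝ) : ℂ)) := by
  obtain ⟨R, hR0, hR⟩ := exists_bound_of_hasCompactSupport hφ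
  obtain ⟨χ, hχ, hχ1, -⟩ := exists_cutoff R
  obtain ⟨M, hM⟩ : ∃ M, ∀ x, ‖φ x‖ ≤ M := by
    obtain ⟨M, hM⟩ := φ.toBoundedContinuousFunction.isBounded_range.exists_norm_le
    exact ⟨M, fun x ↦ hM _ ⟨x, rfl⟩⟩
  have h1 := (hf.integrable_norm_sq hs hχ).ofReal (𝕜 := ℂ)
  have h2 := h1.bdd_mul (c := M) φ.continuous.aestronglyMeasurable (.of_forall hM)
  refine h2.congr (.of_forall fun x ↦ ?_)
  by_cases hx : |x| ≤ R
  · simp [hχ1 x hx]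
  · simp [hR x (not_le.1 hx)]

/-- `u` and `v` are `|q|² - 1` and `q'` as elements of `H^{s-1}`. -/
structure IsEnergyData (s : ℝ) (q : ℝ → ℂ) (u v : Hs (s - 1)) : Prop where
  density : ∀ φ : 𝓢(ℝ, ℂ), HasCompactSupport φ →
    Hs.toDistribution (s - 1) u φ = ∫ x, φ x * ((‖q x‖ ^ 2 - 1 : ℝ) : ℂ)
  derivative : ∀ φ : 𝓢(ℝ, ℂ), HasCompactSupport φ →
    Hs.toDistribution (s - 1) v φ = -∫ x, deriv φ x * q x

theorem exists_energyData (s : ℝ) (N : ℝ) : ∃ C : ℝ, 0 ≤ C ∧ ∀ q : ℝ → ℂ,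
    energy s q ≤ ENNReal.ofReal N →
      ∃ u v, IsEnergyData s q u v ∧ ‖u‖ ≤ C ∧ ‖v‖ ≤ C := by
  refine ⟨4 ^ |(s - 1) / 2| * (max N 0 + 1), by positivity, fun q hq ↦ ?_⟩
  have hlt : ENNReal.ofReal N < ENNReal.ofReal (max N 0 + 1) :=
    (ENNReal.ofReal_lt_ofReal_iff (by positivity)).2
      ((le_max_left N 0).trans_lt (lt_add_one _))
  have hle : ∀ a b : ℝ≥0∞, a ≤ (a ^ 2 + b ^ 2) ^ (1 / 2 : ℝ) := fun a b ↦ by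
    calc a = (a ^ 2) ^ (1 / 2 : ℝ) := by
          rw [← ENNReal.rpow_natCast, ← ENNReal.rpow_mul]; norm_num
      _ ≤ _ := ENNReal.rpow_le_rpow le_self_add (by norm_num)
  have h1 : functionNorm 2 (s - 1) (fun x ↦ ((‖q x‖ ^ 2 - 1 : ℝ) : ℂ)) ≤ energy s q := hle _ _
  have h2 : derivNorm 2 (s - 1) q ≤ energy s q := by
    rw [energy, add_comm]; exact hle _ _
  obtain ⟨u, hu, hu'⟩ := exists_of_distributionNorm_two_lt ((h1.trans hq).trans_lt hlt)
  obtain ⟨v, hv, hv'⟩ := exists_of_distributionNorm_two_lt ((h2.trans hq).trans_lt hlt)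
  exact ⟨u, v, ⟨hu, hv⟩, hu', hv'⟩

theorem energy_le_of_energyData {s : ℝ} {q : ℝ → ℂ} {u v : Hs (s - 1)} (h : IsEnergyData s q u v)
    {C : ℝ} (hu : ‖u‖ ≤ C) (hv : ‖v‖ ≤ C) :
    energy s q ≤ ENNReal.ofReal (2 * (4 ^ |(s - 1) / 2| * C)) := by
  have h1 : functionNorm 2 (s - 1) (fun x ↦ ((‖q x‖ ^ 2 - 1 : ℝ) : ℂ))
      ≤ ENNReal.ofReal (4 ^ |(s - 1) / 2| * C) :=
    (distributionNorm_two_le u h.density).trans (ENNReal.ofReal_le_ofReal (by gcongr))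
  have h2 : derivNorm 2 (s - 1) q ≤ ENNReal.ofReal (4 ^ |(s - 1) / 2| * C) :=
    (distributionNorm_two_le v h.derivative).trans (ENNReal.ofReal_le_ofReal (by gcongr))
  have hC : 0 ≤ C := (norm_nonneg u).trans hu
  set D := 4 ^ |(s - 1) / 2| * C
  have hD : 0 ≤ D := by positivity
  calc energy s q ≤ ((ENNReal.ofReal (2 * D)) ^ 2) ^ (1 / 2 : ℝ) := by
        refine ENNReal.rpow_le_rpow ?_ (by norm_num)
        refine (add_le_add (pow_le_pow_left₀ (zero_le) h1 2)
          (pow_le_pow_left₀ (zero_le) h2 2)).trans ?_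
        rw [← ENNReal.ofReal_pow hD, ← ENNReal.ofReal_add (by positivity) (by positivity),
          ← ENNReal.ofReal_pow (by positivity)]
        apply ENNReal.ofReal_le_ofReal
        nlinarith [sq_nonneg D]
    _ = ENNReal.ofReal (2 * D) := by
        rw [← ENNReal.rpow_natCast, ← ENNReal.rpow_mul]; norm_num

theorem norm_fn_loc_sq {s : ℝ} (hs : 0 ≤ s) {q : ℝ → ℂ} (hq : LocHs s q) {u v : Hs (s - 1)}
    (h : IsEnergyData s q u v) {χ : 𝓢(ℝ, ℂ)} (hχ : HasCompactSupport χ) :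
    ‖Hs.fn hs (loc s χ q)‖ ^ 2
      = (Hs.toDistribution (s - 1) u (smul' (conjS χ) χ)).re + ∫ x, ‖χ x‖ ^ 2 := by
  have hc := hasCompactSupport_smul' (conjS χ) hχ
  have e : ∀ x, smul' (conjS χ) χ x = ((‖χ x‖ ^ 2 : ℝ) : ℂ) := fun x ↦ by
    rw [smul'_apply, conjS_apply, Complex.conj_mul']; push_cast; rfl
  have hi : Integrable (fun x ↦ ‖χ x‖ ^ 2) := by
    have := (χ.memLp 2 (μ := (volume : Measure ℝ)))
    exact (memLp_two_iff_integrable_sq_norm this.1).1 this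
  rw [norm_sq_Lp, h.density _ hc]
  have e2 : ∀ x, smul' (conjS χ) χ x * ((‖q x‖ ^ 2 - 1 : ℝ) : ℂ)
      = ((‖χ x * q x‖ ^ 2 - ‖χ x‖ ^ 2 : ℝ) : ℂ) := fun x ↦ by
    rw [e, norm_mul]; push_cast; ring
  simp only [e2]
  rw [integral_complex_ofReal, Complex.ofReal_re]
  rw [integral_sub (hq.integrable_norm_sq hs hχ) hi, sub_add_cancel]
  refine integral_congr_ae ?_
  filter_upwards [hq.fn_loc hs hχ] with x hx
  rw [hx]

theorem sobolevSq_translate (σ a : ℝ) (f : 𝓢(ℝ, ℂ)) :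
    sobolevSq σ (translate a f) = sobolevSq σ f := by
  simp only [sobolevSq, enorm_fourier_translate]

theorem norm_ofS_translate (σ a : ℝ) (f : 𝓢(ℝ, ℂ)) : ‖ofS σ (translate a f)‖ = ‖ofS σ f‖ := by
  have h := sobolevSq_translate σ a f
  rw [← enorm_ofS_sq, ← enorm_ofS_sq] at h
  have h2 := congrArg ENNReal.toReal h
  rw [ENNReal.toReal_pow, ENNReal.toReal_pow, toReal_enorm, toReal_enorm] at h2
  exact (pow_left_inj₀ (norm_nonneg _) (norm_nonneg _) two_ne_zero).1 h2

theorem norm_ofS_mono {σ σ' : ℝ} (h : σ' ≤ σ) (f : 𝓢(ℝ, ℂ)) : ‖ofS σ' f‖ ≤ ‖ofS σ f‖ := by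
  rw [← incl_ofS h]; exact norm_incl_le h _

theorem norm_ofS_dilate_le {L : ℝ} (hL : 1 ≤ L) (f : 𝓢(ℝ, ℂ)) :
    ‖ofS 1 (dilate L (zero_lt_one.trans_le hL) f)‖ ≤ √L * ‖ofS 1 f‖ := by
  have h := sobolevSq_dilate_le (σ := 1) zero_le_one hL f
  have e : ENNReal.ofReal L = ENNReal.ofReal √L ^ 2 := by
    rw [← ENNReal.ofReal_pow (Real.sqrt_nonneg _), Real.sq_sqrt (by linarith)]
  rw [e] at h
  have := norm_ofS_le ENNReal.ofReal_ne_top h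
  rwa [ENNReal.toReal_ofReal (Real.sqrt_nonneg _)] at this

theorem smul'_translate (a : ℝ) (f g : 𝓢(ℝ, ℂ)) :
    smul' (translate a f) (translate a g) = translate a (smul' f g) := by
  ext x; simp

theorem conjS_translate (a : ℝ) (f : 𝓢(ℝ, ℂ)) :
    conjS (translate a f) = translate a (conjS f) := by
  ext x; simp

theorem hasCompactSupport_translate {f : 𝓢(ℝ, ℂ)} (hf : HasCompactSupport f) (a : ℝ) :
    HasCompactSupport (translate a f) := by
  have h : (translate a f : ℝ → ℂ) = f ∘ (Homeomorph.subRight a) := funext (translate_apply a f)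
  rw [h]
  exact hf.comp_homeomorph _

theorem hasCompactSupport_dilate {f : 𝓢(ℝ, ℂ)} (hf : HasCompactSupport f) {L : ℝ} (hL : 0 < L) :
    HasCompactSupport (dilate L hL f) := by
  have h : (dilate L hL f : ℝ → ℂ) = f ∘ (Homeomorph.mulRight₀ L⁻¹ (inv_ne_zero hL.ne')) := by
    funext x
    rw [dilate_apply, Function.comp_apply, Homeomorph.coe_mulRight₀, div_eq_mul_inv]
  rw [h]
  exact hf.comp_homeomorph _

theorem hasCompactSupport_derivCLM {f : 𝓢(ℝ, ℂ)} (hf : HasCompactSupport f) :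
    HasCompactSupport (SchwartzMap.derivCLM ℂ ℂ f) := by
  have h : (SchwartzMap.derivCLM ℂ ℂ f : ℝ → ℂ) = deriv f := rfl
  rw [h]
  exact hf.deriv

theorem deriv_translate (a : ℝ) (f : 𝓢(ℝ, ℂ)) :
    SchwartzMap.derivCLM ℂ ℂ (translate a f) = translate a (SchwartzMap.derivCLM ℂ ℂ f) := by
  ext x
  rw [translate_apply, SchwartzMap.derivCLM_apply, SchwartzMap.derivCLM_apply]
  have h : (translate a f : ℝ → ℂ) = fun x ↦ f (x - a) := funext (translate_apply a f)
  rw [h, deriv_comp_sub_const]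

/-- The windowed function is bounded below: `‖χ((· - a)/L) q‖_{H^s}² ≥ L ∫ |χ|² - C √L`. -/
theorem exists_le_norm_loc_sq {s : ℝ} (hs : 0 ≤ s) (N : ℝ) {χ : 𝓢(ℝ, ℂ)}
    (hχ : HasCompactSupport χ) : ∃ C : ℝ, ∀ (L : ℝ) (hL : 1 ≤ L) (q : EnergyFun s) (a : ℝ),
      energy s q.toFun ≤ ENNReal.ofReal N →
      L * (∫ x, ‖χ x‖ ^ 2) - C * √L
        ≤ ‖loc s (translate a (dilate L (zero_lt_one.trans_le hL) χ)) q.toFun‖ ^ 2 := by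
  obtain ⟨C, hC0, hC⟩ := exists_energyData s N
  refine ⟨C * ‖ofS 1 (smul' (conjS χ) χ)‖, fun L hL q a hq ↦ ?_⟩
  have hL0 : 0 < L := by linarith
  obtain ⟨u, v, hd, hu, hv⟩ := hC _ hq
  set f := translate a (dilate L (zero_lt_one.trans_le hL) χ)
  have hf : HasCompactSupport f := hasCompactSupport_translate (hasCompactSupport_dilate hχ _) a
  have h1 := norm_fn_loc_sq hs q.locHs hd hf
  have h2 := Hs.norm_fn_le hs (loc s f q.toFun)
  have h3 : ‖loc s f q.toFun‖ ^ 2 ≥ ‖Hs.fn hs (loc s f q.toFun)‖ ^ 2 := by gcongr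
  have h4 : ∫ x, ‖f x‖ ^ 2 = L * ∫ x, ‖χ x‖ ^ 2 := by
    have : ∀ x, ‖f x‖ ^ 2 = (fun y ↦ ‖χ (y / L)‖ ^ 2) (x - a) := fun x ↦ by
      simp only [f, translate_apply, dilate_apply]
    simp only [this]
    rw [integral_sub_right_eq_self (fun y ↦ ‖χ (y / L)‖ ^ 2) a,
      Measure.integral_comp_div (fun y ↦ ‖χ y‖ ^ 2), abs_of_pos hL0, smul_eq_mul]
  have h5 : smul' (conjS f) f
      = translate a (dilate L (zero_lt_one.trans_le hL) (smul' (conjS χ) χ)) := by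
    ext x
    simp only [f, smul'_apply, conjS_apply, translate_apply, dilate_apply]
  have h6 : ‖Hs.toDistribution (s - 1) u (smul' (conjS f) f)‖
      ≤ C * ‖ofS 1 (smul' (conjS χ) χ)‖ * √L := by
    refine (norm_toDistribution_apply_le u _).trans ?_
    rw [h5, norm_ofS_translate]
    calc _ ≤ C * (√L * ‖ofS 1 (smul' (conjS χ) χ)‖) := by
          gcongr
          exact (norm_ofS_mono (by linarith) _).trans (norm_ofS_dilate_le hL _)
      _ = _ := by ring
  have h7 := (abs_le.1 (Complex.abs_re_le_norm
    (Hs.toDistribution (s - 1) u (smul' (conjS f) f)))).1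
  rw [h4] at h1
  linarith

/-- The derivative of the test function `χ φ`. -/
theorem deriv_smul' (χ φ : 𝓢(ℝ, ℂ)) (x : ℝ) :
    deriv (smul' χ φ) x = deriv χ x * φ x + χ x * deriv φ x := by
  have h : (smul' χ φ : ℝ → ℂ) = fun x ↦ χ x * φ x := funext (smul'_apply _ _)
  rw [h]
  exact deriv_fun_mul χ.differentiableAt φ.differentiableAt

theorem incl_incl {σ₁ σ₂ σ₃ : ℝ} (h : σ₂ ≤ σ₁) (h' : σ₃ ≤ σ₂) (u : Hs σ₁) :
    incl h' (incl h u) = incl (h'.trans h) u := by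
  apply Hs.ext_distribution
  intro φ
  simp only [toDistribution_incl]

theorem incl_self {σ : ℝ} (u : Hs σ) : incl le_rfl u = u := by
  apply Hs.ext_distribution
  intro φ
  simp only [toDistribution_incl]

theorem derivOp_loc {s : ℝ} {q : ℝ → ℂ} (hq : LocHs s q) {u v : Hs (s - 1)}
    (h : IsEnergyData s q u v) {χ : 𝓢(ℝ, ℂ)} (hχ : HasCompactSupport χ) :
    derivOp s (loc s χ q) = mulOp (s - 1) χ v
      + incl (sub_le_self s zero_le_one) (loc s (SchwartzMap.derivCLM ℂ ℂ χ) q) := by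
  apply Hs.ext_of_hasCompactSupport
  intro φ hφ
  rw [toDistribution_derivOp_apply, toDistribution_add_apply, toDistribution_mulOp_apply,
    toDistribution_incl, hq.represents (hasCompactSupport_derivCLM hχ) φ hφ,
    hq.represents hχ _ (hasCompactSupport_derivCLM hφ),
    h.derivative _ (hasCompactSupport_smul' χ hφ), ← integral_neg, ← integral_neg,
    ← integral_add]
  · refine integral_congr_ae (.of_forall fun x ↦ ?_)
    simp only [deriv_smul', SchwartzMap.derivCLM_apply]
    ring
  · have h1 := integrable_mul_of_hasCompactSupport hq.locallyIntegrable
      (hasCompactSupport_derivCLM (hasCompactSupport_smul' χ hφ))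
    exact h1.neg
  · exact integrable_mul_of_hasCompactSupport
      (hq.locallyIntegrable_smul (SchwartzMap.derivCLM ℂ ℂ χ)) hφ

theorem derivOp_incl {σ s : ℝ} (h : σ ≤ s) (u : Hs s) :
    derivOp σ (incl h u) = incl (sub_le_sub_right h 1) (derivOp s u) := by
  apply Hs.ext_distribution
  intro φ
  simp only [toDistribution_incl, toDistribution_derivOp_apply]

theorem exists_norm_incl_loc_le {s : ℝ} (hs : 0 ≤ s) (N : ℝ) (k : ℕ) : ∀ {σ : ℝ} (hσ : σ ≤ s),
    σ ≤ k → ∀ {χ : 𝓢(ℝ, ℂ)}, HasCompactSupport χ → ∃ C : ℝ, 0 ≤ C ∧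
      ∀ (q : EnergyFun s) (a : ℝ), energy s q.toFun ≤ ENNReal.ofReal N →
        ‖incl hσ (loc s (translate a χ) q.toFun)‖ ≤ C := by
  obtain ⟨C, hC0, hC⟩ := exists_energyData s N
  induction k with
  | zero =>
    intro σ hσ hσ0 χ hχ
    rw [Nat.cast_zero] at hσ0
    have hI : 0 ≤ ∫ x, ‖χ x‖ ^ 2 := integral_nonneg fun _ ↦ by positivity
    refine ⟨√(C * ‖ofS (-(s - 1)) (smul' (conjS χ) χ)‖ + ∫ x, ‖χ x‖ ^ 2), Real.sqrt_nonneg _,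
      fun q a hq ↦ Real.le_sqrt_of_sq_le ?_⟩
    obtain ⟨u, v, hd, hu, hv⟩ := hC _ hq
    have h1 := norm_fn_loc_sq hs q.locHs hd (hasCompactSupport_translate hχ a)
    rw [conjS_translate, smul'_translate] at h1
    have h2 : ‖incl hσ (loc s (translate a χ) q.toFun)‖
        ≤ ‖Hs.fn hs (loc s (translate a χ) q.toFun)‖ := by
      rw [← incl_incl hs hσ0]
      exact norm_incl_le _ _
    have h3 := norm_toDistribution_apply_le u (translate a (smul' (conjS χ) χ))
    rw [norm_ofS_translate] at h3
    have h4 := (Complex.re_le_norm _).trans (h3.trans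
      (mul_le_mul_of_nonneg_right hu (norm_nonneg _)))
    have h5 : ∫ x, ‖translate a χ x‖ ^ 2 = ∫ x, ‖χ x‖ ^ 2 := by
      simp only [translate_apply]
      exact integral_sub_right_eq_self (fun y ↦ ‖χ y‖ ^ 2) a
    rw [h5] at h1
    calc _ ≤ ‖Hs.fn hs (loc s (translate a χ) q.toFun)‖ ^ 2 := by gcongr
      _ ≤ _ := by rw [h1]; gcongr
  | succ k ih =>
    intro σ hσ hσk χ hχ
    push_cast at hσk
    have hσ' : σ - 1 ≤ s := by linarith
    obtain ⟨C₁, hC₁0, hC₁⟩ := ih hσ' (by linarith) hχ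
    obtain ⟨C₂, hC₂0, hC₂⟩ := ih hσ' (by linarith) (hasCompactSupport_derivCLM hχ)
    have hM : 0 ≤ (multBound (s - 1) χ).toReal := ENNReal.toReal_nonneg
    refine ⟨C₁ + ((multBound (s - 1) χ).toReal * C + C₂), by positivity, fun q a hq ↦ ?_⟩
    obtain ⟨u, v, hd, hu, hv⟩ := hC _ hq
    set w := loc s (translate a χ) q.toFun
    have h1 := norm_sq_eq_add_derivOp (incl hσ w)
    rw [incl_incl, derivOp_incl, derivOp_loc q.locHs hd (hasCompactSupport_translate hχ a),
      map_add, deriv_translate, incl_incl] at h1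
    have h2 := hC₁ q a hq
    have h3 := hC₂ q a hq
    have h4 : ‖incl (sub_le_sub_right hσ 1) (mulOp (s - 1) (translate a χ) v)‖
        ≤ (multBound (s - 1) χ).toReal * C :=
      (norm_incl_le _ _).trans ((ContinuousLinearMap.le_opNorm _ _).trans
        (mul_le_mul (norm_mulOp_translate_le _ _ _) hv (norm_nonneg _) hM))
    have h5 := norm_add_le (incl (sub_le_sub_right hσ 1) (mulOp (s - 1) (translate a χ) v))
      (incl hσ' (loc s (translate a (SchwartzMap.derivCLM ℂ ℂ χ)) q.toFun))
    refine abs_le_of_sq_le_sq' ?_ (by positivity) |>.2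
    rw [h1]
    have h6 := h5.trans (add_le_add h4 h3)
    have n1 := norm_nonneg (incl hσ' w)
    calc _ ≤ C₁ ^ 2 + ((multBound (s - 1) χ).toReal * C + C₂) ^ 2 := by gcongr
      _ ≤ _ := by nlinarith [mul_nonneg hC₁0 (add_nonneg (mul_nonneg hM hC0) hC₂0)]

/-- Functions of bounded energy are locally bounded in `H^s`. -/
theorem exists_norm_loc_le {s : ℝ} (hs : 0 ≤ s) (N : ℝ) {χ : 𝓢(ℝ, ℂ)}
    (hχ : HasCompactSupport χ) : ∃ C : ℝ, 0 ≤ C ∧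
      ∀ (q : EnergyFun s) (a : ℝ), energy s q.toFun ≤ ENNReal.ofReal N →
        ‖loc s (translate a χ) q.toFun‖ ≤ C := by
  obtain ⟨C, hC0, hC⟩ := exists_norm_incl_loc_le hs N ⌈s⌉₊ le_rfl (Nat.le_ceil s) hχ
  exact ⟨C, hC0, fun q a hq ↦ by simpa only [incl_self] using hC q a hq⟩


/-! ### Perturbations of functions of finite energy -/

theorem deriv_smul'_eq_mul {ρ χ : 𝓢(ℝ, ℂ)} (h : ∀ x, ρ x * χ x = ρ x) (φ : 𝓢(ℝ, ℂ)) (x : ℝ) :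
    deriv (smul' ρ φ) x * χ x = deriv (smul' ρ φ) x := by
  by_cases hx : χ x = 1
  · rw [hx, mul_one]
  · have h1 : ∀ᶠ y in nhds x, χ y ≠ 1 := χ.continuous.continuousAt.eventually_ne hx
    have h2 : (smul' ρ φ : ℝ → ℂ) =ᶠ[nhds x] fun _ ↦ 0 := by
      filter_upwards [h1] with y hy
      have : ρ y * (χ y - 1) = 0 := by rw [mul_sub, h, mul_one, sub_self]
      rw [smul'_apply, (mul_eq_zero.1 this).resolve_right (sub_ne_zero.2 hy), zero_mul]
    rw [h2.deriv_eq, deriv_const, zero_mul]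

theorem exists_density_difference {s : ℝ} (hs : 0 ≤ s) {q g : ℝ → ℂ} (hq : LocHs s q)
    (hg : LocHs s g) {χ : 𝓢(ℝ, ℂ)} (hχ : HasCompactSupport χ) : ∃ w : Hs (s - 1),
      ‖w‖ ≤ (prodBound s).toReal * (2 * ‖loc s χ q‖ + ‖loc s χ g‖) * ‖loc s χ g‖ ∧
      ∀ φ : 𝓢(ℝ, ℂ), (∀ x, φ x * χ x = φ x) →
        Hs.toDistribution (s - 1) w φ
          = ∫ x, φ x * ((‖q x + g x‖ ^ 2 - ‖q x‖ ^ 2 : ℝ) : ℂ) := by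
  obtain ⟨w₁, h₁, e₁⟩ := exists_product hs (loc s χ q) (loc s χ g)
  obtain ⟨w₂, h₂, e₂⟩ := exists_product hs (loc s χ g) (loc s χ q)
  obtain ⟨w₃, h₃, e₃⟩ := exists_product hs (loc s χ g) (loc s χ g)
  have hi : ∀ (u v : Hs s) (φ : 𝓢(ℝ, ℂ)),
      Integrable (fun x ↦ φ x * (Hs.fn hs u x * starRingEnd ℂ (Hs.fn hs v x))) := by
    intro u v φ
    obtain ⟨M, hM⟩ := φ.toBoundedContinuousFunction.isBounded_range.exists_norm_le
    refine Integrable.bdd_mul (c := M) ?_ φ.continuous.aestronglyMeasurable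
      (.of_forall fun x ↦ hM _ ⟨x, rfl⟩)
    exact MemLp.integrable_mul (Lp.memLp (Hs.fn hs u)) (Lp.memLp (Hs.fn hs v)).star
  refine ⟨w₁ + w₂ + w₃, ?_, fun φ hφχ ↦ ?_⟩
  · refine (norm_add₃_le).trans ?_
    calc _ ≤ _ := add_le_add (add_le_add h₁ h₂) h₃
      _ = _ := by ring
  · rw [toDistribution_add_apply, toDistribution_add_apply, e₁, e₂, e₃,
      ← integral_add (hi _ _ _) (hi _ _ _), ← integral_add ((hi _ _ _).fun_add (hi _ _ _)) (hi _ _ _)]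
    refine integral_congr_ae ?_
    filter_upwards [hq.fn_loc hs hχ, hg.fn_loc hs hχ] with x h1 h2
    rw [h1, h2]
    by_cases hx : φ x = 0
    · simp [hx]
    · have hx1 : χ x = 1 := mul_left_cancel₀ hx ((hφχ x).trans (mul_one _).symm)
      have e : ((‖q x + g x‖ ^ 2 - ‖q x‖ ^ 2 : ℝ) : ℂ) = (q x + g x) * starRingEnd ℂ (q x + g x)
          - q x * starRingEnd ℂ (q x) := by
        rw [Complex.mul_conj', Complex.mul_conj']; push_cast; rfl
      rw [e, hx1, map_add]
      ring_nf

theorem summable_of_le_of_sq {α : Type*} {e f : α → ℝ} {C : ℝ} (he : Summable fun n ↦ e n ^ 2)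
    (hf : ∀ n, 0 ≤ f n) (h : ∀ n, f n ≤ C * e n) : Summable (fun n ↦ f n ^ 2) ∧
      ∑' n, f n ^ 2 ≤ C ^ 2 * ∑' n, e n ^ 2 := by
  have h1 : ∀ n, f n ^ 2 ≤ C ^ 2 * e n ^ 2 := fun n ↦ by
    rw [← mul_pow]; exact pow_le_pow_left₀ (hf n) (h n) 2
  have h2 := Summable.of_nonneg_of_le (fun n ↦ by positivity) h1 (he.mul_left _)
  refine ⟨h2, ?_⟩
  rw [← tsum_mul_left]
  exact h2.tsum_le_tsum h1 (he.mul_left _)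

theorem summable_norm_mulOp_translate_sq (σ : ℝ) {h : ℝ} (hh : 1 ≤ h) {χ : 𝓢(ℝ, ℂ)}
    (hχ : HasCompactSupport χ) : ∃ C : ℝ, 0 ≤ C ∧ ∀ u : Hs σ,
      Summable (fun m : ℤ ↦ ‖mulOp σ (translate (h * m) χ) u‖ ^ 2) ∧
      ∑' m : ℤ, ‖mulOp σ (translate (h * m) χ) u‖ ^ 2 ≤ C ^ 2 * ‖u‖ ^ 2 := by
  obtain ⟨C, hC0, hC⟩ := exists_sum_norm_mulOp_translate_sq_le σ hh hχ
  refine ⟨C, hC0, fun u ↦ ?_⟩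
  have h1 : Summable (fun m : ℤ ↦ ‖mulOp σ (translate (h * m) χ) u‖ ^ 2) :=
    summable_of_sum_le (fun _ ↦ by positivity) (hC u)
  exact ⟨h1, h1.tsum_le_of_sum_le (hC u)⟩

/-- If `p` is close to `q` on cells, up to phases, then `p` has finite energy. -/
theorem exists_energy_le {s : ℝ} (hs : 0 ≤ s) (N M : ℝ) {h : ℝ} (hh : 1 ≤ h) {ρ χ : 𝓢(ℝ, ℂ)}
    (hρ : IsPartition h ρ) (hχ : HasCompactSupport χ) (hρχ : ∀ x, ρ x * χ x = ρ x) :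
    ∃ G : ℝ, ∀ (q : EnergyFun s) (p : ℝ → ℂ) (c : ℤ → ℂ) (e : ℤ → ℝ),
      energy s q.toFun ≤ ENNReal.ofReal N → LocHs s p → (∀ n, ‖c n‖ = 1) →
      (∀ n : ℤ, ‖loc s (translate (h * n) χ) (fun x ↦ c n * p x - q.toFun x)‖ ≤ e n) →
      Summable (fun n ↦ e n ^ 2) → ∑' n, e n ^ 2 ≤ M ^ 2 →
      energy s p ≤ ENNReal.ofReal G := by
  obtain ⟨C₀, hC₀0, hC₀⟩ := exists_energyData s N
  obtain ⟨B, hB0, hB⟩ := exists_norm_loc_le hs N hχ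
  obtain ⟨C₁, hC₁0, hC₁⟩ := exists_of_cells (s - 1) hh hρ
  obtain ⟨C₂, hC₂0, hC₂⟩ := summable_norm_mulOp_translate_sq (s - 1) hh hχ
  set P := (prodBound s).toReal
  have hP : 0 ≤ P := ENNReal.toReal_nonneg
  set D₁ := C₁ * √((P * (2 * B + |M|)) ^ 2 * M ^ 2)
  set D₂ := C₁ * √(2 * (C₂ ^ 2 * C₀ ^ 2) + 2 * M ^ 2)
  have hD1 : 0 ≤ D₁ := by positivity
  have hD2 : 0 ≤ D₂ := by positivity
  refine ⟨2 * (4 ^ |(s - 1) / 2| * (C₀ + D₁ + D₂)), fun q p c e hq hp hc he hes heM ↦ ?_⟩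
  obtain ⟨u, v, hd, hu, hv⟩ := hC₀ _ hq
  have he0 : ∀ n, 0 ≤ e n := fun n ↦ (norm_nonneg _).trans (he n)
  have heM' : ∀ n, e n ≤ |M| := fun n ↦ by
    have := (hes.le_tsum n fun _ _ ↦ by positivity).trans heM
    exact (abs_of_nonneg (he0 n)).symm.trans_le (sq_le_sq.1 this)
  have hg : ∀ n, LocHs s (fun x ↦ c n * p x - q.toFun x) := fun n ↦ (hp.const_mul _).sub q.locHs
  have hχn : ∀ n : ℤ, HasCompactSupport (translate (h * n) χ) := fun n ↦
    hasCompactSupport_translate hχ _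
  have hρχn : ∀ (n : ℤ) x, translate (h * n) ρ x * translate (h * n) χ x = translate (h * n) ρ x :=
    fun n x ↦ by simp only [translate_apply, hρχ]
  have hconj : ∀ n, starRingEnd ℂ (c n) * c n = 1 := fun n ↦ by
    rw [Complex.conj_mul', hc]; simp
  -- the density
  choose w hw hw' using fun n : ℤ ↦ exists_density_difference hs q.locHs (hg n) (hχn n)
  have hwe : ∀ n, ‖w n‖ ≤ P * (2 * B + |M|) * e n := fun n ↦ (hw n).trans (by
    gcongr
    · exact hB q _ hq
    · exact (he n).trans (heM' n)
    · exact he n)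
  have hws := summable_of_le_of_sq hes (fun n ↦ norm_nonneg (w n)) hwe
  have h1 := hC₁ (fun φ ↦ ∫ x, φ x * ((‖p x‖ ^ 2 - ‖q.toFun x‖ ^ 2 : ℝ) : ℂ)) w (by
    intro φ ψ hφ hψ
    have hi : ∀ φ : 𝓢(ℝ, ℂ), HasCompactSupport φ →
        Integrable (fun x ↦ φ x * ((‖p x‖ ^ 2 - ‖q.toFun x‖ ^ 2 : ℝ) : ℂ)) := fun φ hφ ↦ by
      refine ((hp.integrable_mul_norm_sq hs hφ).sub
        (q.locHs.integrable_mul_norm_sq hs hφ)).congr (.of_forall fun x ↦ ?_)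
      simp only [Pi.sub_apply]
      push_cast
      ring
    rw [← integral_add (hi φ hφ) (hi ψ hψ)]
    refine integral_congr_ae (.of_forall fun x ↦ ?_)
    simp only [_root_.add_apply]
    ring) (by
    intro n φ hφ
    rw [hw' n _ fun x ↦ by
      rw [smul'_apply, mul_right_comm, hρχn]]
    refine integral_congr_ae (.of_forall fun x ↦ ?_)
    simp only [add_sub_cancel, norm_mul, hc, one_mul]) hws.1
  -- the derivative
  have hdp : ∀ (n : ℤ) (φ : 𝓢(ℝ, ℂ)), HasCompactSupport φ →
      Hs.toDistribution (s - 1) (starRingEnd ℂ (c n) • (mulOp (s - 1) (translate (h * n) χ) v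
        + derivOp s (loc s (translate (h * n) χ) (fun x ↦ c n * p x - q.toFun x))))
        (smul' (translate (h * n) ρ) φ)
        = -∫ x, deriv (smul' (translate (h * n) ρ) φ) x * p x := by
    intro n φ hφ
    set ψ := smul' (translate (h * n) ρ) φ
    have hψ : HasCompactSupport ψ := hasCompactSupport_smul' _ hφ
    have hψχ : smul' (translate (h * n) χ) ψ = ψ := by
      ext x
      simp only [ψ, smul'_apply]
      rw [← mul_assoc, mul_comm (translate (h * n) χ x), hρχn]
    rw [toDistribution_smul_apply, toDistribution_add_apply, toDistribution_mulOp_apply, hψχ,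
      hd.derivative _ hψ, toDistribution_derivOp_apply,
      (hg n).represents (hχn n) _ (hasCompactSupport_derivCLM hψ), ← neg_add, mul_neg,
      ← integral_add, ← integral_const_mul]
    · congr 1
      refine integral_congr_ae (.of_forall fun x ↦ ?_)
      simp only [SchwartzMap.derivCLM_apply]
      rw [← mul_assoc (deriv ψ x), deriv_smul'_eq_mul (hρχn n)]
      linear_combination (deriv ψ x * p x) * hconj n
    · exact integrable_mul_of_hasCompactSupport q.locallyIntegrable
        (hasCompactSupport_derivCLM hψ)
    · exact integrable_mul_of_hasCompactSupport ((hg n).locallyIntegrable_smul _)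
        (hasCompactSupport_derivCLM hψ)
  have hys : ∀ n : ℤ, ‖starRingEnd ℂ (c n) • (mulOp (s - 1) (translate (h * n) χ) v
        + derivOp s (loc s (translate (h * n) χ) (fun x ↦ c n * p x - q.toFun x)))‖ ^ 2
        ≤ 2 * ‖mulOp (s - 1) (translate (h * n) χ) v‖ ^ 2 + 2 * e n ^ 2 := by
    intro n
    rw [norm_smul, RCLike.norm_conj, hc, one_mul]
    have h2 := norm_add_le (mulOp (s - 1) (translate (h * n) χ) v)
      (derivOp s (loc s (translate (h * n) χ) (fun x ↦ c n * p x - q.toFun x)))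
    have h3 := (norm_derivOp_le _).trans (he n)
    have h4 := pow_le_pow_left₀ (norm_nonneg _) (h2.trans (add_le_add_right h3 _)) 2
    refine h4.trans ?_
    nlinarith [sq_nonneg (‖mulOp (s - 1) (translate (h * n) χ) v‖ - e n)]
  have hvs := hC₂ v
  have hrs := (hvs.1.mul_left 2).add (hes.mul_left 2)
  have hys' := Summable.of_nonneg_of_le (fun n ↦ by positivity) hys hrs
  have h2 := hC₁ (fun φ ↦ -∫ x, deriv φ x * p x) (fun n ↦ starRingEnd ℂ (c n) •
      (mulOp (s - 1) (translate (h * n) χ) v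
        + derivOp s (loc s (translate (h * n) χ) (fun x ↦ c n * p x - q.toFun x)))) (by
    intro φ ψ hφ hψ
    have hi : ∀ φ : 𝓢(ℝ, ℂ), HasCompactSupport φ → Integrable (fun x ↦ deriv φ x * p x) :=
      fun φ hφ ↦ integrable_mul_of_hasCompactSupport hp.locallyIntegrable
        (hasCompactSupport_derivCLM hφ)
    rw [← neg_add, ← integral_add (hi φ hφ) (hi ψ hψ)]
    congr 1
    refine integral_congr_ae (.of_forall fun x ↦ ?_)
    have : deriv (φ + ψ : 𝓢(ℝ, ℂ)) x = deriv φ x + deriv ψ x :=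
      deriv_add φ.differentiableAt ψ.differentiableAt
    simp only [this]
    ring) hdp hys'
  refine energy_le_of_energyData (u := u + ∑' n : ℤ, mulOp (s - 1) (translate (h * n) ρ) (w n))
    (v := ∑' n : ℤ, mulOp (s - 1) (translate (h * n) ρ) (starRingEnd ℂ (c n) •
      (mulOp (s - 1) (translate (h * n) χ) v
        + derivOp s (loc s (translate (h * n) χ) (fun x ↦ c n * p x - q.toFun x))))) ⟨?_, h2.1⟩ ?_ ?_
  · intro φ hφ
    rw [toDistribution_add_apply, h1.1 φ hφ, hd.density φ hφ, ← integral_add]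
    · refine integral_congr_ae (.of_forall fun x ↦ ?_)
      simp only
      push_cast
      ring
    · refine ((q.locHs.integrable_mul_norm_sq hs hφ).sub φ.integrable).congr
        (.of_forall fun x ↦ ?_)
      simp only [Pi.sub_apply]
      push_cast
      ring
    · refine ((hp.integrable_mul_norm_sq hs hφ).sub
        (q.locHs.integrable_mul_norm_sq hs hφ)).congr (.of_forall fun x ↦ ?_)
      simp only [Pi.sub_apply]
      push_cast
      ring
  · refine (norm_add_le _ _).trans ?_
    have h3 : ‖∑' n : ℤ, mulOp (s - 1) (translate (h * n) ρ) (w n)‖ ≤ D₁ :=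
      h1.2.trans (by
        refine mul_le_mul_of_nonneg_left (Real.sqrt_le_sqrt (hws.2.trans ?_)) hC₁0
        gcongr)
    linarith
  · have h3 := h2.2
    refine h3.trans ?_
    have h4 := hys'.tsum_le_tsum hys hrs
    rw [(hvs.1.mul_left 2).tsum_add (hes.mul_left 2), tsum_mul_left, tsum_mul_left] at h4
    have h5 : C₁ * √(∑' n : ℤ, ‖starRingEnd ℂ (c n) • (mulOp (s - 1) (translate (h * n) χ) v
        + derivOp s (loc s (translate (h * n) χ) (fun x ↦ c n * p x - q.toFun x)))‖ ^ 2) ≤ D₂ := by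
      refine mul_le_mul_of_nonneg_left (Real.sqrt_le_sqrt (h4.trans ?_)) hC₁0
      have h6 : C₂ ^ 2 * ‖v‖ ^ 2 ≤ C₂ ^ 2 * C₀ ^ 2 := by gcongr
      linarith [hvs.2]
    linarith


/-! ### The hyperbolic secant -/

theorem hasDerivAt_sech_mul (P : Polynomial ℝ) (x : ℝ) :
    HasDerivAt (fun x ↦ (Real.cosh x)⁻¹ * P.eval (Real.tanh x))
      ((Real.cosh x)⁻¹ * (-Polynomial.X * P
        + (1 - Polynomial.X ^ 2) * Polynomial.derivative P).eval (Real.tanh x)) x := by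
  have hc : Real.cosh x ≠ 0 := (Real.cosh_pos x).ne'
  have h1 : HasDerivAt (fun x ↦ (Real.cosh x)⁻¹) (-Real.sinh x / Real.cosh x ^ 2) x :=
    (Real.hasDerivAt_cosh x).inv hc
  have h2 : HasDerivAt Real.tanh
      ((Real.cosh x * Real.cosh x - Real.sinh x * Real.sinh x) / Real.cosh x ^ 2) x := by
    have := (Real.hasDerivAt_sinh x).div (Real.hasDerivAt_cosh x) hc
    have e : Real.tanh = fun x ↦ Real.sinh x / Real.cosh x := funext Real.tanh_eq_sinh_div_cosh
    rw [e]
    exact this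
  have h3 : HasDerivAt (fun x ↦ P.eval (Real.tanh x)) _ x :=
    (P.hasDerivAt (Real.tanh x)).comp x h2
  refine (h1.fun_mul h3).congr_deriv ?_
  simp only [Polynomial.eval_add, Polynomial.eval_mul, Polynomial.eval_neg, Polynomial.eval_X,
    Polynomial.eval_sub, Polynomial.eval_one, Polynomial.eval_pow, Real.tanh_eq_sinh_div_cosh]
  field_simp

theorem exists_iteratedDeriv_sech (n : ℕ) : ∃ P : Polynomial ℝ,
    iteratedDeriv n (fun x ↦ (Real.cosh x)⁻¹) = fun x ↦ (Real.cosh x)⁻¹ * P.eval (Real.tanh x) := by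
  induction n with
  | zero => exact ⟨1, by funext x; simp⟩
  | succ n ih =>
    obtain ⟨P, hP⟩ := ih
    refine ⟨-Polynomial.X * P + (1 - Polynomial.X ^ 2) * Polynomial.derivative P,
      funext fun x ↦ ?_⟩
    rw [iteratedDeriv_succ, hP]
    exact (hasDerivAt_sech_mul P x).deriv

theorem pow_mul_sech_le (k : ℕ) (x : ℝ) : |x| ^ k * (Real.cosh x)⁻¹ ≤ 2 * k.factorial := by
  have h1 : |x| ^ k / k.factorial ≤ Real.exp |x| := Real.pow_div_factorial_le_exp |x| (abs_nonneg x) k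
  have h2 : Real.exp |x| ≤ 2 * Real.cosh x := by
    rw [← Real.cosh_abs, Real.cosh_eq]
    have := Real.exp_pos (-|x|)
    linarith
  rw [div_le_iff₀ (by positivity)] at h1
  rw [← div_eq_mul_inv, div_le_iff₀ (Real.cosh_pos x)]
  calc |x| ^ k ≤ Real.exp |x| * k.factorial := h1
    _ ≤ 2 * Real.cosh x * k.factorial := by gcongr
    _ = _ := by ring

/-- The function `1 / cosh` as a Schwartz function. -/
def sech : 𝓢(ℝ, ℂ) where
  toFun x := ((1 / Real.cosh x : ℝ) : ℂ)
  smooth' := by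
    have h : ContDiff ℝ ∞ fun x ↦ 1 / Real.cosh x :=
      contDiff_const.div Real.contDiff_cosh fun x ↦ (Real.cosh_pos x).ne'
    exact Complex.ofRealCLM.contDiff.comp h
  decay' := by
    intro k n
    obtain ⟨P, hP⟩ := exists_iteratedDeriv_sech n
    obtain ⟨M, hM⟩ := (isCompact_Icc (a := (-1 : ℝ)) (b := 1)).exists_bound_of_continuousOn
      P.continuous.continuousOn
    have hM0 : 0 ≤ M := (norm_nonneg _).trans (hM 0 (by simp))
    refine ⟨2 * k.factorial * M, fun x ↦ ?_⟩
    have e : (fun x : ℝ ↦ ((1 / Real.cosh x : ℝ) : ℂ))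
        = Complex.ofRealLI ∘ fun x ↦ (Real.cosh x)⁻¹ := by
      funext x; simp
    have hs : ContDiff ℝ ∞ fun x ↦ (Real.cosh x)⁻¹ :=
      Real.contDiff_cosh.inv fun x ↦ (Real.cosh_pos x).ne'
    rw [e, Complex.ofRealLI.norm_iteratedFDeriv_comp_left (hs.contDiffAt.of_le (by
      exact_mod_cast le_top)) (i := n) le_rfl, norm_iteratedFDeriv_eq_norm_iteratedDeriv, hP,
      norm_mul, Real.norm_eq_abs, Real.norm_of_nonneg (inv_nonneg.2 (Real.cosh_pos x).le),
      ← mul_assoc]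
    have ht : Real.tanh x ∈ Set.Icc (-1 : ℝ) 1 :=
      abs_le.1 (Real.abs_tanh_lt_one x).le
    exact mul_le_mul (pow_mul_sech_le k x) (hM _ ht) (norm_nonneg _) (by positivity)

@[simp] theorem sech_apply (x : ℝ) : sech x = ((1 / Real.cosh x : ℝ) : ℂ) := rfl

/-! ### Off-diagonal decay -/

/-- Multiplication by `x`. -/
def mulX (f : 𝓢(ℝ, ℂ)) : 𝓢(ℝ, ℂ) := SchwartzMap.smulLeftCLM ℂ (fun x : ℝ ↦ (x : ℂ)) f

theorem mulX_apply (f : 𝓢(ℝ, ℂ)) (x : ℝ) : mulX f x = x * f x := by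
  have h : (fun x : ℝ ↦ (x : ℂ)).HasTemperateGrowth := by fun_prop
  rw [mulX, SchwartzMap.smulLeftCLM_apply_apply h, smul_eq_mul]

theorem exists_decay (σ : ℝ) (k : ℕ) : ∀ φ f : 𝓢(ℝ, ℂ), ∃ C : ℝ, 0 ≤ C ∧ ∀ y a : ℝ,
    |y - a| ^ k * ‖mulOp σ (smul' (translate y φ) (translate a f))‖ ≤ C := by
  induction k with
  | zero =>
    intro φ f
    refine ⟨(multBound σ φ).toReal * (multBound σ f).toReal,
      mul_nonneg ENNReal.toReal_nonneg ENNReal.toReal_nonneg, fun y a ↦ ?_⟩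
    have e : mulOp σ (smul' (translate y φ) (translate a f))
        = (mulOp σ (translate y φ)).comp (mulOp σ (translate a f)) := by
      ext1 u
      exact (mulOp_mulOp (fun x ↦ (smul'_apply _ _ x).symm) u).symm
    rw [pow_zero, one_mul, e]
    exact (ContinuousLinearMap.opNorm_comp_le _ _).trans (mul_le_mul
      (norm_mulOp_translate_le _ _ _) (norm_mulOp_translate_le _ _ _) (norm_nonneg _)
      ENNReal.toReal_nonneg)
  | succ k ih =>
    intro φ f
    obtain ⟨C₁, h10, h1⟩ := ih φ (mulX f)
    obtain ⟨C₂, h20, h2⟩ := ih (mulX φ) f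
    refine ⟨C₁ + C₂, by positivity, fun y a ↦ ?_⟩
    have e : ((y - a : ℝ) : ℂ) • smul' (translate y φ) (translate a f)
        = smul' (translate y φ) (translate a (mulX f))
          - smul' (translate y (mulX φ)) (translate a f) := by
      ext x
      rw [_root_.sub_apply, _root_.smul_apply]
      simp only [smul'_apply, translate_apply, mulX_apply, smul_eq_mul]
      push_cast
      ring
    have e2 : |y - a| * ‖mulOp σ (smul' (translate y φ) (translate a f))‖
        = ‖mulOp σ (smul' (translate y φ) (translate a (mulX f)))
          - mulOp σ (smul' (translate y (mulX φ)) (translate a f))‖ := by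
      have := (mulOpₗ σ).map_sub (smul' (translate y φ) (translate a (mulX f)))
        (smul' (translate y (mulX φ)) (translate a f))
      change mulOp σ _ = mulOp σ _ - mulOp σ _ at this
      rw [← this, ← e, mulOp_smul, norm_smul, Complex.norm_real, Real.norm_eq_abs]
    rw [pow_succ, mul_assoc, e2]
    calc _ ≤ |y - a| ^ k * (‖mulOp σ (smul' (translate y φ) (translate a (mulX f)))‖
          + ‖mulOp σ (smul' (translate y (mulX φ)) (translate a f))‖) := by
          gcongr; exact norm_sub_le _ _
      _ ≤ _ := by rw [mul_add]; exact add_le_add (h1 y a) (h2 y a)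

/-! ### Sequences with square summable differences -/

theorem tsum_enorm_sub_sq_le_nat {V : Type*} [SeminormedAddCommGroup V] {c : ℤ → V} {e : ℤ → ℝ}
    (hc : ∀ n, ‖c n - c (n - 1)‖ ≤ e n) (k : ℕ) :
    ∑' m : ℤ, ENNReal.ofReal (‖c (m + k) - c m‖ ^ 2)
      ≤ k ^ 2 * ∑' n, ENNReal.ofReal (e n ^ 2) := by
  have h1 : ∀ m : ℤ, ‖c (m + k) - c m‖ ^ 2
      ≤ k * ∑ j ∈ Finset.range k, e (m + (j + 1)) ^ 2 := by
    intro m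
    have h2 : ‖c (m + k) - c m‖ ≤ ∑ j ∈ Finset.range k, e (m + (j + 1)) := by
      have := dist_le_range_sum_of_dist_le (f := fun j : ℕ ↦ c (m + j)) k
        (d := fun j ↦ e (m + (j + 1))) fun {j} _ ↦ by
          rw [dist_comm, dist_eq_norm]
          have := hc (m + (j + 1))
          rw [show m + ((j : ℤ) + 1) - 1 = m + j by ring] at this
          push_cast
          exact this
      rw [dist_comm, dist_eq_norm] at this
      simpa using this
    have h3 := sq_sum_le_card_mul_sum_sq (s := Finset.range k) (f := fun j : ℕ ↦ e (m + (j + 1)))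
    rw [Finset.card_range] at h3
    exact (pow_le_pow_left₀ (norm_nonneg _) h2 2).trans h3
  calc ∑' m : ℤ, ENNReal.ofReal (‖c (m + k) - c m‖ ^ 2)
      ≤ ∑' m : ℤ, (k : ℝ≥0∞) * ∑ j ∈ Finset.range k, ENNReal.ofReal (e (m + (j + 1)) ^ 2) := by
        refine ENNReal.tsum_le_tsum fun m ↦ (ENNReal.ofReal_le_ofReal (h1 m)).trans ?_
        rw [ENNReal.ofReal_mul (by positivity), ENNReal.ofReal_natCast,
          ENNReal.ofReal_sum_of_nonneg fun _ _ ↦ by positivity]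
    _ = (k : ℝ≥0∞) * ∑ j ∈ Finset.range k, ∑' m : ℤ, ENNReal.ofReal (e (m + (j + 1)) ^ 2) := by
        rw [ENNReal.tsum_mul_left, Summable.tsum_finsetSum fun _ _ ↦ ENNReal.summable]
    _ = (k : ℝ≥0∞) * ∑ j ∈ Finset.range k, ∑' m : ℤ, ENNReal.ofReal (e m ^ 2) := by
        congr 1
        refine Finset.sum_congr rfl fun j _ ↦ ?_
        exact (Equiv.addRight ((j : ℤ) + 1)).tsum_eq (fun m ↦ ENNReal.ofReal (e m ^ 2))
    _ = _ := by rw [Finset.sum_const, Finset.card_range, nsmul_eq_mul]; ring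

theorem tsum_enorm_sub_sq_le {V : Type*} [SeminormedAddCommGroup V] {c : ℤ → V} {e : ℤ → ℝ}
    (hc : ∀ n, ‖c n - c (n - 1)‖ ≤ e n) (k : ℤ) :
    ∑' m : ℤ, ENNReal.ofReal (‖c (m + k) - c m‖ ^ 2)
      ≤ (k.natAbs : ℝ≥0∞) ^ 2 * ∑' n, ENNReal.ofReal (e n ^ 2) := by
  obtain ⟨n, rfl | rfl⟩ := k.eq_nat_or_neg
  · simpa using tsum_enorm_sub_sq_le_nat hc n
  · have h := tsum_enorm_sub_sq_le_nat hc n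
    rw [← (Equiv.addRight (-(n : ℤ))).tsum_eq] at h
    simp only [Equiv.coe_addRight, neg_add_cancel_right] at h
    simpa [norm_sub_rev] using h

theorem summable_inv_one_add_abs_sq : Summable fun k : ℤ ↦ ((1 + |(k : ℝ)|) ^ 2)⁻¹ := by
  have h : Summable fun n : ℕ ↦ ((1 + (n : ℝ)) ^ 2)⁻¹ := by
    have := (summable_nat_add_iff 1).2 (Real.summable_nat_pow_inv.2 one_lt_two)
    refine this.congr fun n ↦ ?_
    push_cast
    rw [add_comm]
  refine Summable.of_nat_of_neg ?_ ?_ <;> simpa using h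


/-! ### The distance in terms of cells -/

theorem exists_lt_of_setLIntegral {I : ℝ → ℝ≥0∞} {S : Set ℝ} (hS : MeasurableSet S)
    (hS1 : volume S = 1) (hI : ∫⁻ y in S, I y ≠ ⊤) {ε : ℝ≥0∞} (hε : ε ≠ 0) :
    ∃ y ∈ S, I y < (∫⁻ y in S, I y) + ε := by
  by_contra! h
  have h1 : (∫⁻ y in S, I y) + ε ≤ ∫⁻ y in S, I y := by
    calc (∫⁻ y in S, I y) + ε = ∫⁻ _ in S, ((∫⁻ y in S, I y) + ε) := by
          rw [setLIntegral_const, hS1, mul_one]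
      _ ≤ _ := setLIntegral_mono' hS fun y hy ↦ h y hy
  exact absurd (ENNReal.lt_add_right hI hε) (not_lt.2 h1)

theorem exists_cosh_bound (σ : ℝ) {χ : 𝓢(ℝ, ℂ)} (hχ : HasCompactSupport χ) :
    ∃ C : ℝ, 0 ≤ C ∧ ∀ a y : ℝ, a ≤ y → y ≤ a + 1 → ∃ f : 𝓢(ℝ, ℂ),
      (∀ x, f x = translate a χ x * (Real.cosh (x - y) : ℝ)) ∧ ‖mulOp σ f‖ ≤ C := by
  have hs : ∀ t : ℝ, ContDiff ℝ ∞ fun x : ℝ ↦ χ x * ((Real.exp (t * x) : ℝ) : ℂ) := fun t ↦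
    (χ.smooth _).mul (Complex.ofRealCLM.contDiff.comp
      (Real.contDiff_exp.comp (contDiff_const.mul contDiff_id)))
  have hc : ∀ t : ℝ, HasCompactSupport fun x : ℝ ↦ χ x * ((Real.exp (t * x) : ℝ) : ℂ) :=
    fun t ↦ hχ.mul_right
  let g : ℝ → 𝓢(ℝ, ℂ) := fun t ↦ (hc t).toSchwartzMap (hs t)
  have hg : ∀ t x, g t x = χ x * ((Real.exp (t * x) : ℝ) : ℂ) := fun t x ↦ rfl
  refine ⟨Real.exp 1 / 2 * (multBound σ (g 1)).toReal + Real.exp 1 / 2 * (multBound σ (g (-1))).toReal,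
    add_nonneg (mul_nonneg (by positivity) ENNReal.toReal_nonneg)
      (mul_nonneg (by positivity) ENNReal.toReal_nonneg), fun a y h1 h2 ↦ ?_⟩
  refine ⟨((Real.exp (-(y - a)) / 2 : ℝ) : ℂ) • translate a (g 1)
    + ((Real.exp (y - a) / 2 : ℝ) : ℂ) • translate a (g (-1)), fun x ↦ ?_, ?_⟩
  · rw [_root_.add_apply, _root_.smul_apply, _root_.smul_apply]
    simp only [translate_apply, hg, smul_eq_mul, Real.cosh_eq]
    have e1 : Real.exp (x - y) = Real.exp (-(y - a)) * Real.exp (1 * (x - a)) := by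
      rw [← Real.exp_add]; ring_nf
    have e2 : Real.exp (-(x - y)) = Real.exp (y - a) * Real.exp (-1 * (x - a)) := by
      rw [← Real.exp_add]; ring_nf
    rw [e1, e2]
    push_cast
    ring
  · rw [mulOp_add, mulOp_smul, mulOp_smul]
    refine (norm_add_le _ _).trans ?_
    rw [norm_smul, norm_smul, Complex.norm_real, Complex.norm_real,
      Real.norm_of_nonneg (by positivity), Real.norm_of_nonneg (by positivity)]
    have e3 : Real.exp (-(y - a)) ≤ Real.exp 1 := Real.exp_le_exp.2 (by linarith)
    have e4 : Real.exp (y - a) ≤ Real.exp 1 := Real.exp_le_exp.2 (by linarith)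
    have := norm_mulOp_translate_le σ a (g 1)
    have := norm_mulOp_translate_le σ a (g (-1))
    gcongr

theorem exists_phases_of_funDist_lt (s : ℝ) {h : ℝ} (hh : 1 ≤ h) {χ : 𝓢(ℝ, ℂ)}
    (hχ : HasCompactSupport χ) : ∃ C : ℝ, 0 ≤ C ∧ ∀ (p q : ℝ → ℂ) (r : ℝ), 0 < r →
      funDist s p q < ENNReal.ofReal r → ∃ (c : ℤ → ℂ) (e : ℤ → ℝ), (∀ n, ‖c n‖ = 1) ∧
        (∀ n, 0 ≤ e n) ∧
        (∀ n : ℤ, ‖loc s (translate (h * n) χ) (fun x ↦ c n * p x - q x)‖ ≤ C * e n) ∧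
        Summable (fun n ↦ e n ^ 2) ∧ ∑' n, e n ^ 2 < r ^ 2 := by
  obtain ⟨C, hC0, hC⟩ := exists_cosh_bound s hχ
  refine ⟨C, hC0, fun p q r hr hd ↦ ?_⟩
  set I : ℝ → ℝ≥0∞ := fun y ↦ ⨅ c : Metric.sphere (0 : ℂ) 1,
    functionNorm 1 s (fun x ↦ ((1 / Real.cosh (x - y) : ℝ) : ℂ) * (c * p x - q x)) ^ 2 with hI
  have h1 : ∫⁻ y, I y < ENNReal.ofReal (r ^ 2) := by
    have h2 : (∫⁻ y, I y) ^ (1 / 2 : ℝ) < ENNReal.ofReal r := hd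
    have h3 := ENNReal.rpow_lt_rpow h2 (z := 2) (by norm_num)
    rw [← ENNReal.rpow_mul, show (1 / 2 : ℝ) * 2 = 1 by norm_num, ENNReal.rpow_one] at h3
    rw [ENNReal.ofReal_pow hr.le, ← ENNReal.rpow_natCast]
    exact_mod_cast h3
  obtain ⟨δ, hδ0, hδ⟩ := ENNReal.exists_pos_sum_of_countable (tsub_pos_of_lt h1).ne' ℤ
  set S : ℤ → Set ℝ := fun n ↦ Set.Ico (h * n) (h * n + 1)
  have hS : ∀ n, MeasurableSet (S n) := fun n ↦ measurableSet_Ico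
  have hSd : Pairwise (Function.onFun Disjoint S) := by
    intro m n hmn
    rw [Function.onFun, Set.disjoint_left]
    rintro x ⟨hx1, hx2⟩ ⟨hx3, hx4⟩
    rcases lt_or_gt_of_ne hmn with hlt | hlt
    · have : (m : ℝ) + 1 ≤ n := by exact_mod_cast hlt
      nlinarith
    · have : (n : ℝ) + 1 ≤ m := by exact_mod_cast hlt
      nlinarith
  set J : ℤ → ℝ≥0∞ := fun n ↦ ∫⁻ y in S n, I y
  have hJ : ∑' n, J n ≤ ∫⁻ y, I y := by
    rw [← lintegral_iUnion hS hSd]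
    exact setLIntegral_le_lintegral _ _
  have hJt : ∀ n, J n ≠ ⊤ := fun n ↦
    (((ENNReal.le_tsum n).trans hJ).trans_lt (h1.trans ENNReal.ofReal_lt_top)).ne
  have hsum : ∑' n, (J n + δ n) < ENNReal.ofReal (r ^ 2) := by
    rw [ENNReal.tsum_add]
    calc _ ≤ (∫⁻ y, I y) + ∑' n, (δ n : ℝ≥0∞) := by gcongr
      _ < (∫⁻ y, I y) + (ENNReal.ofReal (r ^ 2) - ∫⁻ y, I y) :=
        ENNReal.add_lt_add_left (h1.trans ENNReal.ofReal_lt_top).ne hδ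
      _ = _ := add_tsub_cancel_of_le h1.le
  have hstep : ∀ n : ℤ, ∃ c : ℂ, ‖c‖ = 1 ∧
      ‖loc s (translate (h * n) χ) (fun x ↦ c * p x - q x)‖ ≤ C * √(J n + δ n).toReal := by
    intro n
    obtain ⟨y, hy, hIy⟩ := exists_lt_of_setLIntegral (hS n) (by simp [S]) (hJt n)
      (ε := δ n) (by exact_mod_cast (hδ0 n).ne')
    obtain ⟨c, hc⟩ := iInf_lt_iff.1 hIy
    have hlt : functionNorm 1 s (fun x ↦ ((1 / Real.cosh (x - y) : ℝ) : ℂ) * (c * p x - q x))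
        < (J n + δ n) ^ (1 / 2 : ℝ) := by
      rw [← ENNReal.rpow_natCast] at hc
      have := ENNReal.rpow_lt_rpow hc (z := 1 / 2) (by norm_num)
      rwa [← ENNReal.rpow_mul, show ((2 : ℕ) : ℝ) * (1 / 2) = 1 by norm_num,
        ENNReal.rpow_one] at this
    obtain ⟨u, hu, hun⟩ := exists_of_functionNorm_lt hlt
    obtain ⟨f, hf, hfn⟩ := hC (h * n) y hy.1 hy.2.le
    refine ⟨c, by simp, ?_⟩
    have e : loc s (translate (h * n) χ) (fun x ↦ c * p x - q x) = mulOp s f u := by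
      apply loc_eq
      have h3 := hu.mulOp f
      refine h3.congr (.of_forall fun x ↦ ?_)
      have hc0 : ((Real.cosh (x - y) : ℝ) : ℂ) ≠ 0 := by
        exact_mod_cast (Real.cosh_pos _).ne'
      simp only [hf]
      rw [Complex.ofReal_div, Complex.ofReal_one]
      field_simp
    have hu2 : ‖u‖ ≤ √(J n + δ n).toReal := by
      have h4 := ENNReal.toReal_mono (ENNReal.rpow_ne_top_of_nonneg (by norm_num)
        (ENNReal.add_ne_top.2 ⟨hJt n, ENNReal.coe_ne_top⟩)) hun.le
      rwa [toReal_enorm, ← ENNReal.toReal_rpow, ← Real.sqrt_eq_rpow] at h4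
    rw [e]
    exact (ContinuousLinearMap.le_opNorm _ _).trans (mul_le_mul hfn hu2 (norm_nonneg _) hC0)
  choose c hc hcn using hstep
  have hsq : ∀ n, √(J n + δ n).toReal ^ 2 = (J n + δ n).toReal := fun n ↦
    Real.sq_sqrt ENNReal.toReal_nonneg
  refine ⟨c, fun n ↦ √(J n + δ n).toReal, hc, fun n ↦ Real.sqrt_nonneg _, hcn, ?_, ?_⟩
  · simp only [hsq]
    exact ENNReal.summable_toReal (hsum.trans ENNReal.ofReal_lt_top).ne
  · simp only [hsq]
    rw [← ENNReal.tsum_toReal_eq fun n ↦ ENNReal.add_ne_top.2 ⟨hJt n, ENNReal.coe_ne_top⟩]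
    have := (ENNReal.toReal_lt_toReal (hsum.trans ENNReal.ofReal_lt_top).ne
      ENNReal.ofReal_ne_top).2 hsum
    rwa [ENNReal.toReal_ofReal (by positivity)] at this

theorem functionNorm_add_le {s : ℝ} {f g : ℝ → ℂ} (hf : LocallyIntegrable f volume)
    (hg : LocallyIntegrable g volume) :
    functionNorm 1 s (fun x ↦ f x + g x) ≤ functionNorm 1 s f + functionNorm 1 s g := by
  refine ENNReal.le_of_forall_pos_le_add fun ε hε hlt ↦ ?_
  have hfin := ENNReal.add_lt_top.1 hlt
  have hε2 : ((ε / 2 : ℝ≥0) : ℝ≥0∞) ≠ 0 := by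
    have : 0 < ε / 2 := half_pos hε
    exact_mod_cast this.ne'
  obtain ⟨u, hu, hun⟩ := exists_of_functionNorm_lt (ENNReal.lt_add_right hfin.1.ne hε2)
  obtain ⟨v, hv, hvn⟩ := exists_of_functionNorm_lt (ENNReal.lt_add_right hfin.2.ne hε2)
  refine (functionNorm_le (hu.add hv hf hg)).trans ((enorm_add_le _ _).trans
    ((add_le_add hun.le hvn.le).trans (le_of_eq ?_)))
  rw [add_add_add_comm, ← ENNReal.coe_add, add_halves]

/-- A representation of `sech(· - y) f` by cells. -/
theorem exists_represents_sech {s : ℝ} {h : ℝ} (hh : 1 ≤ h) {ρ χ : 𝓢(ℝ, ℂ)}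
    (hρ : IsPartition h ρ) (hχ : HasCompactSupport χ) (hρχ : ∀ x, ρ x * χ x = ρ x) {f : ℝ → ℂ}
    (hf : LocHs s f) (y : ℝ)
    (hs : Summable fun n : ℤ ↦ mulOp s (smul' (translate y sech) (translate (h * n) ρ))
      (loc s (translate (h * n) χ) f)) :
    (∑' n : ℤ, mulOp s (smul' (translate y sech) (translate (h * n) ρ))
      (loc s (translate (h * n) χ) f)).Represents
        (fun x ↦ ((1 / Real.cosh (x - y) : ℝ) : ℂ) * f x) := by
  intro φ hφ
  obtain ⟨F, hF0, hF⟩ := hρ.exists_sum_eq (zero_lt_one.trans_le hh) hφ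
  rw [← evalOp_apply, (evalOp s φ).map_tsum hs]
  have e1 : ∀ n : ℤ, evalOp s φ (mulOp s (smul' (translate y sech) (translate (h * n) ρ))
      (loc s (translate (h * n) χ) f))
      = ∫ x, smul' (translate (h * n) ρ) φ x * (((1 / Real.cosh (x - y) : ℝ) : ℂ) * f x) := by
    intro n
    rw [evalOp_apply, toDistribution_mulOp_apply,
      hf.represents (hasCompactSupport_translate hχ _) _ (hasCompactSupport_smul' _ hφ)]
    refine integral_congr_ae (.of_forall fun x ↦ ?_)
    simp only [smul'_apply, translate_apply, sech_apply]
    linear_combination (((1 / Real.cosh (x - y) : ℝ) : ℂ) * φ x * f x) * hρχ (x - h * n)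
  simp only [e1]
  rw [tsum_eq_sum (s := F) fun n hn ↦ by
    rw [hF0 n hn]
    exact (integral_congr_ae (.of_forall fun x ↦ zero_mul _)).trans (integral_zero _ _),
    ← integral_finsetSum]
  · refine integral_congr_ae (.of_forall fun x ↦ ?_)
    simp only
    rw [← Finset.sum_mul]
    congr 1
    have := congrArg (fun ψ : 𝓢(ℝ, ℂ) ↦ ψ x) hF
    simp only [sum_apply] at this
    exact this
  · intro n _
    have hl : LocallyIntegrable (fun x ↦ translate y sech x * f x) volume :=
      hf.locallyIntegrable_smul _
    exact integrable_mul_of_hasCompactSupport hl (hasCompactSupport_smul' _ hφ)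

theorem exists_sech_decay (s : ℝ) {h : ℝ} (hh : 1 ≤ h) (ρ : 𝓢(ℝ, ℂ)) : ∃ C : ℝ, 0 ≤ C ∧
    ∀ (m k : ℤ) (y : ℝ), h * m ≤ y → y < h * (m + 1) →
      ‖mulOp s (smul' (translate y sech) (translate (h * (m + k : ℤ)) ρ))‖
        ≤ C * ((1 + |(k : ℝ)|) ^ 4)⁻¹ := by
  obtain ⟨C₀, h00, h0⟩ := exists_decay s 0 sech ρ
  obtain ⟨C₄, h40, h4⟩ := exists_decay s 4 sech ρ
  refine ⟨8 * (16 * C₀ + C₄), by positivity, fun m k y hy1 hy2 ↦ ?_⟩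
  set a := h * (m + k : ℤ) with ha
  set A := ‖mulOp s (smul' (translate y sech) (translate a ρ))‖
  have h5 := h0 y a
  have h6 := h4 y a
  rw [pow_zero, one_mul] at h5
  rw [← div_eq_mul_inv, le_div_iff₀ (by positivity)]
  have hk : 1 + |(k : ℝ)| ≤ 2 + |y - a| := by
    have e : y - a = (y - h * m) - h * k := by rw [ha]; push_cast; ring
    have h7 : |h * (k : ℝ)| = h * |(k : ℝ)| := by rw [abs_mul, abs_of_pos (by linarith)]
    have h8 := abs_sub_abs_le_abs_sub (h * (k : ℝ)) (y - h * m)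
    rw [abs_sub_comm (h * (k : ℝ)) (y - h * m), ← e, h7,
      abs_of_nonneg (show 0 ≤ y - h * m by linarith)] at h8
    by_cases hk0 : k = 0
    · rw [hk0]; simp only [Int.cast_zero, abs_zero]; linarith [abs_nonneg (y - a)]
    · have h9 : 1 ≤ |(k : ℝ)| := by exact_mod_cast Int.one_le_abs hk0
      nlinarith
  have hp : (1 + |(k : ℝ)|) ^ 4 ≤ 8 * (16 + |y - a| ^ 4) := by
    have ht := abs_nonneg (y - a)
    set t := |y - a|
    calc (1 + |(k : ℝ)|) ^ 4 ≤ (2 + t) ^ 4 := by gcongr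
      _ ≤ 8 * (2 ^ 4 + t ^ 4) := by
        have := add_pow_le (a := (2 : ℝ)) (b := t) (by norm_num) ht 4
        norm_num at this ⊢
        linarith
      _ = _ := by norm_num
  have hA : 0 ≤ A := norm_nonneg _
  calc A * (1 + |(k : ℝ)|) ^ 4 ≤ A * (8 * (16 + |y - a| ^ 4)) := by gcongr
    _ = 8 * (16 * A + |y - a| ^ 4 * A) := by ring
    _ ≤ _ := by gcongr


theorem tsum_weight_mul_sq_le {α : Type*} [Countable α] (k g : α → ℝ≥0∞) :
    (∑' a, k a * g a) ^ 2 ≤ (∑' a, k a) * ∑' a, k a * g a ^ 2 := by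
  let _ : MeasurableSpace α := ⊤
  have : MeasurableSingletonClass α := ⟨fun _ ↦ trivial⟩
  have := lintegral_weight_mul_sq_le (Measure.count : Measure α) (k := k) (g := g)
    (measurable_from_top.aemeasurable) (measurable_from_top.aemeasurable)
  simpa only [lintegral_count] using this

theorem tsum_sech_weights_le {V : Type*} [SeminormedAddCommGroup V] {c : ℤ → V} {e : ℤ → ℝ}
    (he : ∀ n, 0 ≤ e n) (hc : ∀ n, ‖c n - c (n - 1)‖ ≤ e n) (w : ℤ → ℝ≥0∞) {B : ℝ} (hB : 0 ≤ B) :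
    ∑' m : ℤ, (∑' k : ℤ, w k * ENNReal.ofReal (e (m + k) + B * ‖c (m + k) - c m‖)) ^ 2
      ≤ (∑' k, w k) * (∑' k : ℤ, w k * ENNReal.ofReal (2 + 2 * B ^ 2 * (k : ℝ) ^ 2))
        * ∑' n, ENNReal.ofReal (e n ^ 2) := by
  set S := ∑' n, ENNReal.ofReal (e n ^ 2)
  have h1 : ∀ k : ℤ, ∑' m : ℤ, ENNReal.ofReal (e (m + k) + B * ‖c (m + k) - c m‖) ^ 2
      ≤ ENNReal.ofReal (2 + 2 * B ^ 2 * (k : ℝ) ^ 2) * S := by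
    intro k
    calc _ ≤ ∑' m : ℤ, (ENNReal.ofReal 2 * ENNReal.ofReal (e (m + k) ^ 2)
          + ENNReal.ofReal (2 * B ^ 2) * ENNReal.ofReal (‖c (m + k) - c m‖ ^ 2)) := by
          refine ENNReal.tsum_le_tsum fun m ↦ ?_
          rw [← ENNReal.ofReal_pow (add_nonneg (he _) (by positivity)),
            ← ENNReal.ofReal_mul (by norm_num), ← ENNReal.ofReal_mul (by positivity),
            ← ENNReal.ofReal_add (by positivity) (by positivity)]
          apply ENNReal.ofReal_le_ofReal
          nlinarith [sq_nonneg (e (m + k) - B * ‖c (m + k) - c m‖)]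
      _ = ENNReal.ofReal 2 * S + ENNReal.ofReal (2 * B ^ 2)
          * ∑' m : ℤ, ENNReal.ofReal (‖c (m + k) - c m‖ ^ 2) := by
          rw [ENNReal.tsum_add, ENNReal.tsum_mul_left, ENNReal.tsum_mul_left]
          congr 2
          exact (Equiv.addRight k).tsum_eq (fun m ↦ ENNReal.ofReal (e m ^ 2))
      _ ≤ ENNReal.ofReal 2 * S + ENNReal.ofReal (2 * B ^ 2) * ((k.natAbs : ℝ≥0∞) ^ 2 * S) := by
          gcongr
          exact tsum_enorm_sub_sq_le hc k
      _ = _ := by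
          have : (k.natAbs : ℝ≥0∞) ^ 2 = ENNReal.ofReal ((k : ℝ) ^ 2) := by
            rw [← ENNReal.ofReal_natCast, ← ENNReal.ofReal_pow (by positivity)]
            congr 1
            rw [Nat.cast_natAbs, Int.cast_abs, sq_abs]
          rw [this, ← mul_assoc, ← ENNReal.ofReal_mul (by positivity), ← add_mul,
            ← ENNReal.ofReal_add (by positivity) (by positivity)]
  calc _ ≤ ∑' m : ℤ, (∑' k, w k)
        * ∑' k : ℤ, w k * ENNReal.ofReal (e (m + k) + B * ‖c (m + k) - c m‖) ^ 2 :=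
        ENNReal.tsum_le_tsum fun m ↦ tsum_weight_mul_sq_le _ _
    _ = (∑' k, w k) * ∑' k : ℤ, w k
        * ∑' m : ℤ, ENNReal.ofReal (e (m + k) + B * ‖c (m + k) - c m‖) ^ 2 := by
        rw [ENNReal.tsum_mul_left, ENNReal.tsum_comm]
        simp only [ENNReal.tsum_mul_left]
    _ ≤ (∑' k, w k) * ∑' k : ℤ, w k * (ENNReal.ofReal (2 + 2 * B ^ 2 * (k : ℝ) ^ 2) * S) := by
        gcongr with k
        exact h1 k
    _ = _ := by simp only [← mul_assoc, ENNReal.tsum_mul_right]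

theorem lintegral_comp_floor_le {h : ℝ} (hh : 0 < h) (g : ℤ → ℝ≥0∞) :
    ∫⁻ y : ℝ, g ⌊y / h⌋ ≤ ENNReal.ofReal h * ∑' m, g m := by
  have hU : (⋃ m : ℤ, Set.Ico (h * m) (h * m + h)) = Set.univ := by
    refine Set.eq_univ_of_forall fun y ↦ Set.mem_iUnion.2 ⟨⌊y / h⌋, ?_, ?_⟩
    · have := Int.floor_le (y / h)
      rwa [le_div_iff₀ hh, mul_comm] at this
    · have := Int.lt_floor_add_one (y / h)
      rw [div_lt_iff₀ hh] at this
      linarith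
  calc ∫⁻ y : ℝ, g ⌊y / h⌋ = ∫⁻ y in ⋃ m : ℤ, Set.Ico (h * m) (h * m + h), g ⌊y / h⌋ := by
        rw [hU, Measure.restrict_univ]
    _ ≤ ∑' m : ℤ, ∫⁻ y in Set.Ico (h * m) (h * m + h), g ⌊y / h⌋ := lintegral_iUnion_le _ _
    _ = ∑' m : ℤ, ∫⁻ _ in Set.Ico (h * m) (h * m + h), g m := by
        refine tsum_congr fun m ↦ setLIntegral_congr_fun measurableSet_Ico fun y hy ↦ ?_
        have : ⌊y / h⌋ = m := by
          rw [Int.floor_eq_iff, le_div_iff₀ hh, div_lt_iff₀ hh]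
          exact ⟨by linarith [hy.1], by linarith [hy.2]⟩
        simp only [this]
    _ = _ := by
        simp only [setLIntegral_const, Real.volume_Ico, add_sub_cancel_left]
        rw [ENNReal.tsum_mul_right, mul_comm]

/-- If `p'` is close to `p` on cells, up to slowly varying phases, then it is close to `p` for the
distance; the integrand of the distance is bounded by a measurable function. -/
theorem exists_step_bound {s : ℝ} {h : ℝ} (hh : 1 ≤ h) {ρ χ : 𝓢(ℝ, ℂ)}
    (hρ : IsPartition h ρ) (hχ : HasCompactSupport χ) (hρχ : ∀ x, ρ x * χ x = ρ x) {B : ℝ}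
    (hB : 0 ≤ B) : ∃ C : ℝ, 0 ≤ C ∧ ∀ (p p' : ℝ → ℂ) (c : ℤ → ℂ) (e : ℤ → ℝ),
      LocHs s p → LocHs s p' → (∀ n, ‖c n‖ = 1) →
      (∀ n : ℤ, ‖loc s (translate (h * n) χ) (fun x ↦ c n * p x - p' x)‖ ≤ e n) →
      (∀ n, ‖c n - c (n - 1)‖ ≤ e n) → (∀ n : ℤ, ‖loc s (translate (h * n) χ) p‖ ≤ B) →
      Summable (fun n ↦ e n ^ 2) → ∃ G : ℝ → ℝ≥0∞, Measurable G ∧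
        ∫⁻ y, G y ≤ ENNReal.ofReal (C * ∑' n, e n ^ 2) ∧
        ∀ y, functionNorm 1 s (fun x ↦ ((1 / Real.cosh (x - y) : ℝ) : ℂ)
          * (c ⌊y / h⌋ * p x - p' x)) ^ 2 ≤ G y := by
  obtain ⟨D, hD0, hD⟩ := exists_sech_decay s hh ρ
  have hh0 : 0 < h := by linarith
  set w : ℤ → ℝ≥0∞ := fun k ↦ ENNReal.ofReal (D * ((1 + |(k : ℝ)|) ^ 4)⁻¹) with hw
  set W := ∑' k, w k
  set K := ∑' k : ℤ, w k * ENNReal.ofReal (2 + 2 * B ^ 2 * (k : ℝ) ^ 2)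
  have hsum : ∀ {t : ℝ}, 0 ≤ t → ∑' k : ℤ, w k * ENNReal.ofReal (t * (1 + |(k : ℝ)|) ^ 2) ≠ ⊤ := by
    intro t ht
    have e : ∀ k : ℤ, w k * ENNReal.ofReal (t * (1 + |(k : ℝ)|) ^ 2)
        = ENNReal.ofReal (D * t * ((1 + |(k : ℝ)|) ^ 2)⁻¹) := fun k ↦ by
      rw [hw, ← ENNReal.ofReal_mul (by positivity)]
      congr 1
      have : 0 < 1 + |(k : ℝ)| := by positivity
      field_simp
    simp only [e]
    exact (summable_inv_one_add_abs_sq.mul_left (D * t)).tsum_ofReal_ne_top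
  have hW : W ≠ ⊤ := by
    refine ne_top_of_le_ne_top (hsum zero_le_one) (ENNReal.tsum_le_tsum fun k ↦ ?_)
    refine le_mul_of_one_le_right (zero_le) ?_
    rw [ENNReal.one_le_ofReal]
    nlinarith [abs_nonneg (k : ℝ)]
  have hK : K ≠ ⊤ := by
    refine ne_top_of_le_ne_top (hsum (t := 2 + 2 * B ^ 2) (by positivity))
      (ENNReal.tsum_le_tsum fun k ↦ ?_)
    gcongr
    rw [← sq_abs (k : ℝ)]
    have := abs_nonneg (k : ℝ)
    have hB2 := sq_nonneg B
    nlinarith [mul_nonneg hB2 this]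
  refine ⟨(ENNReal.ofReal h * (W * K)).toReal, ENNReal.toReal_nonneg,
    fun p p' c e hp hp' hc he hce hpB hes ↦ ?_⟩
  have he0 : ∀ n, 0 ≤ e n := fun n ↦ (norm_nonneg _).trans (he n)
  set g : ℤ → ℝ≥0∞ := fun m ↦
    (∑' k : ℤ, w k * ENNReal.ofReal (e (m + k) + B * ‖c (m + k) - c m‖)) ^ 2 with hg
  have hgm : Measurable fun y : ℝ ↦ g ⌊y / h⌋ :=
    (measurable_from_top (f := g)).comp (Int.measurable_floor.comp (measurable_id.div_const h))
  refine ⟨fun y ↦ g ⌊y / h⌋, hgm, ?_, fun y ↦ ?_⟩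
  · refine (lintegral_comp_floor_le hh0 g).trans ?_
    rw [ENNReal.ofReal_mul ENNReal.toReal_nonneg, ENNReal.ofReal_toReal
      (ENNReal.mul_ne_top ENNReal.ofReal_ne_top (ENNReal.mul_ne_top hW hK)),
      ENNReal.ofReal_tsum_of_nonneg (fun n ↦ by positivity) hes, mul_assoc]
    gcongr
    exact tsum_sech_weights_le he0 hce w hB
  · set m := ⌊y / h⌋
    have hm1 : h * m ≤ y := by
      have := Int.floor_le (y / h)
      rwa [le_div_iff₀ hh0, mul_comm] at this
    have hm2 : y < h * (m + 1) := by
      have := Int.lt_floor_add_one (y / h)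
      rwa [div_lt_iff₀ hh0, mul_comm] at this
    have hf : LocHs s (fun x ↦ c m * p x - p' x) := (hp.const_mul _).sub hp'
    have hloc : ∀ n : ℤ, ‖loc s (translate (h * n) χ) (fun x ↦ c m * p x - p' x)‖
        ≤ e n + B * ‖c n - c m‖ := by
      intro n
      have hχn := hasCompactSupport_translate hχ (h * n)
      have e1 : loc s (translate (h * n) χ) (fun x ↦ c m * p x - p' x)
          = loc s (translate (h * n) χ) (fun x ↦ c n * p x - p' x)
            - (c n - c m) • loc s (translate (h * n) χ) p := by
        rw [(hp.const_mul _).loc_sub hp' hχn, (hp.const_mul _).loc_sub hp' hχn,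
          hp.loc_const_mul hχn, hp.loc_const_mul hχn, sub_smul]
        abel
      rw [e1]
      refine (norm_sub_le _ _).trans (add_le_add (he n) ?_)
      rw [norm_smul, mul_comm]
      gcongr
      exact hpB n
    set y' : ℤ → Hs s := fun n ↦ mulOp s (smul' (translate y sech) (translate (h * n) ρ))
      (loc s (translate (h * n) χ) (fun x ↦ c m * p x - p' x)) with hy'
    have hterm : ∀ k : ℤ, ‖y' (m + k)‖
        ≤ D * ((1 + |(k : ℝ)|) ^ 4)⁻¹ * (e (m + k) + B * ‖c (m + k) - c m‖) := fun k ↦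
      (ContinuousLinearMap.le_opNorm _ _).trans
        (mul_le_mul (hD m k y hm1 hm2) (hloc _) (norm_nonneg _) (by positivity))
    set M := √(∑' n, e n ^ 2)
    have heM : ∀ n, e n ≤ M := fun n ↦
      Real.le_sqrt_of_sq_le (hes.le_tsum n fun _ _ ↦ by positivity)
    have hys : Summable fun k : ℤ ↦ y' (m + k) := by
      refine Summable.of_norm_bounded
        (g := fun k : ℤ ↦ D * (M + B * 2) * ((1 + |(k : ℝ)|) ^ 2)⁻¹)
        (summable_inv_one_add_abs_sq.mul_left _) fun k ↦ (hterm k).trans ?_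
      have h1 : e (m + k) + B * ‖c (m + k) - c m‖ ≤ M + B * 2 := by
        gcongr
        · exact heM _
        · exact (norm_sub_le _ _).trans (by rw [hc, hc]; norm_num)
      have h2 : ((1 + |(k : ℝ)|) ^ 4)⁻¹ ≤ ((1 + |(k : ℝ)|) ^ 2)⁻¹ := by
        gcongr
        · linarith [abs_nonneg (k : ℝ)]
        · norm_num
      have h3 : 0 ≤ e (m + k) + B * ‖c (m + k) - c m‖ :=
        add_nonneg (he0 _) (by positivity)
      calc _ ≤ D * ((1 + |(k : ℝ)|) ^ 2)⁻¹ * (M + B * 2) := by gcongr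
        _ = _ := by ring
    have hys' : Summable y' := (Equiv.addLeft m).summable_iff.1 hys
    have hrep := exists_represents_sech hh hρ hχ hρχ hf y hys'
    refine pow_le_pow_left₀ (zero_le) ((functionNorm_le hrep).trans ?_) 2
    have e2 : ∑' n : ℤ, mulOp s (smul' (translate y sech) (translate (h * n) ρ))
      (loc s (translate (h * n) χ) fun x ↦ c m * p x - p' x) = ∑' k, y' (m + k) :=
      ((Equiv.addLeft m).tsum_eq y').symm
    rw [e2]
    refine (enorm_tsum_le_tsum_enorm).trans (ENNReal.tsum_le_tsum fun k ↦ ?_)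
    rw [← ofReal_norm, hw, ← ENNReal.ofReal_mul (by positivity)]
    exact ENNReal.ofReal_le_ofReal (hterm k)

theorem add_sq_le_mul {ε : ℝ} (hε : 0 < ε) (a b : ℝ≥0∞) :
    (a + b) ^ 2 ≤ ENNReal.ofReal (1 + ε) * a ^ 2 + ENNReal.ofReal (1 + ε⁻¹) * b ^ 2 := by
  have h1 : ENNReal.ofReal (1 + ε) ≠ 0 := by simpa using by linarith
  have h2 : ENNReal.ofReal (1 + ε⁻¹) ≠ 0 := by
    have := inv_pos.2 hε
    simpa using by linarith
  by_cases ha : a = ⊤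
  · simp [ha, ENNReal.mul_top h1]
  by_cases hb : b = ⊤
  · simp [hb, ENNReal.mul_top h2]
  lift a to ℝ≥0 using ha
  lift b to ℝ≥0 using hb
  have h3 : (a : ℝ≥0∞) = ENNReal.ofReal a := by simp
  have h4 : (b : ℝ≥0∞) = ENNReal.ofReal b := by simp
  have ha : (0 : ℝ) ≤ a := a.2
  have hb : (0 : ℝ) ≤ b := b.2
  rw [h3, h4, ← ENNReal.ofReal_add ha hb, ← ENNReal.ofReal_pow (by positivity),
    ← ENNReal.ofReal_pow (by positivity), ← ENNReal.ofReal_pow (by positivity),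
    ← ENNReal.ofReal_mul (by positivity), ← ENNReal.ofReal_mul (by positivity),
    ← ENNReal.ofReal_add (by positivity) (by positivity)]
  apply ENNReal.ofReal_le_ofReal
  have h5 : 0 ≤ (ε * a - b) ^ 2 * ε⁻¹ := by positivity
  have h6 : (ε * a - b) ^ 2 * ε⁻¹ = ε * (a : ℝ) ^ 2 - 2 * a * b + ε⁻¹ * b ^ 2 := by
    field_simp
    ring
  nlinarith

theorem funDist_sq (s : ℝ) (p q : ℝ → ℂ) : funDist s p q ^ 2
    = ∫⁻ y : ℝ, ⨅ c : Metric.sphere (0 : ℂ) 1,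
      functionNorm 1 s (fun x ↦ ((1 / Real.cosh (x - y) : ℝ) : ℂ) * (c * p x - q x)) ^ 2 := by
  rw [funDist, ← ENNReal.rpow_natCast, ← ENNReal.rpow_mul]
  norm_num

theorem funDist_sq_le_of_step {s : ℝ} {p p' q : ℝ → ℂ} (hp : LocHs s p) (hp' : LocHs s p')
    (hq : LocHs s q) {c : ℝ → ℂ} (hc : ∀ y, ‖c y‖ = 1) {G : ℝ → ℝ≥0∞} (hG : Measurable G)
    (h : ∀ y, functionNorm 1 s (fun x ↦ ((1 / Real.cosh (x - y) : ℝ) : ℂ)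
      * (c y * p x - p' x)) ^ 2 ≤ G y) {ε : ℝ} (hε : 0 < ε) :
    funDist s p' q ^ 2
      ≤ ENNReal.ofReal (1 + ε) * funDist s p q ^ 2 + ENNReal.ofReal (1 + ε⁻¹) * ∫⁻ y, G y := by
  have h1 : ENNReal.ofReal (1 + ε) ≠ 0 := by simpa using by linarith
  rw [funDist_sq, funDist_sq, ← lintegral_const_mul' _ _ ENNReal.ofReal_ne_top,
    ← lintegral_const_mul' _ _ ENNReal.ofReal_ne_top,
    ← lintegral_add_right _ (hG.const_mul _)]
  refine lintegral_mono fun y ↦ ?_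
  rw [ENNReal.mul_iInf_of_ne h1 ENNReal.ofReal_ne_top, ENNReal.iInf_add]
  refine le_iInf fun d ↦ ?_
  have hd : ‖(d : ℂ)‖ = 1 := by simp
  have hcc : starRingEnd ℂ (c y) * c y = 1 := by rw [Complex.conj_mul', hc]; simp
  refine (iInf_le _ (⟨d * starRingEnd ℂ (c y), by simp [hc]⟩ : Metric.sphere (0 : ℂ) 1)).trans ?_
  have e : ∀ x, ((1 / Real.cosh (x - y) : ℝ) : ℂ) * (d * starRingEnd ℂ (c y) * p' x - q x)
      = ((1 / Real.cosh (x - y) : ℝ) : ℂ) * (d * p x - q x)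
        + (-(d * starRingEnd ℂ (c y))) * (((1 / Real.cosh (x - y) : ℝ) : ℂ)
          * (c y * p x - p' x)) := fun x ↦ by
    linear_combination (d * p x * ((1 / Real.cosh (x - y) : ℝ) : ℂ)) * hcc
  have hsm : Continuous fun x : ℝ ↦ ((1 / Real.cosh (x - y) : ℝ) : ℂ) :=
    (translate y sech).continuous.congr fun x ↦ by simp
  have hl1 : LocallyIntegrable (fun x ↦ ((1 / Real.cosh (x - y) : ℝ) : ℂ) * (d * p x - q x))
      volume := ((hp.const_mul d).sub hq).locallyIntegrable.continuous_mul hsm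
  have hl2 : LocallyIntegrable (fun x ↦ (-(d * starRingEnd ℂ (c y)))
      * (((1 / Real.cosh (x - y) : ℝ) : ℂ) * (c y * p x - p' x))) volume :=
    (((hp.const_mul (c y)).sub hp').locallyIntegrable.continuous_mul hsm).continuous_mul
      continuous_const
  simp only [e]
  refine (pow_le_pow_left₀ (zero_le) (functionNorm_add_le hl1 hl2) 2).trans
    ((add_sq_le_mul hε _ _).trans ?_)
  gcongr
  refine le_trans (pow_le_pow_left₀ (zero_le) (functionNorm_le_of_ae_eq 1 s
    (-(d * starRingEnd ℂ (c y))) (by simp [hc]) (Filter.EventuallyEq.refl _ _)) 2) (h y)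

theorem funDist_sq_le_lintegral {s : ℝ} {p p' : ℝ → ℂ} {c : ℝ → ℂ} (hc : ∀ y, ‖c y‖ = 1)
    {G : ℝ → ℝ≥0∞} (h : ∀ y, functionNorm 1 s (fun x ↦ ((1 / Real.cosh (x - y) : ℝ) : ℂ)
      * (c y * p x - p' x)) ^ 2 ≤ G y) : funDist s p p' ^ 2 ≤ ∫⁻ y, G y := by
  rw [funDist_sq]
  exact lintegral_mono fun y ↦
    (iInf_le _ (⟨c y, by simp [hc]⟩ : Metric.sphere (0 : ℂ) 1)).trans (h y)


/-! ### Windows and phases -/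

/-- The windows `η` and `ρ` as Schwartz functions, together with a wider cutoff `χ`. -/
structure Windows (η ρ : ℝ → ℝ) where
  /-- the window `η` -/
  ηS : 𝓢(ℝ, ℂ)
  /-- the partition function `ρ` -/
  ρS : 𝓢(ℝ, ℂ)
  /-- the wide cutoff -/
  χS : 𝓢(ℝ, ℂ)
  /-- a bound for the supports -/
  R : ℝ
  ηS_apply : ∀ x, ηS x = η x
  ρS_apply : ∀ x, ρS x = ρ x
  η_compact : HasCompactSupport ηS
  ρ_compact : HasCompactSupport ρS
  χ_compact : HasCompactSupport χS
  η_eq_zero : ∀ x, 1 < |x| → η x = 0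
  η_eq_one : ∀ x, |x| ≤ 1 / 2 → η x = 1
  ρ_eq_zero : ∀ x, R < |x| → ρ x = 0
  χ_eq_zero : ∀ x, R < |x| → χS x = 0
  χ_eq_one : ∀ x, |x| ≤ 5 → χS x = 1
  ρ_mul_χ : ∀ x, ρS x * χS x = ρS x
  ρ_shift : ∀ x, |x| ≤ 1 → ∀ n : ℤ, ρ (x - 4 * n) = if n = 0 then 1 else 0
  ρ_sum : ∀ x, ∑' n : ℤ, ρ (x - 4 * n) = 1
  ρ_smooth : ContDiff ℝ ∞ ρ

theorem exists_windows {η ρ : ℝ → ℝ} (hη : ContDiff ℝ ∞ η)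
    (hη_supp : tsupport η ⊆ Set.Icc (-1) 1)
    (hη_one : ∀ x ∈ Set.Icc (-1 / 2 : ℝ) (1 / 2), η x = 1)
    (hρ : ContDiff ℝ ∞ ρ) (hρ_supp : HasCompactSupport ρ) (hρ_nonneg : ∀ x, 0 ≤ ρ x)
    (hρ_one : ∀ x ∈ Set.Icc (-1 : ℝ) 1, ρ x = 1)
    (hρ_sum : ∀ x : ℝ, ∑' n : ℤ, ρ (x - 4 * n) = 1) : Nonempty (Windows η ρ) := by
  have hηc : HasCompactSupport η :=
    (isCompact_Icc (a := (-1 : ℝ)) (b := 1)).of_isClosed_subset (isClosed_tsupport η) hη_supp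
  have hηC : HasCompactSupport fun x ↦ (η x : ℂ) := hηc.comp_left Complex.ofReal_zero
  have hρC : HasCompactSupport fun x ↦ (ρ x : ℂ) := hρ_supp.comp_left Complex.ofReal_zero
  obtain ⟨R₁, hR10, hR1⟩ := exists_bound_of_hasCompactSupport hρC
  obtain ⟨χ, hχc, hχ1, -⟩ := exists_cutoff (max R₁ 5)
  obtain ⟨R₂, hR20, hR2⟩ := exists_bound_of_hasCompactSupport hχc
  have hsum : ∀ x : ℝ, Summable fun n : ℤ ↦ ρ (x - 4 * n) := fun x ↦ by
    by_contra hns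
    have := hρ_sum x
    rw [tsum_eq_zero_of_not_summable hns] at this
    exact zero_ne_one this
  refine ⟨hηC.toSchwartzMap (Complex.ofRealCLM.contDiff.comp hη),
    hρC.toSchwartzMap (Complex.ofRealCLM.contDiff.comp hρ), χ, max R₁ R₂,
    fun x ↦ rfl, fun x ↦ rfl, hηC, hρC, hχc, ?_, ?_, ?_, ?_, ?_, ?_, ?_, hρ_sum, hρ⟩
  · intro x hx
    by_contra h
    exact absurd (abs_le.2 (hη_supp (subset_tsupport η h))) (not_le.2 hx)
  · intro x hx
    exact hη_one x ⟨by linarith [(abs_le.1 hx).1], (abs_le.1 hx).2⟩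
  · intro x hx
    exact_mod_cast hR1 x ((le_max_left _ _).trans_lt hx)
  · intro x hx
    exact hR2 x ((le_max_right _ _).trans_lt hx)
  · intro x hx
    exact hχ1 x (hx.trans (le_max_right _ _))
  · intro x
    change (ρ x : ℂ) * χ x = ρ x
    by_cases hx : |x| ≤ R₁
    · rw [hχ1 x (hx.trans (le_max_left _ _)), mul_one]
    · rw [hR1 x (not_le.1 hx), zero_mul]
  · intro x hx n
    have h0 : ρ x = 1 := hρ_one x (abs_le.1 hx)
    split_ifs with hn
    · rw [hn]; simpa using h0
    · have h1 := (hsum x).sum_le_tsum {0, n} fun _ _ ↦ hρ_nonneg _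
      rw [Finset.sum_pair (Ne.symm hn), hρ_sum] at h1
      simp only [Int.cast_zero, mul_zero, sub_zero, h0] at h1
      exact le_antisymm (by linarith) (hρ_nonneg _)

/-- The function `f((x - 4Ln)/L)`. -/
def cell (L : ℕ+) (f : 𝓢(ℝ, ℂ)) (n : ℤ) : 𝓢(ℝ, ℂ) :=
  translate (4 * ((L : ℕ) : ℝ) * n) (dilate ((L : ℕ) : ℝ) (Nat.cast_pos.2 L.pos) f)

theorem cell_apply (L : ℕ+) (f : 𝓢(ℝ, ℂ)) (n : ℤ) (x : ℝ) :
    cell L f n x = f ((x - 4 * ((L : ℕ) : ℝ) * n) / ((L : ℕ) : ℝ)) := by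
  rw [cell, translate_apply, dilate_apply]

theorem cast_pnat_pos (L : ℕ+) : (0 : ℝ) < ((L : ℕ) : ℝ) := Nat.cast_pos.2 L.pos

theorem one_le_cast_pnat (L : ℕ+) : (1 : ℝ) ≤ ((L : ℕ) : ℝ) := Nat.one_le_cast.2 L.pos

theorem one_le_scale (L : ℕ+) : (1 : ℝ) ≤ 4 * ((L : ℕ) : ℝ) := by
  linarith [one_le_cast_pnat L]

theorem hasCompactSupport_cell {f : 𝓢(ℝ, ℂ)} (hf : HasCompactSupport f) (L : ℕ+) (n : ℤ) :
    HasCompactSupport (cell L f n) :=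
  hasCompactSupport_translate (hasCompactSupport_dilate hf _) _

theorem norm_mulOp_cell_le (σ : ℝ) (L : ℕ+) (f : 𝓢(ℝ, ℂ)) (n : ℤ) :
    ‖mulOp σ (cell L f n)‖ ≤ (multBound σ f).toReal :=
  (norm_mulOp_translate_le _ _ _).trans
    (toReal_multBound_mono (multBound_dilate_le (one_le_cast_pnat L) f))

/-- The index of the cell of width `4L` near the `m`-th cell of width `4L₁`. -/
def refIndex (L L₁ : ℕ+) (m : ℤ) : ℤ := ((L₁ : ℕ) : ℤ) * m / ((L : ℕ) : ℤ)

theorem refIndex_self (L : ℕ+) (m : ℤ) : refIndex L L m = m :=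
  Int.mul_ediv_cancel_left m (by exact_mod_cast L.pos.ne')

theorem refIndex_bounds (L L₁ : ℕ+) (m : ℤ) :
    ((L : ℕ) : ℝ) * refIndex L L₁ m ≤ ((L₁ : ℕ) : ℝ) * m ∧
      ((L₁ : ℕ) : ℝ) * m < ((L : ℕ) : ℝ) * (refIndex L L₁ m + 1) := by
  have hL : (0 : ℤ) < ((L : ℕ) : ℤ) := by exact_mod_cast L.pos
  constructor
  · have := Int.mul_ediv_self_le (x := ((L₁ : ℕ) : ℤ) * m) hL.ne'
    exact_mod_cast this
  · have := Int.lt_ediv_add_one_mul_self (((L₁ : ℕ) : ℤ) * m) hL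
    rw [mul_comm (_ + 1)] at this
    exact_mod_cast this

theorem tsum_comp_refIndex_le (L L₁ : ℕ+) (f : ℤ → ℝ≥0∞) :
    ∑' m, f (refIndex L L₁ m) ≤ (L : ℕ) * ∑' n, f n := by
  have hL : (0 : ℤ) < ((L : ℕ) : ℤ) := by exact_mod_cast L.pos
  have hL1 : ((L₁ : ℕ) : ℤ) ≠ 0 := by exact_mod_cast L₁.pos.ne'
  have hr : ∀ m : ℤ, (((L₁ : ℕ) : ℤ) * m % ((L : ℕ) : ℤ)).toNat < (L : ℕ) := fun m ↦ by
    have h1 := Int.emod_lt_of_pos (((L₁ : ℕ) : ℤ) * m) hL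
    have h2 := Int.emod_nonneg (((L₁ : ℕ) : ℤ) * m) hL.ne'
    omega
  let g : ℤ → ℤ × Fin (L : ℕ) := fun m ↦
    (refIndex L L₁ m, ⟨(((L₁ : ℕ) : ℤ) * m % ((L : ℕ) : ℤ)).toNat, hr m⟩)
  have hg : Function.Injective g := by
    intro m m' hm
    simp only [g, Prod.mk.injEq, Fin.mk.injEq, refIndex] at hm
    have h2 := Int.emod_nonneg (((L₁ : ℕ) : ℤ) * m) hL.ne'
    have h2' := Int.emod_nonneg (((L₁ : ℕ) : ℤ) * m') hL.ne'
    have h3 : ((L₁ : ℕ) : ℤ) * m % ((L : ℕ) : ℤ) = ((L₁ : ℕ) : ℤ) * m' % ((L : ℕ) : ℤ) := by omega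
    have h4 := Int.mul_ediv_add_emod (((L₁ : ℕ) : ℤ) * m) ((L : ℕ) : ℤ)
    rw [hm.1, h3, Int.mul_ediv_add_emod] at h4
    exact (mul_left_cancel₀ hL1 h4).symm
  calc ∑' m, f (refIndex L L₁ m) = ∑' m, (fun z : ℤ × Fin (L : ℕ) ↦ f z.1) (g m) := rfl
    _ ≤ ∑' z : ℤ × Fin (L : ℕ), f z.1 := ENNReal.tsum_comp_le_tsum_of_injective hg _
    _ = _ := by
      rw [ENNReal.tsum_prod (f := fun n _ ↦ f n)]
      simp only [tsum_fintype, Finset.sum_const, Finset.card_univ, Fintype.card_fin, nsmul_eq_mul]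
      rw [ENNReal.tsum_mul_left]

theorem Windows.window_η {η ρ : ℝ → ℝ} (w : Windows η ρ) (L : ℕ+) (n : ℤ) (x : ℝ) :
    (window η ((L : ℕ) : ℝ) n x : ℂ) = cell L w.ηS n x := by
  rw [cell_apply, w.ηS_apply]; rfl

theorem Windows.window_ρ {η ρ : ℝ → ℝ} (w : Windows η ρ) (L : ℕ+) (n : ℤ) (x : ℝ) :
    (window ρ ((L : ℕ) : ℝ) n x : ℂ) = cell L w.ρS n x := by
  rw [cell_apply, w.ρS_apply]; rfl

theorem window_eq (ρ : ℝ → ℝ) (L : ℕ+) (n : ℤ) (x : ℝ) :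
    window ρ ((L : ℕ) : ℝ) n x = ρ (x / ((L : ℕ) : ℝ) - 4 * n) := by
  have := (cast_pnat_pos L).ne'
  rw [window]
  congr 1
  field_simp

theorem Windows.tsum_window {η ρ : ℝ → ℝ} (w : Windows η ρ) (L : ℕ+) (x : ℝ) :
    ∑' n : ℤ, window ρ ((L : ℕ) : ℝ) n x = 1 := by
  simp only [window_eq]
  exact w.ρ_sum _

theorem Windows.isPartition {η ρ : ℝ → ℝ} (w : Windows η ρ) (L : ℕ+) :
    IsPartition (4 * ((L : ℕ) : ℝ)) (dilate ((L : ℕ) : ℝ) (cast_pnat_pos L) w.ρS) := by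
  refine ⟨hasCompactSupport_dilate w.ρ_compact _, fun x ↦ ?_⟩
  have h : ∀ n : ℤ, dilate ((L : ℕ) : ℝ) (cast_pnat_pos L) w.ρS (x - 4 * ((L : ℕ) : ℝ) * n)
      = ((window ρ ((L : ℕ) : ℝ) n x : ℝ) : ℂ) := fun n ↦ by
    rw [dilate_apply, w.ρS_apply]; rfl
  simp only [h]
  rw [← Complex.ofReal_tsum, w.tsum_window, Complex.ofReal_one]

/-- The number of neighbouring cells that have to be taken into account. -/
def Windows.range {η ρ : ℝ → ℝ} (w : Windows η ρ) (L L₁ : ℕ+) : ℤ :=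
  ⌈w.R * (((L : ℕ) : ℝ) + ((L₁ : ℕ) : ℝ)) / (4 * ((L : ℕ) : ℝ))⌉ + 1

/-- The indices of the neighbouring cells. -/
def Windows.nbhd {η ρ : ℝ → ℝ} (w : Windows η ρ) (L L₁ : ℕ+) : Finset ℤ := Finset.Icc (-w.range L L₁) (w.range L L₁)

theorem Windows.mem_nbhd {η ρ : ℝ → ℝ} (w : Windows η ρ) {L L₁ : ℕ+} {m : ℤ} {x : ℝ}
    (hx : |x - 4 * ((L₁ : ℕ) : ℝ) * m| ≤ w.R * ((L₁ : ℕ) : ℝ)) {k : ℤ}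
    (hk : window ρ ((L : ℕ) : ℝ) (refIndex L L₁ m + k) x ≠ 0) : k ∈ w.nbhd L L₁ := by
  have hL := cast_pnat_pos L
  have h1 : |x - 4 * ((L : ℕ) : ℝ) * (refIndex L L₁ m + k : ℤ)| ≤ w.R * ((L : ℕ) : ℝ) := by
    by_contra h
    refine hk (w.ρ_eq_zero _ ?_)
    rw [abs_div, abs_of_pos hL, lt_div_iff₀ hL]
    exact not_le.1 h
  obtain ⟨h2, h3⟩ := refIndex_bounds L L₁ m
  rw [abs_le] at h1 hx
  push_cast at h1
  have hceil := Int.le_ceil (w.R * (((L : ℕ) : ℝ) + ((L₁ : ℕ) : ℝ)) / (4 * ((L : ℕ) : ℝ)))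
  rw [div_le_iff₀ (by positivity)] at hceil
  set K : ℝ := ((⌈w.R * (((L : ℕ) : ℝ) + ((L₁ : ℕ) : ℝ)) / (4 * ((L : ℕ) : ℝ))⌉ : ℤ) : ℝ)
  rw [nbhd, Finset.mem_Icc]
  constructor
  · have h4 : -(K + 1) ≤ (k : ℝ) := by
      by_contra hlt
      nlinarith
    rw [range, ← Int.cast_le (R := ℝ), Int.cast_neg, Int.cast_add, Int.cast_one]
    exact h4
  · have h4 : (k : ℝ) ≤ K + 1 := by
      by_contra hlt
      nlinarith
    rw [range, ← Int.cast_le (R := ℝ), Int.cast_add, Int.cast_one]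
    exact h4

/-- The function `θ - a_n` on the `m`-th cell, where `n = refIndex L L₁ m`. -/
def Windows.localPhase {η ρ : ℝ → ℝ} (w : Windows η ρ) (L L₁ : ℕ+) (m : ℤ) (a : ℤ → ℝ) : 𝓢(ℝ, ℂ) :=
  ∑ k ∈ w.nbhd L L₁, ((a (refIndex L L₁ m + k) - a (refIndex L L₁ m) : ℝ) : ℂ)
    • cell L w.ρS (refIndex L L₁ m + k)

theorem Windows.localPhase_apply {η ρ : ℝ → ℝ} (w : Windows η ρ) {L L₁ : ℕ+} {m : ℤ} {x : ℝ}
    (hx : |x - 4 * ((L₁ : ℕ) : ℝ) * m| ≤ w.R * ((L₁ : ℕ) : ℝ)) (a : ℤ → ℝ) :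
    w.localPhase L L₁ m a x = ((phase ρ ((L : ℕ) : ℝ) a x - a (refIndex L L₁ m) : ℝ) : ℂ) := by
  set n := refIndex L L₁ m
  have h0 : ∀ k ∉ w.nbhd L L₁, window ρ ((L : ℕ) : ℝ) (n + k) x = 0 := fun k hk ↦ by
    by_contra h
    exact hk (w.mem_nbhd hx h)
  have h1 : phase ρ ((L : ℕ) : ℝ) a x
      = ∑ k ∈ w.nbhd L L₁, a (n + k) * window ρ ((L : ℕ) : ℝ) (n + k) x := by
    rw [phase, ← (Equiv.addLeft n).tsum_eq]
    exact tsum_eq_sum fun k hk ↦ by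
      rw [Equiv.coe_addLeft, h0 k hk, mul_zero]
  have h2 : 1 = ∑ k ∈ w.nbhd L L₁, window ρ ((L : ℕ) : ℝ) (n + k) x := by
    rw [← w.tsum_window L x, ← (Equiv.addLeft n).tsum_eq]
    exact tsum_eq_sum fun k hk ↦ by rw [Equiv.coe_addLeft, h0 k hk]
  have h3 : phase ρ ((L : ℕ) : ℝ) a x - a n
      = ∑ k ∈ w.nbhd L L₁, (a (n + k) - a n) * window ρ ((L : ℕ) : ℝ) (n + k) x := by
    simp only [sub_mul, Finset.sum_sub_distrib, ← Finset.mul_sum]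
    rw [← h2, mul_one, h1]
  rw [h3, localPhase, sum_apply]
  rw [Complex.ofReal_sum]
  refine Finset.sum_congr rfl fun k _ ↦ ?_
  rw [_root_.smul_apply, smul_eq_mul, Complex.ofReal_mul, w.window_ρ]

theorem Windows.phase_eq_of_abs_le {η ρ : ℝ → ℝ} (w : Windows η ρ) {L : ℕ+} {n : ℤ} {x : ℝ}
    (hx : |x - 4 * ((L : ℕ) : ℝ) * n| ≤ ((L : ℕ) : ℝ)) (a : ℤ → ℝ) :
    phase ρ ((L : ℕ) : ℝ) a x = a n := by
  have hL := cast_pnat_pos L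
  have h1 : ∀ m : ℤ, window ρ ((L : ℕ) : ℝ) m x = if m = n then 1 else 0 := fun m ↦ by
    have hy : |(x - 4 * ((L : ℕ) : ℝ) * n) / ((L : ℕ) : ℝ)| ≤ 1 := by
      rw [abs_div, abs_of_pos hL, div_le_one hL]; exact hx
    have h2 := w.ρ_shift _ hy (m - n)
    have e : (x - 4 * ((L : ℕ) : ℝ) * n) / ((L : ℕ) : ℝ) - 4 * ((m - n : ℤ) : ℝ)
        = x / ((L : ℕ) : ℝ) - 4 * m := by
      push_cast
      field_simp
      ring
    rw [window_eq, ← e, h2]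
    simp only [sub_eq_zero]
  rw [phase, tsum_eq_single n fun m hm ↦ by rw [h1, if_neg hm, mul_zero], h1, if_pos rfl, mul_one]

theorem Windows.phase_sub {η ρ : ℝ → ℝ} (w : Windows η ρ) (L : ℕ+) (a a' : ℤ → ℝ) (x : ℝ) :
    phase ρ ((L : ℕ) : ℝ) (a' - a) x
      = phase ρ ((L : ℕ) : ℝ) a' x - phase ρ ((L : ℕ) : ℝ) a x := by
  have hs : ∀ a : ℤ → ℝ, Summable fun n : ℤ ↦ a n * window ρ ((L : ℕ) : ℝ) n x := fun a ↦ by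
    refine summable_of_hasFiniteSupport (Set.Finite.subset ?_
      (Function.support_mul_subset_right _ _))
    obtain ⟨F, hF⟩ := finite_translate (h := 4 * ((L : ℕ) : ℝ)) (by linarith [one_le_scale L])
      (hasCompactSupport_dilate w.ρ_compact (cast_pnat_pos L)) |x|
    refine F.finite_toSet.subset fun n hn ↦ ?_
    by_contra h
    apply hn
    have := hF n h x le_rfl
    rw [dilate_apply, w.ρS_apply] at this
    exact Complex.ofReal_eq_zero.1 this
  rw [phase, phase, phase, ← (hs a').tsum_sub (hs a)]
  refine tsum_congr fun n ↦ ?_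
  rw [Pi.sub_apply, sub_mul]

theorem Windows.phase_const {η ρ : ℝ → ℝ} (w : Windows η ρ) (L : ℕ+) (t : ℝ) (x : ℝ) :
    phase ρ ((L : ℕ) : ℝ) (fun _ ↦ t) x = t := by
  rw [phase, tsum_mul_left, w.tsum_window, mul_one]

theorem Windows.contDiff_phase {η ρ : ℝ → ℝ} (w : Windows η ρ) (L : ℕ+) (a : ℤ → ℝ) :
    ContDiff ℝ ∞ (phase ρ ((L : ℕ) : ℝ) a) := by
  refine contDiff_iff_contDiffAt.2 fun x ↦ ?_
  obtain ⟨F, hF⟩ := finite_translate (h := 4 * ((L : ℕ) : ℝ)) (by linarith [one_le_scale L])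
    (hasCompactSupport_dilate w.ρ_compact (cast_pnat_pos L)) (|x| + 1)
  have h1 : phase ρ ((L : ℕ) : ℝ) a =ᶠ[nhds x]
      fun y ↦ ∑ n ∈ F, a n * window ρ ((L : ℕ) : ℝ) n y := by
    filter_upwards [Metric.ball_mem_nhds x one_pos] with y hy
    rw [Metric.mem_ball, Real.dist_eq] at hy
    refine tsum_eq_sum fun n hn ↦ ?_
    have := hF n hn y (by
      have := abs_add_le (y - x) x
      rw [sub_add_cancel] at this
      linarith)
    rw [dilate_apply, w.ρS_apply] at this
    have h2 : window ρ ((L : ℕ) : ℝ) n y = 0 := Complex.ofReal_eq_zero.1 this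
    rw [h2, mul_zero]
  refine ContDiffAt.congr_of_eventuallyEq ?_ h1
  refine ContDiff.contDiffAt (ContDiff.sum fun n _ ↦ contDiff_const.mul ?_)
  exact w.ρ_smooth.comp ((contDiff_id.sub contDiff_const).div_const _)


/-! ### Phases as operators -/

theorem summable_of_tsum_ofReal_le {α : Type*} {f : α → ℝ} (hf : ∀ n, 0 ≤ f n) {C : ℝ}
    (hC : 0 ≤ C) (h : ∑' n, ENNReal.ofReal (f n) ≤ ENNReal.ofReal C) :
    Summable f ∧ ∑' n, f n ≤ C := by
  have h1 : ∀ F : Finset α, ∑ n ∈ F, f n ≤ C := fun F ↦ by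
    rw [← ENNReal.ofReal_le_ofReal_iff hC, ENNReal.ofReal_sum_of_nonneg fun n _ ↦ hf n]
    exact (ENNReal.sum_le_tsum F).trans h
  have h2 := summable_of_sum_le hf h1
  exact ⟨h2, h2.tsum_le_of_sum_le h1⟩

theorem toHs_congr_ae {s : ℝ} {f g : ℝ → ℂ} (h : f =ᵐ[volume] g) : toHs s f = toHs s g := by
  by_cases hf : ∃ u : Hs s, u.Represents f
  · obtain ⟨u, hu⟩ := hf
    rw [toHs_eq hu, toHs_eq (hu.congr h)]
  · have hg : ¬∃ u : Hs s, u.Represents g := fun ⟨u, hu⟩ ↦ hf ⟨u, hu.congr h.symm⟩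
    rw [toHs, toHs, dif_neg hf, dif_neg hg]

theorem loc_congr_ae {s : ℝ} {χ : 𝓢(ℝ, ℂ)} {f g : ℝ → ℂ} (h : f =ᵐ[volume] g) :
    loc s χ f = loc s χ g :=
  toHs_congr_ae (by filter_upwards [h] with x hx; rw [hx])

theorem norm_cexp_I_mul_sub_le (a b : ℝ) :
    ‖Complex.exp (Complex.I * a) - Complex.exp (Complex.I * b)‖ ≤ |a - b| := by
  have e : Complex.exp (Complex.I * a) - Complex.exp (Complex.I * b)
      = Complex.exp (Complex.I * b) * (Complex.exp (Complex.I * ((a - b : ℝ) : ℂ)) - 1) := by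
    rw [mul_sub, ← Complex.exp_add, mul_one]
    congr 2
    push_cast
    ring
  rw [e, norm_mul, mul_comm Complex.I (b : ℂ), Complex.norm_exp_ofReal_mul_I, one_mul]
  exact Real.norm_exp_I_mul_ofReal_sub_one_le

theorem norm_cexp_I_mul (a : ℝ) : ‖Complex.exp (Complex.I * a)‖ = 1 := by
  rw [mul_comm, Complex.norm_exp_ofReal_mul_I]

theorem phase_neg (ρ : ℝ → ℝ) (L : ℝ) (a : ℤ → ℝ) (x : ℝ) : phase ρ L (-a) x = -phase ρ L a x := by
  rw [phase, phase, ← tsum_neg]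
  exact tsum_congr fun n ↦ by rw [Pi.neg_apply, neg_mul]

/-- The oscillation of a sequence near the `m`-th cell. -/
def Windows.osc {η ρ : ℝ → ℝ} (w : Windows η ρ) (L L₁ : ℕ+) (m : ℤ) (a : ℤ → ℝ) : ℝ :=
  ∑ k ∈ w.nbhd L L₁, |a (refIndex L L₁ m + k) - a (refIndex L L₁ m)|

theorem Windows.exists_osc_bound {η ρ : ℝ → ℝ} (w : Windows η ρ) (L L₁ : ℕ+) :
    ∃ C : ℝ, 0 ≤ C ∧ ∀ a : L2dSeq, Summable (fun m ↦ w.osc L L₁ m a.seq ^ 2) ∧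
      ∑' m, w.osc L L₁ m a.seq ^ 2 ≤ C ^ 2 * ‖a‖ ^ 2 := by
  set D : ℝ := (w.nbhd L L₁).card * ∑ k ∈ w.nbhd L L₁, (L : ℕ) * (k.natAbs : ℝ) ^ 2
  have hD : 0 ≤ D := by positivity
  refine ⟨√D, Real.sqrt_nonneg _, fun a ↦ ?_⟩
  rw [Real.sq_sqrt hD]
  refine summable_of_tsum_ofReal_le (fun m ↦ by positivity) (by positivity) ?_
  have hS : ∑' n, ENNReal.ofReal (|a.seq n - a.seq (n - 1)| ^ 2) = ENNReal.ofReal (‖a‖ ^ 2) := by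
    rw [← ENNReal.ofReal_tsum_of_nonneg (fun n ↦ by positivity) a.hasSum_norm_sq.summable,
      a.hasSum_norm_sq.tsum_eq]
  have h1 : ∀ k : ℤ, ∑' m : ℤ, ENNReal.ofReal
      (|a.seq (refIndex L L₁ m + k) - a.seq (refIndex L L₁ m)| ^ 2)
      ≤ ENNReal.ofReal ((L : ℕ) * (k.natAbs : ℝ) ^ 2) * ENNReal.ofReal (‖a‖ ^ 2) := by
    intro k
    refine (tsum_comp_refIndex_le L L₁
      (fun n ↦ ENNReal.ofReal (|a.seq (n + k) - a.seq n| ^ 2))).trans ?_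
    have h2 := tsum_enorm_sub_sq_le (c := a.seq) (e := fun n ↦ |a.seq n - a.seq (n - 1)|)
      (fun n ↦ le_of_eq (Real.norm_eq_abs _)) k
    rw [hS] at h2
    rw [ENNReal.ofReal_mul (by positivity), ENNReal.ofReal_natCast,
      ENNReal.ofReal_pow (by positivity), ENNReal.ofReal_natCast, mul_assoc]
    gcongr
    exact h2
  calc ∑' m, ENNReal.ofReal (w.osc L L₁ m a.seq ^ 2)
      ≤ ∑' m, ((w.nbhd L L₁).card : ℝ≥0∞) * ∑ k ∈ w.nbhd L L₁, ENNReal.ofReal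
        (|a.seq (refIndex L L₁ m + k) - a.seq (refIndex L L₁ m)| ^ 2) := by
        refine ENNReal.tsum_le_tsum fun m ↦ ?_
        rw [← ENNReal.ofReal_sum_of_nonneg fun _ _ ↦ by positivity, ← ENNReal.ofReal_natCast,
          ← ENNReal.ofReal_mul (by positivity)]
        exact ENNReal.ofReal_le_ofReal sq_sum_le_card_mul_sum_sq
    _ = ((w.nbhd L L₁).card : ℝ≥0∞) * ∑ k ∈ w.nbhd L L₁, ∑' m, ENNReal.ofReal
        (|a.seq (refIndex L L₁ m + k) - a.seq (refIndex L L₁ m)| ^ 2) := by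
        rw [ENNReal.tsum_mul_left, Summable.tsum_finsetSum fun _ _ ↦ ENNReal.summable]
    _ ≤ ((w.nbhd L L₁).card : ℝ≥0∞) * ∑ k ∈ w.nbhd L L₁,
        ENNReal.ofReal ((L : ℕ) * (k.natAbs : ℝ) ^ 2) * ENNReal.ofReal (‖a‖ ^ 2) := by
        gcongr with k
        exact h1 k
    _ = _ := by
        rw [← Finset.sum_mul, ← ENNReal.ofReal_sum_of_nonneg fun _ _ ↦ by positivity,
          ← mul_assoc, ← ENNReal.ofReal_natCast, ← ENNReal.ofReal_mul (by positivity),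
          ← ENNReal.ofReal_mul hD]

theorem Windows.norm_mulOp_localPhase_le {η ρ : ℝ → ℝ} (w : Windows η ρ) (s : ℝ) (L L₁ : ℕ+)
    (m : ℤ) (a : ℤ → ℝ) :
    ‖mulOp s (w.localPhase L L₁ m a)‖ ≤ (multBound s w.ρS).toReal * w.osc L L₁ m a := by
  have e : mulOp s (w.localPhase L L₁ m a) = ∑ k ∈ w.nbhd L L₁,
      ((a (refIndex L L₁ m + k) - a (refIndex L L₁ m) : ℝ) : ℂ)
        • mulOp s (cell L w.ρS (refIndex L L₁ m + k)) := by
    change mulOpₗ s (w.localPhase L L₁ m a) = _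
    rw [localPhase, map_sum]
    refine Finset.sum_congr rfl fun k _ ↦ ?_
    rw [map_smul]
    rfl
  rw [e, osc, Finset.mul_sum]
  refine (norm_sum_le _ _).trans (Finset.sum_le_sum fun k _ ↦ ?_)
  rw [norm_smul, Complex.norm_real, Real.norm_eq_abs, mul_comm]
  gcongr
  exact norm_mulOp_cell_le _ _ _ _

/-- Multiplication by `e^{i(θ - a_n)}` on the `m`-th cell. -/
def Windows.expOp {η ρ : ℝ → ℝ} (w : Windows η ρ) (s : ℝ) (L L₁ : ℕ+) (m : ℤ) (a : ℤ → ℝ) :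
    Hs s →L[ℂ] Hs s :=
  NormedSpace.exp (mulOp s (Complex.I • w.localPhase L L₁ m a))

theorem Windows.loc_phase_mul {η ρ : ℝ → ℝ} (w : Windows η ρ) {s : ℝ} {L L₁ : ℕ+} {m : ℤ}
    {χ : 𝓢(ℝ, ℂ)} (hχ : HasCompactSupport χ)
    (hχ0 : ∀ x, w.R * ((L₁ : ℕ) : ℝ) < |x - 4 * ((L₁ : ℕ) : ℝ) * m| → χ x = 0) {f : ℝ → ℂ}
    (hf : LocHs s f) (a : ℤ → ℝ) :
    loc s χ (fun x ↦ Complex.exp (Complex.I * (phase ρ ((L : ℕ) : ℝ) a x : ℂ)) * f x)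
      = Complex.exp (Complex.I * (a (refIndex L L₁ m) : ℂ)) •
        w.expOp s L L₁ m a (loc s χ f) := by
  apply loc_eq
  have h := ((hf.represents hχ).exp_mulOp (hf.locallyIntegrable_smul χ)
    (Complex.I • w.localPhase L L₁ m a)).const_smul
      (Complex.exp (Complex.I * (a (refIndex L L₁ m) : ℂ)))
  refine h.congr (.of_forall fun x ↦ ?_)
  simp only
  by_cases hx : |x - 4 * ((L₁ : ℕ) : ℝ) * m| ≤ w.R * ((L₁ : ℕ) : ℝ)
  · rw [_root_.smul_apply, w.localPhase_apply hx, smul_eq_mul, ← mul_assoc, ← Complex.exp_add]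
    have e : Complex.I * (a (refIndex L L₁ m) : ℂ) + Complex.I
        * ((phase ρ ((L : ℕ) : ℝ) a x - a (refIndex L L₁ m) : ℝ) : ℂ)
        = Complex.I * (phase ρ ((L : ℕ) : ℝ) a x : ℂ) := by
      push_cast; ring
    rw [e]
    ring
  · rw [hχ0 x (not_le.1 hx)]
    ring

theorem Windows.cell_χ_eq_zero {η ρ : ℝ → ℝ} (w : Windows η ρ) {L : ℕ+} {n : ℤ} (x : ℝ)
    (hx : w.R * ((L : ℕ) : ℝ) < |x - 4 * ((L : ℕ) : ℝ) * n|) : cell L w.χS n x = 0 := by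
  have hL := cast_pnat_pos L
  rw [cell_apply]
  apply w.χ_eq_zero
  rwa [abs_div, abs_of_pos hL, lt_div_iff₀ hL]

theorem Windows.hasCompactSupport_χ {η ρ : ℝ → ℝ} (w : Windows η ρ) (L : ℕ+) (n : ℤ) :
    HasCompactSupport (cell L w.χS n) := hasCompactSupport_cell w.χ_compact L n

theorem Windows.hasCompactSupport_η {η ρ : ℝ → ℝ} (w : Windows η ρ) (L : ℕ+) (n : ℤ) :
    HasCompactSupport (cell L w.ηS n) := hasCompactSupport_cell w.η_compact L n

theorem Windows.ρ_mul_χ_cell {η ρ : ℝ → ℝ} (w : Windows η ρ) (L : ℕ+) (n : ℤ) (x : ℝ) :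
    cell L w.ρS n x * cell L w.χS n x = cell L w.ρS n x := by
  simp only [cell_apply, w.ρ_mul_χ]

theorem Windows.loc_phase_mul_χ {η ρ : ℝ → ℝ} (w : Windows η ρ) {s : ℝ} {L : ℕ+} (n : ℤ)
    {f : ℝ → ℂ} (hf : LocHs s f) (a : ℤ → ℝ) :
    loc s (cell L w.χS n)
        (fun x ↦ Complex.exp (Complex.I * (phase ρ ((L : ℕ) : ℝ) a x : ℂ)) * f x)
      = Complex.exp (Complex.I * (a n : ℂ)) •
        w.expOp s L L n a (loc s (cell L w.χS n) f) := by
  have h := w.loc_phase_mul (L := L) (w.hasCompactSupport_χ L n) w.cell_χ_eq_zero hf a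
  rwa [refIndex_self] at h

theorem Windows.exists_expOp_bound {η ρ : ℝ → ℝ} (w : Windows η ρ) (s : ℝ) (L L₁ : ℕ+) (M : ℝ) :
    ∃ C : ℝ, 1 ≤ C ∧ ∀ a : L2dSeq, ‖a‖ ≤ M → ∃ x : ℤ → ℝ, (∀ m, 0 ≤ x m) ∧
      Summable (fun m ↦ x m ^ 2) ∧ ∑' m, x m ^ 2 ≤ C ^ 2 * ‖a‖ ^ 2 ∧
      (∀ m u, ‖w.expOp s L L₁ m a.seq u - u‖ ≤ x m * ‖u‖) ∧
      ∀ m u, ‖w.expOp s L L₁ m a.seq u‖ ≤ C * ‖u‖ := by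
  obtain ⟨D, hD0, hD⟩ := w.exists_osc_bound L L₁
  set κ := (multBound s w.ρS).toReal
  have hκ : 0 ≤ κ := ENNReal.toReal_nonneg
  set A := κ * (D * |M|)
  have hA : 0 ≤ A := by positivity
  set T := κ * Real.exp A
  have hT : 0 ≤ T := by positivity
  refine ⟨1 + T * D + T * (D * |M|), by
    have : 0 ≤ T * D + T * (D * |M|) := by positivity
    linarith, fun a ha ↦ ?_⟩
  have hosc0 : ∀ m, 0 ≤ w.osc L L₁ m a.seq := fun m ↦ Finset.sum_nonneg fun _ _ ↦ abs_nonneg _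
  have hosc : ∀ m, w.osc L L₁ m a.seq ≤ D * |M| := fun m ↦ by
    have h1 := ((hD a).1.le_tsum m fun _ _ ↦ by positivity).trans (hD a).2
    rw [← mul_pow] at h1
    refine (abs_le_of_sq_le_sq' h1 (by positivity)).2.trans ?_
    gcongr
    exact ha.trans (le_abs_self M)
  have hI : ∀ m, ‖mulOp s (Complex.I • w.localPhase L L₁ m a.seq)‖ ≤ κ * w.osc L L₁ m a.seq :=
    fun m ↦ by
      rw [mulOp_smul, norm_smul, Complex.norm_I, one_mul]
      exact w.norm_mulOp_localPhase_le s L L₁ m a.seq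
  have hE : ∀ m u, ‖w.expOp s L L₁ m a.seq u - u‖ ≤ T * w.osc L L₁ m a.seq * ‖u‖ := by
    intro m u
    have h1 := norm_exp_sub_one_le_mul_exp (mulOp s (Complex.I • w.localPhase L L₁ m a.seq))
    have h2 : w.expOp s L L₁ m a.seq u - u
        = (NormedSpace.exp (mulOp s (Complex.I • w.localPhase L L₁ m a.seq)) - 1) u := rfl
    rw [h2]
    refine (ContinuousLinearMap.le_opNorm _ _).trans ?_
    gcongr
    refine h1.trans ?_
    calc _ ≤ (κ * w.osc L L₁ m a.seq) * Real.exp A := by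
          exact mul_le_mul (hI m) (Real.exp_le_exp.2 ((hI m).trans
            (mul_le_mul_of_nonneg_left (hosc m) hκ))) (Real.exp_nonneg _)
            (mul_nonneg hκ (hosc0 m))
      _ = _ := by ring
  refine ⟨fun m ↦ T * w.osc L L₁ m a.seq, fun m ↦ mul_nonneg hT (hosc0 m), ?_, ?_, hE, ?_⟩
  · simp only [mul_pow]
    exact (hD a).1.mul_left _
  · simp only [mul_pow]
    rw [tsum_mul_left]
    calc T ^ 2 * ∑' m, w.osc L L₁ m a.seq ^ 2 ≤ T ^ 2 * (D ^ 2 * ‖a‖ ^ 2) := by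
          gcongr; exact (hD a).2
      _ = (T * D) ^ 2 * ‖a‖ ^ 2 := by ring
      _ ≤ _ := by
          gcongr
          have : 0 ≤ T * (D * |M|) := by positivity
          linarith
  · intro m u
    have h1 := norm_add_le (w.expOp s L L₁ m a.seq u - u) u
    rw [sub_add_cancel] at h1
    have h2 := hE m u
    have h3 : T * w.osc L L₁ m a.seq * ‖u‖ ≤ T * (D * |M|) * ‖u‖ := by gcongr; exact hosc m
    have h4 : 0 ≤ T * D * ‖u‖ := by positivity
    nlinarith

/-- Functions of the form `e^{iθ_d} p + e^{iθ_a} g` are close to `p` on cells. -/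
theorem Windows.exists_cells_of_phase {η ρ : ℝ → ℝ} (w : Windows η ρ) {s : ℝ} (hs : 0 ≤ s)
    (L : ℕ+) (B M : ℝ) : ∃ C : ℝ, 0 ≤ C ∧ ∀ (p p' : ℝ → ℂ) (d a : L2dSeq) (g : Hs s),
      LocHs s p → LocHs s p' → ‖d‖ ≤ M → ‖a‖ ≤ M → (∀ n, ‖loc s (cell L w.χS n) p‖ ≤ B) →
      (p' =ᵐ[volume] fun x ↦ Complex.exp (Complex.I * (phase ρ ((L : ℕ) : ℝ) d.seq x : ℂ)) * p x
        + Complex.exp (Complex.I * (phase ρ ((L : ℕ) : ℝ) a.seq x : ℂ)) * Hs.fn hs g x) →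
      ∃ e : ℤ → ℝ, (∀ n, ‖loc s (cell L w.χS n)
          (fun x ↦ Complex.exp (Complex.I * (d.seq n : ℂ)) * p x - p' x)‖ ≤ e n) ∧
        (∀ n, ‖Complex.exp (Complex.I * (d.seq n : ℂ))
          - Complex.exp (Complex.I * (d.seq (n - 1) : ℂ))‖ ≤ e n) ∧
        Summable (fun n ↦ e n ^ 2) ∧ ∑' n, e n ^ 2 ≤ C ^ 2 * (‖d‖ + ‖g‖) ^ 2 := by
  obtain ⟨C₁, hC₁1, hC₁⟩ := w.exists_expOp_bound s L L M
  obtain ⟨C₂, hC₂0, hC₂⟩ := summable_norm_mulOp_translate_sq s (one_le_scale L)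
    (hasCompactSupport_dilate w.χ_compact (cast_pnat_pos L))
  have hC₁0 : 0 ≤ C₁ := by linarith
  set D := |B| * C₁ + C₁ * C₂ + 1
  have hD0 : 0 ≤ D := by positivity
  refine ⟨2 * D, by positivity, fun p p' d a g hp hp' hd ha hB hpp ↦ ?_⟩
  obtain ⟨x, hx0, hxs, hxb, hx, -⟩ := hC₁ d hd
  obtain ⟨-, -, -, -, -, hy⟩ := hC₁ a ha
  have hg := hC₂ g
  have hθ : ∀ a : ℤ → ℝ, ContDiff ℝ ∞
      fun x ↦ Complex.exp (Complex.I * (phase ρ ((L : ℕ) : ℝ) a x : ℂ)) := fun a ↦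
    Complex.contDiff_exp.comp (contDiff_const.mul
      (Complex.ofRealCLM.contDiff.comp (w.contDiff_phase L a)))
  set e₁ : ℤ → ℝ := fun n ↦ |B| * x n
  set e₂ : ℤ → ℝ := fun n ↦ C₁ * ‖mulOp s (cell L w.χS n) g‖
  set e₃ : ℤ → ℝ := fun n ↦ |d.seq n - d.seq (n - 1)|
  have h1 : Summable (fun n ↦ e₁ n ^ 2) ∧ ∑' n, e₁ n ^ 2 ≤ (|B| * C₁) ^ 2 * ‖d‖ ^ 2 := by
    simp only [e₁, mul_pow]
    refine ⟨hxs.mul_left _, ?_⟩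
    rw [tsum_mul_left, mul_assoc]
    gcongr
  have h2 : Summable (fun n ↦ e₂ n ^ 2) ∧ ∑' n, e₂ n ^ 2 ≤ (C₁ * C₂) ^ 2 * ‖g‖ ^ 2 := by
    simp only [e₂, mul_pow]
    refine ⟨hg.1.mul_left _, ?_⟩
    rw [tsum_mul_left, mul_assoc]
    gcongr
    exact hg.2
  have h3 : Summable (fun n ↦ e₃ n ^ 2) ∧ ∑' n, e₃ n ^ 2 ≤ ‖d‖ ^ 2 :=
    ⟨d.hasSum_norm_sq.summable, d.hasSum_norm_sq.tsum_eq.le⟩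
  have hle : ∀ n, (e₁ n + e₂ n + e₃ n) ^ 2 ≤ 3 * e₁ n ^ 2 + 3 * e₂ n ^ 2 + 3 * e₃ n ^ 2 := fun n ↦ by
    nlinarith [sq_nonneg (e₁ n - e₂ n), sq_nonneg (e₁ n - e₃ n), sq_nonneg (e₂ n - e₃ n)]
  have hsum := ((h1.1.mul_left 3).add (h2.1.mul_left 3)).add (h3.1.mul_left 3)
  have hsum' := Summable.of_nonneg_of_le (fun n ↦ by positivity) hle hsum
  have p1 : ∀ n, 0 ≤ e₁ n := fun n ↦ mul_nonneg (abs_nonneg _) (hx0 n)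
  have p2 : ∀ n, 0 ≤ e₂ n := fun n ↦ by positivity
  have p3 : ∀ n, 0 ≤ e₃ n := fun n ↦ abs_nonneg _
  refine ⟨fun n ↦ e₁ n + e₂ n + e₃ n, fun n ↦ ?_, fun n ↦ ?_, hsum', ?_⟩
  · have hχ := w.hasCompactSupport_χ L n
    have hfg := LocHs.fn hs g
    have e : loc s (cell L w.χS n) (fun x ↦ Complex.exp (Complex.I * (d.seq n : ℂ)) * p x - p' x)
        = -(Complex.exp (Complex.I * (d.seq n : ℂ)) •
            (w.expOp s L L n d.seq (loc s (cell L w.χS n) p) - loc s (cell L w.χS n) p))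
          - Complex.exp (Complex.I * (a.seq n : ℂ)) •
            w.expOp s L L n a.seq (mulOp s (cell L w.χS n) g) := by
      rw [(hp.const_mul _).loc_sub hp' hχ, hp.loc_const_mul hχ, loc_congr_ae hpp,
        (hp.smooth_mul (hθ _)).loc_add (hfg.smooth_mul (hθ _)) hχ, w.loc_phase_mul_χ n hp,
        w.loc_phase_mul_χ n hfg, loc_of_represents (Hs.represents_fn hs g), smul_sub]
      abel
    rw [e]
    refine (norm_sub_le _ _).trans ?_
    rw [norm_neg, norm_smul, norm_smul, norm_cexp_I_mul, norm_cexp_I_mul, one_mul, one_mul]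
    have q1 : ‖w.expOp s L L n d.seq (loc s (cell L w.χS n) p) - loc s (cell L w.χS n) p‖
        ≤ e₁ n := by
      refine (hx n _).trans ?_
      rw [mul_comm]
      exact mul_le_mul_of_nonneg_right ((hB n).trans (le_abs_self B)) (hx0 n)
    have q2 := hy n (mulOp s (cell L w.χS n) g)
    linarith [p3 n]
  · linarith [norm_cexp_I_mul_sub_le (d.seq n) (d.seq (n - 1)), p1 n, p2 n]
  · refine (hsum'.tsum_le_tsum hle hsum).trans ?_
    rw [((h1.1.mul_left 3).add (h2.1.mul_left 3)).tsum_add (h3.1.mul_left 3),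
      (h1.1.mul_left 3).tsum_add (h2.1.mul_left 3), tsum_mul_left, tsum_mul_left, tsum_mul_left]
    have r1 : (|B| * C₁) ^ 2 * ‖d‖ ^ 2 ≤ (|B| * C₁) ^ 2 * (‖d‖ + ‖g‖) ^ 2 := by
      gcongr; linarith [norm_nonneg g]
    have r2 : (C₁ * C₂) ^ 2 * ‖g‖ ^ 2 ≤ (C₁ * C₂) ^ 2 * (‖d‖ + ‖g‖) ^ 2 := by
      gcongr; linarith [norm_nonneg d]
    have r3 : ‖d‖ ^ 2 ≤ (‖d‖ + ‖g‖) ^ 2 := by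
      gcongr; linarith [norm_nonneg g]
    have r4 : (|B| * C₁) ^ 2 + (C₁ * C₂) ^ 2 + 1 ≤ D ^ 2 := by
      have t1 : 0 ≤ |B| * C₁ := by positivity
      have t2 : 0 ≤ C₁ * C₂ := by positivity
      simp only [D]
      nlinarith [mul_nonneg t1 t2]
    nlinarith [mul_le_mul_of_nonneg_right r4 (sq_nonneg (‖d‖ + ‖g‖)), h1.2, h2.2, h3.2,
      sq_nonneg (‖d‖ + ‖g‖), mul_nonneg (sq_nonneg D) (sq_nonneg (‖d‖ + ‖g‖))]

/-- A function with square summable cells is an element of `H^s`. -/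
theorem Windows.exists_represents_tsum {η ρ : ℝ → ℝ} (w : Windows η ρ) (s : ℝ) (L : ℕ+) :
    ∃ C : ℝ, 0 ≤ C ∧ ∀ F : ℝ → ℂ, LocHs s F →
      Summable (fun n ↦ ‖loc s (cell L w.χS n) F‖ ^ 2) →
      (∑' n, mulOp s (cell L w.ρS n) (loc s (cell L w.χS n) F)).Represents F ∧
      ‖∑' n, mulOp s (cell L w.ρS n) (loc s (cell L w.χS n) F)‖
        ≤ C * √(∑' n, ‖loc s (cell L w.χS n) F‖ ^ 2) := by
  obtain ⟨C, hC0, hC⟩ := exists_of_cells s (one_le_scale L) (w.isPartition L)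
  refine ⟨C, hC0, fun F hFl hsum ↦ hC (fun φ ↦ ∫ x, φ x * F x) _ (fun φ ψ hφ hψ ↦ ?_)
    (fun n φ hφ ↦ ?_) hsum⟩
  · rw [← integral_add (integrable_mul_of_hasCompactSupport hFl.locallyIntegrable hφ)
      (integrable_mul_of_hasCompactSupport hFl.locallyIntegrable hψ)]
    refine integral_congr_ae (.of_forall fun x ↦ ?_)
    simp only [_root_.add_apply]
    ring
  · rw [hFl.represents (w.hasCompactSupport_χ L n) _ (hasCompactSupport_smul' _ hφ)]
    refine integral_congr_ae (.of_forall fun x ↦ ?_)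
    have := w.ρ_mul_χ_cell L n x
    simp only [smul'_apply]
    change cell L w.ρS n x * φ x * (cell L w.χS n x * F x) = cell L w.ρS n x * φ x * F x
    linear_combination (φ x * F x) * this

/-- Functions that are close on cells up to phases differ by an element of `H^s` after the phases
are removed. -/
theorem Windows.exists_difference {η ρ : ℝ → ℝ} (w : Windows η ρ) (s : ℝ)
    (L : ℕ+) (B M : ℝ) : ∃ C : ℝ, 0 ≤ C ∧ ∀ (p p' : ℝ → ℂ) (a a' : L2dSeq) (c : ℤ → ℂ) (e : ℤ → ℝ),
      LocHs s p → LocHs s p' → ‖a‖ ≤ M → ‖a'‖ ≤ M → (∀ n, ‖loc s (cell L w.χS n) p‖ ≤ B) →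
      (∀ n, ‖loc s (cell L w.χS n) (fun x ↦ c n * p x - p' x)‖ ≤ e n) →
      (∀ n, ‖c n * Complex.exp (Complex.I * (a.seq n : ℂ))
        - Complex.exp (Complex.I * (a'.seq n : ℂ))‖ ≤ e n) →
      Summable (fun n ↦ e n ^ 2) →
      ∃ g : Hs s, g.Represents (fun x ↦
          Complex.exp (-Complex.I * (phase ρ ((L : ℕ) : ℝ) a'.seq x : ℂ)) * p' x
          - Complex.exp (-Complex.I * (phase ρ ((L : ℕ) : ℝ) a.seq x : ℂ)) * p x) ∧
        ‖g‖ ≤ C * (√(∑' n, e n ^ 2) + ‖a' - a‖) := by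
  obtain ⟨C₁, hC₁1, hC₁⟩ := w.exists_expOp_bound s L L (2 * |M|)
  obtain ⟨C₂, hC₂0, hC₂⟩ := w.exists_represents_tsum s L
  have hC₁0 : 0 ≤ C₁ := by linarith
  refine ⟨C₂ * (2 * (C₁ * (1 + |B|) + C₁ * |B| * C₁)), by positivity,
    fun p p' a a' c e hp hp' ha ha' hB he hce hes ↦ ?_⟩
  have haM : ‖-a'‖ ≤ 2 * |M| := by
    rw [norm_neg]; linarith [ha'.trans (le_abs_self M), abs_nonneg M]
  have hdM : ‖a' - a‖ ≤ 2 * |M| := by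
    linarith [norm_sub_le a' a, ha'.trans (le_abs_self M), ha.trans (le_abs_self M)]
  obtain ⟨x, hx0, hxs, hxb, hx, -⟩ := hC₁ (a' - a) hdM
  obtain ⟨-, -, -, -, -, hy⟩ := hC₁ (-a') haM
  have hθ : ∀ a : ℤ → ℝ, ContDiff ℝ ∞
      fun x ↦ Complex.exp (Complex.I * (phase ρ ((L : ℕ) : ℝ) a x : ℂ)) := fun a ↦
    Complex.contDiff_exp.comp (contDiff_const.mul
      (Complex.ofRealCLM.contDiff.comp (w.contDiff_phase L a)))
  set F : ℝ → ℂ := fun x ↦ Complex.exp (-Complex.I * (phase ρ ((L : ℕ) : ℝ) a'.seq x : ℂ)) * p' x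
          - Complex.exp (-Complex.I * (phase ρ ((L : ℕ) : ℝ) a.seq x : ℂ)) * p x with hF
  have hneg : (-a' : L2dSeq).seq = -a'.seq := map_neg _ _
  have hsub : (a' - a : L2dSeq).seq = a'.seq - a.seq := map_sub _ _ _
  set h : ℝ → ℂ := fun x ↦
    p' x - Complex.exp (Complex.I * (phase ρ ((L : ℕ) : ℝ) (a' - a : L2dSeq).seq x : ℂ)) * p x
  have hh : LocHs s h := hp'.sub (hp.smooth_mul (hθ _))
  have hFh : F = fun x ↦ Complex.exp (Complex.I
      * (phase ρ ((L : ℕ) : ℝ) (-a' : L2dSeq).seq x : ℂ)) * h x := by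
    funext x
    simp only [F, h]
    rw [hneg, hsub, phase_neg, w.phase_sub, mul_sub, ← mul_assoc, ← Complex.exp_add]
    congr 3
    · push_cast; ring
    · push_cast; ring_nf
  have hFl : LocHs s F := by rw [hFh]; exact hh.smooth_mul (hθ _)
  have hy' : ∀ n, ‖loc s (cell L w.χS n) F‖ ≤ C₁ * (1 + |B|) * e n + C₁ * |B| * x n := by
    intro n
    have hχ := w.hasCompactSupport_χ L n
    set z := Complex.exp (Complex.I * ((a' - a : L2dSeq).seq n : ℂ)) with hz
    have hz1 : ‖z‖ = 1 := norm_cexp_I_mul _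
    have e1 : loc s (cell L w.χS n) h
        = -loc s (cell L w.χS n) (fun x ↦ c n * p x - p' x)
          + (c n - z) • loc s (cell L w.χS n) p
          - z • (w.expOp s L L n (a' - a : L2dSeq).seq (loc s (cell L w.χS n) p)
            - loc s (cell L w.χS n) p) := by
      rw [hp'.loc_sub (hp.smooth_mul (hθ _)) hχ, w.loc_phase_mul_χ n hp,
        (hp.const_mul _).loc_sub hp' hχ, hp.loc_const_mul hχ, smul_sub, sub_smul]
      abel
    have e2 : ‖c n - z‖ ≤ e n := by
      have e3 : c n - z = (c n * Complex.exp (Complex.I * (a.seq n : ℂ))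
          - Complex.exp (Complex.I * (a'.seq n : ℂ)))
            * Complex.exp (Complex.I * ((-a.seq n : ℝ) : ℂ)) := by
        rw [sub_mul, mul_assoc, ← Complex.exp_add, ← Complex.exp_add, hz, hsub, Pi.sub_apply]
        have : Complex.I * (a.seq n : ℂ) + Complex.I * ((-a.seq n : ℝ) : ℂ) = 0 := by
          push_cast; ring
        rw [this, Complex.exp_zero, mul_one]
        congr 2
        push_cast; ring
      rw [e3, norm_mul, norm_cexp_I_mul, mul_one]
      exact hce n
    have hBn : ‖loc s (cell L w.χS n) p‖ ≤ |B| := (hB n).trans (le_abs_self B)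
    have e4 : ‖loc s (cell L w.χS n) h‖ ≤ e n + e n * |B| + x n * |B| := by
      rw [e1]
      refine (norm_sub_le _ _).trans (add_le_add ((norm_add_le _ _).trans (add_le_add ?_ ?_)) ?_)
      · rw [norm_neg]; exact he n
      · rw [norm_smul]
        exact mul_le_mul e2 hBn (norm_nonneg _) ((norm_nonneg _).trans e2)
      · rw [norm_smul, hz1, one_mul]
        exact (hx n _).trans (mul_le_mul_of_nonneg_left hBn (hx0 n))
    rw [hFh, w.loc_phase_mul_χ n hh, norm_smul, norm_cexp_I_mul, one_mul]
    refine (hy n _).trans ?_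
    calc _ ≤ C₁ * (e n + e n * |B| + x n * |B|) := by gcongr
      _ = _ := by ring
  set u₁ := C₁ * (1 + |B|)
  set u₂ := C₁ * |B|
  have he0 : ∀ n, 0 ≤ e n := fun n ↦ (norm_nonneg _).trans (he n)
  have hsq : ∀ n, ‖loc s (cell L w.χS n) F‖ ^ 2 ≤ 2 * u₁ ^ 2 * e n ^ 2 + 2 * u₂ ^ 2 * x n ^ 2 :=
    fun n ↦ by
      refine (pow_le_pow_left₀ (norm_nonneg _) (hy' n) 2).trans ?_
      nlinarith [sq_nonneg (u₁ * e n - u₂ * x n)]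
  have hsum := (hes.mul_left (2 * u₁ ^ 2)).add (hxs.mul_left (2 * u₂ ^ 2))
  have hsum' := Summable.of_nonneg_of_le (fun n ↦ by positivity) hsq hsum
  have hcell := hC₂ F hFl hsum'
  refine ⟨_, hcell.1, hcell.2.trans ?_⟩
  rw [mul_assoc]
  refine mul_le_mul_of_nonneg_left (Real.sqrt_le_iff.2 ⟨by positivity, ?_⟩) hC₂0
  refine (hsum'.tsum_le_tsum hsq hsum).trans ?_
  rw [(hes.mul_left _).tsum_add (hxs.mul_left _), tsum_mul_left, tsum_mul_left]
  have hS : 0 ≤ ∑' n, e n ^ 2 := tsum_nonneg fun _ ↦ by positivity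
  have hS2 := Real.sq_sqrt hS
  set t := √(∑' n, e n ^ 2)
  have ht : 0 ≤ t := Real.sqrt_nonneg _
  have hn := norm_nonneg (a' - a)
  rw [← hS2]
  have hu1 : 0 ≤ u₁ := by positivity
  have hu2 : 0 ≤ u₂ := by positivity
  have k1 : 2 * u₂ ^ 2 * ∑' n, x n ^ 2 ≤ 2 * u₂ ^ 2 * (C₁ ^ 2 * ‖a' - a‖ ^ 2) := by gcongr
  have k2 : (u₁ * t + u₂ * C₁ * ‖a' - a‖) ^ 2 ≤ ((u₁ + u₂ * C₁) * (t + ‖a' - a‖)) ^ 2 := by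
    have : 0 ≤ u₂ * C₁ := by positivity
    apply pow_le_pow_left₀ (by positivity)
    nlinarith [mul_nonneg hu1 hn, mul_nonneg this ht]
  have k3 : 0 ≤ u₁ * t * (u₂ * C₁ * ‖a' - a‖) := by positivity
  nlinarith [sq_nonneg (u₁ * t), sq_nonneg (u₂ * C₁ * ‖a' - a‖)]


/-! ### Sequences of phases -/

theorem norm_unit_sub_unit_le {z : ℂ} (hz : z ≠ 0) (v : ℂ) :
    ‖v / (‖v‖ : ℂ) - z / (‖z‖ : ℂ)‖ ≤ 2 * ‖v - z‖ / ‖z‖ := by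
  have hz0 : 0 < ‖z‖ := norm_pos_iff.2 hz
  by_cases hv : v = 0
  · subst hv
    simp only [zero_div, zero_sub, norm_neg, norm_div, Complex.norm_real, norm_norm]
    rw [div_self hz0.ne', mul_div_assoc, div_self hz0.ne']
    norm_num
  have hv0 : 0 < ‖v‖ := norm_pos_iff.2 hv
  have hzc : (‖z‖ : ℂ) ≠ 0 := Complex.ofReal_ne_zero.2 hz0.ne'
  have hvc : (‖v‖ : ℂ) ≠ 0 := Complex.ofReal_ne_zero.2 hv0.ne'
  have e : v / (‖v‖ : ℂ) - z / (‖z‖ : ℂ)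
      = v / (‖v‖ : ℂ) * ((‖z‖ - ‖v‖ : ℝ) : ℂ) / (‖z‖ : ℂ) + (v - z) / (‖z‖ : ℂ) := by
    push_cast
    field_simp
    ring
  rw [e]
  refine (norm_add_le _ _).trans ?_
  rw [norm_div, norm_mul, norm_div, norm_div, Complex.norm_real, Complex.norm_real,
    Complex.norm_real, norm_norm, norm_norm, div_self hv0.ne', one_mul, ← add_div]
  refine div_le_div_of_nonneg_right ?_ hz0.le
  have := abs_norm_sub_norm_le z v
  rw [norm_sub_rev z v] at this
  rw [Real.norm_eq_abs]
  linarith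

theorem abs_le_mul_norm_cexp_sub_one {x : ℝ} (hx : |x| ≤ Real.pi) :
    |x| ≤ Real.pi / 2 * ‖Complex.exp (Complex.I * x) - 1‖ := by
  rw [Complex.norm_exp_I_mul_ofReal_sub_one, norm_mul, Real.norm_ofNat, Real.norm_eq_abs]
  have h1 := Real.mul_abs_le_abs_sin (x := x / 2) (by
    rw [abs_div, abs_two]; linarith)
  rw [abs_div, abs_two] at h1
  have hpi := Real.pi_pos
  have h2 := mul_le_mul_of_nonneg_left h1 hpi.le
  have h3 : Real.pi * (2 / Real.pi * (|x| / 2)) = |x| := by field_simp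
  rw [h3] at h2
  linarith

/-- The sequence that vanishes at `0` and has the given differences. -/
def antidiff (α : ℤ → ℝ) (n : ℤ) : ℝ := ∑ k ∈ Finset.Ioc 0 n, α k - ∑ k ∈ Finset.Ioc n 0, α k

theorem antidiff_zero (α : ℤ → ℝ) : antidiff α 0 = 0 := by simp [antidiff]

theorem antidiff_sub (α : ℤ → ℝ) (n : ℤ) : antidiff α n - antidiff α (n - 1) = α n := by
  simp only [antidiff]
  by_cases hn : 1 ≤ n
  · have e1 : Finset.Ioc 0 n = insert n (Finset.Ioc 0 (n - 1)) := by
      ext k; simp only [Finset.mem_Ioc, Finset.mem_insert]; omega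
    have e2 : Finset.Ioc n 0 = ∅ := Finset.Ioc_eq_empty_of_le (by omega)
    have e3 : Finset.Ioc (n - 1) 0 = ∅ := Finset.Ioc_eq_empty_of_le (by omega)
    rw [e2, e3, e1, Finset.sum_insert (by simp)]
    simp
  · have e1 : Finset.Ioc (n - 1) 0 = insert n (Finset.Ioc n 0) := by
      ext k; simp only [Finset.mem_Ioc, Finset.mem_insert]; omega
    have e2 : Finset.Ioc 0 n = ∅ := Finset.Ioc_eq_empty_of_le (by omega)
    have e3 : Finset.Ioc 0 (n - 1) = ∅ := Finset.Ioc_eq_empty_of_le (by omega)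
    rw [e2, e3, e1, Finset.sum_insert (by simp)]
    simp

theorem eq_of_succ_eq {X : Type*} {f g : ℤ → X} (F : ℤ → X ≃ X) (h0 : f 0 = g 0)
    (hf : ∀ n, f n = F n (f (n - 1))) (hg : ∀ n, g n = F n (g (n - 1))) : f = g := by
  funext n
  induction n using Int.induction_on with
  | zero => exact h0
  | succ n ih => rw [hf, hg, add_sub_cancel_right, ih]
  | pred n ih =>
    rw [hf, hg] at ih
    exact (F _).injective ih

theorem eq_of_sub_eq {a b : ℤ → ℝ} (h0 : a 0 = b 0)
    (h : ∀ n, a n - a (n - 1) = b n - b (n - 1)) : a = b :=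
  eq_of_succ_eq (fun n ↦ Equiv.addRight (b n - b (n - 1))) h0
    (fun n ↦ by rw [Equiv.coe_addRight, ← h n]; ring) fun n ↦ by rw [Equiv.coe_addRight]; ring

theorem memℓp_two_of_summable {α : ℤ → ℝ} (h : Summable fun n ↦ α n ^ 2) :
    Memℓp α (2 : ℝ≥0∞) := by
  refine memℓp_gen ?_
  simpa using h

/-- The sequence with given value at `0` and given differences. -/
def L2dSeq.ofDiff (t : ℝ) (α : ℤ → ℝ) (hα : Memℓp α 2) : L2dSeq :=
  ⟨fun n ↦ t + antidiff α n, by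
    change Memℓp (fun n ↦ t + antidiff α n - (t + antidiff α (n - 1))) 2
    simpa only [add_sub_add_left_eq_sub, antidiff_sub] using hα⟩

theorem L2dSeq.ofDiff_seq (t : ℝ) (α : ℤ → ℝ) (hα : Memℓp α 2) (n : ℤ) :
    (L2dSeq.ofDiff t α hα).seq n = t + antidiff α n := rfl

theorem L2dSeq.norm_sq (a : L2dSeq) : ‖a‖ ^ 2 = ∑' n, (a.seq n - a.seq (n - 1)) ^ 2 := by
  rw [← a.hasSum_norm_sq.tsum_eq]
  simp only [sq_abs]

theorem L2dSeq.summable_sq (a : L2dSeq) : Summable fun n ↦ (a.seq n - a.seq (n - 1)) ^ 2 := by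
  simpa only [sq_abs] using a.hasSum_norm_sq.summable

theorem L2dSeq.abs_sub_le (a : L2dSeq) (n : ℤ) : |a.seq n - a.seq (n - 1)| ≤ ‖a‖ := by
  refine (abs_le_of_sq_le_sq' ?_ (norm_nonneg a)).2
  rw [← a.hasSum_norm_sq.tsum_eq]
  exact a.hasSum_norm_sq.summable.le_tsum n fun _ _ ↦ by positivity

/-- A sequence of complex phases with small jumps has a real logarithm in `ℓ²_d`. -/
theorem exists_l2dSeq_of_phases {u : ℤ → ℂ} (hu : ∀ n, ‖u n‖ = 1) {e : ℤ → ℝ}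
    (he : ∀ n, ‖u n - u (n - 1)‖ ≤ e n) (hs : Summable fun n ↦ e n ^ 2) :
    ∃ a : L2dSeq, (∀ n, Complex.exp (Complex.I * (a.seq n : ℂ)) = u n) ∧
      ‖a‖ ^ 2 ≤ (Real.pi / 2) ^ 2 * ∑' n, e n ^ 2 := by
  have hu0 : ∀ n, u n ≠ 0 := fun n h ↦ by have := hu n; rw [h] at this; simp at this
  have hcexp : ∀ z : ℂ, ‖z‖ = 1 → Complex.exp (Complex.I * (z.arg : ℂ)) = z := fun z hz ↦ by
    have := Complex.norm_mul_exp_arg_mul_I z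
    rwa [hz, Complex.ofReal_one, one_mul, mul_comm] at this
  have hr1 : ∀ n, ‖u n / u (n - 1)‖ = 1 := fun n ↦ by rw [norm_div, hu, hu, div_one]
  set α : ℤ → ℝ := fun n ↦ (u n / u (n - 1)).arg with hα
  have hαe : ∀ n, |α n| ≤ Real.pi / 2 * e n := fun n ↦ by
    refine (abs_le_mul_norm_cexp_sub_one (Complex.abs_arg_le_pi _)).trans ?_
    rw [hcexp _ (hr1 n), div_sub_one (hu0 _), norm_div, hu, div_one]
    exact mul_le_mul_of_nonneg_left (he n) (by positivity)
  have hsq : ∀ n, α n ^ 2 ≤ (Real.pi / 2) ^ 2 * e n ^ 2 := fun n ↦ by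
    rw [← sq_abs, ← mul_pow]
    exact pow_le_pow_left₀ (abs_nonneg _) (hαe n) 2
  have hsum : Summable fun n ↦ α n ^ 2 :=
    Summable.of_nonneg_of_le (fun n ↦ sq_nonneg _) hsq (hs.mul_left _)
  set a := L2dSeq.ofDiff (u 0).arg α (memℓp_two_of_summable hsum) with ha
  have hd : ∀ n, a.seq n - a.seq (n - 1) = α n := fun n ↦ by
    rw [ha, L2dSeq.ofDiff_seq, L2dSeq.ofDiff_seq, add_sub_add_left_eq_sub, antidiff_sub]
  refine ⟨a, fun n ↦ ?_, ?_⟩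
  · refine congrFun (eq_of_succ_eq (f := fun n ↦ Complex.exp (Complex.I * (a.seq n : ℂ))) (g := u)
      (fun n ↦ Equiv.mulLeft₀ (u n / u (n - 1)) (div_ne_zero (hu0 _) (hu0 _))) ?_ ?_ ?_) n
    · simp only [ha, L2dSeq.ofDiff_seq, antidiff_zero, add_zero]
      exact hcexp _ (hu 0)
    · intro n
      change _ = u n / u (n - 1) * _
      rw [← hcexp _ (hr1 n), ← Complex.exp_add]
      congr 1
      have : a.seq n = α n + a.seq (n - 1) := by rw [← hd n]; ring
      rw [this]
      push_cast
      ring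
    · intro n
      change _ = u n / u (n - 1) * _
      rw [div_mul_cancel₀ _ (hu0 _)]
  · rw [L2dSeq.norm_sq, ← tsum_mul_left]
    simp only [hd]
    exact hsum.tsum_le_tsum hsq (hs.mul_left _)

/-- Phase sequences in the small ball of `ℓ²_d` are controlled by their exponentials. -/
theorem L2dSeq.norm_sub_le_of_phases {a a' : L2dSeq} (ha : ‖a‖ ^ 2 < 1 / 2) (ha' : ‖a'‖ ^ 2 < 1 / 2)
    {c : ℤ → ℂ} {e : ℤ → ℝ}
    (hca : ∀ n, ‖c n * Complex.exp (Complex.I * (a.seq n : ℂ))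
      - Complex.exp (Complex.I * (a'.seq n : ℂ))‖ ≤ e n)
    (hcc : ∀ n, ‖c n - c (n - 1)‖ ≤ e n + e (n - 1)) (hs : Summable fun n ↦ e n ^ 2) :
    ‖a' - a‖ ^ 2 ≤ 16 * Real.pi ^ 2 * ∑' n, e n ^ 2 := by
  have hsmall : ∀ {t : ℝ}, 0 ≤ t → t ^ 2 < 1 / 2 → t ≤ 1 := fun h1 h2 ↦ by nlinarith
  have h1 : ∀ n, |(a' - a).seq n - (a' - a).seq (n - 1)| ≤ Real.pi * (e n + e (n - 1)) := by
    intro n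
    have h2 : |(a' - a).seq n - (a' - a).seq (n - 1)| ≤ Real.pi := by
      refine ((a' - a).abs_sub_le n).trans ((norm_sub_le _ _).trans ?_)
      linarith [hsmall (norm_nonneg _) ha, hsmall (norm_nonneg _) ha', Real.pi_gt_three]
    refine (abs_le_mul_norm_cexp_sub_one h2).trans ?_
    set v := fun n ↦ Complex.exp (Complex.I * (a.seq n : ℂ))
    set v' := fun n ↦ Complex.exp (Complex.I * (a'.seq n : ℂ))
    have hv : ∀ n, ‖v n‖ = 1 := fun n ↦ norm_cexp_I_mul _
    have hv' : ∀ n, ‖v' n‖ = 1 := fun n ↦ norm_cexp_I_mul _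
    have hv0 : ∀ n, v n ≠ 0 := fun n ↦ Complex.exp_ne_zero _
    have hv0' : ∀ n, v' n ≠ 0 := fun n ↦ Complex.exp_ne_zero _
    have e1 : Complex.exp (Complex.I * (((a' - a).seq n - (a' - a).seq (n - 1) : ℝ) : ℂ))
        = v' n * v (n - 1) / (v n * v' (n - 1)) := by
      rw [eq_div_iff (mul_ne_zero (hv0 _) (hv0' _))]
      simp only [v, v', ← Complex.exp_add]
      congr 1
      rw [map_sub, Pi.sub_apply, Pi.sub_apply]
      push_cast
      ring
    have e2 : ‖Complex.exp (Complex.I * (((a' - a).seq n - (a' - a).seq (n - 1) : ℝ) : ℂ)) - 1‖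
        = ‖v' n * v (n - 1) - v n * v' (n - 1)‖ := by
      rw [e1, div_sub_one (mul_ne_zero (hv0 _) (hv0' _)), norm_div, norm_mul (v n), hv, hv',
        mul_one, div_one]
    have e3 : v' n * v (n - 1) - v n * v' (n - 1)
        = -(c n * v n - v' n) * v (n - 1) + v n * (c n - c (n - 1)) * v (n - 1)
          + v n * (c (n - 1) * v (n - 1) - v' (n - 1)) := by ring
    rw [e2, e3]
    have h4 : ‖-(c n * v n - v' n) * v (n - 1) + v n * (c n - c (n - 1)) * v (n - 1)
          + v n * (c (n - 1) * v (n - 1) - v' (n - 1))‖ ≤ e n + (e n + e (n - 1)) + e (n - 1) := by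
      refine (norm_add₃_le).trans ?_
      simp only [norm_mul, norm_neg, hv, mul_one, one_mul]
      exact add_le_add_three (hca n) (hcc n) (hca (n - 1))
    calc _ ≤ Real.pi / 2 * (e n + (e n + e (n - 1)) + e (n - 1)) := by gcongr
      _ = _ := by ring
  have hs' : Summable fun n : ℤ ↦ e (n - 1) ^ 2 :=
    (Equiv.subRight (1 : ℤ)).summable_iff (f := fun n ↦ e n ^ 2) |>.2 hs
  have ht : ∑' n : ℤ, e (n - 1) ^ 2 = ∑' n, e n ^ 2 :=
    (Equiv.subRight (1 : ℤ)).tsum_eq (fun n ↦ e n ^ 2)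
  have hsum := (hs.mul_left (2 * Real.pi ^ 2)).add (hs'.mul_left (2 * Real.pi ^ 2))
  rw [L2dSeq.norm_sq]
  refine ((a' - a).summable_sq.tsum_le_tsum (fun n ↦ ?_) hsum).trans ?_
  · rw [← sq_abs]
    refine (pow_le_pow_left₀ (abs_nonneg _) (h1 n) 2).trans ?_
    nlinarith [mul_nonneg (sq_nonneg Real.pi) (sq_nonneg (e n - e (n - 1)))]
  · rw [(hs.mul_left _).tsum_add (hs'.mul_left _), tsum_mul_left, tsum_mul_left, ht]
    have : 0 ≤ ∑' n, e n ^ 2 := tsum_nonneg fun _ ↦ sq_nonneg _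
    nlinarith [mul_nonneg (sq_nonneg Real.pi) this]

/-! ### Correlations with a function of bounded energy -/

/-- The correlation of `p` with `q` on the `n`-th cell. -/
def Windows.corr {η ρ : ℝ → ℝ} (w : Windows η ρ) (s : ℝ) (L : ℕ+) (q p : ℝ → ℂ) (n : ℤ) : ℂ :=
  inner ℂ (loc s (cell L w.ηS n) q) (loc s (cell L w.ηS n) p)

theorem Windows.toHs_windowed {η ρ : ℝ → ℝ} (w : Windows η ρ) (s : ℝ) (L : ℕ+) (f : ℝ → ℂ) (n : ℤ) :
    toHs s (windowed η ((L : ℕ) : ℝ) n f) = loc s (cell L w.ηS n) f := by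
  have : windowed η ((L : ℕ) : ℝ) n f = fun x ↦ cell L w.ηS n x * f x := by
    funext x
    rw [windowed, w.window_η]
  rw [this, loc]

theorem Windows.correlation_eq {η ρ : ℝ → ℝ} (w : Windows η ρ) (s : ℝ) (L : ℕ+) (q p : EnergyFun s)
    (n : ℤ) : correlation s η ((L : ℕ) : ℝ) q p n = w.corr s L q.toFun p.toFun n := by
  rw [correlation, hsInner, w.toHs_windowed, w.toHs_windowed, corr]

/-- The function `q` is bounded below and above on all cells of scale `L`. -/
structure Windows.Good {η ρ : ℝ → ℝ} (w : Windows η ρ) (s : ℝ) (L : ℕ+) (B : ℝ) (q : ℝ → ℂ) :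
    Prop where
  locHs : LocHs s q
  bound : ∀ n, ‖loc s (cell L w.χS n) q‖ ≤ B
  lower : ∀ n, 1 / 2 ≤ ‖loc s (cell L w.ηS n) q‖ ^ 2

theorem Windows.one_le_integral_η {η ρ : ℝ → ℝ} (w : Windows η ρ) : 1 ≤ ∫ x, ‖w.ηS x‖ ^ 2 := by
  have hcont : Continuous fun x ↦ ‖w.ηS x‖ ^ 2 := (w.ηS.continuous.norm).pow 2
  have hcs : HasCompactSupport fun x ↦ ‖w.ηS x‖ ^ 2 :=
    w.η_compact.comp_left (g := fun z : ℂ ↦ ‖z‖ ^ 2) (by simp)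
  have hint : Integrable (fun x ↦ ‖w.ηS x‖ ^ 2) := hcont.integrable_of_hasCompactSupport hcs
  have h1 : ∫ x in Set.Icc (-1 / 2 : ℝ) (1 / 2), ‖w.ηS x‖ ^ 2 = 1 := by
    rw [setIntegral_congr_fun (g := fun _ ↦ (1 : ℝ)) measurableSet_Icc]
    · simp; norm_num
    · intro x hx
      have := w.η_eq_one x (abs_le.2 ⟨by linarith [hx.1], hx.2⟩)
      simp [w.ηS_apply, this]
  rw [← h1]
  exact setIntegral_le_integral hint (.of_forall fun x ↦ by positivity)

theorem Windows.exists_good {η ρ : ℝ → ℝ} (w : Windows η ρ) {s : ℝ} (hs : 0 ≤ s) (N : ℝ) :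
    ∃ (L : ℕ+) (B : ℝ), 1 ≤ B ∧ ∀ q : EnergyFun s, energy s q.toFun ≤ ENNReal.ofReal N →
      w.Good s L B q.toFun := by
  obtain ⟨C, hC⟩ := exists_le_norm_loc_sq hs N w.η_compact
  obtain ⟨m, hm⟩ := exists_nat_gt ((|C| + 1) ^ 2)
  have hm0 : 0 < m := by
    have : (0 : ℝ) < m := (by positivity : (0 : ℝ) ≤ (|C| + 1) ^ 2).trans_lt hm
    exact_mod_cast this
  set L : ℕ+ := ⟨m, hm0⟩
  have hLm : ((L : ℕ) : ℝ) = m := rfl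
  obtain ⟨B, hB0, hB⟩ := exists_norm_loc_le hs N
    (hasCompactSupport_dilate w.χ_compact (cast_pnat_pos L))
  refine ⟨L, max B 1, le_max_right _ _, fun q hq ↦ ⟨q.locHs, fun n ↦ ?_, fun n ↦ ?_⟩⟩
  · exact (hB q _ hq).trans (le_max_left _ _)
  · refine le_trans ?_ (hC _ (one_le_cast_pnat L) q (4 * ((L : ℕ) : ℝ) * n) hq)
    have h1 := w.one_le_integral_η
    have h2 : |C| + 1 ≤ √((L : ℕ) : ℝ) := Real.le_sqrt_of_sq_le (by rw [hLm]; exact hm.le)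
    have h3 := Real.mul_self_sqrt (cast_pnat_pos L).le
    have h4 := le_abs_self C
    have h5 := mul_le_mul_of_nonneg_left h1 (cast_pnat_pos L).le
    have h6 : 1 ≤ √((L : ℕ) : ℝ) := by linarith [abs_nonneg C]
    nlinarith

theorem Windows.η_mul_χ {η ρ : ℝ → ℝ} (w : Windows η ρ) (L : ℕ+) {m n : ℤ} (hmn : |n - m| ≤ 1)
    (x : ℝ) : cell L w.ηS m x * cell L w.χS n x = cell L w.ηS m x := by
  have hL := cast_pnat_pos L
  rw [cell_apply, cell_apply, w.ηS_apply]
  by_cases h : |(x - 4 * ((L : ℕ) : ℝ) * m) / ((L : ℕ) : ℝ)| ≤ 1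
  · rw [w.χ_eq_one, mul_one]
    have e : (x - 4 * ((L : ℕ) : ℝ) * n) / ((L : ℕ) : ℝ)
        = (x - 4 * ((L : ℕ) : ℝ) * m) / ((L : ℕ) : ℝ) - 4 * ((n - m : ℤ) : ℝ) := by
      push_cast
      field_simp
      ring
    rw [e]
    have h1 : |((n - m : ℤ) : ℝ)| ≤ 1 := by
      rw [← Int.cast_abs]
      exact_mod_cast hmn
    rw [abs_le] at *
    constructor <;> linarith [h.1, h.2, h1.1, h1.2]
  · rw [w.η_eq_zero _ (not_le.1 h)]
    simp

theorem Windows.norm_loc_η_le {η ρ : ℝ → ℝ} (w : Windows η ρ) {s : ℝ} (L : ℕ+) {f : ℝ → ℂ}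
    (hf : LocHs s f) {m n : ℤ} (hmn : |n - m| ≤ 1) :
    ‖loc s (cell L w.ηS m) f‖ ≤ (multBound s w.ηS).toReal * ‖loc s (cell L w.χS n) f‖ := by
  rw [← hf.mulOp_loc (w.hasCompactSupport_χ L n) (w.η_mul_χ L hmn)]
  exact (ContinuousLinearMap.le_opNorm _ _).trans
    (mul_le_mul_of_nonneg_right (norm_mulOp_cell_le _ _ _ _) (norm_nonneg _))

theorem Windows.Good.norm_loc_η_le {η ρ : ℝ → ℝ} {w : Windows η ρ} {s : ℝ} {L : ℕ+} {B : ℝ}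
    {q : ℝ → ℂ} (hq : w.Good s L B q) (n : ℤ) :
    ‖loc s (cell L w.ηS n) q‖ ≤ (multBound s w.ηS).toReal * B :=
  (w.norm_loc_η_le L hq.locHs (by simp)).trans
    (mul_le_mul_of_nonneg_left (hq.bound n) ENNReal.toReal_nonneg)

/-- Two functions that are close on cells up to phases have close correlations. -/
theorem Windows.Good.norm_corr_sub_le {η ρ : ℝ → ℝ} {w : Windows η ρ} {s : ℝ} {L : ℕ+} {B : ℝ}
    {q : ℝ → ℂ} (hq : w.Good s L B q) {p p' : ℝ → ℂ} (hp : LocHs s p) (hp' : LocHs s p')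
    {c : ℂ} {e : ℝ} {n : ℤ}
    (he : ‖loc s (cell L w.χS n) (fun x ↦ c * p x - p' x)‖ ≤ e) :
    ‖c * w.corr s L q p n - w.corr s L q p' n‖ ≤ (multBound s w.ηS).toReal ^ 2 * B * e := by
  have hη := w.hasCompactSupport_η L n
  have e1 : c * w.corr s L q p n - w.corr s L q p' n
      = inner ℂ (loc s (cell L w.ηS n) q) (loc s (cell L w.ηS n) (fun x ↦ c * p x - p' x)) := by
    rw [(hp.const_mul c).loc_sub hp' hη, hp.loc_const_mul hη, inner_sub_right, inner_smul_right]
    rfl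
  rw [e1]
  refine (norm_inner_le_norm _ _).trans ?_
  have h2 := w.norm_loc_η_le L ((hp.const_mul c).sub hp') (m := n) (n := n) (by simp)
  have h3 := hq.norm_loc_η_le n
  have hκ : 0 ≤ (multBound s w.ηS).toReal := ENNReal.toReal_nonneg
  calc _ ≤ ((multBound s w.ηS).toReal * B) * ((multBound s w.ηS).toReal * e) :=
        mul_le_mul h3 (h2.trans (mul_le_mul_of_nonneg_left he hκ)) (norm_nonneg _)
          ((norm_nonneg _).trans h3)
    _ = _ := by ring

theorem Windows.Good.norm_phase_sub_le {η ρ : ℝ → ℝ} {w : Windows η ρ} {s : ℝ} {L : ℕ+} {B : ℝ}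
    {q : ℝ → ℂ} (hq : w.Good s L B q) {p p' : ℝ → ℂ} (hp : LocHs s p) (hp' : LocHs s p')
    {c : ℤ → ℂ} {e : ℤ → ℝ}
    (he : ∀ n, ‖loc s (cell L w.χS n) (fun x ↦ c n * p x - p' x)‖ ≤ e n)
    {n : ℤ} (hn : 1 / 4 ≤ ‖w.corr s L q p (n - 1)‖) :
    ‖c n - c (n - 1)‖ ≤ 4 * (multBound s w.ηS).toReal ^ 2 * B * (e n + e (n - 1)) := by
  have hη := w.hasCompactSupport_η L (n - 1)
  set κ := (multBound s w.ηS).toReal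
  have hκ : 0 ≤ κ := ENNReal.toReal_nonneg
  set v := loc s (cell L w.ηS (n - 1)) p
  have e1 : (c n - c (n - 1)) • v
      = loc s (cell L w.ηS (n - 1)) (fun x ↦ c n * p x - p' x)
        - loc s (cell L w.ηS (n - 1)) (fun x ↦ c (n - 1) * p x - p' x) := by
    rw [(hp.const_mul _).loc_sub hp' hη, (hp.const_mul _).loc_sub hp' hη, hp.loc_const_mul hη,
      hp.loc_const_mul hη, sub_smul]
    abel
  have h1 : ‖c n - c (n - 1)‖ * ‖v‖ ≤ κ * (e n + e (n - 1)) := by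
    rw [← norm_smul, e1]
    refine (norm_sub_le _ _).trans ?_
    rw [mul_add]
    refine add_le_add ?_ ?_
    · exact (w.norm_loc_η_le L ((hp.const_mul _).sub hp') (n := n) (by simp)).trans
        (mul_le_mul_of_nonneg_left (he n) hκ)
    · exact (w.norm_loc_η_le L ((hp.const_mul _).sub hp') (n := n - 1) (by simp)).trans
        (mul_le_mul_of_nonneg_left (he _) hκ)
  have h2 : 1 / 4 ≤ κ * B * ‖v‖ := hn.trans ((norm_inner_le_norm _ _).trans
    (mul_le_mul_of_nonneg_right (hq.norm_loc_η_le _) (norm_nonneg _)))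
  have hB : 0 ≤ κ * B := (norm_nonneg _).trans (hq.norm_loc_η_le n)
  have h3 := mul_le_mul_of_nonneg_left h1 hB
  have h4 := mul_le_mul_of_nonneg_left h2 (norm_nonneg (c n - c (n - 1)))
  nlinarith


/-! ### Coordinates of functions -/

/-- `(a, b)` are coordinates of the function `p` in the chart around `q`. -/
structure Windows.Coord {η ρ : ℝ → ℝ} (w : Windows η ρ) (s : ℝ) (L : ℕ+) (q p : ℝ → ℂ)
    (a : L2dSeq) (b : Hs s) : Prop where
  phase_eq : ∀ n, Complex.exp (Complex.I * (a.seq n : ℂ))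
    = w.corr s L q p n / (‖w.corr s L q p n‖ : ℂ)
  small : ‖a‖ ^ 2 < 1 / 2
  represents : b.Represents (fun x ↦
    Complex.exp (-Complex.I * (phase ρ ((L : ℕ) : ℝ) a.seq x : ℂ)) * p x - q x)

/-- `p` is so close to `q` that its correlations with `q` are bounded below. -/
structure Windows.Near {η ρ : ℝ → ℝ} (w : Windows η ρ) (s : ℝ) (L : ℕ+) (B : ℝ) (q p : ℝ → ℂ) :
    Prop where
  locHs : LocHs s p
  bound : ∀ n, ‖loc s (cell L w.χS n) p‖ ≤ B + 1
  lower : ∀ n, 1 / 4 ≤ ‖w.corr s L q p n‖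

theorem Windows.Coord.corr_ne_zero {η ρ : ℝ → ℝ} {w : Windows η ρ} {s : ℝ} {L : ℕ+} {q p : ℝ → ℂ}
    {a : L2dSeq} {b : Hs s} (h : w.Coord s L q p a b) (n : ℤ) : w.corr s L q p n ≠ 0 := fun h0 ↦ by
  have := h.phase_eq n
  rw [h0, zero_div] at this
  exact Complex.exp_ne_zero _ this

theorem Windows.Coord.norm_le_one {η ρ : ℝ → ℝ} {w : Windows η ρ} {s : ℝ} {L : ℕ+} {q p : ℝ → ℂ}
    {a : L2dSeq} {b : Hs s} (h : w.Coord s L q p a b) : ‖a‖ ≤ 1 := by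
  nlinarith [h.small, norm_nonneg a]

theorem Windows.contDiff_cexp_phase {η ρ : ℝ → ℝ} (w : Windows η ρ) (L : ℕ+) (a : ℤ → ℝ) (z : ℂ) :
    ContDiff ℝ ∞ fun x ↦ Complex.exp (z * (phase ρ ((L : ℕ) : ℝ) a x : ℂ)) :=
  Complex.contDiff_exp.comp (contDiff_const.mul
    (Complex.ofRealCLM.contDiff.comp (w.contDiff_phase L a)))

theorem Windows.loc_η_phase {η ρ : ℝ → ℝ} (w : Windows η ρ) {s : ℝ} (L : ℕ+) (n : ℤ) {f : ℝ → ℂ}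
    (hf : LocHs s f) (a : ℤ → ℝ) (z : ℂ) :
    loc s (cell L w.ηS n) (fun x ↦ Complex.exp (z * (phase ρ ((L : ℕ) : ℝ) a x : ℂ)) * f x)
      = Complex.exp (z * (a n : ℂ)) • loc s (cell L w.ηS n) f := by
  rw [← hf.loc_const_mul (w.hasCompactSupport_η L n)]
  refine loc_congr fun x ↦ ?_
  by_cases h : |x - 4 * ((L : ℕ) : ℝ) * n| ≤ ((L : ℕ) : ℝ)
  · rw [w.phase_eq_of_abs_le h]
  · have hL := cast_pnat_pos L
    rw [cell_apply, w.ηS_apply, w.η_eq_zero]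
    · simp
    · rw [abs_div, abs_of_pos hL, one_lt_div hL]
      exact not_le.1 h

theorem Windows.corr_self {η ρ : ℝ → ℝ} (w : Windows η ρ) (s : ℝ) (L : ℕ+) (q : ℝ → ℂ) (n : ℤ) :
    w.corr s L q q n = ((‖loc s (cell L w.ηS n) q‖ ^ 2 : ℝ) : ℂ) := by
  rw [corr, inner_self_eq_norm_sq_to_K]
  norm_cast

theorem Windows.Coord.mulOp_η {η ρ : ℝ → ℝ} {w : Windows η ρ} {s : ℝ} {L : ℕ+} {q p : ℝ → ℂ}
    {a : L2dSeq} {b : Hs s} (h : w.Coord s L q p a b) (hq : LocHs s q) (hp : LocHs s p) (n : ℤ) :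
    mulOp s (cell L w.ηS n) b = Complex.exp (-Complex.I * (a.seq n : ℂ)) • loc s (cell L w.ηS n) p
      - loc s (cell L w.ηS n) q := by
  have hη := w.hasCompactSupport_η L n
  rw [← loc_of_represents h.represents,
    (hp.smooth_mul (w.contDiff_cexp_phase L a.seq _)).loc_sub hq hη, w.loc_η_phase L n hp]

theorem Windows.Coord.inner_mulOp_η {η ρ : ℝ → ℝ} {w : Windows η ρ} {s : ℝ} {L : ℕ+} {q p : ℝ → ℂ}
    {a : L2dSeq} {b : Hs s} (h : w.Coord s L q p a b) (hq : LocHs s q) (hp : LocHs s p) (n : ℤ) :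
    (inner ℂ (loc s (cell L w.ηS n) q) (mulOp s (cell L w.ηS n) b) : ℂ)
      = ((‖w.corr s L q p n‖ - ‖loc s (cell L w.ηS n) q‖ ^ 2 : ℝ) : ℂ) := by
  rw [h.mulOp_η hq hp, inner_sub_right, inner_smul_right]
  change _ * w.corr s L q p n - w.corr s L q q n = _
  have h0 : (‖w.corr s L q p n‖ : ℂ) ≠ 0 := by
    exact_mod_cast norm_ne_zero_iff.2 (h.corr_ne_zero n)
  have h1 : Complex.exp (Complex.I * (a.seq n : ℂ)) * (‖w.corr s L q p n‖ : ℂ)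
      = w.corr s L q p n := by
    rw [h.phase_eq, div_mul_cancel₀ _ h0]
  have h2 : Complex.exp (-Complex.I * (a.seq n : ℂ)) * w.corr s L q p n
      = (‖w.corr s L q p n‖ : ℂ) := by
    conv_lhs => rw [← h1]
    rw [← mul_assoc, ← Complex.exp_add, neg_mul, neg_add_cancel, Complex.exp_zero, one_mul]
  rw [h2, w.corr_self, Complex.ofReal_sub]

theorem Windows.mem_Htilde_iff {η ρ : ℝ → ℝ} (w : Windows η ρ) {s : ℝ} {L : ℕ+} {q : EnergyFun s}
    {b : Hs s} : b ∈ Htilde s η ((L : ℕ) : ℝ) q ↔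
      ∀ n, (inner ℂ (loc s (cell L w.ηS n) q.toFun) (mulOp s (cell L w.ηS n) b) : ℂ).im = 0 := by
  have e : ∀ n : ℤ, (fun x ↦ (window η ((L : ℕ) : ℝ) n x : ℂ)) = cell L w.ηS n := fun n ↦
    funext fun x ↦ w.window_η L n x
  constructor
  · intro h n
    obtain ⟨v, hv, hi⟩ := h n
    rw [e, ← toDistribution_mulOp] at hv
    have : v = mulOp s (cell L w.ηS n) b := Hs.ext_of_hasCompactSupport fun φ _ ↦ by rw [hv]
    rwa [w.toHs_windowed, this] at hi
  · intro h n
    refine ⟨mulOp s (cell L w.ηS n) b, ?_, ?_⟩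
    · rw [e, toDistribution_mulOp]
    · rw [w.toHs_windowed]
      exact h n

theorem Windows.Coord.mem_Htilde {η ρ : ℝ → ℝ} {w : Windows η ρ} {s : ℝ} {L : ℕ+} {q : EnergyFun s}
    {p : ℝ → ℂ} {a : L2dSeq} {b : Hs s} (h : w.Coord s L q.toFun p a b) (hp : LocHs s p) :
    b ∈ Htilde s η ((L : ℕ) : ℝ) q :=
  w.mem_Htilde_iff.2 fun n ↦ by rw [h.inner_mulOp_η q.locHs hp, Complex.ofReal_im]

/-- The function with coordinates `(a, b)`. -/
def ofCoord (ρ : ℝ → ℝ) {s : ℝ} (hs : 0 ≤ s) (L : ℕ+) (q : ℝ → ℂ) (a : L2dSeq) (b : Hs s) (x : ℝ) :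
    ℂ :=
  Complex.exp (Complex.I * (phase ρ ((L : ℕ) : ℝ) a.seq x : ℂ)) * (q x + Hs.fn hs b x)

theorem Windows.locHs_ofCoord {η ρ : ℝ → ℝ} (w : Windows η ρ) {s : ℝ} (hs : 0 ≤ s) (L : ℕ+)
    {q : ℝ → ℂ} (hq : LocHs s q) (a : L2dSeq) (b : Hs s) : LocHs s (ofCoord ρ hs L q a b) :=
  (hq.add (LocHs.fn hs b)).smooth_mul (w.contDiff_cexp_phase L a.seq _)

theorem cexp_neg_mul_cancel (x : ℂ) (z : ℂ) :
    Complex.exp (-Complex.I * x) * (Complex.exp (Complex.I * x) * z) = z := by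
  rw [← mul_assoc, ← Complex.exp_add, neg_mul, neg_add_cancel, Complex.exp_zero, one_mul]

theorem cexp_mul_cancel (x : ℂ) (z : ℂ) :
    Complex.exp (Complex.I * x) * (Complex.exp (-Complex.I * x) * z) = z := by
  rw [← mul_assoc, ← Complex.exp_add, neg_mul, add_neg_cancel, Complex.exp_zero, one_mul]

theorem Windows.coord_ofCoord {η ρ : ℝ → ℝ} (w : Windows η ρ) {s : ℝ} (hs : 0 ≤ s) {L : ℕ+}
    {q : ℝ → ℂ} (hq : LocHs s q) {a : L2dSeq} {b : Hs s} (ha : ‖a‖ ^ 2 < 1 / 2)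
    (him : ∀ n, (inner ℂ (loc s (cell L w.ηS n) q) (mulOp s (cell L w.ηS n) b) : ℂ).im = 0)
    (hre : ∀ n, 0 < ‖loc s (cell L w.ηS n) q‖ ^ 2
      + (inner ℂ (loc s (cell L w.ηS n) q) (mulOp s (cell L w.ηS n) b) : ℂ).re) :
    w.Coord s L q (ofCoord ρ hs L q a b) a b := by
  refine ⟨fun n ↦ ?_, ha, (Hs.represents_fn hs b).congr (.of_forall fun x ↦ ?_)⟩
  · have hη := w.hasCompactSupport_η L n
    set t : ℝ := ‖loc s (cell L w.ηS n) q‖ ^ 2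
      + (inner ℂ (loc s (cell L w.ηS n) q) (mulOp s (cell L w.ηS n) b) : ℂ).re
    have e : w.corr s L q (ofCoord ρ hs L q a b) n
        = Complex.exp (Complex.I * (a.seq n : ℂ)) * (t : ℂ) := by
      have h1 : loc s (cell L w.ηS n) (ofCoord ρ hs L q a b)
          = Complex.exp (Complex.I * (a.seq n : ℂ)) •
            (loc s (cell L w.ηS n) q + mulOp s (cell L w.ηS n) b) := by
        rw [← loc_of_represents (Hs.represents_fn hs b), ← hq.loc_add (LocHs.fn hs b) hη,
          ← w.loc_η_phase L n (hq.add (LocHs.fn hs b))]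
        rfl
      rw [corr, h1, inner_smul_right, inner_add_right]
      change _ * (w.corr s L q q n + _) = _
      rw [w.corr_self]
      congr 1
      apply Complex.ext
      · simp [t]
      · rw [Complex.add_im, Complex.ofReal_im, him n, Complex.ofReal_im, add_zero]
    have ht : ‖(t : ℂ)‖ = t := by rw [Complex.norm_real, Real.norm_of_nonneg (hre n).le]
    rw [e, norm_mul, norm_cexp_I_mul, one_mul, ht, mul_div_assoc, div_self, mul_one]
    exact Complex.ofReal_ne_zero.2 (hre n).ne'
  · simp only [ofCoord]
    rw [cexp_neg_mul_cancel, add_sub_cancel_left]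

/-- Coordinates depend in a Lipschitz way on the cells of a function. -/
theorem Windows.exists_coord_sub_le {η ρ : ℝ → ℝ} (w : Windows η ρ) (s : ℝ) (L : ℕ+) {B : ℝ}
    (hB : 0 ≤ B) : ∃ C : ℝ, 0 ≤ C ∧ ∀ (q p p' : ℝ → ℂ) (a a' : L2dSeq) (b b' : Hs s) (c : ℤ → ℂ)
      (e : ℤ → ℝ), w.Good s L B q → w.Near s L B q p → LocHs s p' → w.Coord s L q p a b →
      w.Coord s L q p' a' b' → (∀ n, ‖c n‖ = 1) →
      (∀ n, ‖loc s (cell L w.χS n) (fun x ↦ c n * p x - p' x)‖ ≤ e n) →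
      Summable (fun n ↦ e n ^ 2) →
      ‖a' - a‖ ≤ C * √(∑' n, e n ^ 2) ∧ ‖b' - b‖ ≤ C * √(∑' n, e n ^ 2) := by
  obtain ⟨C₁, hC₁0, hC₁⟩ := w.exists_difference s L (B + 1) 1
  set κ := (multBound s w.ηS).toReal
  have hκ : 0 ≤ κ := ENNReal.toReal_nonneg
  set D := 1 + 8 * κ ^ 2 * B with hD
  have hκB : 0 ≤ κ ^ 2 * B := by positivity
  have hD1 : 1 ≤ D := by linarith
  have hpi := Real.pi_pos
  refine ⟨4 * Real.pi * D + C₁ * (D + 4 * Real.pi * D), by positivity,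
    fun q p p' a a' b b' c e hq hp hp' ha ha' hc he hes ↦ ?_⟩
  have he0 : ∀ n, 0 ≤ e n := fun n ↦ (norm_nonneg _).trans (he n)
  have hc0 : ∀ n, c n ≠ 0 := fun n h ↦ by have := hc n; rw [h] at this; simp at this
  have hca : ∀ n, ‖c n * Complex.exp (Complex.I * (a.seq n : ℂ))
      - Complex.exp (Complex.I * (a'.seq n : ℂ))‖ ≤ D * e n := by
    intro n
    have h1 := hq.norm_corr_sub_le hp.locHs hp' (he n)
    have h2 := norm_unit_sub_unit_le (mul_ne_zero (hc0 n) (ha.corr_ne_zero n))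
      (w.corr s L q p' n)
    rw [norm_mul, hc, one_mul, ← ha'.phase_eq, mul_div_assoc, ← ha.phase_eq, norm_sub_rev,
      norm_sub_rev _ (c n * _)] at h2
    refine h2.trans ?_
    rw [div_le_iff₀ (by linarith [hp.lower n])]
    have h3 : D * e n * (1 / 4) ≤ D * e n * ‖w.corr s L q p n‖ :=
      mul_le_mul_of_nonneg_left (hp.lower n) (mul_nonneg (by linarith) (he0 n))
    nlinarith [he0 n]
  have hcc : ∀ n, ‖c n - c (n - 1)‖ ≤ D * e n + D * e (n - 1) := fun n ↦ by
    refine (hq.norm_phase_sub_le hp.locHs hp' he (hp.lower _)).trans ?_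
    nlinarith [mul_nonneg hκB (add_nonneg (he0 n) (he0 (n - 1))), he0 n, he0 (n - 1)]
  have hes' : Summable fun n ↦ (D * e n) ^ 2 := by
    simp only [mul_pow]
    exact hes.mul_left _
  have hS : 0 ≤ ∑' n, e n ^ 2 := tsum_nonneg fun _ ↦ by positivity
  have ht : √(∑' n, (D * e n) ^ 2) = D * √(∑' n, e n ^ 2) := by
    simp only [mul_pow]
    rw [tsum_mul_left, Real.sqrt_mul (by positivity), Real.sqrt_sq (by linarith)]
  set t := √(∑' n, e n ^ 2)
  have ht0 : 0 ≤ t := Real.sqrt_nonneg _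
  have h1 : ‖a' - a‖ ≤ 4 * Real.pi * D * t := by
    refine (abs_le_of_sq_le_sq' ?_ (by positivity)).2
    refine (L2dSeq.norm_sub_le_of_phases ha.small ha'.small hca hcc hes').trans ?_
    have := Real.sq_sqrt (tsum_nonneg (L := .unconditional ℤ) fun n ↦ sq_nonneg (D * e n))
    rw [ht] at this
    rw [← this]
    exact le_of_eq (by ring)
  obtain ⟨g, hg, hgn⟩ := hC₁ p p' a a' c (fun n ↦ D * e n) hp.locHs hp' ha.norm_le_one
    ha'.norm_le_one hp.bound (fun n ↦ (he n).trans (by nlinarith [he0 n])) hca hes'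
  have hl := fun (a : L2dSeq) {p : ℝ → ℂ} (hp : LocHs s p) ↦
    ((hp.smooth_mul (w.contDiff_cexp_phase L a.seq (-Complex.I))).sub hq.locHs).locallyIntegrable
  have hgb : g = b' - b := by
    refine hg.unique ((ha'.represents.sub ha.represents (hl a' hp') (hl a hp.locHs)).congr
      (.of_forall fun x ↦ ?_))
    ring
  rw [ht, hgb] at hgn
  have h2 : C₁ * (D * t + ‖a' - a‖) ≤ C₁ * (D + 4 * Real.pi * D) * t := by
    rw [mul_assoc]
    refine mul_le_mul_of_nonneg_left ?_ hC₁0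
    linarith
  have h3 : 0 ≤ 4 * Real.pi * D * t := by positivity
  have h4 : 0 ≤ C₁ * (D + 4 * Real.pi * D) * t := by positivity
  constructor <;> linarith

theorem norm_loc_conj_sub {s : ℝ} {p q : ℝ → ℂ} (hp : LocHs s p) (hq : LocHs s q) {χ : 𝓢(ℝ, ℂ)}
    (hχ : HasCompactSupport χ) {c : ℂ} (hc : ‖c‖ = 1) :
    ‖loc s χ (fun x ↦ starRingEnd ℂ c * q x - p x)‖ = ‖loc s χ (fun x ↦ c * p x - q x)‖ := by
  have hcc : starRingEnd ℂ c * c = 1 := by rw [Complex.conj_mul', hc]; simp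
  have e1 : loc s χ (fun x ↦ starRingEnd ℂ c * q x - p x)
      = -(starRingEnd ℂ c • loc s χ (fun x ↦ c * p x - q x)) := by
    rw [(hq.const_mul _).loc_sub hp hχ, (hp.const_mul _).loc_sub hq hχ,
      hp.loc_const_mul hχ, hq.loc_const_mul hχ, smul_sub, smul_smul, hcc, one_smul, neg_sub]
  rw [e1, norm_neg, norm_smul, RCLike.norm_conj, hc, one_mul]

/-- Functions whose cells are close to those of `q` have coordinates. -/
theorem Windows.exists_coord {η ρ : ℝ → ℝ} (w : Windows η ρ) (s : ℝ) (L : ℕ+) {B : ℝ}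
    (hB : 0 ≤ B) : ∃ r : ℝ, 0 < r ∧ ∀ (q p : ℝ → ℂ) (c : ℤ → ℂ) (e : ℤ → ℝ), w.Good s L B q →
      LocHs s p → (∀ n, ‖c n‖ = 1) →
      (∀ n, ‖loc s (cell L w.χS n) (fun x ↦ c n * p x - q x)‖ ≤ e n) →
      Summable (fun n ↦ e n ^ 2) → ∑' n, e n ^ 2 ≤ r ^ 2 →
      w.Near s L B q p ∧ ∃ a b, w.Coord s L q p a b := by
  obtain ⟨C₁, hC₁0, hC₁⟩ := w.exists_difference s L B 1
  set κ := (multBound s w.ηS).toReal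
  have hκ : 0 ≤ κ := ENNReal.toReal_nonneg
  set D := 1 + 8 * κ ^ 2 * B with hD
  have hκB : 0 ≤ κ ^ 2 * B := by positivity
  have hD1 : 1 ≤ D := by linarith
  have hr0 : 0 < 1 / (8 * D) := by positivity
  refine ⟨1 / (8 * D), hr0, fun q p c e hq hp hc he hes her ↦ ?_⟩
  set r := 1 / (8 * D)
  have hrD : D * r = 1 / 8 := by simp only [r]; field_simp
  have he0 : ∀ n, 0 ≤ e n := fun n ↦ (norm_nonneg _).trans (he n)
  have hc0 : ∀ n, c n ≠ 0 := fun n h ↦ by have := hc n; rw [h] at this; simp at this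
  have her' : ∀ n, e n ≤ r := fun n ↦
    (abs_le_of_sq_le_sq' ((hes.le_tsum n fun _ _ ↦ by positivity).trans her) hr0.le).2
  have hcorr : ∀ n, ‖c n * w.corr s L q p n - w.corr s L q q n‖ ≤ κ ^ 2 * B * e n := fun n ↦
    hq.norm_corr_sub_le hp hq.locHs (he n)
  have hself : ∀ n, 1 / 2 ≤ ‖w.corr s L q q n‖ := fun n ↦ by
    rw [w.corr_self, Complex.norm_real, Real.norm_of_nonneg (by positivity)]
    exact hq.lower n
  have hnear : w.Near s L B q p := by
    refine ⟨hp, fun n ↦ ?_, fun n ↦ ?_⟩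
    · have hχ := w.hasCompactSupport_χ L n
      have e1 : c n • loc s (cell L w.χS n) p
          = loc s (cell L w.χS n) (fun x ↦ c n * p x - q x) + loc s (cell L w.χS n) q := by
        rw [(hp.const_mul _).loc_sub hq.locHs hχ, hp.loc_const_mul hχ, sub_add_cancel]
      have e2 : ‖loc s (cell L w.χS n) p‖ = ‖c n • loc s (cell L w.χS n) p‖ := by
        rw [norm_smul, hc, one_mul]
      rw [e2, e1]
      refine (norm_add_le _ _).trans ?_
      nlinarith [he n, hq.bound n, her' n]
    · have h1 := norm_sub_norm_le (w.corr s L q q n) (c n * w.corr s L q p n)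
      rw [norm_sub_rev, norm_mul, hc, one_mul] at h1
      have h2 : κ ^ 2 * B * e n ≤ κ ^ 2 * B * r := mul_le_mul_of_nonneg_left (her' n) hκB
      nlinarith [hcorr n, hself n]
  refine ⟨hnear, ?_⟩
  have hne : ∀ n, w.corr s L q p n ≠ 0 := fun n h ↦ by
    have := hnear.lower n
    rw [h, norm_zero] at this
    norm_num at this
  set u : ℤ → ℂ := fun n ↦ w.corr s L q p n / (‖w.corr s L q p n‖ : ℂ) with hu
  have hu1 : ∀ n, ‖u n‖ = 1 := fun n ↦ by
    rw [hu, norm_div, Complex.norm_real, norm_norm, div_self (norm_ne_zero_iff.2 (hne n))]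
  have hcu : ∀ n, ‖c n * u n - 1‖ ≤ D / 2 * e n := by
    intro n
    have h0 : w.corr s L q q n ≠ 0 := fun h ↦ by
      have := hself n
      rw [h, norm_zero] at this
      norm_num at this
    have h2 := norm_unit_sub_unit_le h0 (c n * w.corr s L q p n)
    have h3 : w.corr s L q q n / (‖w.corr s L q q n‖ : ℂ) = 1 := by
      rw [w.corr_self, Complex.norm_real, Real.norm_of_nonneg (by positivity), div_self]
      rw [← w.corr_self]; exact h0
    rw [h3, norm_mul, hc, one_mul, mul_div_assoc] at h2
    refine h2.trans ?_
    rw [div_le_iff₀ (by linarith [hself n])]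
    have h4 : D / 2 * e n * (1 / 2) ≤ D / 2 * e n * ‖w.corr s L q q n‖ :=
      mul_le_mul_of_nonneg_left (hself n) (mul_nonneg (by linarith) (he0 n))
    nlinarith [hcorr n, he0 n]
  have hcc : ∀ n, ‖c n - c (n - 1)‖ ≤ D / 2 * (e n + e (n - 1)) := fun n ↦ by
    refine (hq.norm_phase_sub_le hp hq.locHs he (hnear.lower _)).trans ?_
    nlinarith [mul_nonneg hκB (add_nonneg (he0 n) (he0 (n - 1))), he0 n, he0 (n - 1)]
  have huu : ∀ n, ‖u n - u (n - 1)‖ ≤ D * (e n + e (n - 1)) := fun n ↦ by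
    have e1 : ‖u n - u (n - 1)‖ = ‖c n * c (n - 1) * (u n - u (n - 1))‖ := by
      rw [norm_mul, norm_mul, hc, hc, one_mul, one_mul]
    have e2 : c n * c (n - 1) * (u n - u (n - 1))
        = c (n - 1) * (c n * u n - 1) - (c n - c (n - 1)) - c n * (c (n - 1) * u (n - 1) - 1) := by
      ring
    rw [e1, e2]
    refine (norm_sub_le _ _).trans ((add_le_add_left (norm_sub_le _ _) _).trans ?_)
    simp only [norm_mul, hc, one_mul]
    linarith [hcu n, hcu (n - 1), hcc n]
  have hs' : Summable fun n : ℤ ↦ e (n - 1) ^ 2 :=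
    (Equiv.subRight (1 : ℤ)).summable_iff (f := fun n ↦ e n ^ 2) |>.2 hes
  have htt : ∑' n : ℤ, e (n - 1) ^ 2 = ∑' n, e n ^ 2 :=
    (Equiv.subRight (1 : ℤ)).tsum_eq (fun n ↦ e n ^ 2)
  have hsum := (hes.mul_left (2 * D ^ 2)).add (hs'.mul_left (2 * D ^ 2))
  have hle : ∀ n, (D * (e n + e (n - 1))) ^ 2 ≤ 2 * D ^ 2 * e n ^ 2 + 2 * D ^ 2 * e (n - 1) ^ 2 :=
    fun n ↦ by nlinarith [mul_nonneg (sq_nonneg D) (sq_nonneg (e n - e (n - 1)))]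
  have hsum' := Summable.of_nonneg_of_le (fun n ↦ sq_nonneg _) hle hsum
  have hbound : ∑' n, (D * (e n + e (n - 1))) ^ 2 ≤ 4 * (D * r) ^ 2 := by
    refine (hsum'.tsum_le_tsum hle hsum).trans ?_
    rw [(hes.mul_left _).tsum_add (hs'.mul_left _), tsum_mul_left, tsum_mul_left, htt]
    nlinarith [mul_le_mul_of_nonneg_left her (sq_nonneg D)]
  obtain ⟨a, ha, han⟩ := exists_l2dSeq_of_phases hu1 huu hsum'
  have ha2 : ‖a‖ ^ 2 < 1 / 2 := by
    refine han.trans_lt ?_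
    rw [hrD] at hbound
    have := Real.pi_lt_four
    nlinarith [Real.pi_pos, mul_le_mul_of_nonneg_left hbound (sq_nonneg (Real.pi / 2))]
  have ha1 : ‖a‖ ≤ 1 := by nlinarith [norm_nonneg a]
  have hcc1 : ∀ n, starRingEnd ℂ (c n) * c n = 1 := fun n ↦ by
    rw [Complex.conj_mul', hc]; simp
  have k1 : ∀ n, ‖loc s (cell L w.χS n) (fun x ↦ starRingEnd ℂ (c n) * q x - p x)‖ ≤ D * e n := by
    intro n
    rw [norm_loc_conj_sub hp hq.locHs (w.hasCompactSupport_χ L n) (hc n)]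
    exact (he n).trans (by nlinarith [he0 n])
  have k2 : ∀ n, ‖starRingEnd ℂ (c n) * Complex.exp (Complex.I * ((0 : L2dSeq).seq n : ℂ))
      - Complex.exp (Complex.I * (a.seq n : ℂ))‖ ≤ D * e n := by
    intro n
    have e1 : starRingEnd ℂ (c n) * Complex.exp (Complex.I * ((0 : L2dSeq).seq n : ℂ))
        - Complex.exp (Complex.I * (a.seq n : ℂ)) = -(starRingEnd ℂ (c n) * (c n * u n - 1)) := by
      rw [ha, map_zero, mul_sub, ← mul_assoc, hcc1]
      simp
    rw [e1, norm_neg, norm_mul, RCLike.norm_conj, hc, one_mul]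
    exact (hcu n).trans (by nlinarith [he0 n])
  have k3 : Summable fun n ↦ (D * e n) ^ 2 := by
    simp only [mul_pow]
    exact hes.mul_left _
  obtain ⟨b, hb, -⟩ := hC₁ q p 0 a _ _ hq.locHs hp (by simp) ha1 hq.bound k1 k2 k3
  refine ⟨a, b, ha, ha2, hb.congr (.of_forall fun x ↦ ?_)⟩
  have : phase ρ ((L : ℕ) : ℝ) (0 : L2dSeq).seq x = 0 := by
    rw [map_zero]
    exact w.phase_const L 0 x
  simp only
  rw [this]
  simp

/-- Functions with close coordinates have close cells. -/
theorem Windows.exists_cells_of_coord {η ρ : ℝ → ℝ} (w : Windows η ρ) {s : ℝ} (hs : 0 ≤ s) (L : ℕ+)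
    (B : ℝ) : ∃ C : ℝ, 0 ≤ C ∧ ∀ (q p p' : ℝ → ℂ) (a a' : L2dSeq) (b b' : Hs s), LocHs s q →
      LocHs s p → (∀ n, ‖loc s (cell L w.χS n) p‖ ≤ B + 1) → LocHs s p' → w.Coord s L q p a b →
      w.Coord s L q p' a' b' →
      ∃ (c : ℤ → ℂ) (e : ℤ → ℝ), (∀ n, ‖c n‖ = 1) ∧
        (∀ n, ‖loc s (cell L w.χS n) (fun x ↦ c n * p x - p' x)‖ ≤ e n) ∧
        (∀ n, ‖c n - c (n - 1)‖ ≤ e n) ∧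
        Summable (fun n ↦ e n ^ 2) ∧ ∑' n, e n ^ 2 ≤ C ^ 2 * (‖a' - a‖ + ‖b' - b‖) ^ 2 := by
  obtain ⟨C, hC0, hC⟩ := w.exists_cells_of_phase hs L (B + 1) 2
  refine ⟨C, hC0, fun q p p' a a' b b' hq hp hpB hp' ha ha' ↦ ?_⟩
  have hl := fun (a : L2dSeq) {p : ℝ → ℂ} (hp : LocHs s p) ↦
    ((hp.smooth_mul (w.contDiff_cexp_phase L a.seq (-Complex.I))).sub hq).locallyIntegrable
  have h1 := ha.represents.ae_eq_fn hs (hl a hp)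
  have h2 := ha'.represents.ae_eq_fn hs (hl a' hp')
  have h3 : Hs.fn hs (b' - b) =ᵐ[volume] fun x ↦ Hs.fn hs b' x - Hs.fn hs b x := by
    rw [map_sub]
    exact Lp.coeFn_sub _ _
  obtain ⟨e, he1, he2, he3, he4⟩ := hC p p' (a' - a) a' (b' - b) hp hp'
    ((norm_sub_le _ _).trans (by linarith [ha.norm_le_one, ha'.norm_le_one]))
    (by linarith [ha'.norm_le_one]) hpB (by
      filter_upwards [h1, h2, h3] with x e1 e2 e3
      rw [e3, e1, e2, map_sub, w.phase_sub, Complex.ofReal_sub, mul_sub Complex.I, sub_eq_add_neg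
        (Complex.I * _), Complex.exp_add, ← neg_mul]
      have := cexp_mul_cancel (phase ρ ((L : ℕ) : ℝ) a'.seq x) (p' x)
      linear_combination -this)
  exact ⟨_, e, fun n ↦ norm_cexp_I_mul _, he1, he2, he3, he4⟩


/-! ### The charts -/

theorem Windows.ρ_mul_χ_dilate {η ρ : ℝ → ℝ} (w : Windows η ρ) (L : ℕ+) (x : ℝ) :
    dilate ((L : ℕ) : ℝ) (cast_pnat_pos L) w.ρS x * dilate ((L : ℕ) : ℝ) (cast_pnat_pos L) w.χS x
      = dilate ((L : ℕ) : ℝ) (cast_pnat_pos L) w.ρS x := by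
  rw [dilate_apply, dilate_apply, w.ρ_mul_χ]

theorem Windows.exists_funDist_le {η ρ : ℝ → ℝ} (w : Windows η ρ) {s : ℝ} (hs : 0 ≤ s) (L : ℕ+)
    {B : ℝ} (hB : 0 ≤ B) : ∃ K : ℝ, 0 ≤ K ∧ ∀ (q p p' : ℝ → ℂ) (a a' : L2dSeq) (b b' : Hs s),
      LocHs s q → LocHs s p → (∀ n, ‖loc s (cell L w.χS n) p‖ ≤ B + 1) → LocHs s p' →
      w.Coord s L q p a b → w.Coord s L q p' a' b' →
      funDist s p p' ^ 2 ≤ ENNReal.ofReal (K ^ 2 * (‖a' - a‖ + ‖b' - b‖) ^ 2) ∧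
      ∀ q₁, LocHs s q₁ → ∀ ε : ℝ, 0 < ε → funDist s p' q₁ ^ 2
        ≤ ENNReal.ofReal (1 + ε) * funDist s p q₁ ^ 2
          + ENNReal.ofReal (1 + ε⁻¹) * ENNReal.ofReal (K ^ 2 * (‖a' - a‖ + ‖b' - b‖) ^ 2) := by
  obtain ⟨C₁, hC₁0, hC₁⟩ := w.exists_cells_of_coord hs L B
  obtain ⟨C₂, hC₂0, hC₂⟩ := exists_step_bound (s := s) (one_le_scale L) (w.isPartition L)
    (hasCompactSupport_dilate w.χ_compact (cast_pnat_pos L)) (w.ρ_mul_χ_dilate L)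
    (B := B + 1) (by linarith)
  refine ⟨√C₂ * C₁, by positivity, fun q p p' a a' b b' hq hp hpB hp' ha ha' ↦ ?_⟩
  obtain ⟨c, e, hc, he, hcc, hes, heb⟩ := hC₁ q p p' a a' b b' hq hp hpB hp' ha ha'
  obtain ⟨G, hGm, hG, hGb⟩ := hC₂ p p' c e hp hp' hc he hcc hpB hes
  have hG' : ∫⁻ y, G y ≤ ENNReal.ofReal ((√C₂ * C₁) ^ 2 * (‖a' - a‖ + ‖b' - b‖) ^ 2) := by
    refine hG.trans (ENNReal.ofReal_le_ofReal ?_)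
    rw [mul_pow, Real.sq_sqrt hC₂0, mul_assoc]
    exact mul_le_mul_of_nonneg_left heb hC₂0
  refine ⟨(funDist_sq_le_lintegral (c := fun y ↦ c ⌊y / (4 * ((L : ℕ) : ℝ))⌋) (fun y ↦ hc _)
    hGb).trans hG', fun q₁ hq₁ ε hε ↦ ?_⟩
  refine (funDist_sq_le_of_step (c := fun y ↦ c ⌊y / (4 * ((L : ℕ) : ℝ))⌋) hp hp' hq₁
    (fun y ↦ hc _) hGm hGb hε).trans ?_
  gcongr

/-- The scale and the constants of the charts around functions of energy at most `N`. -/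
structure Windows.ChartData {η ρ : ℝ → ℝ} (w : Windows η ρ) (s N : ℝ) where
  /-- the scale of the windows -/
  L : ℕ+
  /-- a local bound -/
  B : ℝ
  /-- the radius -/
  r : ℝ
  /-- the Lipschitz constant -/
  K : ℝ≥0
  one_le_B : 1 ≤ B
  r_pos : 0 < r
  r_le_one : r ≤ 1
  K_pos : 0 < K
  good : ∀ q : EnergyFun s, energy s q.toFun ≤ ENNReal.ofReal N → w.Good s L B q.toFun
  near : ∀ q p : ℝ → ℂ, w.Good s L B q → LocHs s p → funDist s p q < ENNReal.ofReal r →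
    w.Near s L B q p ∧ ∃ a b, w.Coord s L q p a b
  lip : ∀ (q p p' : ℝ → ℂ) (a a' : L2dSeq) (b b' : Hs s), w.Good s L B q → w.Near s L B q p →
    LocHs s p' → w.Coord s L q p a b → w.Coord s L q p' a' b' → ∀ d : ℝ≥0,
    funDist s p p' < d → ‖a' - a‖ ≤ K * d ∧ ‖b' - b‖ ≤ K * d
  dist_le : ∀ (q p p' : ℝ → ℂ) (a a' : L2dSeq) (b b' : Hs s), LocHs s q → LocHs s p →
    (∀ n, ‖loc s (cell L w.χS n) p‖ ≤ B + 1) → LocHs s p' →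
    w.Coord s L q p a b → w.Coord s L q p' a' b' →
    funDist s p p' ^ 2 ≤ ENNReal.ofReal (K ^ 2 * (‖a' - a‖ + ‖b' - b‖) ^ 2) ∧
      ∀ q₁, LocHs s q₁ → ∀ ε : ℝ, 0 < ε → funDist s p' q₁ ^ 2
        ≤ ENNReal.ofReal (1 + ε) * funDist s p q₁ ^ 2
          + ENNReal.ofReal (1 + ε⁻¹) * ENNReal.ofReal (K ^ 2 * (‖a' - a‖ + ‖b' - b‖) ^ 2)

theorem Windows.nonempty_chartData {η ρ : ℝ → ℝ} (w : Windows η ρ) {s : ℝ} (hs : 0 ≤ s) (N : ℝ) :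
    Nonempty (w.ChartData s N) := by
  obtain ⟨L, B, hB1, hgood⟩ := w.exists_good hs N
  have hB0 : 0 ≤ B := by linarith
  obtain ⟨C, hC0, hC⟩ := exists_phases_of_funDist_lt s (one_le_scale L)
    (hasCompactSupport_dilate w.χ_compact (cast_pnat_pos L))
  obtain ⟨r₀, hr₀, hcoord⟩ := w.exists_coord s L hB0
  obtain ⟨C₁, hC₁0, hC₁⟩ := w.exists_coord_sub_le s L hB0
  obtain ⟨K₁, hK₁0, hK₁⟩ := w.exists_funDist_le hs L hB0
  have hcells : ∀ {C : ℝ} {e : ℤ → ℝ} {d : ℝ}, 0 ≤ C → 0 ≤ d → Summable (fun n ↦ e n ^ 2) →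
      ∑' n, e n ^ 2 < d ^ 2 → Summable (fun n ↦ (C * e n) ^ 2) ∧
        ∑' n, (C * e n) ^ 2 ≤ (C * d) ^ 2 := by
    intro C e d hC hd h1 h2
    simp only [mul_pow]
    refine ⟨h1.mul_left _, ?_⟩
    rw [tsum_mul_left]
    gcongr
  have hr : 0 < min 1 (r₀ / (C + 1)) := by positivity
  obtain ⟨K, hK⟩ : ∃ K : ℝ≥0, (K : ℝ) = C₁ * C + K₁ + 1 := ⟨⟨_, by positivity⟩, rfl⟩
  refine ⟨⟨L, B, min 1 (r₀ / (C + 1)), K, hB1, hr, min_le_left _ _, ?_, hgood, ?_, ?_, ?_⟩⟩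
  · rw [← NNReal.coe_pos, hK]
    positivity
  · intro q p hq hp hd
    obtain ⟨c, e, hc, he0, he, hes, heb⟩ := hC p q _ hr hd
    obtain ⟨h1, h2⟩ := hcells hC0 hr.le hes heb
    refine hcoord q p c _ hq hp hc he h1 (h2.trans ?_)
    gcongr
    calc C * min 1 (r₀ / (C + 1)) ≤ (C + 1) * (r₀ / (C + 1)) := by
          gcongr
          · linarith
          · exact min_le_right _ _
      _ = r₀ := by field_simp
  · intro q p p' a a' b b' hq hp hp' ha ha' d hd
    have hd0 : 0 < d := ENNReal.coe_pos.1 ((zero_le).trans_lt hd)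
    rw [← ENNReal.ofReal_coe_nnreal] at hd
    obtain ⟨c, e, hc, he0, he, hes, heb⟩ := hC p p' d hd0 hd
    obtain ⟨h1, h2⟩ := hcells hC0 d.2 hes heb
    obtain ⟨h3, h4⟩ := hC₁ q p p' a a' b b' c _ hq hp hp' ha ha' hc he h1
    have h5 : C₁ * √(∑' n, (C * e n) ^ 2) ≤ (C₁ * C + K₁ + 1) * d := by
      have h6 : √(∑' n, (C * e n) ^ 2) ≤ C * d :=
        Real.sqrt_le_iff.2 ⟨mul_nonneg hC0 d.2, h2⟩
      have h7 := mul_le_mul_of_nonneg_left h6 hC₁0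
      have h8 : 0 ≤ (K₁ + 1) * d := mul_nonneg (by linarith) d.2
      linarith
    rw [hK]
    exact ⟨h3.trans h5, h4.trans h5⟩
  · intro q p p' a a' b b' hq hp hpB hp' ha ha'
    obtain ⟨h1, h2⟩ := hK₁ q p p' a a' b b' hq hp hpB hp' ha ha'
    have h3 : ENNReal.ofReal (K₁ ^ 2 * (‖a' - a‖ + ‖b' - b‖) ^ 2)
        ≤ ENNReal.ofReal ((C₁ * C + K₁ + 1) ^ 2 * (‖a' - a‖ + ‖b' - b‖) ^ 2) := by
      refine ENNReal.ofReal_le_ofReal ?_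
      gcongr
      have : 0 ≤ C₁ * C := by positivity
      linarith
    rw [hK]
    exact ⟨h1.trans h3, fun q₁ hq₁ ε hε ↦ (h2 q₁ hq₁ ε hε).trans
      (add_le_add_right (mul_le_mul_right h3 _) _)⟩

theorem energyDist_toClass {s : ℝ} (p q : EnergyFun s) :
    energyDist s p.toClass q.toClass = funDist s p.toFun q.toFun := rfl

theorem EnergySpace.exists_rep {s : ℝ} (P : EnergySpace s) : ∃ p : EnergyFun s, p.toClass = P :=
  Quotient.exists_rep P

theorem Windows.isCoordinate_iff {η ρ : ℝ → ℝ} (w : Windows η ρ) {s : ℝ} {L : ℕ+} {q : EnergyFun s}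
    {P : EnergySpace s} {z : L2d × Htilde s η ((L : ℕ) : ℝ) q} :
    IsCoordinate s η ρ ((L : ℕ) : ℝ) q P z ↔ ∃ (p : EnergyFun s) (a : L2dSeq), p.toClass = P ∧
      SeparationQuotient.mk a = z.1 ∧ w.Coord s L q.toFun p.toFun a z.2 := by
  constructor
  · rintro ⟨p, a, h1, h2, h3, h4, h5⟩
    exact ⟨p, a, h1, h2, fun n ↦ by rw [← w.correlation_eq]; exact (h3 n).2, h4, h5⟩
  · rintro ⟨p, a, h1, h2, h3⟩
    refine ⟨p, a, h1, h2, fun n ↦ ?_, h3.small, h3.represents⟩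
    rw [w.correlation_eq]
    exact ⟨h3.corr_ne_zero n, h3.phase_eq n⟩

namespace Windows.ChartData

variable {η ρ : ℝ → ℝ} {w : Windows η ρ} {s N : ℝ}

theorem exists_isCoordinate (D : w.ChartData s N) {q : EnergyFun s}
    (hq : energy s q.toFun ≤ ENNReal.ofReal N) {P : EnergySpace s}
    (hP : P ∈ energyBall s q D.r) : ∃ z, IsCoordinate s η ρ ((D.L : ℕ) : ℝ) q P z := by
  obtain ⟨p, rfl⟩ := P.exists_rep
  obtain ⟨-, a, b, hab⟩ := D.near _ _ (D.good q hq) p.locHs hP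
  exact ⟨(SeparationQuotient.mk a, ⟨b, hab.mem_Htilde p.locHs⟩),
    w.isCoordinate_iff.2 ⟨p, a, rfl, rfl, hab⟩⟩

theorem edist_eq {L : ℝ} {q : EnergyFun s} {z z' : L2d × Htilde s η L q} {a a' : L2dSeq}
    (ha : SeparationQuotient.mk a = z.1) (ha' : SeparationQuotient.mk a' = z'.1) :
    edist z z' = max (ENNReal.ofReal ‖a' - a‖) (ENNReal.ofReal ‖(z'.2 : Hs s) - (z.2 : Hs s)‖) := by
  rw [Prod.edist_eq, ← ha, ← ha', SeparationQuotient.edist_mk, Subtype.edist_eq, edist_comm,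
    edist_comm (z.2 : Hs s), edist_dist, edist_dist, dist_eq_norm, dist_eq_norm]

theorem edist_le (D : w.ChartData s N) {q : EnergyFun s}
    (hq : energy s q.toFun ≤ ENNReal.ofReal N) {P P' : EnergySpace s}
    (hP : P ∈ energyBall s q D.r) {z z' : L2d × Htilde s η ((D.L : ℕ) : ℝ) q}
    (hz : IsCoordinate s η ρ ((D.L : ℕ) : ℝ) q P z)
    (hz' : IsCoordinate s η ρ ((D.L : ℕ) : ℝ) q P' z') :
    edist z z' ≤ D.K * energyDist s P P' := by
  obtain ⟨p, a, rfl, ha, hc⟩ := w.isCoordinate_iff.1 hz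
  obtain ⟨p', a', rfl, ha', hc'⟩ := w.isCoordinate_iff.1 hz'
  have hK : (D.K : ℝ≥0∞) ≠ 0 := ENNReal.coe_ne_zero.2 D.K_pos.ne'
  by_contra! h
  rw [mul_comm, ← ENNReal.lt_div_iff_mul_lt (.inl hK) (.inl ENNReal.coe_ne_top)] at h
  obtain ⟨d, hd1, hd2⟩ := ENNReal.lt_iff_exists_nnreal_btwn.1 h
  obtain ⟨h1, h2⟩ := D.lip _ _ _ a a' _ _ (D.good q hq)
    (D.near _ _ (D.good q hq) p.locHs hP).1 p'.locHs hc hc' d hd1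
  rw [ENNReal.lt_div_iff_mul_lt (.inl hK) (.inl ENNReal.coe_ne_top), mul_comm, edist_eq ha ha',
    ← ENNReal.coe_mul, ← ENNReal.ofReal_coe_nnreal] at hd2
  refine absurd hd2 (not_lt.2 (max_le ?_ ?_))
  · exact ENNReal.ofReal_le_ofReal h1
  · exact ENNReal.ofReal_le_ofReal h2

theorem energyDist_le (D : w.ChartData s N) {q : EnergyFun s}
    (hq : energy s q.toFun ≤ ENNReal.ofReal N) {P P' : EnergySpace s}
    (hP : P ∈ energyBall s q D.r) {z z' : L2d × Htilde s η ((D.L : ℕ) : ℝ) q}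
    (hz : IsCoordinate s η ρ ((D.L : ℕ) : ℝ) q P z)
    (hz' : IsCoordinate s η ρ ((D.L : ℕ) : ℝ) q P' z') :
    energyDist s P P' ≤ (2 * D.K : ℝ≥0) * edist z z' := by
  obtain ⟨p, a, rfl, ha, hc⟩ := w.isCoordinate_iff.1 hz
  obtain ⟨p', a', rfl, ha', hc'⟩ := w.isCoordinate_iff.1 hz'
  have h := (D.dist_le _ _ _ a a' _ _ q.locHs p.locHs
    (D.near _ _ (D.good q hq) p.locHs hP).1.bound p'.locHs hc hc').1
  rw [← mul_pow, ENNReal.ofReal_pow (by positivity)] at h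
  rw [energyDist_toClass, edist_eq ha ha']
  refine ((ENNReal.pow_le_pow_left_iff two_ne_zero).1 h).trans ?_
  rw [← ENNReal.ofReal_max, ← ENNReal.ofReal_coe_nnreal, ← ENNReal.ofReal_mul (NNReal.coe_nonneg _)]
  refine ENNReal.ofReal_le_ofReal ?_
  push_cast
  have h1 := le_max_left ‖a' - a‖ ‖(z'.2 : Hs s) - (z.2 : Hs s)‖
  have h2 := le_max_right ‖a' - a‖ ‖(z'.2 : Hs s) - (z.2 : Hs s)‖
  have hK : (0 : ℝ) ≤ D.K := D.K.2
  nlinarith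

theorem isCoordinate_unique (D : w.ChartData s N) {q : EnergyFun s}
    (hq : energy s q.toFun ≤ ENNReal.ofReal N) {P : EnergySpace s}
    (hP : P ∈ energyBall s q D.r) {z z' : L2d × Htilde s η ((D.L : ℕ) : ℝ) q}
    (hz : IsCoordinate s η ρ ((D.L : ℕ) : ℝ) q P z)
    (hz' : IsCoordinate s η ρ ((D.L : ℕ) : ℝ) q P z') : z = z' := by
  have h1 := D.energyDist_le hq hP hz hz
  rw [edist_self, mul_zero] at h1
  have h2 := D.edist_le hq hP hz hz'
  rw [nonpos_iff_eq_zero.1 h1, mul_zero] at h2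
  exact edist_le_zero.1 h2

theorem chart_spec (D : w.ChartData s N) {q : EnergyFun s}
    (hq : energy s q.toFun ≤ ENNReal.ofReal N) {P : EnergySpace s}
    (hP : P ∈ energyBall s q D.r) :
    IsCoordinate s η ρ ((D.L : ℕ) : ℝ) q P (chart s η ρ ((D.L : ℕ) : ℝ) q P) := by
  have h := D.exists_isCoordinate hq hP
  rw [chart, dif_pos h]
  exact h.choose_spec

theorem chart_eq (D : w.ChartData s N) {q : EnergyFun s}
    (hq : energy s q.toFun ≤ ENNReal.ofReal N) {P : EnergySpace s}
    (hP : P ∈ energyBall s q D.r) {z : L2d × Htilde s η ((D.L : ℕ) : ℝ) q}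
    (hz : IsCoordinate s η ρ ((D.L : ℕ) : ℝ) q P z) : chart s η ρ ((D.L : ℕ) : ℝ) q P = z :=
  D.isCoordinate_unique hq hP (D.chart_spec hq hP) hz

/-- Points near the coordinates of a function are the coordinates of a function. -/
theorem eventually_exists_coord (D : w.ChartData s N) (hs : 0 ≤ s) {q : EnergyFun s}
    (hq : energy s q.toFun ≤ ENNReal.ofReal N) {P : EnergySpace s}
    (hP : P ∈ energyBall s q D.r) :
    ∀ᶠ z : L2d × Htilde s η ((D.L : ℕ) : ℝ) q in nhds (chart s η ρ ((D.L : ℕ) : ℝ) q P),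
      ∀ a : L2dSeq, SeparationQuotient.mk a = z.1 → ∃ p : EnergyFun s,
        p.toFun = ofCoord ρ hs D.L q.toFun a z.2 ∧ w.Coord s D.L q.toFun p.toFun a z.2 := by
  obtain ⟨p₀, a₀, rfl, ha₀, hc₀⟩ := w.isCoordinate_iff.1 (D.chart_spec hq hP)
  set z₀ := chart s η ρ ((D.L : ℕ) : ℝ) q p₀.toClass
  have hg := D.good q hq
  have hnear := (D.near _ _ hg p₀.locHs hP).1
  set κ := (multBound s w.ηS).toReal
  have hκ : 0 ≤ κ := ENNReal.toReal_nonneg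
  have hB : 0 ≤ D.B := by linarith [D.one_le_B]
  obtain ⟨C, hC0, hC⟩ := w.exists_cells_of_coord hs D.L D.B
  have hE : energy s p₀.toFun ≤ ENNReal.ofReal (energy s p₀.toFun).toReal := by
    rw [ENNReal.ofReal_toReal p₀.energy_lt_top.ne]
  obtain ⟨G, hG⟩ := exists_energy_le hs (energy s p₀.toFun).toReal C (one_le_scale D.L)
    (w.isPartition D.L) (hasCompactSupport_dilate w.χ_compact (cast_pnat_pos D.L))
    (w.ρ_mul_χ_dilate D.L)
  have hev1 : ∀ᶠ z : L2d × Htilde s η ((D.L : ℕ) : ℝ) q in nhds z₀, ‖z.1‖ ^ 2 < 1 / 2 := by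
    refine ContinuousAt.eventually_lt (by fun_prop) continuousAt_const ?_
    rw [← ha₀]
    exact hc₀.small
  have hev2 : ∀ᶠ z : L2d × Htilde s η ((D.L : ℕ) : ℝ) q in nhds z₀,
      κ ^ 2 * D.B * ‖(z.2 : Hs s) - (z₀.2 : Hs s)‖ < 1 / 4 := by
    refine ContinuousAt.eventually_lt (by fun_prop) continuousAt_const ?_
    simp
  have hev3 : ∀ᶠ z : L2d × Htilde s η ((D.L : ℕ) : ℝ) q in nhds z₀,
      ‖z.1 - z₀.1‖ + ‖(z.2 : Hs s) - (z₀.2 : Hs s)‖ < 1 := by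
    refine ContinuousAt.eventually_lt (by fun_prop) continuousAt_const ?_
    simp
  filter_upwards [hev1, hev2, hev3] with z h1 h2 h3 a ha
  rw [← ha] at h1
  have hcoord : w.Coord s D.L q.toFun (ofCoord ρ hs D.L q.toFun a z.2) a z.2 := by
    refine w.coord_ofCoord hs q.locHs h1 (w.mem_Htilde_iff.1 z.2.2) fun n ↦ ?_
    have e := congrArg Complex.re (hc₀.inner_mulOp_η q.locHs p₀.locHs n)
    rw [Complex.ofReal_re] at e
    have e2 : (inner ℂ (loc s (cell D.L w.ηS n) q.toFun) (mulOp s (cell D.L w.ηS n) z.2) : ℂ)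
        = inner ℂ (loc s (cell D.L w.ηS n) q.toFun) (mulOp s (cell D.L w.ηS n) z₀.2)
        + inner ℂ (loc s (cell D.L w.ηS n) q.toFun)
          (mulOp s (cell D.L w.ηS n) ((z.2 : Hs s) - (z₀.2 : Hs s))) := by
      rw [← inner_add_right, ← map_add, add_sub_cancel]
    have e3 : ‖(inner ℂ (loc s (cell D.L w.ηS n) q.toFun)
          (mulOp s (cell D.L w.ηS n) ((z.2 : Hs s) - (z₀.2 : Hs s))) : ℂ)‖
        ≤ κ ^ 2 * D.B * ‖(z.2 : Hs s) - (z₀.2 : Hs s)‖ := by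
      refine (norm_inner_le_norm _ _).trans ?_
      have f1 := hg.norm_loc_η_le n
      have f2 := (ContinuousLinearMap.le_opNorm (mulOp s (cell D.L w.ηS n))
        ((z.2 : Hs s) - (z₀.2 : Hs s))).trans
          (mul_le_mul_of_nonneg_right (norm_mulOp_cell_le s D.L w.ηS n) (norm_nonneg _))
      calc _ ≤ (κ * D.B) * (κ * ‖(z.2 : Hs s) - (z₀.2 : Hs s)‖) :=
            mul_le_mul f1 f2 (norm_nonneg _) (mul_nonneg hκ hB)
        _ = _ := by ring
    have e4 := (abs_le.1 ((Complex.abs_re_le_norm _).trans e3)).1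
    rw [e2, Complex.add_re, e]
    linarith [hnear.lower n]
  have hloc := w.locHs_ofCoord hs D.L q.locHs a z.2
  obtain ⟨c, e, hc, he, -, hes, heb⟩ := hC q.toFun p₀.toFun _ a₀ a _ _ q.locHs p₀.locHs hnear.bound
    hloc hc₀ hcoord
  have hen := hG p₀ (ofCoord ρ hs D.L q.toFun a z.2) (fun n ↦ starRingEnd ℂ (c n)) e hE hloc
    (fun n ↦ by rw [RCLike.norm_conj, hc])
    (fun n ↦ (norm_loc_conj_sub p₀.locHs hloc (w.hasCompactSupport_χ D.L n) (hc n)).trans_le (he n))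
    hes (heb.trans ?_)
  · exact ⟨⟨_, hloc.locallyIntegrable, hloc.exists_represents, hen.trans_lt ENNReal.ofReal_lt_top⟩,
      rfl, hcoord⟩
  · rw [← ha, ← ha₀, ← SeparationQuotient.mk_sub, SeparationQuotient.norm_mk] at h3
    refine mul_le_of_le_one_right (sq_nonneg C) (pow_le_one₀ (by positivity) h3.le)

/-- Functions with coordinates near those of a function in a ball belong to the ball. -/
theorem eventually_mem_energyBall (D : w.ChartData s N) {q : EnergyFun s}
    (hq : energy s q.toFun ≤ ENNReal.ofReal N) {P : EnergySpace s}
    (hP : P ∈ energyBall s q D.r) {q₁ : EnergyFun s} {r₁ : ℝ} (hP₁ : P ∈ energyBall s q₁ r₁) :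
    ∀ᶠ z : L2d × Htilde s η ((D.L : ℕ) : ℝ) q in nhds (chart s η ρ ((D.L : ℕ) : ℝ) q P),
      ∀ P' : EnergySpace s, IsCoordinate s η ρ ((D.L : ℕ) : ℝ) q P' z →
        P' ∈ energyBall s q₁ r₁ := by
  obtain ⟨p₀, a₀, rfl, ha₀, hc₀⟩ := w.isCoordinate_iff.1 (D.chart_spec hq hP)
  set z₀ := chart s η ρ ((D.L : ℕ) : ℝ) q p₀.toClass
  have hnear := (D.near _ _ (D.good q hq) p₀.locHs hP).1
  have hF : funDist s p₀.toFun q₁.toFun < ENNReal.ofReal r₁ := hP₁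
  have hr₁ : 0 < r₁ := ENNReal.ofReal_pos.1 ((zero_le).trans_lt hF)
  set f := (funDist s p₀.toFun q₁.toFun).toReal
  have hf : funDist s p₀.toFun q₁.toFun = ENNReal.ofReal f :=
    (ENNReal.ofReal_toReal hF.ne_top).symm
  have hf0 : 0 ≤ f := ENNReal.toReal_nonneg
  rw [hf, ENNReal.ofReal_lt_ofReal_iff hr₁] at hF
  have hfr : 0 < r₁ ^ 2 - f ^ 2 := by nlinarith
  set ε := (r₁ ^ 2 - f ^ 2) / (2 * (f ^ 2 + 1))
  have hε : 0 < ε := by positivity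
  have hεf : ε * f ^ 2 ≤ (r₁ ^ 2 - f ^ 2) / 2 := by
    have : ε * (2 * (f ^ 2 + 1)) = r₁ ^ 2 - f ^ 2 := by simp only [ε]; field_simp
    nlinarith
  have hev : ∀ᶠ z : L2d × Htilde s η ((D.L : ℕ) : ℝ) q in nhds z₀,
      (1 + ε⁻¹) * (D.K ^ 2 * (‖z.1 - z₀.1‖ + ‖(z.2 : Hs s) - (z₀.2 : Hs s)‖) ^ 2)
        < (r₁ ^ 2 - f ^ 2) / 2 := by
    refine ContinuousAt.eventually_lt (by fun_prop) continuousAt_const ?_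
    simp [hfr]
  filter_upwards [hev] with z hz P' hP'
  obtain ⟨p, a, rfl, ha, hc⟩ := w.isCoordinate_iff.1 hP'
  rw [← ha, ← ha₀, ← SeparationQuotient.mk_sub, SeparationQuotient.norm_mk] at hz
  have h := (D.dist_le _ _ _ a₀ a _ _ q.locHs p₀.locHs hnear.bound p.locHs hc₀ hc).2 q₁.toFun
    q₁.locHs ε hε
  change funDist s p.toFun q₁.toFun < ENNReal.ofReal r₁
  rw [← ENNReal.pow_lt_pow_left_iff two_ne_zero]
  refine h.trans_lt ?_
  rw [hf, ← ENNReal.ofReal_pow hf0, ← ENNReal.ofReal_pow hr₁.le,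
    ← ENNReal.ofReal_mul (by positivity), ← ENNReal.ofReal_mul (by positivity),
    ← ENNReal.ofReal_add (by positivity) (by positivity),
    ENNReal.ofReal_lt_ofReal_iff (by positivity)]
  linarith

theorem isOpen_image (D : w.ChartData s N) (hs : 0 ≤ s) {q : EnergyFun s}
    (hq : energy s q.toFun ≤ ENNReal.ofReal N) (q₁ : EnergyFun s) (r₁ : ℝ) :
    IsOpen (chart s η ρ ((D.L : ℕ) : ℝ) q '' (energyBall s q D.r ∩ energyBall s q₁ r₁)) := by
  rw [isOpen_iff_mem_nhds]
  rintro _ ⟨P, ⟨hP, hP₁⟩, rfl⟩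
  filter_upwards [D.eventually_exists_coord hs hq hP, D.eventually_mem_energyBall hq hP hP,
    D.eventually_mem_energyBall hq hP hP₁] with z h1 h2 h3
  obtain ⟨a, ha⟩ := SeparationQuotient.surjective_mk z.1
  obtain ⟨p, -, hc⟩ := h1 a ha
  have hz : IsCoordinate s η ρ ((D.L : ℕ) : ℝ) q p.toClass z :=
    w.isCoordinate_iff.2 ⟨p, a, rfl, ha, hc⟩
  exact ⟨p.toClass, ⟨h2 _ hz, h3 _ hz⟩, D.chart_eq hq (h2 _ hz) hz⟩

end Windows.ChartData

/-- Functions whose balls of radius one meet have comparable energy. -/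
theorem exists_energy_le_of_mem {η ρ : ℝ → ℝ} (w : Windows η ρ) {s : ℝ} (hs : 0 ≤ s) (N : ℝ) :
    ∃ G : ℝ, ∀ (q q₁ : EnergyFun s) (P : EnergySpace s), energy s q.toFun ≤ ENNReal.ofReal N →
      P ∈ energyBall s q 1 → P ∈ energyBall s q₁ 1 → energy s q₁.toFun ≤ ENNReal.ofReal G := by
  have hL := one_le_scale 1
  have hχ := hasCompactSupport_dilate w.χ_compact (cast_pnat_pos 1)
  obtain ⟨C, hC0, hC⟩ := exists_phases_of_funDist_lt s hL hχ
  obtain ⟨G₁, hG₁⟩ := exists_energy_le hs N C hL (w.isPartition 1) hχ (w.ρ_mul_χ_dilate 1)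
  obtain ⟨G₂, hG₂⟩ := exists_energy_le hs G₁ C hL (w.isPartition 1) hχ (w.ρ_mul_χ_dilate 1)
  refine ⟨G₂, fun q q₁ P hq hP hP₁ ↦ ?_⟩
  obtain ⟨p, rfl⟩ := P.exists_rep
  have hcells : ∀ {e : ℤ → ℝ}, Summable (fun n ↦ e n ^ 2) → ∑' n, e n ^ 2 < 1 ^ 2 →
      Summable (fun n ↦ (C * e n) ^ 2) ∧ ∑' n, (C * e n) ^ 2 ≤ C ^ 2 := by
    intro e h1 h2
    simp only [mul_pow]
    refine ⟨h1.mul_left _, ?_⟩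
    rw [tsum_mul_left]
    exact mul_le_of_le_one_right (sq_nonneg C) (by simpa using h2.le)
  obtain ⟨c, e, hc, -, he, hes, heb⟩ := hC p.toFun q.toFun 1 one_pos hP
  obtain ⟨h1, h2⟩ := hcells hes heb
  have hp := hG₁ q p.toFun c _ hq p.locHs hc he h1 h2
  obtain ⟨c, e, hc, -, he, hes, heb⟩ := hC p.toFun q₁.toFun 1 one_pos hP₁
  obtain ⟨h1, h2⟩ := hcells hes heb
  exact hG₂ p q₁.toFun (fun n ↦ starRingEnd ℂ (c n)) _ hp q₁.locHs
    (fun n ↦ by rw [RCLike.norm_conj, hc])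
    (fun n ↦ (norm_loc_conj_sub p.locHs q₁.locHs (hasCompactSupport_translate hχ _) (hc n)).trans_le
      (he n)) h1 h2


/-! ### Analytic maps with bounded derivatives -/

/-- `f` is analytic at `0`, vanishes there, and its derivatives at `0` are bounded by `C`. -/
structure AnalyticBound {X Y : Type*} [NormedAddCommGroup X] [NormedSpace ℝ X]
    [NormedAddCommGroup Y] [NormedSpace ℝ Y] (C : ℕ → ℝ) (f : X → Y) : Prop where
  contDiffAt : ContDiffAt ℝ ω f 0
  map_zero : f 0 = 0
  bound : ∀ k, ‖iteratedFDeriv ℝ k f 0‖ ≤ C k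

/-- The bound for the derivatives of a composition. -/
def compBound (Cg Cf : ℕ → ℝ) (k : ℕ) : ℝ :=
  k.factorial * (∑ i ∈ Finset.range (k + 1), |Cg i|) * (1 + ∑ i ∈ Finset.range (k + 1), |Cf i|) ^ k

section

variable {X Y Z : Type*} [NormedAddCommGroup X] [NormedSpace ℝ X] [NormedAddCommGroup Y]
  [NormedSpace ℝ Y] [NormedAddCommGroup Z] [NormedSpace ℝ Z]

theorem AnalyticBound.of_contDiffAt {f : X → Y} (h : ContDiffAt ℝ ω f 0) (h0 : f 0 = 0) :
    AnalyticBound (fun k ↦ ‖iteratedFDeriv ℝ k f 0‖) f :=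
  ⟨h, h0, fun _ ↦ le_rfl⟩

theorem AnalyticBound.clm (T : X →L[ℝ] Y) {M : ℝ} (hT : ‖T‖ ≤ M) :
    AnalyticBound (fun _ ↦ M) T := by
  refine ⟨T.contDiff.contDiffAt, T.map_zero, fun k ↦ ?_⟩
  have hM : 0 ≤ M := (norm_nonneg _).trans hT
  match k with
  | 0 => simpa [norm_iteratedFDeriv_zero] using hM
  | 1 => rw [norm_iteratedFDeriv_one, T.fderiv]; exact hT
  | k + 2 =>
    rw [← norm_iteratedFDeriv_fderiv]
    have : fderiv ℝ T = fun _ ↦ T := funext fun x ↦ T.fderiv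
    rw [this, iteratedFDeriv_const_of_ne (Nat.succ_ne_zero k)]
    simpa using hM

theorem AnalyticBound.comp {Cg Cf : ℕ → ℝ} {g : Y → Z} {f : X → Y} (hg : AnalyticBound Cg g)
    (hf : AnalyticBound Cf f) : AnalyticBound (compBound Cg Cf) (fun x ↦ g (f x)) := by
  have hg' : ContDiffAt ℝ ω g (f 0) := by rw [hf.map_zero]; exact hg.contDiffAt
  refine ⟨hg'.comp 0 hf.contDiffAt, by rw [hf.map_zero, hg.map_zero], fun k ↦ ?_⟩
  obtain ⟨t, htg, hto, ht0⟩ := eventually_nhds_iff.1 (hg'.eventually (by simp))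
  obtain ⟨s, hsf, hso, hs0⟩ := eventually_nhds_iff.1 ((hf.contDiffAt.eventually (by simp)).and
    (hf.contDiffAt.continuousAt.eventually (hto.mem_nhds ht0)))
  have h := norm_iteratedFDerivWithin_comp_le (n := k) (N := ω) (x := (0 : X)) (s := s) (t := t)
    (g := g) (f := f) (C := ∑ i ∈ Finset.range (k + 1), |Cg i|)
    (D := 1 + ∑ i ∈ Finset.range (k + 1), |Cf i|)
    (fun y hy ↦ (htg y hy).contDiffWithinAt) (fun x hx ↦ (hsf x hx).1.contDiffWithinAt) le_top
    hto.uniqueDiffOn hso.uniqueDiffOn (fun x hx ↦ (hsf x hx).2) hs0 (fun i hi ↦ ?_) fun i h1 hi ↦ ?_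
  · rw [iteratedFDerivWithin_of_isOpen _ hso hs0] at h
    exact h
  · rw [iteratedFDerivWithin_of_isOpen _ hto ht0, hf.map_zero]
    exact (hg.bound i).trans ((le_abs_self _).trans (Finset.single_le_sum
      (f := fun i ↦ |Cg i|) (fun _ _ ↦ abs_nonneg _) (Finset.mem_range.2 (by omega))))
  · rw [iteratedFDerivWithin_of_isOpen _ hso hs0]
    have h2 : |Cf i| ≤ ∑ i ∈ Finset.range (k + 1), |Cf i| := Finset.single_le_sum
      (f := fun i ↦ |Cf i|) (fun _ _ ↦ abs_nonneg _) (Finset.mem_range.2 (by omega))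
    have h3 : 0 ≤ ∑ i ∈ Finset.range (k + 1), |Cf i| := (abs_nonneg _).trans h2
    calc _ ≤ 1 + ∑ i ∈ Finset.range (k + 1), |Cf i| := by
          linarith [hf.bound i, le_abs_self (Cf i)]
      _ ≤ _ := le_self_pow₀ (by linarith) (by omega)

theorem AnalyticBound.tendsto {C : ℕ → ℝ} {f : X → Y} (h : AnalyticBound C f) :
    Filter.Tendsto f (nhds 0) (nhds 0) := by
  have := h.contDiffAt.continuousAt.tendsto
  rwa [h.map_zero] at this

theorem AnalyticBound.add {Cf Cg : ℕ → ℝ} {f g : X → Y} (hf : AnalyticBound Cf f)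
    (hg : AnalyticBound Cg g) : AnalyticBound (fun k ↦ Cf k + Cg k) (fun x ↦ f x + g x) := by
  refine ⟨hf.contDiffAt.add hg.contDiffAt, by simp [hf.map_zero, hg.map_zero], fun k ↦ ?_⟩
  have h : iteratedFDeriv ℝ k (fun x ↦ f x + g x) 0 = _ := iteratedFDeriv_add_apply
    (hf.contDiffAt.of_le le_top) (hg.contDiffAt.of_le le_top)
  rw [h]
  exact (norm_add_le _ _).trans (add_le_add (hf.bound k) (hg.bound k))

theorem AnalyticBound.prodMk {Cf Cg : ℕ → ℝ} {f : X → Y} {g : X → Z} (hf : AnalyticBound Cf f)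
    (hg : AnalyticBound Cg g) :
    AnalyticBound (fun k ↦ max (Cf k) (Cg k)) (fun x ↦ (f x, g x)) := by
  refine ⟨hf.contDiffAt.prodMk hg.contDiffAt, by simp [hf.map_zero, hg.map_zero], fun k ↦ ?_⟩
  rw [iteratedFDeriv_prodMk hf.contDiffAt hg.contDiffAt le_top, ContinuousMultilinearMap.opNorm_prod]
  exact max_le_max (hf.bound k) (hg.bound k)

end

/-! ### Square summable sequences -/

/-- Square summable sequences in `E`. -/
abbrev L2Seq (E : Type*) [NormedAddCommGroup E] : Type _ := lp (fun _ : ℤ ↦ E) 2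

namespace L2Seq

variable {E F G X : Type*} [NormedAddCommGroup E] [NormedAddCommGroup F] [NormedAddCommGroup G]
  [NormedAddCommGroup X]

theorem hasSum_norm_sq (x : L2Seq E) : HasSum (fun n ↦ ‖x n‖ ^ 2) (‖x‖ ^ 2) := by
  have h := lp.hasSum_norm (p := 2) (by norm_num) x
  have h2 : (2 : ℝ≥0∞).toReal = ((2 : ℕ) : ℝ) := by norm_num
  simp only [h2, Real.rpow_natCast] at h
  exact h

theorem norm_apply_le (x : L2Seq E) (n : ℤ) : ‖x n‖ ≤ ‖x‖ := lp.norm_apply_le_norm (by simp) x n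

/-- The element of `ℓ²` with the given entries. -/
def mk (f : ℤ → E) (h : Summable fun n ↦ ‖f n‖ ^ 2) : L2Seq E :=
  ⟨f, memℓp_gen (by simpa using h)⟩

theorem mk_apply (f : ℤ → E) (h : Summable fun n ↦ ‖f n‖ ^ 2) (n : ℤ) : mk f h n = f n := rfl

theorem norm_mk_le {f : ℤ → E} (h : Summable fun n ↦ ‖f n‖ ^ 2) {C : ℝ} (hC : 0 ≤ C)
    (hf : ∑' n, ‖f n‖ ^ 2 ≤ C ^ 2) : ‖mk f h‖ ≤ C := by
  refine (abs_le_of_sq_le_sq' ?_ hC).2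
  rw [← (hasSum_norm_sq (mk f h)).tsum_eq]
  exact hf

variable [NormedSpace ℝ E] [NormedSpace ℝ F] [NormedSpace ℝ G] [NormedSpace ℝ X]

/-- The bounded operator into `ℓ²` with the given entries. -/
theorem exists_clm (f : ℤ → X →ₗ[ℝ] E) {C : ℝ} (hC : 0 ≤ C)
    (h : ∀ x, Summable (fun n ↦ ‖f n x‖ ^ 2) ∧ ∑' n, ‖f n x‖ ^ 2 ≤ C ^ 2 * ‖x‖ ^ 2) :
    ∃ T : X →L[ℝ] L2Seq E, ‖T‖ ≤ C ∧ ∀ x n, T x n = f n x := by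
  let T : X →ₗ[ℝ] L2Seq E :=
    { toFun := fun x ↦ mk (fun n ↦ f n x) (h x).1
      map_add' := fun x y ↦ by ext n; simp [mk_apply]
      map_smul' := fun c x ↦ by ext n; simp [mk_apply] }
  refine ⟨T.mkContinuous C fun x ↦ ?_, LinearMap.mkContinuous_norm_le _ hC _, fun x n ↦ rfl⟩
  exact norm_mk_le (h x).1 (by positivity) (by rw [mul_pow]; exact (h x).2)

theorem exists_diag (f : ℤ → E →L[ℝ] F) {C : ℝ} (hC : 0 ≤ C) (h : ∀ n, ‖f n‖ ≤ C) :
    ∃ T : L2Seq E →L[ℝ] L2Seq F, ‖T‖ ≤ C ∧ ∀ x n, T x n = f n (x n) := by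
  let f' : ℤ → L2Seq E →ₗ[ℝ] F := fun n ↦
    { toFun := fun x ↦ f n (x n)
      map_add' := fun x y ↦ by rw [lp.coeFn_add, Pi.add_apply, map_add]
      map_smul' := fun c x ↦ by rw [lp.coeFn_smul, Pi.smul_apply, map_smul, RingHom.id_apply] }
  refine exists_clm f' hC fun x ↦ ?_
  have h1 := hasSum_norm_sq x
  have h2 : ∀ n, ‖f' n x‖ ^ 2 ≤ C ^ 2 * ‖x n‖ ^ 2 := fun n ↦ by
    rw [← mul_pow]
    exact pow_le_pow_left₀ (norm_nonneg _) ((f n).le_of_opNorm_le (h n) _) 2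
  have h3 := Summable.of_nonneg_of_le (fun n ↦ by positivity) h2 (h1.summable.mul_left _)
  refine ⟨h3, (h3.tsum_le_tsum h2 (h1.summable.mul_left _)).trans ?_⟩
  rw [tsum_mul_left, h1.tsum_eq]

theorem exists_bilinear (B : E →L[ℝ] F →L[ℝ] G) : ∃ T : L2Seq E →L[ℝ] L2Seq F →L[ℝ] L2Seq G,
    ∀ x y n, T x y n = B (x n) (y n) := by
  have h : ∀ (x : L2Seq E) (y : L2Seq F), Summable (fun n ↦ ‖B (x n) (y n)‖ ^ 2) ∧
      ∑' n, ‖B (x n) (y n)‖ ^ 2 ≤ (‖B‖ * ‖x‖ * ‖y‖) ^ 2 := fun x y ↦ by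
    have h1 := hasSum_norm_sq y
    have h2 : ∀ n, ‖B (x n) (y n)‖ ^ 2 ≤ (‖B‖ * ‖x‖) ^ 2 * ‖y n‖ ^ 2 := fun n ↦ by
      rw [← mul_pow]
      refine pow_le_pow_left₀ (norm_nonneg _) ((B.le_opNorm₂ _ _).trans ?_) 2
      gcongr
      exact norm_apply_le x n
    have h3 := Summable.of_nonneg_of_le (fun n ↦ by positivity) h2 (h1.summable.mul_left _)
    refine ⟨h3, (h3.tsum_le_tsum h2 (h1.summable.mul_left _)).trans ?_⟩
    rw [tsum_mul_left, h1.tsum_eq, mul_pow _ ‖y‖]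
  refine ⟨LinearMap.mkContinuous₂ (LinearMap.mk₂ ℝ (fun x y ↦ mk (fun n ↦ B (x n) (y n)) (h x y).1)
    ?_ ?_ ?_ ?_) ‖B‖ fun x y ↦ norm_mk_le (h x y).1 (by positivity) (h x y).2,
    fun x y n ↦ rfl⟩
  all_goals
    intros
    ext n
    simp [mk_apply]

theorem contDiff_exp (A : Type*) [NormedRing A] [NormedAlgebra ℝ A] [CompleteSpace A] :
    ContDiff ℝ ω (NormedSpace.exp : A → A) := by
  rw [contDiff_iff_contDiffAt]
  intro x
  exact (NormedSpace.exp_analytic (𝕂 := ℝ) x).contDiffAt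

theorem exists_exp_apply {V : Type*} [NormedAddCommGroup V] [NormedSpace ℝ V] [CompleteSpace V]
    (T : X →L[ℝ] V →L[ℝ] V) (v : V) : ∃ f : X → V, ContDiff ℝ ω f ∧
      (∀ x, HasSum (fun k : ℕ ↦ (k.factorial⁻¹ : ℝ) • ((T x) ^ k) v) (f x)) ∧
      HasFDerivAt f (T.flip v) 0 := by
  have hexp := (contDiff_exp (V →L[ℝ] V)).comp T.contDiff
  refine ⟨fun x ↦ NormedSpace.exp (T x) v, hexp.clm_apply contDiff_const, fun x ↦ ?_, ?_⟩
  · have h := (ContinuousLinearMap.apply ℝ V v).hasSum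
      (NormedSpace.exp_series_hasSum_exp' (𝕂 := ℝ) (T x))
    exact h
  · have h1 : HasFDerivAt (NormedSpace.exp : (V →L[ℝ] V) → (V →L[ℝ] V))
        (1 : (V →L[ℝ] V) →L[ℝ] (V →L[ℝ] V)) (T 0) := by
      rw [_root_.map_zero]
      exact hasFDerivAt_exp_zero
    have h2 := (h1.comp (0 : X) T.hasFDerivAt).clm_apply (hasFDerivAt_const v (0 : X))
    refine h2.congr_fderiv ?_
    ext x
    simp

/-- The map `a ↦ e^a - 1` on square summable sequences in a Banach algebra is analytic. -/
theorem exists_expm1 (A : Type*) [NormedRing A] [NormedAlgebra ℝ A] [CompleteSpace A] :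
    ∃ S : L2Seq A → L2Seq A, ContDiff ℝ ω S ∧ (∀ a n, S a n = NormedSpace.exp (a n) - 1) ∧
      HasFDerivAt S (ContinuousLinearMap.id ℝ (L2Seq A)) 0 := by
  obtain ⟨M, hM⟩ := exists_bilinear (ContinuousLinearMap.mul ℝ A)
  let inl := ContinuousLinearMap.inl ℝ (L2Seq A) ℝ
  let fst := ContinuousLinearMap.fst ℝ (L2Seq A) ℝ
  let snd := ContinuousLinearMap.snd ℝ (L2Seq A) ℝ
  let T : L2Seq A →L[ℝ] (L2Seq A × ℝ →L[ℝ] L2Seq A × ℝ) :=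
    (ContinuousLinearMap.compL ℝ (L2Seq A × ℝ) (L2Seq A) (L2Seq A × ℝ) inl).comp
      (((ContinuousLinearMap.compL ℝ (L2Seq A × ℝ) (L2Seq A) (L2Seq A)).flip fst).comp M
        + ContinuousLinearMap.smulRightL ℝ (L2Seq A × ℝ) (L2Seq A) snd)
  have hT : ∀ a x t, T a (x, t) = (M a x + t • a, 0) := fun a x t ↦ rfl
  obtain ⟨f, hf, hfs, hfd⟩ := exists_exp_apply T ((0 : L2Seq A), (1 : ℝ))
  refine ⟨fun a ↦ fst (f a), fst.contDiff.comp hf, fun a n ↦ ?_, ?_⟩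
  · have hc : Continuous fun x : L2Seq A ↦ x n :=
      continuous_iff_continuousAt.2 fun x ↦ by
        refine Metric.continuousAt_iff.2 fun ε hε ↦ ⟨ε, hε, fun {y} hy ↦ ?_⟩
        rw [dist_eq_norm] at hy ⊢
        exact (norm_apply_le (y - x) n).trans_lt hy
    let π : L2Seq A →+ A := ⟨⟨fun x ↦ x n, rfl⟩, fun x y ↦ rfl⟩
    have h2 := (fst.hasSum (hfs a)).map π hc
    have h3 : ∀ k : ℕ, ((T a ^ (k + 1)) ((0 : L2Seq A), (1 : ℝ))).2 = 0 ∧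
        ((T a ^ (k + 1)) ((0 : L2Seq A), (1 : ℝ))).1 n = a n ^ (k + 1) := by
      intro k
      induction k with
      | zero =>
        simp only [zero_add, pow_one, hT]
        simp
      | succ k ih =>
        rw [pow_succ', mul_apply_eq_comp, ← Prod.mk.eta (p := (T a ^ (k + 1)) _), ih.1, hT]
        refine ⟨rfl, ?_⟩
        simp only [zero_smul, add_zero]
        rw [hM, ih.2, ContinuousLinearMap.mul_apply', ← pow_succ']
    have h4 := (NormedSpace.exp_series_hasSum_exp' (𝕂 := ℝ) (a n)).sub
      (hasSum_ite_eq (0 : ℕ) (1 : A))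
    refine h2.unique ?_
    convert! h4 using 1
    funext k
    simp only [Function.comp_apply, map_smul]
    change (k.factorial⁻¹ : ℝ) • ((T a ^ k) ((0 : L2Seq A), (1 : ℝ))).1 n = _
    match k with
    | 0 => simp
    | k + 1 => rw [(h3 k).2, if_neg (Nat.succ_ne_zero k), sub_zero]
  · exact fst.hasFDerivAt.comp 0 hfd |>.congr_fderiv (ContinuousLinearMap.ext fun a ↦ by
      change M a 0 + (1 : ℝ) • a = a
      rw [map_zero, zero_add, one_smul])

/-- A local inverse of `a ↦ e^a - 1` on complex sequences. -/
theorem exists_log1p : ∃ R : L2Seq ℂ → L2Seq ℂ, ContDiffAt ℝ ω R 0 ∧ R 0 = 0 ∧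
    ∀ᶠ v in nhds (0 : L2Seq ℂ), ∀ n, Complex.exp (R v n) = 1 + v n := by
  obtain ⟨S, hS, hSe, hSd⟩ := exists_expm1 ℂ
  have hS0 : S 0 = 0 := by
    ext n
    rw [hSe]
    simp
  have hSd' : HasFDerivAt S ((ContinuousLinearEquiv.refl ℝ (L2Seq ℂ) :
    L2Seq ℂ →L[ℝ] L2Seq ℂ)) 0 := hSd
  have h1 := hS.contDiffAt (x := (0 : L2Seq ℂ))
  have h2 := h1.to_localInverse hSd' (by simp)
  have h3 := h1.localInverse_apply_image hSd' (by simp)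
  have h4 := (h1.hasStrictFDerivAt' hSd' (by simp)).eventually_right_inverse
  rw [hS0] at h2 h3 h4
  refine ⟨_, h2, h3, ?_⟩
  filter_upwards [h4] with v hv n
  have h5 := congrArg (fun x : L2Seq ℂ ↦ x n) hv
  simp only [hSe] at h5
  rw [Complex.exp_eq_exp_ℂ, ← sub_eq_iff_eq_add']
  exact h5

end L2Seq


/-! ### The model spaces -/

theorem antidiff_add (α β : ℤ → ℝ) (n : ℤ) : antidiff (α + β) n = antidiff α n + antidiff β n := by
  simp only [antidiff, Pi.add_apply, Finset.sum_add_distrib]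
  ring

theorem antidiff_smul (c : ℝ) (α : ℤ → ℝ) (n : ℤ) : antidiff (c • α) n = c * antidiff α n := by
  simp only [antidiff, Pi.smul_apply, smul_eq_mul, ← Finset.mul_sum]
  ring

/-- The sequence that vanishes at `0` and has the given differences. -/
def L2dSeq.lift : L2Seq ℝ →ₗ[ℝ] L2dSeq where
  toFun α := L2dSeq.ofDiff 0 α α.2
  map_add' α β := Subtype.ext (funext fun n ↦ by
    change 0 + antidiff (α + β : L2Seq ℝ) n = (0 + antidiff α n) + (0 + antidiff β n)
    rw [lp.coeFn_add, antidiff_add]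
    ring)
  map_smul' c α := Subtype.ext (funext fun n ↦ by
    change 0 + antidiff (c • α : L2Seq ℝ) n = c • (0 + antidiff α n)
    rw [lp.coeFn_smul, antidiff_smul, zero_add, zero_add, smul_eq_mul])

theorem L2dSeq.diff_apply (a : L2dSeq) (n : ℤ) : L2dSeq.diff a n = a.seq n - a.seq (n - 1) := rfl

theorem L2dSeq.norm_eq (a : L2dSeq) : ‖a‖ = ‖L2dSeq.diff a‖ := rfl

theorem L2dSeq.diff_lift (α : L2Seq ℝ) : L2dSeq.diff (L2dSeq.lift α) = α := by
  ext n
  rw [L2dSeq.diff_apply]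
  change 0 + antidiff α n - (0 + antidiff α (n - 1)) = α n
  rw [add_sub_add_left_eq_sub, antidiff_sub]

theorem L2dSeq.norm_lift (α : L2Seq ℝ) : ‖L2dSeq.lift α‖ = ‖α‖ := by
  rw [L2dSeq.norm_eq, L2dSeq.diff_lift]

theorem L2dSeq.mk_eq_mk {a a' : L2dSeq} (h : L2dSeq.diff a = L2dSeq.diff a') :
    (SeparationQuotient.mk a : L2d) = SeparationQuotient.mk a' := by
  rw [← sub_eq_zero, ← SeparationQuotient.mk_sub, ← norm_eq_zero, SeparationQuotient.norm_mk,
    L2dSeq.norm_eq, map_sub, h, sub_self, norm_zero]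

/-- The class of the sequences with given differences. -/
def L2d.ofDiff : L2Seq ℝ →L[ℝ] L2d :=
  LinearMap.mkContinuous ((SeparationQuotient.mkCLM ℝ L2dSeq).toLinearMap.comp L2dSeq.lift) 1
    fun α ↦ by
      change ‖(SeparationQuotient.mk (L2dSeq.lift α) : L2d)‖ ≤ _
      rw [SeparationQuotient.norm_mk, L2dSeq.norm_lift, one_mul]

theorem L2d.norm_ofDiff_le : ‖L2d.ofDiff‖ ≤ 1 := LinearMap.mkContinuous_norm_le _ zero_le_one _

theorem L2d.ofDiff_apply (α : L2Seq ℝ) : L2d.ofDiff α = SeparationQuotient.mk (L2dSeq.lift α) := rfl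

/-- The differences of a sequence. -/
def L2d.diff : L2d →L[ℝ] L2Seq ℝ :=
  SeparationQuotient.liftCLM (LinearMap.mkContinuous L2dSeq.diff 1 fun a ↦ by
      rw [one_mul, L2dSeq.norm_eq]) fun a a' h ↦ by
    rw [Metric.inseparable_iff, dist_eq_norm, L2dSeq.norm_eq, map_sub, norm_eq_zero, sub_eq_zero] at h
    exact h

theorem L2d.diff_mk (a : L2dSeq) : L2d.diff (SeparationQuotient.mk a) = L2dSeq.diff a := rfl

theorem L2d.norm_diff_le : ‖L2d.diff‖ ≤ 1 := by
  refine ContinuousLinearMap.opNorm_le_bound _ zero_le_one fun z ↦ ?_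
  obtain ⟨a, rfl⟩ := SeparationQuotient.surjective_mk z
  rw [L2d.diff_mk, one_mul, SeparationQuotient.norm_mk, L2dSeq.norm_eq]

theorem L2d.ofDiff_diff (z : L2d) : L2d.ofDiff (L2d.diff z) = z := by
  obtain ⟨a, rfl⟩ := SeparationQuotient.surjective_mk z
  rw [L2d.diff_mk, L2d.ofDiff_apply]
  exact L2dSeq.mk_eq_mk (L2dSeq.diff_lift _)

theorem Windows.exists_projection {η ρ : ℝ → ℝ} (w : Windows η ρ) {s : ℝ} {L : ℕ+}
    (q : EnergyFun s) : ∃ P : Hs s →L[ℝ] Htilde s η ((L : ℕ) : ℝ) q, ‖P‖ ≤ 1 ∧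
      ∀ b : Htilde s η ((L : ℕ) : ℝ) q, P b = b := by
  let : InnerProductSpace ℝ (Hs s) := InnerProductSpace.complexToReal
  have hc : IsClosed (Htilde s η ((L : ℕ) : ℝ) q : Set (Hs s)) := by
    have e : (Htilde s η ((L : ℕ) : ℝ) q : Set (Hs s)) = ⋂ n : ℤ, {b | (inner ℂ
        (loc s (cell L w.ηS n) q.toFun) (mulOp s (cell L w.ηS n) b) : ℂ).im = 0} := by
      ext b
      rw [SetLike.mem_coe, w.mem_Htilde_iff, Set.mem_iInter]
      rfl
    rw [e]
    refine isClosed_iInter fun n ↦ isClosed_eq ?_ continuous_const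
    exact Complex.continuous_im.comp
      (Continuous.inner continuous_const (mulOp s (cell L w.ηS n)).continuous)
  have : CompleteSpace (Htilde s η ((L : ℕ) : ℝ) q) := hc.completeSpace_coe
  exact ⟨(Htilde s η ((L : ℕ) : ℝ) q).orthogonalProjectionOnto,
    (Htilde s η ((L : ℕ) : ℝ) q).orthogonalProjectionOnto_norm_le,
    fun b ↦ Submodule.orthogonalProjectionOnto_mem_subspace_eq_self b⟩

/-! ### The analytic formula for coordinate changes -/

theorem exists_change_formula {s : ℝ} (Θ Θ₁ J : L2Seq ℝ →L[ℝ] L2Seq (Hs s →L[ℂ] Hs s))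
    (lin dif : L2Seq ℝ →L[ℝ] L2Seq ℝ) (M : ℝ) : ∃ C : ℕ → ℝ,
    ∀ (P₀ : L2Seq (Hs s →L[ℂ] Hs s) →L[ℝ] L2Seq (Hs s)) (V : Hs s →L[ℝ] L2Seq (Hs s))
      (l : L2Seq (Hs s) →L[ℝ] L2Seq ℂ) (syn : L2Seq (Hs s) →L[ℝ] Hs s),
      ‖P₀‖ ≤ M → ‖V‖ ≤ M → ‖l‖ ≤ M → ‖syn‖ ≤ M →
      ∃ F : L2Seq ℝ × Hs s → L2Seq ℝ × Hs s, AnalyticBound C F ∧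
        ∀ᶠ h in nhds 0, ∃ (S S₁ : L2Seq (Hs s →L[ℂ] Hs s)) (Q Y : L2Seq (Hs s)) (g : L2Seq ℝ)
          (ζ : L2Seq ℂ), (∀ m, S m = NormedSpace.exp (Θ h.1 m) - 1) ∧
          (∀ m, Q m = P₀ S m + V h.2 m + S m (V h.2 m)) ∧
          (∀ m, Complex.exp (ζ m) = 1 + l Q m) ∧ (∀ m, g m = (ζ m).im) ∧
          (∀ m, S₁ m = NormedSpace.exp (-Θ₁ (F h).1 m - J g m) - 1) ∧
          (∀ m, Y m = P₀ S₁ m + Q m + S₁ m (Q m)) ∧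
          (F h).1 = lin h.1 + dif g ∧ (F h).2 = syn Y := by
  obtain ⟨S, hS, hSe, -⟩ := L2Seq.exists_expm1 (Hs s →L[ℂ] Hs s)
  obtain ⟨R, hR, hR0, hRe⟩ := L2Seq.exists_log1p
  obtain ⟨B, hB'⟩ := L2Seq.exists_bilinear (E := Hs s →L[ℂ] Hs s) (F := Hs s) (G := Hs s)
    (ContinuousLinearMap.restrictScalarsL ℂ (Hs s) (Hs s) ℝ ℝ)
  have hB : ∀ x y n, B x y n = x n (y n) := fun x y n ↦ hB' x y n
  obtain ⟨im, -, him⟩ := L2Seq.exists_diag (fun _ : ℤ ↦ Complex.imCLM) (norm_nonneg _) fun _ ↦ le_rfl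
  have hS0 : S 0 = 0 := by
    ext n : 2
    rw [hSe]
    simp
  have bS := AnalyticBound.of_contDiffAt (hS.contDiffAt (x := 0)) hS0
  have bR := AnalyticBound.of_contDiffAt hR hR0
  have bB := AnalyticBound.of_contDiffAt (f := fun z : L2Seq (Hs s →L[ℂ] Hs s) × L2Seq (Hs s) ↦
    B z.1 z.2) (B.isBoundedBilinearMap.contDiff.contDiffAt (x := 0)) (by simp)
  have bfst := AnalyticBound.clm (ContinuousLinearMap.fst ℝ (L2Seq ℝ) (Hs s)) le_rfl
  have bsnd := AnalyticBound.clm (ContinuousLinearMap.snd ℝ (L2Seq ℝ) (Hs s)) le_rfl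
  have bnΘ := AnalyticBound.clm (-Θ₁) le_rfl
  have bnJ := AnalyticBound.clm (-J) le_rfl
  have beps := AnalyticBound.clm (lin.comp (ContinuousLinearMap.fst ℝ (L2Seq ℝ) (L2Seq ℝ))
    + dif.comp (ContinuousLinearMap.snd ℝ (L2Seq ℝ) (L2Seq ℝ))) le_rfl
  have bΘ := bS.comp ((AnalyticBound.clm Θ le_rfl).comp bfst)
  have bim := AnalyticBound.clm im le_rfl
  apply Exists.intro
  · intro P₀ V l syn hP₀ hV hl hsyn
    have bP := AnalyticBound.clm P₀ hP₀
    have bV := (AnalyticBound.clm V hV).comp bsnd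
    have bl := AnalyticBound.clm l hl
    have bsyn := AnalyticBound.clm syn hsyn
    have bQ : AnalyticBound _ fun h : L2Seq ℝ × Hs s ↦
      P₀ (S (Θ h.1)) + V h.2 + B (S (Θ h.1)) (V h.2) :=
      ((bP.comp bΘ).add bV).add (bB.comp (bΘ.prodMk bV))
    generalize hQ : (fun h : L2Seq ℝ × Hs s ↦
      P₀ (S (Θ h.1)) + V h.2 + B (S (Θ h.1)) (V h.2)) = Q at bQ
    have hQh : ∀ h m, Q h m = P₀ (S (Θ h.1)) m + V h.2 m + S (Θ h.1) m (V h.2 m) := fun h m ↦ by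
      rw [← hQ]
      simp only [lp.coeFn_add, Pi.add_apply, hB]
    have blQ := bl.comp bQ
    have bg := bim.comp (bR.comp blQ)
    generalize hg : (fun h ↦ im (R (l (Q h)))) = g at bg
    have bε : AnalyticBound _ fun h : L2Seq ℝ × Hs s ↦ lin h.1 + dif (g h) :=
      beps.comp (bfst.prodMk bg)
    generalize hε : (fun h : L2Seq ℝ × Hs s ↦ lin h.1 + dif (g h)) = ε at bε
    have bS₁ : AnalyticBound _ fun h ↦ S ((-Θ₁) (ε h) + (-J) (g h)) :=
      bS.comp ((bnΘ.comp bε).add (bnJ.comp bg))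
    generalize hS₁ : (fun h ↦ S ((-Θ₁) (ε h) + (-J) (g h))) = S₁ at bS₁
    have bY : AnalyticBound _ fun h ↦ P₀ (S₁ h) + Q h + B (S₁ h) (Q h) :=
      ((bP.comp bS₁).add bQ).add (bB.comp (bS₁.prodMk bQ))
    generalize hY : (fun h ↦ P₀ (S₁ h) + Q h + B (S₁ h) (Q h)) = Y at bY
    have hYh : ∀ h m, Y h m = P₀ (S₁ h) m + Q h m + S₁ h m (Q h m) := fun h m ↦ by
      rw [← hY]
      simp only [lp.coeFn_add, Pi.add_apply, hB]
    refine ⟨fun h ↦ (ε h, syn (Y h)), bε.prodMk (bsyn.comp bY), ?_⟩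
    filter_upwards [blQ.tendsto.eventually hRe] with h hh
    refine ⟨S (Θ h.1), S₁ h, Q h, Y h, g h, R (l (Q h)), hSe _, hQh h, hh, fun m ↦ ?_, fun m ↦ ?_,
      hYh h, ?_, rfl⟩
    · rw [← hg]
      exact him _ m
    · rw [← hS₁]
      have e := hSe ((-Θ₁) (ε h) + (-J) (g h)) m
      rwa [_root_.neg_apply, _root_.neg_apply, ← sub_eq_add_neg] at e
    · rw [← hε]


/-! ### The operators in the formula for coordinate changes -/

theorem Windows.localPhase_congr {η ρ : ℝ → ℝ} (w : Windows η ρ) (L L₁ : ℕ+) (m : ℤ) {a a' : ℤ → ℝ}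
    (h : ∀ k n, a k - a n = a' k - a' n) : w.localPhase L L₁ m a = w.localPhase L L₁ m a' := by
  simp only [localPhase, h]

theorem Windows.localPhase_add {η ρ : ℝ → ℝ} (w : Windows η ρ) (L L₁ : ℕ+) (m : ℤ) (a a' : ℤ → ℝ) :
    w.localPhase L L₁ m (a + a') = w.localPhase L L₁ m a + w.localPhase L L₁ m a' := by
  simp only [localPhase, ← Finset.sum_add_distrib, ← add_smul, ← Complex.ofReal_add, Pi.add_apply]
  refine Finset.sum_congr rfl fun k _ ↦ ?_
  congr 2
  ring

theorem Windows.localPhase_smul {η ρ : ℝ → ℝ} (w : Windows η ρ) (L L₁ : ℕ+) (m : ℤ) (c : ℝ)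
    (a : ℤ → ℝ) : w.localPhase L L₁ m (c • a) = (c : ℂ) • w.localPhase L L₁ m a := by
  simp only [localPhase, Finset.smul_sum, smul_smul, ← Complex.ofReal_mul, Pi.smul_apply,
    smul_eq_mul, mul_sub]

theorem Windows.exists_phaseOp {η ρ : ℝ → ℝ} (w : Windows η ρ) (s : ℝ) (L L₁ : ℕ+) :
    ∃ Θ : L2Seq ℝ →L[ℝ] L2Seq (Hs s →L[ℂ] Hs s), ∀ α m,
      Θ α m = mulOp s (Complex.I • w.localPhase L L₁ m (L2dSeq.lift α).seq) := by
  obtain ⟨D, hD0, hD⟩ := w.exists_osc_bound L L₁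
  set κ := (multBound s w.ρS).toReal
  have hκ : 0 ≤ κ := ENNReal.toReal_nonneg
  let f : ℤ → L2Seq ℝ →ₗ[ℝ] (Hs s →L[ℂ] Hs s) := fun m ↦
    { toFun := fun α ↦ mulOp s (Complex.I • w.localPhase L L₁ m (L2dSeq.lift α).seq)
      map_add' := fun α β ↦ by
        rw [map_add, map_add, w.localPhase_add, smul_add, mulOp_add]
      map_smul' := fun c α ↦ by
        rw [map_smul, map_smul, w.localPhase_smul, smul_comm, mulOp_smul]
        rfl }
  obtain ⟨Θ, -, hΘ⟩ := L2Seq.exists_clm f (C := κ * D) (by positivity) fun α ↦ by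
    have h1 : ∀ m, ‖f m α‖ ^ 2 ≤ κ ^ 2 * w.osc L L₁ m (L2dSeq.lift α).seq ^ 2 := fun m ↦ by
      rw [← mul_pow]
      refine pow_le_pow_left₀ (norm_nonneg _) ?_ 2
      change ‖mulOp s (Complex.I • w.localPhase L L₁ m (L2dSeq.lift α).seq)‖ ≤ _
      rw [mulOp_smul, norm_smul, Complex.norm_I, one_mul]
      exact w.norm_mulOp_localPhase_le s L L₁ m _
    have h2 := (hD (L2dSeq.lift α)).1.mul_left (κ ^ 2)
    have h3 := Summable.of_nonneg_of_le (fun m ↦ by positivity) h1 h2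
    refine ⟨h3, (h3.tsum_le_tsum h1 h2).trans ?_⟩
    rw [tsum_mul_left, mul_pow, mul_assoc, ← L2dSeq.norm_lift α]
    exact mul_le_mul_of_nonneg_left (hD _).2 (by positivity)
  exact ⟨Θ, hΘ⟩

theorem Windows.five_le_R {η ρ : ℝ → ℝ} (w : Windows η ρ) : 5 ≤ w.R := by
  by_contra! h
  have h1 := w.χ_eq_zero 5 (by rwa [abs_of_pos (by norm_num)])
  rw [w.χ_eq_one 5 (by rw [abs_of_pos (by norm_num)])] at h1
  exact one_ne_zero h1

theorem Windows.refIndex_sub_mem_nbhd {η ρ : ℝ → ℝ} (w : Windows η ρ) (L L₁ : ℕ+) (m : ℤ) :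
    refIndex L L₁ (m - 1) - refIndex L L₁ m ∈ w.nbhd L L₁ := by
  have hL := cast_pnat_pos L
  have hL₁ := cast_pnat_pos L₁
  obtain ⟨h1, h2⟩ := refIndex_bounds L L₁ m
  obtain ⟨h3, h4⟩ := refIndex_bounds L L₁ (m - 1)
  have hceil := Int.le_ceil (w.R * (((L : ℕ) : ℝ) + ((L₁ : ℕ) : ℝ)) / (4 * ((L : ℕ) : ℝ)))
  rw [div_le_iff₀ (by positivity)] at hceil
  push_cast at h3 h4
  have hR := w.five_le_R
  have hRL : 5 * (((L : ℕ) : ℝ) + ((L₁ : ℕ) : ℝ)) ≤ w.R * (((L : ℕ) : ℝ) + ((L₁ : ℕ) : ℝ)) := by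
    gcongr
  rw [nbhd, Finset.mem_Icc, range, ← Int.cast_le (R := ℝ), ← Int.cast_le (R := ℝ)]
  push_cast
  set K : ℝ := ((⌈w.R * (((L : ℕ) : ℝ) + ((L₁ : ℕ) : ℝ)) / (4 * ((L : ℕ) : ℝ))⌉ : ℤ) : ℝ)
  constructor <;> by_contra! hlt <;> nlinarith

theorem Windows.exists_refDiff {η ρ : ℝ → ℝ} (w : Windows η ρ) (L L₁ : ℕ+) :
    ∃ T : L2Seq ℝ →L[ℝ] L2Seq ℝ, ∀ α m, T α m = (L2dSeq.lift α).seq (refIndex L L₁ m)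
      - (L2dSeq.lift α).seq (refIndex L L₁ (m - 1)) := by
  obtain ⟨D, hD0, hD⟩ := w.exists_osc_bound L L₁
  let f : ℤ → L2Seq ℝ →ₗ[ℝ] ℝ := fun m ↦
    { toFun := fun α ↦ (L2dSeq.lift α).seq (refIndex L L₁ m)
        - (L2dSeq.lift α).seq (refIndex L L₁ (m - 1))
      map_add' := fun α β ↦ by simp only [map_add, Pi.add_apply]; ring
      map_smul' := fun c α ↦ by
        simp only [map_smul, Pi.smul_apply, smul_eq_mul, RingHom.id_apply]; ring }
  have hf : ∀ m α, f m α = (L2dSeq.lift α).seq (refIndex L L₁ m)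
      - (L2dSeq.lift α).seq (refIndex L L₁ (m - 1)) := fun m α ↦ rfl
  obtain ⟨T, -, hT⟩ := L2Seq.exists_clm f hD0 fun α ↦ by
    have h1 : ∀ m, ‖f m α‖ ^ 2 ≤ w.osc L L₁ m (L2dSeq.lift α).seq ^ 2 := fun m ↦ by
      refine pow_le_pow_left₀ (norm_nonneg _) ?_ 2
      rw [hf, norm_sub_rev, Real.norm_eq_abs]
      have h := Finset.single_le_sum (f := fun k ↦ |(L2dSeq.lift α).seq (refIndex L L₁ m + k)
        - (L2dSeq.lift α).seq (refIndex L L₁ m)|) (fun _ _ ↦ abs_nonneg _)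
        (w.refIndex_sub_mem_nbhd L L₁ m)
      simp only [add_sub_cancel] at h
      exact h
    have h3 := Summable.of_nonneg_of_le (fun m ↦ by positivity) h1 (hD (L2dSeq.lift α)).1
    refine ⟨h3, (h3.tsum_le_tsum h1 (hD _).1).trans ?_⟩
    rw [← L2dSeq.norm_lift α]
    exact (hD _).2
  exact ⟨T, fun α m ↦ (hT α m).trans (hf m α)⟩

theorem L2Seq.exists_diff : ∃ T : L2Seq ℝ →L[ℝ] L2Seq ℝ, ∀ α m, T α m = α m - α (m - 1) := by
  let f : ℤ → L2Seq ℝ →ₗ[ℝ] ℝ := fun m ↦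
    { toFun := fun α ↦ α m - α (m - 1)
      map_add' := fun α β ↦ by simp only [lp.coeFn_add, Pi.add_apply]; ring
      map_smul' := fun c α ↦ by
        simp only [lp.coeFn_smul, Pi.smul_apply, smul_eq_mul, RingHom.id_apply]; ring }
  obtain ⟨T, -, hT⟩ := L2Seq.exists_clm f zero_le_two fun α ↦ by
    have h0 := hasSum_norm_sq α
    have h0' : HasSum (fun n ↦ ‖α (n - 1)‖ ^ 2) (‖α‖ ^ 2) :=
      (Equiv.subRight (1 : ℤ)).hasSum_iff.2 h0
    have h1 : ∀ m, ‖f m α‖ ^ 2 ≤ 2 * ‖α m‖ ^ 2 + 2 * ‖α (m - 1)‖ ^ 2 := fun m ↦ by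
      change ‖α m - α (m - 1)‖ ^ 2 ≤ _
      simp only [Real.norm_eq_abs, sq_abs]
      nlinarith [sq_nonneg (α m + α (m - 1))]
    have h2 := (h0.mul_left 2).add (h0'.mul_left 2)
    have h3 := Summable.of_nonneg_of_le (fun m ↦ by positivity) h1 h2.summable
    refine ⟨h3, (h3.tsum_le_tsum h1 h2.summable).trans ?_⟩
    rw [h2.tsum_eq]
    linarith
  exact ⟨T, hT⟩

theorem Windows.exists_synthesis {η ρ : ℝ → ℝ} (w : Windows η ρ) (s : ℝ) (L : ℕ+) :
    ∃ T : L2Seq (Hs s) →L[ℝ] Hs s, ∀ y, T y = ∑' m, mulOp s (cell L w.ρS m) (y m) := by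
  obtain ⟨C, hC0, hC⟩ := GrossPitaevskii.exists_synthesis s (one_le_scale L)
    (hasCompactSupport_dilate w.ρ_compact (cast_pnat_pos L))
  have hS : ∀ y : L2Seq (Hs s), Summable fun m ↦ mulOp s (cell L w.ρS m) (y m) := fun y ↦
    (hC _ (L2Seq.hasSum_norm_sq y).summable).1
  let f : L2Seq (Hs s) →ₗ[ℝ] Hs s :=
    { toFun := fun y ↦ ∑' m, mulOp s (cell L w.ρS m) (y m)
      map_add' := fun y z ↦ by
        rw [← (hS y).tsum_add (hS z)]
        exact tsum_congr fun m ↦ by rw [lp.coeFn_add, Pi.add_apply, map_add]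
      map_smul' := fun c y ↦ by
        rw [RingHom.id_apply, ← (hS y).tsum_const_smul c]
        refine tsum_congr fun m ↦ ?_
        rw [lp.coeFn_smul, Pi.smul_apply]
        exact (mulOp s (cell L w.ρS m)).map_smul_of_tower c (y m) }
  refine ⟨f.mkContinuous C fun y ↦ ?_, fun y ↦ rfl⟩
  refine (hC _ (L2Seq.hasSum_norm_sq y).summable).2.trans ?_
  rw [(L2Seq.hasSum_norm_sq y).tsum_eq, Real.sqrt_sq (norm_nonneg _)]

theorem L2Seq.exists_eval {s : ℝ} {x : ℤ → Hs s} {B : ℝ} (hB : 0 ≤ B) (hx : ∀ m, ‖x m‖ ≤ B) :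
    ∃ P : L2Seq (Hs s →L[ℂ] Hs s) →L[ℝ] L2Seq (Hs s), ‖P‖ ≤ B ∧ ∀ S m, P S m = S m (x m) := by
  obtain ⟨P, hP, hPe⟩ := L2Seq.exists_diag (E := Hs s →L[ℂ] Hs s) (F := Hs s)
    (fun m ↦ (ContinuousLinearMap.apply ℂ (Hs s) (x m)).restrictScalars ℝ) hB fun m ↦ by
      rw [ContinuousLinearMap.norm_restrictScalars]
      refine ContinuousLinearMap.opNorm_le_bound _ hB fun T ↦ ?_
      refine (T.le_opNorm (x m)).trans ?_
      rw [mul_comm]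
      exact mul_le_mul_of_nonneg_right (hx m) (norm_nonneg _)
  exact ⟨P, hP, fun S m ↦ hPe S m⟩

theorem Windows.exists_phaseCells {η ρ : ℝ → ℝ} (w : Windows η ρ) (s : ℝ) (L L₁ : ℕ+) :
    ∃ C : ℝ, 0 ≤ C ∧ ∀ a : L2dSeq, ‖a‖ ≤ 1 → ∃ V : Hs s →L[ℝ] L2Seq (Hs s), ‖V‖ ≤ C ∧
      ∀ u m, V u m = Complex.exp (Complex.I * (a.seq (refIndex L L₁ m) : ℂ)) •
        w.expOp s L L₁ m a.seq (mulOp s (cell L₁ w.χS m) u) := by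
  obtain ⟨C₁, hC₁1, hC₁⟩ := w.exists_expOp_bound s L L₁ 1
  obtain ⟨C₂, hC₂0, hC₂⟩ := summable_norm_mulOp_translate_sq s (one_le_scale L₁)
    (hasCompactSupport_dilate w.χ_compact (cast_pnat_pos L₁))
  refine ⟨C₁ * C₂, by positivity, fun a ha ↦ ?_⟩
  obtain ⟨-, -, -, -, -, hx⟩ := hC₁ a ha
  let g : ℤ → Hs s →L[ℂ] Hs s := fun m ↦
    Complex.exp (Complex.I * (a.seq (refIndex L L₁ m) : ℂ)) •
      (w.expOp s L L₁ m a.seq).comp (mulOp s (cell L₁ w.χS m))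
  have hg : ∀ u m, ‖g m u‖ ^ 2 ≤ C₁ ^ 2 * ‖mulOp s (cell L₁ w.χS m) u‖ ^ 2 := fun u m ↦ by
    rw [← mul_pow]
    refine pow_le_pow_left₀ (norm_nonneg _) ?_ 2
    change ‖Complex.exp (Complex.I * (a.seq (refIndex L L₁ m) : ℂ)) •
      w.expOp s L L₁ m a.seq (mulOp s (cell L₁ w.χS m) u)‖ ≤ _
    rw [norm_smul, norm_cexp_I_mul, one_mul]
    exact hx m _
  obtain ⟨V, hV, hVe⟩ := L2Seq.exists_clm (fun m ↦ ((g m).restrictScalars ℝ).toLinearMap)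
    (C := C₁ * C₂) (by positivity) fun u ↦ by
    have h3 := Summable.of_nonneg_of_le (fun m ↦ by positivity) (hg u) ((hC₂ u).1.mul_left _)
    refine ⟨h3, (h3.tsum_le_tsum (hg u) ((hC₂ u).1.mul_left _)).trans ?_⟩
    rw [tsum_mul_left, mul_pow, mul_assoc]
    exact mul_le_mul_of_nonneg_left (hC₂ u).2 (by positivity)
  exact ⟨V, hV, fun u m ↦ hVe u m⟩

theorem Windows.exists_phaseMul {η ρ : ℝ → ℝ} (w : Windows η ρ) (s : ℝ) (L : ℕ+) :
    ∃ C : ℝ, 0 ≤ C ∧ ∀ a : L2dSeq, ‖a‖ ≤ 1 → ∃ V : L2Seq (Hs s) →L[ℝ] L2Seq (Hs s), ‖V‖ ≤ C ∧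
      ∀ y m, V y m = Complex.exp (Complex.I * (a.seq m : ℂ)) • w.expOp s L L m a.seq (y m) := by
  obtain ⟨C, hC1, hC⟩ := w.exists_expOp_bound s L L 1
  have hC0 : 0 ≤ C := zero_le_one.trans hC1
  refine ⟨C, hC0, fun a ha ↦ ?_⟩
  obtain ⟨-, -, -, -, -, hx⟩ := hC a ha
  let g : ℤ → Hs s →L[ℂ] Hs s := fun m ↦
    Complex.exp (Complex.I * (a.seq m : ℂ)) • w.expOp s L L m a.seq
  obtain ⟨V, hV, hVe⟩ := L2Seq.exists_diag (fun m ↦ (g m).restrictScalars ℝ) hC0 fun m ↦ by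
    rw [ContinuousLinearMap.norm_restrictScalars, norm_smul, norm_cexp_I_mul, one_mul]
    exact ContinuousLinearMap.opNorm_le_bound _ hC0 (hx m)
  exact ⟨V, hV, fun y m ↦ hVe y m⟩

theorem Windows.Near.exists_relCorr {η ρ : ℝ → ℝ} {w : Windows η ρ} {s : ℝ} {L : ℕ+} {B : ℝ}
    {q p : ℝ → ℂ} (hp : w.Near s L B q p) (hq : w.Good s L B q) :
    ∃ l : L2Seq (Hs s) →L[ℝ] L2Seq ℂ, ‖l‖ ≤ 4 * (multBound s w.ηS).toReal ^ 2 * |B| ∧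
      ∀ y m, l y m = (w.corr s L q p m)⁻¹ *
        inner ℂ (loc s (cell L w.ηS m) q) (mulOp s (cell L w.ηS m) (y m)) := by
  set κ := (multBound s w.ηS).toReal
  have hκ : 0 ≤ κ := ENNReal.toReal_nonneg
  let g : ℤ → Hs s →L[ℂ] ℂ := fun m ↦ (w.corr s L q p m)⁻¹ •
    (innerSL ℂ (loc s (cell L w.ηS m) q)).comp (mulOp s (cell L w.ηS m))
  obtain ⟨l, hl, hle⟩ := L2Seq.exists_diag (fun m ↦ (g m).restrictScalars ℝ)
    (C := 4 * κ ^ 2 * |B|) (by positivity) fun m ↦ by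
    rw [ContinuousLinearMap.norm_restrictScalars, norm_smul, norm_inv]
    have h1 := ContinuousLinearMap.opNorm_comp_le (innerSL ℂ (loc s (cell L w.ηS m) q))
      (mulOp s (cell L w.ηS m))
    rw [innerSL_apply_norm] at h1
    have h2 : ‖loc s (cell L w.ηS m) q‖ ≤ κ * |B| :=
      (hq.norm_loc_η_le m).trans (mul_le_mul_of_nonneg_left (le_abs_self B) hκ)
    have h3 : ‖w.corr s L q p m‖⁻¹ ≤ 4 := by
      rw [inv_le_comm₀ (by linarith [hp.lower m]) (by norm_num)]
      linarith [hp.lower m]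
    calc _ ≤ 4 * ((κ * |B|) * κ) := by
          refine mul_le_mul h3 (h1.trans ?_) (norm_nonneg _) (by norm_num)
          exact mul_le_mul h2 (norm_mulOp_cell_le s L w.ηS m) (norm_nonneg _) (by positivity)
      _ = _ := by ring
  exact ⟨l, hl, fun y m ↦ hle y m⟩


/-! ### Coordinate changes -/

theorem Windows.phase_add {η ρ : ℝ → ℝ} (w : Windows η ρ) (L : ℕ+) (a a' : ℤ → ℝ) (x : ℝ) :
    phase ρ ((L : ℕ) : ℝ) (a + a') x
      = phase ρ ((L : ℕ) : ℝ) a x + phase ρ ((L : ℕ) : ℝ) a' x := by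
  have h := w.phase_sub L a (a + a') x
  rw [add_sub_cancel_left] at h
  linarith

theorem cexp_I_mul_add (x y : ℝ) : Complex.exp (Complex.I * ((x + y : ℝ) : ℂ))
    = Complex.exp (Complex.I * (x : ℂ)) * Complex.exp (Complex.I * (y : ℂ)) := by
  rw [Complex.ofReal_add, mul_add, Complex.exp_add]

/-- The function with coordinates `(a + d, b + β)` in terms of the one with coordinates `(a, b)`. -/
theorem Windows.Coord.ofCoord_add_ae {η ρ : ℝ → ℝ} {w : Windows η ρ} {s : ℝ} (hs : 0 ≤ s) {L : ℕ+}
    {q p : ℝ → ℂ} {a : L2dSeq} {b : Hs s} (h : w.Coord s L q p a b) (hq : LocHs s q)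
    (hp : LocHs s p) (d : L2dSeq) (β : Hs s) :
    ofCoord ρ hs L q (a + d) (b + β) =ᵐ[volume] fun x ↦
      Complex.exp (Complex.I * (phase ρ ((L : ℕ) : ℝ) d.seq x : ℂ)) *
        (p x + Complex.exp (Complex.I * (phase ρ ((L : ℕ) : ℝ) a.seq x : ℂ)) * Hs.fn hs β x) := by
  have h1 := h.represents.ae_eq_fn hs
    ((hp.smooth_mul (w.contDiff_cexp_phase L a.seq (-Complex.I))).sub hq).locallyIntegrable
  have h2 : Hs.fn hs (b + β) =ᵐ[volume] fun x ↦ Hs.fn hs b x + Hs.fn hs β x := by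
    rw [map_add]
    exact Lp.coeFn_add _ _
  filter_upwards [h1, h2] with x e1 e2
  rw [ofCoord, e2, e1, map_add, w.phase_add, cexp_I_mul_add]
  have := cexp_mul_cancel (phase ρ ((L : ℕ) : ℝ) a.seq x) (p x)
  linear_combination Complex.exp (Complex.I * (phase ρ ((L : ℕ) : ℝ) d.seq x : ℂ)) * this

theorem Windows.loc_phase_mul_cell {η ρ : ℝ → ℝ} (w : Windows η ρ) {s : ℝ} (L L₁ : ℕ+) (m : ℤ)
    {f : ℝ → ℂ} (hf : LocHs s f) (a : ℤ → ℝ) :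
    loc s (cell L₁ w.χS m)
        (fun x ↦ Complex.exp (Complex.I * (phase ρ ((L : ℕ) : ℝ) a x : ℂ)) * f x)
      = Complex.exp (Complex.I * (a (refIndex L L₁ m) : ℂ)) •
        w.expOp s L L₁ m a (loc s (cell L₁ w.χS m) f) :=
  w.loc_phase_mul (w.hasCompactSupport_χ L₁ m) w.cell_χ_eq_zero hf a

theorem Windows.Coord.loc_ofCoord_add {η ρ : ℝ → ℝ} {w : Windows η ρ} {s : ℝ} (hs : 0 ≤ s)
    {L : ℕ+} {q p : ℝ → ℂ} {a : L2dSeq} {b : Hs s} (h : w.Coord s L q p a b) (hq : LocHs s q)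
    (hp : LocHs s p) (d : L2dSeq) (β : Hs s) (L₁ : ℕ+) (m : ℤ) :
    loc s (cell L₁ w.χS m) (ofCoord ρ hs L q (a + d) (b + β))
      = Complex.exp (Complex.I * (d.seq (refIndex L L₁ m) : ℂ)) •
        w.expOp s L L₁ m d.seq (loc s (cell L₁ w.χS m) p +
          Complex.exp (Complex.I * (a.seq (refIndex L L₁ m) : ℂ)) •
            w.expOp s L L₁ m a.seq (mulOp s (cell L₁ w.χS m) β)) := by
  have hβ := LocHs.fn hs β
  have hβ' := hβ.smooth_mul (w.contDiff_cexp_phase L a.seq Complex.I)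
  rw [loc_congr_ae (h.ofCoord_add_ae hs hq hp d β), w.loc_phase_mul_cell L L₁ m (hp.add hβ'),
    hp.loc_add hβ' (w.hasCompactSupport_χ L₁ m), w.loc_phase_mul_cell L L₁ m hβ,
    loc_of_represents (Hs.represents_fn hs β)]

theorem L2dSeq.sub_eq_sub {a a' : L2dSeq} (h : L2dSeq.diff a = L2dSeq.diff a') (k n : ℤ) :
    a.seq k - a.seq n = a'.seq k - a'.seq n := by
  have h1 : (fun j ↦ a.seq j - a.seq 0) = fun j ↦ a'.seq j - a'.seq 0 :=
    eq_of_sub_eq (by simp) fun j ↦ by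
      have := congrArg (fun f : L2Seq ℝ ↦ f j) h
      simp only [diff_apply] at this
      linarith
  have h2 := congrFun h1 k
  have h3 := congrFun h1 n
  linarith

theorem mulOp_neg (σ : ℝ) (f : 𝓢(ℝ, ℂ)) : mulOp σ (-f) = -mulOp σ f := (mulOpₗ σ).map_neg f

theorem exp_sub_smul_one {A : Type*} [NormedRing A] [NormedAlgebra ℂ A] [CompleteSpace A] (a : A)
    (z : ℂ) : NormedSpace.exp (a - z • (1 : A)) = Complex.exp (-z) • NormedSpace.exp a := by
  have h1 : a - z • (1 : A) = algebraMap ℂ A (-z) + a := by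
    rw [Algebra.algebraMap_eq_smul_one, neg_smul]
    abel
  let : NormedAlgebra ℚ A := NormedAlgebra.restrictScalars ℚ ℂ A
  rw [h1, NormedSpace.exp_add_of_commute (Algebra.commutes (-z) a),
    ← NormedSpace.algebraMap_exp_comm, Complex.exp_eq_exp_ℂ, Algebra.smul_def]

theorem Windows.exists_change {η ρ : ℝ → ℝ} (w : Windows η ρ) {s : ℝ} (hs : 0 ≤ s) (L L₁ : ℕ+)
    (B : ℝ) : ∃ C : ℕ → ℝ, ∀ (q q₁ p : ℝ → ℂ) (a a₁ : L2dSeq) (b b₁ : Hs s), LocHs s q →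
      w.Good s L₁ B q₁ → w.Near s L₁ B q₁ p → w.Coord s L q p a b → w.Coord s L₁ q₁ p a₁ b₁ →
      ∃ F : L2Seq ℝ × Hs s → L2Seq ℝ × Hs s, AnalyticBound C F ∧ ∀ᶠ h in nhds 0, ∃ a' : L2dSeq,
        L2dSeq.diff a' = L2dSeq.diff a₁ + (F h).1 ∧
        w.Coord s L₁ q₁ (ofCoord ρ hs L q (a + L2dSeq.lift h.1) (b + h.2)) a' (b₁ + (F h).2) := by
  obtain ⟨Θ, hΘ⟩ := w.exists_phaseOp s L L₁
  obtain ⟨Θ₁, hΘ₁⟩ := w.exists_phaseOp s L₁ L₁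
  obtain ⟨lin, hlin⟩ := w.exists_refDiff L L₁
  obtain ⟨dif, hdif⟩ := L2Seq.exists_diff
  obtain ⟨J, -, hJ⟩ := L2Seq.exists_diag (F := Hs s →L[ℂ] Hs s)
    (fun _ ↦ ContinuousLinearMap.toSpanSingleton ℝ (Complex.I • (1 : Hs s →L[ℂ] Hs s)))
    (norm_nonneg _) fun _ ↦ le_rfl
  obtain ⟨C₁, hC₁0, hC₁⟩ := w.exists_phaseCells s L L₁
  obtain ⟨C₂, hC₂0, hC₂⟩ := w.exists_phaseMul s L₁
  obtain ⟨syn, hsyn⟩ := w.exists_synthesis s L₁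
  obtain ⟨C₃, -, hrep⟩ := w.exists_represents_tsum s L₁
  set M : ℝ := max (max (|B| + 1) C₁) (max (4 * (multBound s w.ηS).toReal ^ 2 * |B|) (‖syn‖ * C₂))
  obtain ⟨C, hC⟩ := exists_change_formula Θ Θ₁ J lin dif M
  refine ⟨C, fun q q₁ p a a₁ b b₁ hq hq₁ hp h₀ h₁ ↦ ?_⟩
  obtain ⟨P, hP, hPe⟩ := L2Seq.exists_eval (x := fun m ↦ loc s (cell L₁ w.χS m) p)
    (B := |B| + 1) (by positivity) fun m ↦ (hp.bound m).trans (by linarith [le_abs_self B])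
  obtain ⟨V, hV, hVe⟩ := hC₁ a h₀.norm_le_one
  obtain ⟨V₁, hV₁, hV₁e⟩ := hC₂ (-a₁) (by rw [norm_neg]; exact h₁.norm_le_one)
  obtain ⟨l, hl, hle⟩ := hp.exists_relCorr hq₁
  obtain ⟨F, hF, hFe⟩ := hC P V l (syn.comp V₁)
    (hP.trans ((le_max_left _ _).trans (le_max_left _ _)))
    (hV.trans ((le_max_right _ _).trans (le_max_left _ _)))
    (hl.trans ((le_max_left _ _).trans (le_max_right _ _)))
    ((ContinuousLinearMap.opNorm_comp_le _ _).trans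
      ((mul_le_mul_of_nonneg_left hV₁ (norm_nonneg _)).trans
        ((le_max_right _ _).trans (le_max_right _ _))))
  refine ⟨F, hF, ?_⟩
  have hsmall : ∀ᶠ h in nhds (0 : L2Seq ℝ × Hs s), ‖L2dSeq.diff a₁ + (F h).1‖ ^ 2 < 1 / 2 := by
    have h2 : Filter.Tendsto (fun h ↦ ‖L2dSeq.diff a₁ + (F h).1‖ ^ 2) (nhds 0)
        (nhds (‖L2dSeq.diff a₁ + (0 : L2Seq ℝ × Hs s).1‖ ^ 2)) :=
      (((continuous_fst.tendsto _).comp hF.tendsto).const_add _).norm.pow 2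
    refine h2.eventually_lt_const ?_
    rw [Prod.fst_zero, add_zero, ← L2dSeq.norm_eq]
    exact h₁.small
  filter_upwards [hFe, hsmall] with h hh hsm
  obtain ⟨S, S₁, Q, Y, g, ζ, hS, hQ, hζ, hg, hS₁, hY, hF1, hF2⟩ := hh
  set d := L2dSeq.lift h.1
  set p' := ofCoord ρ hs L q (a + d) (b + h.2) with hp'
  have hp'l : LocHs s p' := w.locHs_ofCoord hs L hq _ _
  have hεe : ∀ m, (F h).1 m = (d.seq (refIndex L L₁ m) + g m)
      - (d.seq (refIndex L L₁ (m - 1)) + g (m - 1)) := fun m ↦ by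
    rw [hF1, lp.coeFn_add, Pi.add_apply, hlin, hdif]
    ring
  let e : L2dSeq := ⟨fun m ↦ d.seq (refIndex L L₁ m) + g m, by
    change Memℓp (fun m ↦ (d.seq (refIndex L L₁ m) + g m)
      - (d.seq (refIndex L L₁ (m - 1)) + g (m - 1))) 2
    rw [← funext hεe]
    exact lp.memℓp _⟩
  have hes : ∀ m, e.seq m = d.seq (refIndex L L₁ m) + g m := fun m ↦ rfl
  have hed : L2dSeq.diff e = (F h).1 := by
    ext m
    rw [L2dSeq.diff_apply, hes, hes, hεe]
  have ha' : L2dSeq.diff (a₁ + e) = L2dSeq.diff a₁ + (F h).1 := by rw [map_add, hed]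
  have hlocp : ∀ m, loc s (cell L₁ w.χS m) p' = Complex.exp (Complex.I *
      (d.seq (refIndex L L₁ m) : ℂ)) • (loc s (cell L₁ w.χS m) p + Q m) := fun m ↦ by
    have hSm : w.expOp s L L₁ m d.seq = S m + 1 := by
      rw [hS, hΘ, sub_add_cancel]
      rfl
    rw [hp', h₀.loc_ofCoord_add hs hq hp.locHs d h.2 L₁ m, hQ, hPe, hVe, hSm, _root_.add_apply,
      map_add, one_apply_eq_self]
    congr 1
    abel
  have hcorr : ∀ m, w.corr s L₁ q₁ p' m = Complex.exp (Complex.I *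
      (d.seq (refIndex L L₁ m) : ℂ)) * (w.corr s L₁ q₁ p m * Complex.exp (ζ m)) := fun m ↦ by
    have hη : ∀ {f : ℝ → ℂ}, LocHs s f → mulOp s (cell L₁ w.ηS m) (loc s (cell L₁ w.χS m) f)
        = loc s (cell L₁ w.ηS m) f := fun hf ↦
      hf.mulOp_loc (w.hasCompactSupport_χ L₁ m) (w.η_mul_χ L₁ (by simp))
    rw [hζ, hle, corr, ← hη hp'l, hlocp, map_smul, map_add, hη hp.locHs, inner_smul_right,
      inner_add_right, mul_add (w.corr s L₁ q₁ p m), mul_one, mul_inv_cancel_left₀ (h₁.corr_ne_zero m)]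
    rfl
  refine ⟨a₁ + e, ha', fun m ↦ ?_, ?_, ?_⟩
  · have hz : Complex.exp (ζ m) = (‖Complex.exp (ζ m)‖ : ℂ) * Complex.exp (Complex.I * (g m : ℂ)) := by
      rw [hg, Complex.norm_exp, Complex.ofReal_exp, ← Complex.exp_add, mul_comm Complex.I,
        Complex.re_add_im]
    have hz0 : (‖Complex.exp (ζ m)‖ : ℂ) ≠ 0 :=
      Complex.ofReal_ne_zero.2 (norm_ne_zero_iff.2 (Complex.exp_ne_zero _))
    have hc0 : (‖w.corr s L₁ q₁ p m‖ : ℂ) ≠ 0 :=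
      Complex.ofReal_ne_zero.2 (norm_ne_zero_iff.2 (h₁.corr_ne_zero m))
    rw [hcorr, norm_mul, norm_mul, norm_cexp_I_mul, one_mul, map_add, Pi.add_apply, hes,
      cexp_I_mul_add, cexp_I_mul_add, h₁.phase_eq, Complex.ofReal_mul, eq_div_iff (mul_ne_zero hc0 hz0)]
    conv_rhs => rw [hz]
    field_simp
  · rw [L2dSeq.norm_eq, ha']
    exact hsm
  · set θ : (ℤ → ℝ) → ℝ → ℂ := fun c x ↦
      Complex.exp (Complex.I * (phase ρ ((L₁ : ℕ) : ℝ) c x : ℂ)) with hθ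
    set G : ℝ → ℂ := fun x ↦ θ (-e : L2dSeq).seq x * p' x - p x
    have hθs : ∀ c, ContDiff ℝ ∞ (θ c) := fun c ↦ w.contDiff_cexp_phase L₁ c Complex.I
    have hG1 := hp'l.smooth_mul (hθs (-e : L2dSeq).seq)
    have hG : LocHs s G := hG1.sub hp.locHs
    have hlocG : ∀ m, loc s (cell L₁ w.χS m) G = Y m := fun m ↦ by
      have hSm : S₁ m + 1 = Complex.exp (-(g m * Complex.I)) • w.expOp s L₁ L₁ m (-e : L2dSeq).seq := by
        have e1 : w.localPhase L₁ L₁ m (-e : L2dSeq).seq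
            = -w.localPhase L₁ L₁ m (L2dSeq.lift (F h).1).seq := by
          have e2 := w.localPhase_smul L₁ L₁ m (-1) e.seq
          rw [neg_one_smul, Complex.ofReal_neg, Complex.ofReal_one, neg_one_smul] at e2
          rw [map_neg, e2]
          congr 1
          exact w.localPhase_congr L₁ L₁ m
            (L2dSeq.sub_eq_sub (hed.trans (L2dSeq.diff_lift _).symm))
        have e2 : ContinuousLinearMap.toSpanSingleton ℝ (Complex.I • (1 : Hs s →L[ℂ] Hs s)) (g m)
            = (g m * Complex.I : ℂ) • 1 := by
          rw [ContinuousLinearMap.toSpanSingleton_apply, mul_smul, Complex.coe_smul]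
        rw [hS₁, sub_add_cancel, hJ, hΘ₁, expOp, e1, ← exp_sub_smul_one, smul_neg, mulOp_neg, e2]
      have e3 := w.loc_phase_mul_cell L₁ L₁ m hp'l (-e : L2dSeq).seq
      rw [hG1.loc_sub hp.locHs (w.hasCompactSupport_χ L₁ m), e3, refIndex_self, hlocp, hY, hPe]
      have e4 : S₁ m (loc s (cell L₁ w.χS m) p) + Q m + S₁ m (Q m)
          = (S₁ m + 1) (loc s (cell L₁ w.χS m) p + Q m) - loc s (cell L₁ w.χS m) p := by
        rw [_root_.add_apply, map_add, one_apply_eq_self]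
        abel
      rw [e4, hSm, _root_.smul_apply, map_smul, smul_smul, ← Complex.exp_add, map_neg, Pi.neg_apply,
        hes]
      congr 3
      push_cast
      ring
    have hsynY : (F h).2.Represents (fun x ↦ θ (-a₁ : L2dSeq).seq x * G x) := by
      have hGl := hG.smooth_mul (hθs (-a₁ : L2dSeq).seq)
      have hcell : ∀ m, loc s (cell L₁ w.χS m) (fun x ↦ θ (-a₁ : L2dSeq).seq x * G x) = V₁ Y m :=
        fun m ↦ by
          have e3 := w.loc_phase_mul_cell L₁ L₁ m hG (-a₁ : L2dSeq).seq
          rw [e3, refIndex_self, hlocG, hV₁e]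
      have h3 := (hrep _ hGl (by
        simp only [hcell]
        exact (L2Seq.hasSum_norm_sq (V₁ Y)).summable)).1
      rw [hF2, ContinuousLinearMap.comp_apply, hsyn]
      simpa only [hcell] using h3
    have hl1 := (hp.locHs.smooth_mul (w.contDiff_cexp_phase L₁ a₁.seq (-Complex.I))).sub hq₁.locHs
    have h4 := h₁.represents.add hsynY hl1.locallyIntegrable
      (hG.smooth_mul (hθs (-a₁ : L2dSeq).seq)).locallyIntegrable
    refine h4.congr (.of_forall fun x ↦ ?_)
    simp only [G, hθ, map_neg, map_add, phase_neg, w.phase_add, Complex.ofReal_add,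
      Complex.ofReal_neg, mul_add (-Complex.I), Complex.exp_add, mul_neg, neg_mul]
    ring


/-- A map that agrees near `z₀` with a translate of `f` inherits the bounds of `f`. -/
theorem AnalyticBound.of_translate {X Y : Type*} [NormedAddCommGroup X] [NormedSpace ℝ X]
    [NormedAddCommGroup Y] [NormedSpace ℝ Y] {C : ℕ → ℝ} {f T : X → Y} (hf : AnalyticBound C f)
    {z₀ : X} {c : Y} (h : ∀ᶠ z in nhds z₀, T z = c + f (z - z₀)) :
    AnalyticAt ℝ T z₀ ∧ ∀ k, 1 ≤ k → ‖iteratedFDeriv ℝ k T z₀‖ ≤ C k := by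
  have h1 : ContDiffAt ℝ ω (fun z ↦ f (z - z₀)) z₀ := by
    refine ContDiffAt.comp (g := f) z₀ ?_ (contDiffAt_id.sub contDiffAt_const)
    rw [sub_self]
    exact hf.contDiffAt
  constructor
  · exact ContDiffAt.analyticAt <| ((contDiffAt_const.add h1).congr_of_eventuallyEq h)
  · intro k hk
    have h2 : T =ᶠ[nhds z₀] (fun _ ↦ c) + fun z ↦ f (z - z₀) := h
    rw [(h2.iteratedFDeriv ℝ k).eq_of_nhds, iteratedFDeriv_add_apply contDiffAt_const (h1.of_le le_top),
      iteratedFDeriv_const_of_ne (by omega), Pi.zero_apply, zero_add]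
    simp only [sub_eq_add_neg]
    rw [iteratedFDeriv_comp_add_right, add_neg_cancel]
    exact hf.bound k

theorem norm_prodMap_le_one {X Y X' Y' : Type*} [NormedAddCommGroup X] [NormedSpace ℝ X]
    [NormedAddCommGroup Y] [NormedSpace ℝ Y] [NormedAddCommGroup X'] [NormedSpace ℝ X']
    [NormedAddCommGroup Y'] [NormedSpace ℝ Y'] {f : X →L[ℝ] X'} {g : Y →L[ℝ] Y'} (hf : ‖f‖ ≤ 1)
    (hg : ‖g‖ ≤ 1) : ‖f.prodMap g‖ ≤ 1 := by
  refine ContinuousLinearMap.opNorm_le_bound _ zero_le_one fun x ↦ ?_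
  rw [one_mul]
  exact max_le_max ((f.le_of_opNorm_le hf x.1).trans_eq (one_mul _))
    ((g.le_of_opNorm_le hg x.2).trans_eq (one_mul _))

namespace Windows.ChartData

variable {η ρ : ℝ → ℝ} {w : Windows η ρ} {s N N₁ : ℝ}

theorem exists_local_formula (D : w.ChartData s N) (D₁ : w.ChartData s N₁) (hs : 0 ≤ s) :
    ∃ C : ℕ → ℝ, ∀ q q₁ : EnergyFun s, energy s q.toFun ≤ ENNReal.ofReal N →
      energy s q₁.toFun ≤ ENNReal.ofReal N₁ → ∀ P₀ ∈ energyBall s q D.r ∩ energyBall s q₁ D₁.r,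
      ∃ f : L2d × Htilde s η ((D.L : ℕ) : ℝ) q → L2d × Htilde s η ((D₁.L : ℕ) : ℝ) q₁,
        AnalyticBound C f ∧ ∀ᶠ z in nhds (chart s η ρ ((D.L : ℕ) : ℝ) q P₀),
          ∃ P ∈ energyBall s q D.r ∩ energyBall s q₁ D₁.r, chart s η ρ ((D.L : ℕ) : ℝ) q P = z ∧
            chart s η ρ ((D₁.L : ℕ) : ℝ) q₁ P = chart s η ρ ((D₁.L : ℕ) : ℝ) q₁ P₀
              + f (z - chart s η ρ ((D.L : ℕ) : ℝ) q P₀) := by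
  obtain ⟨C, hC⟩ := w.exists_change hs D.L D₁.L D₁.B
  refine ⟨compBound (fun _ ↦ 1) (compBound C fun _ ↦ 1), fun q q₁ hq hq₁ P₀ hP₀ ↦ ?_⟩
  obtain ⟨p₀, a₀, rfl, ha₀, hc₀⟩ := w.isCoordinate_iff.1 (D.chart_spec hq hP₀.1)
  obtain ⟨hn, a₁, b₁, hc₁⟩ := D₁.near _ _ (D₁.good q₁ hq₁) p₀.locHs hP₀.2
  have hz₁ : chart s η ρ ((D₁.L : ℕ) : ℝ) q₁ p₀.toClass
      = (SeparationQuotient.mk a₁, ⟨b₁, hc₁.mem_Htilde p₀.locHs⟩) :=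
    D₁.chart_eq hq₁ hP₀.2 (w.isCoordinate_iff.2 ⟨p₀, a₁, rfl, rfl, hc₁⟩)
  obtain ⟨F, hF, hFe⟩ := hC q.toFun q₁.toFun p₀.toFun a₀ a₁ _ b₁ q.locHs (D₁.good q₁ hq₁) hn hc₀ hc₁
  obtain ⟨Pr, hPr, hPre⟩ := w.exists_projection (L := D₁.L) q₁
  set z₀ := chart s η ρ ((D.L : ℕ) : ℝ) q p₀.toClass
  let R := L2d.diff.prodMap (Htilde s η ((D.L : ℕ) : ℝ) q).subtypeL
  have hR : ‖R‖ ≤ 1 := norm_prodMap_le_one L2d.norm_diff_le (Submodule.norm_subtypeL_le _)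
  have hQ : ‖L2d.ofDiff.prodMap Pr‖ ≤ 1 := norm_prodMap_le_one L2d.norm_ofDiff_le hPr
  refine ⟨fun z ↦ L2d.ofDiff.prodMap Pr (F (R z)),
    (AnalyticBound.clm _ hQ).comp (hF.comp (AnalyticBound.clm R hR)), ?_⟩
  have ht : Filter.Tendsto (fun z ↦ R (z - z₀)) (nhds z₀) (nhds 0) := by
    have : Continuous fun z ↦ R (z - z₀) := by fun_prop
    simpa using this.tendsto z₀
  filter_upwards [ht.eventually hFe, D.eventually_exists_coord hs hq hP₀.1,
    D.eventually_mem_energyBall hq hP₀.1 hP₀.1, D.eventually_mem_energyBall hq hP₀.1 hP₀.2]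
    with z ⟨a', ha', hc'⟩ h1 h2 h3
  have ha : SeparationQuotient.mk (a₀ + L2dSeq.lift (R (z - z₀)).1) = z.1 := by
    rw [SeparationQuotient.mk_add, ha₀, ← L2d.ofDiff_apply]
    change z₀.1 + L2d.ofDiff (L2d.diff (z.1 - z₀.1)) = z.1
    rw [L2d.ofDiff_diff, add_sub_cancel]
  have hb : (z₀.2 : Hs s) + (R (z - z₀)).2 = z.2 := by
    change (z₀.2 : Hs s) + ((z.2 - z₀.2 : Htilde s η ((D.L : ℕ) : ℝ) q) : Hs s) = z.2
    rw [Submodule.coe_sub, add_sub_cancel]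
  obtain ⟨p, hp, hc⟩ := h1 _ ha
  rw [hb, ← hp] at hc'
  have hz : IsCoordinate s η ρ ((D.L : ℕ) : ℝ) q p.toClass z :=
    w.isCoordinate_iff.2 ⟨p, _, rfl, ha, hc⟩
  refine ⟨p.toClass, ⟨h2 _ hz, h3 _ hz⟩, D.chart_eq hq (h2 _ hz) hz, ?_⟩
  have hm := hc'.mem_Htilde p.locHs
  rw [D₁.chart_eq hq₁ (h3 _ hz) (w.isCoordinate_iff.2 ⟨p, a', rfl, rfl, hc'⟩ :
    IsCoordinate s η ρ ((D₁.L : ℕ) : ℝ) q₁ p.toClass (SeparationQuotient.mk a', ⟨_, hm⟩)), hz₁]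
  refine Prod.ext ?_ ?_
  · change SeparationQuotient.mk a' = SeparationQuotient.mk a₁ + L2d.ofDiff (F (R (z - z₀))).1
    rw [L2d.ofDiff_apply, ← SeparationQuotient.mk_add]
    exact L2dSeq.mk_eq_mk (by rw [ha', map_add, L2dSeq.diff_lift])
  · have hm' : (F (R (z - z₀))).2 ∈ Htilde s η ((D₁.L : ℕ) : ℝ) q₁ :=
      ((Htilde s η ((D₁.L : ℕ) : ℝ) q₁).add_mem_iff_right (hc₁.mem_Htilde p₀.locHs)).1 hm
    change _ = (⟨b₁, hc₁.mem_Htilde p₀.locHs⟩ : Htilde s η ((D₁.L : ℕ) : ℝ) q₁)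
      + Pr (F (R (z - z₀))).2
    rw [hPre ⟨_, hm'⟩]
    rfl

theorem exists_transition (D : w.ChartData s N) (D₁ : w.ChartData s N₁) (hs : 0 ≤ s) :
    ∃ C : ℕ → ℝ, ∀ q q₁ : EnergyFun s, energy s q.toFun ≤ ENNReal.ofReal N →
      energy s q₁.toFun ≤ ENNReal.ofReal N₁ →
      ∃ T : L2d × Htilde s η ((D.L : ℕ) : ℝ) q → L2d × Htilde s η ((D₁.L : ℕ) : ℝ) q₁,
        (∀ P ∈ energyBall s q D.r ∩ energyBall s q₁ D₁.r,
          T (chart s η ρ ((D.L : ℕ) : ℝ) q P) = chart s η ρ ((D₁.L : ℕ) : ℝ) q₁ P) ∧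
        AnalyticOnNhd ℝ T (chart s η ρ ((D.L : ℕ) : ℝ) q ''
          (energyBall s q D.r ∩ energyBall s q₁ D₁.r)) ∧
        ∀ k, 1 ≤ k → ∀ P ∈ energyBall s q D.r ∩ energyBall s q₁ D₁.r,
          ‖iteratedFDeriv ℝ k T (chart s η ρ ((D.L : ℕ) : ℝ) q P)‖ ≤ C k := by
  classical
  obtain ⟨C, hC⟩ := D.exists_local_formula D₁ hs
  refine ⟨C, fun q q₁ hq hq₁ ↦ ?_⟩
  let T : L2d × Htilde s η ((D.L : ℕ) : ℝ) q → L2d × Htilde s η ((D₁.L : ℕ) : ℝ) q₁ := fun z ↦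
    if h : ∃ P ∈ energyBall s q D.r ∩ energyBall s q₁ D₁.r, chart s η ρ ((D.L : ℕ) : ℝ) q P = z
    then chart s η ρ ((D₁.L : ℕ) : ℝ) q₁ h.choose else 0
  have hT : ∀ P ∈ energyBall s q D.r ∩ energyBall s q₁ D₁.r,
      T (chart s η ρ ((D.L : ℕ) : ℝ) q P) = chart s η ρ ((D₁.L : ℕ) : ℝ) q₁ P := fun P hP ↦ by
    have h : ∃ P' ∈ energyBall s q D.r ∩ energyBall s q₁ D₁.r,
      chart s η ρ ((D.L : ℕ) : ℝ) q P' = chart s η ρ ((D.L : ℕ) : ℝ) q P := ⟨P, hP, rfl⟩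
    have hch := h.choose_spec
    have h1 := D.energyDist_le hq hch.1.1 (D.chart_spec hq hch.1.1) (D.chart_spec hq hP.1)
    rw [hch.2, edist_self, mul_zero] at h1
    have h2 := D₁.edist_le hq₁ hch.1.2 (D₁.chart_spec hq₁ hch.1.2) (D₁.chart_spec hq₁ hP.2)
    rw [nonpos_iff_eq_zero.1 h1, mul_zero] at h2
    change dite _ _ _ = _
    rw [dif_pos h]
    exact edist_le_zero.1 h2
  have hloc : ∀ P ∈ energyBall s q D.r ∩ energyBall s q₁ D₁.r,
      AnalyticAt ℝ T (chart s η ρ ((D.L : ℕ) : ℝ) q P) ∧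
        ∀ k, 1 ≤ k → ‖iteratedFDeriv ℝ k T (chart s η ρ ((D.L : ℕ) : ℝ) q P)‖ ≤ C k := fun P hP ↦ by
    obtain ⟨f, hf, hfe⟩ := hC q q₁ hq hq₁ P hP
    refine hf.of_translate (c := chart s η ρ ((D₁.L : ℕ) : ℝ) q₁ P) ?_
    filter_upwards [hfe] with z ⟨P', hP', hz, he⟩
    rw [← he, ← hT P' hP', hz]
  refine ⟨T, hT, ?_, fun k hk P hP ↦ (hloc P hP).2 k hk⟩
  rintro _ ⟨P, hP, rfl⟩
  exact (hloc P hP).1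

end Windows.ChartData

end

end GrossPitaevskii

theorem mainTheorem9 (s : ℝ) (hs : 0 ≤ s)
    (η : ℝ → ℝ) (hη : ContDiff ℝ ∞ η) (hη_supp : tsupport η ⊆ Set.Icc (-1) 1)
    (hη_one : ∀ x ∈ Set.Icc (-1 / 2 : ℝ) (1 / 2), η x = 1)
    (ρ : ℝ → ℝ) (hρ : ContDiff ℝ ∞ ρ) (hρ_supp : HasCompactSupport ρ) (hρ_nonneg : ∀ x, 0 ≤ ρ x)
    (hρ_one : ∀ x ∈ Set.Icc (-1 : ℝ) 1, ρ x = 1)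
    (hρ_sum : ∀ x : ℝ, ∑' n : ℤ, ρ (x - 4 * n) = 1) :
    ∃ (r L : ℝ → ℝ) (K : ℝ → ℝ≥0) (C : ℝ → ℕ → ℝ), (∀ E, 0 < r E ∧ 0 < L E) ∧
      ∀ (q : EnergyFun s) (E : ℝ), E = (energy s q.toFun).toReal →
        -- the chart around `q` is well defined on the ball
        (∀ P ∈ energyBall s q (r E), ∃! z, IsCoordinate s η ρ (L E) q P z) ∧
        -- it is bi-Lipschitz onto its image, which is open
        (∀ P ∈ energyBall s q (r E), ∀ P' ∈ energyBall s q (r E),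
          edist (chart s η ρ (L E) q P) (chart s η ρ (L E) q P') ≤ K E * energyDist s P P' ∧
          energyDist s P P' ≤
            K E * edist (chart s η ρ (L E) q P) (chart s η ρ (L E) q P')) ∧
        IsOpen (chart s η ρ (L E) q '' energyBall s q (r E)) ∧
        -- coordinate changes
        ∀ (q₁ : EnergyFun s) (E₁ : ℝ), E₁ = (energy s q₁.toFun).toReal →
          (energyBall s q (r E) ∩ energyBall s q₁ (r E₁)).Nonempty →
          IsOpen (chart s η ρ (L E) q '' (energyBall s q (r E) ∩ energyBall s q₁ (r E₁))) ∧
          IsOpen (chart s η ρ (L E₁) q₁ '' (energyBall s q (r E) ∩ energyBall s q₁ (r E₁))) ∧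
          ∃ (T : L2d × Htilde s η (L E) q → L2d × Htilde s η (L E₁) q₁)
            (T₁ : L2d × Htilde s η (L E₁) q₁ → L2d × Htilde s η (L E) q),
            (∀ P ∈ energyBall s q (r E) ∩ energyBall s q₁ (r E₁),
              T (chart s η ρ (L E) q P) = chart s η ρ (L E₁) q₁ P ∧
              T₁ (chart s η ρ (L E₁) q₁ P) = chart s η ρ (L E) q P) ∧
            AnalyticOnNhd ℝ T
              (chart s η ρ (L E) q '' (energyBall s q (r E) ∩ energyBall s q₁ (r E₁))) ∧
            AnalyticOnNhd ℝ T₁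
              (chart s η ρ (L E₁) q₁ '' (energyBall s q (r E) ∩ energyBall s q₁ (r E₁))) ∧
            ∀ k : ℕ, 1 ≤ k → ∀ P ∈ energyBall s q (r E) ∩ energyBall s q₁ (r E₁),
              ‖iteratedFDeriv ℝ k T (chart s η ρ (L E) q P)‖ ≤ C E k ∧
              ‖iteratedFDeriv ℝ k T₁ (chart s η ρ (L E₁) q₁ P)‖ ≤ C E k := by
  obtain ⟨w⟩ := exists_windows hη hη_supp hη_one hρ hρ_supp hρ_nonneg hρ_one hρ_sum
  let D : ∀ n : ℕ, w.ChartData s n := fun n ↦ (w.nonempty_chartData hs n).some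
  choose C₀ hC₀ using fun n m : ℕ ↦ (D n).exists_transition (D m) hs
  choose G hG using fun n : ℕ ↦ exists_energy_le_of_mem w hs n
  have hE : ∀ q : EnergyFun s, energy s q.toFun ≤ ENNReal.ofReal (⌈(energy s q.toFun).toReal⌉₊ : ℝ) :=
    fun q ↦ (ENNReal.ofReal_toReal q.energy_lt_top.ne).ge.trans
      (ENNReal.ofReal_le_ofReal (Nat.le_ceil _))
  refine ⟨fun E ↦ (D ⌈E⌉₊).r, fun E ↦ (((D ⌈E⌉₊).L : ℕ) : ℝ), fun E ↦ 2 * (D ⌈E⌉₊).K,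
    fun E k ↦ ∑ j ∈ Finset.range (⌈max (G ⌈E⌉₊) 0⌉₊ + 1), (|C₀ ⌈E⌉₊ j k| + |C₀ j ⌈E⌉₊ k|),
    fun E ↦ ⟨(D ⌈E⌉₊).r_pos, cast_pnat_pos _⟩, ?_⟩
  rintro q _ rfl
  have hq := hE q
  set n := ⌈(energy s q.toFun).toReal⌉₊
  refine ⟨fun P hP ↦ ?_, fun P hP P' hP' ↦ ⟨?_, ?_⟩, ?_, ?_⟩
  · obtain ⟨z, hz⟩ := (D n).exists_isCoordinate hq hP
    exact ⟨z, hz, fun z' hz' ↦ (D n).isCoordinate_unique hq hP hz' hz⟩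
  · refine ((D n).edist_le hq hP ((D n).chart_spec hq hP) ((D n).chart_spec hq hP')).trans ?_
    gcongr
    exact le_mul_of_one_le_left (zero_le) one_le_two
  · exact (D n).energyDist_le hq hP ((D n).chart_spec hq hP) ((D n).chart_spec hq hP')
  · have h := (D n).isOpen_image hs hq q (D n).r
    rwa [Set.inter_self] at h
  · rintro q₁ _ rfl ⟨P₀, hP₀⟩
    have hq₁ := hE q₁
    have hb : ∀ {q : EnergyFun s} {n : ℕ}, energyBall s q (D n).r ⊆ energyBall s q 1 :=
      fun hP ↦
        lt_of_lt_of_le (Set.mem_ofPred.1 hP) (ENNReal.ofReal_le_ofReal (D _).r_le_one)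
    have hG₁ : ⌈(energy s q₁.toFun).toReal⌉₊ ≤ ⌈max (G n) 0⌉₊ := by
      refine Nat.ceil_le_ceil ?_
      have h := ENNReal.toReal_mono ENNReal.ofReal_ne_top (hG n q q₁ P₀ hq (hb hP₀.1) (hb hP₀.2))
      rwa [ENNReal.toReal_ofReal'] at h
    set m := ⌈(energy s q₁.toFun).toReal⌉₊
    have hsum := fun k ↦ Finset.single_le_sum (f := fun j ↦ |C₀ n j k| + |C₀ j n k|)
      (fun j _ ↦ by positivity) (Finset.mem_range.2 (Nat.lt_succ_of_le hG₁))
    obtain ⟨T, hT, hTa, hTb⟩ := hC₀ n m q q₁ hq hq₁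
    obtain ⟨T₁, hT₁, hT₁a, hT₁b⟩ := hC₀ m n q₁ q hq₁ hq
    have hopen := (D m).isOpen_image hs hq₁ q (D n).r
    rw [Set.inter_comm] at hT₁ hT₁a hT₁b hopen
    refine ⟨(D n).isOpen_image hs hq q₁ (D m).r, hopen, T, T₁, fun P hP ↦ ⟨hT P hP, hT₁ P hP⟩, hTa,
      hT₁a, fun k hk P hP ↦ ⟨(hTb k hk P hP).trans ?_, (hT₁b k hk P hP).trans ?_⟩⟩
    · linarith [hsum k, le_abs_self (C₀ n m k), abs_nonneg (C₀ m n k)]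
    · linarith [hsum k, le_abs_self (C₀ m n k), abs_nonneg (C₀ n m k)]
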